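/- Let $Z=Z_0\cup_Y(Y\times[0,\infty))$ be a complete Riemannian manifold with cylindrical end: $Y$ is a closed Riemannian manifold, $Z_0$ is compact with boundary $Y$, the metric is $g_Y+du\otimes du$ on the end and on a collar of $\partial Z_0$. Let $E\to Z$ be a Hermitian vector bundle which on the end is the pull-back of a Hermitian bundle $E'\to Y$ (metric included), and let $\Delta$ be a compatible Laplacian on $E$: a formally self-adjoint second order differential operator with principal symbol $\sigma_2(\Delta)(z,\xi)=|\xi|^2_{g_z}$ such that on $Y\times[0,\infty)$ one has $\Delta=-\partial_u^2+\Delta_Y$, with $\Delta_Y$ a generalized Laplacian on $C^\infty(Y,E')$. Let $0<K<R$ and let $\varphi\in C^\infty(\mathbb R)$ satisfy $\varphi'\ge 0$, $\varphi=0$ on $(0,K)$, $\varphi=1$ on $(R,\infty)$. For $\theta\in\mathbb C$ put $\psi_\theta(u)=(\varphi(u)\theta+1)u$. The dilated Laplacian $\Delta_\theta$ is the operator equal to $\Delta$ on $Z_0$ and to $$\Delta_\theta=a_2(\theta,u)\,\partial_u^2+a_1(\theta,u)\,\partial_u+a_0(\theta,u)+\Delta_Y$$ on $Y\times(0,\infty)$,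 where $$a_2=-\frac1{(\psi_\theta')^2},\qquad a_1=\frac{2\psi_\theta''}{(\psi_\theta')^3},\qquad a_0=\frac{\psi_\theta'''}{2(\psi_\theta')^3}-\frac{5(\psi_\theta'')^2}{4(\psi_\theta')^4};$$ for $\theta>0$ this is $U_\theta\Delta U_\theta^{-1}$ with $U_\theta f(y,u)=\psi_\theta'(u)^{1/2}f(y,\psi_\theta(u))$ on the end and $U_\theta f=f$ on $Z_0$. Let $$\Gamma=\{\theta=\theta_0+i\theta_1\in\mathbb C:\ \theta_0>0,\ \theta_0\ge|\theta_1|,\ \theta_1^2<1/2\}.$$ Let $\nabla$ be a connection on $E$ which on the end is the pull-back of a connection on $E'$, and let $\mathscr W_1(Z,E)\subset L^2(Z,E)$ be the first Sobolev space, the closure of $C_c^\infty(Z,E)$ for the norm $(\|f\|^2+\|\nabla f\|^2)^{1/2}$. A sesquilinear form $q$ with dense domain $Q(q)$ in a complex inner product space is closed if $\varphi_k\in Q(q)$, $\varphi_k\to\varphi$ and $q(\varphi_j-\varphi_k,\varphi_j-\varphi_k)\to0$ imply $\varphi\in Q(q)$ and $q(\varphi_k-\varphi,\varphi_k-\varphi)\to0$;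 it is sectorial if for some $\vartheta\in(0,\pi/2)$ one has $|\arg q(\varphi,\varphi)|\le\vartheta$ for all $\varphi\in Q(q)$; it is strictly $m$-accretive if it is closed and sectorial, and $m$-sectorial if $e^{i\alpha}q+z$ is strictly $m$-accretive for some $\alpha\in\mathbb R$, $z\in\mathbb C$. **Theorem.** For every $\theta\in\Gamma$, the form $f\mapsto\langle\Delta_\theta f,f\rangle_{L^2(Z,E)}$ on $C_c^\infty(Z,E)$ extends by continuity for the $\mathscr W_1$-norm to a form with domain $\mathscr W_1(Z,E)$, and there is a $\gamma=\gamma(\theta)>0$ such that the form $$f\mapsto\langle\Delta_\theta f,f\rangle_{L^2(Z,E)}+\gamma\,\langle f,f\rangle_{L^2(Z,E)}$$ with domain $\mathscr W_1(Z,E)$ is $m$-sectorial; more precisely it is itself closed and sectorial (strictly $m$-accretive). -/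

import Mathlib

open MeasureTheory Filter Bundle
open scoped Manifold ContDiff Topology ENNReal

namespace CylEnd

noncomputable section

/-! ### Sesquilinear forms on a complex inner product space -/

section Forms

/-- A sesquilinear form `q` (conjugate-linear in the first variable, linear in the second one,
as Mathlib's inner product) defined on a linear subspace of `H`. -/
structure SesqForm (H : Type*) [NormedAddCommGroup H] [InnerProductSpace ℂ H] where
  domain : Submodule ℂ H
  toFun : domain →ₗ⋆[ℂ] domain →ₗ[ℂ] ℂ

variable {H : Type*} [NormedAddCommGroup H] [InnerProductSpace ℂ H]

/-- The form `a q + b ⟨·,·⟩`, with the domain of `q`. -/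
def SesqForm.affine (q : SesqForm H) (a b : ℂ) : SesqForm H where
  domain := q.domain
  toFun := a • q.toFun + b • innerₛₗ ℂ

/-- `q` is closed: if `φ_k ∈ Q(q)` converges to `φ` in `H` and `q(φ_j - φ_k, φ_j - φ_k) → 0`
as `j, k → ∞`, then `φ ∈ Q(q)` and `q(φ_k - φ, φ_k - φ) → 0`. -/
def SesqForm.IsClosed (q : SesqForm H) : Prop :=
  ∀ (φ : ℕ → q.domain) (ψ : H),
    Tendsto (fun k => (φ k : H)) atTop (𝓝 ψ) →
    Tendsto (fun p : ℕ × ℕ => q.toFun (φ p.1 - φ p.2) (φ p.1 - φ p.2)) atTop (𝓝 0) →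
    ∃ hψ : ψ ∈ q.domain,
      Tendsto (fun k => q.toFun (φ k - ⟨ψ, hψ⟩) (φ k - ⟨ψ, hψ⟩)) atTop (𝓝 0)

/-- `q` is sectorial (with vertex `0`): all its values `q(φ, φ)` lie in a sector
`|arg z| ≤ ϑ` with `0 < ϑ < π / 2`. -/
def SesqForm.IsSectorial (q : SesqForm H) : Prop :=
  ∃ ϑ : ℝ, 0 < ϑ ∧ ϑ < Real.pi / 2 ∧ ∀ φ : q.domain, |(q.toFun φ φ).arg| ≤ ϑ

/-- `q` is strictly `m`-accretive: densely defined, closed and sectorial. -/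
structure SesqForm.IsStrictlyMAccretive (q : SesqForm H) : Prop where
  dense : Dense (q.domain : Set H)
  closed : q.IsClosed
  sectorial : q.IsSectorial

/-- `q` is (strictly) `m`-sectorial: `e^{iα} q + z` is strictly `m`-accretive for some real `α`
and some complex `z`. -/
def SesqForm.IsStrictlyMSectorial (q : SesqForm H) : Prop :=
  ∃ (α : ℝ) (z : ℂ), (q.affine (Complex.exp (α * Complex.I)) z).IsStrictlyMAccretive

end Forms

/-! ### Riemannian volume -/

section Volume

variable (n : ℕ) {M : Type*} [TopologicalSpace M] [ChartedSpace (EuclideanSpace ℝ (Fin n)) M]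
  [RiemannianBundle (fun x : M => TangentSpace (𝓡 n) x)]

/-- The matrix `g_{ij}` of the metric in the chart at `x₀`, at the point with coordinates `p`. -/
def chartGram (x₀ : M) (p : EuclideanSpace ℝ (Fin n)) : Matrix (Fin n) (Fin n) ℝ :=
  Matrix.of fun i j =>
    inner ℝ
      (mfderiv 𝓘(ℝ, EuclideanSpace ℝ (Fin n)) (𝓡 n) (extChartAt (𝓡 n) x₀).symm p
        (EuclideanSpace.single i (1 : ℝ) : EuclideanSpace ℝ (Fin n)))
      (mfderiv 𝓘(ℝ, EuclideanSpace ℝ (Fin n)) (𝓡 n) (extChartAt (𝓡 n) x₀).symm p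
        (EuclideanSpace.single j (1 : ℝ) : EuclideanSpace ℝ (Fin n)))

/-- The measure `√(det g) dp` on the domain of the chart at `x₀`. -/
def chartVolume [MeasurableSpace M] (x₀ : M) : Measure M :=
  ((volume.withDensity fun p => ENNReal.ofReal (Real.sqrt (chartGram n x₀ p).det)).restrict
    (extChartAt (𝓡 n) x₀).target).map (extChartAt (𝓡 n) x₀).symm

/-- The Riemannian volume measure: the chart measures agree on overlaps, and the volume is
their supremum in the lattice of measures, i.e. the measure obtained by gluing them. -/
def riemannianVolume (M : Type*) [TopologicalSpace M]
    [ChartedSpace (EuclideanSpace ℝ (Fin n)) M]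
    [RiemannianBundle (fun x : M => TangentSpace (𝓡 n) x)] [MeasurableSpace M] : Measure M :=
  ⨆ x₀ : M, chartVolume n x₀

end Volume

/-! ### Complex Hermitian vector bundles and their sections -/

section Sections

variable (n : ℕ) {M : Type*} [TopologicalSpace M] [ChartedSpace (EuclideanSpace ℝ (Fin n)) M]
  (F : Type*) [NormedAddCommGroup F] [NormedSpace ℂ F]
  (E : M → Type*) [TopologicalSpace (TotalSpace F E)]
  [∀ x, NormedAddCommGroup (E x)] [∀ x, InnerProductSpace ℂ (E x)]
  [FiberBundle F E]

/-- Smoothness of a section. -/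
def IsSmoothSection (s : Π x, E x) : Prop :=
  ContMDiff (𝓡 n) ((𝓡 n).prod 𝓘(ℝ, F)) ∞ (fun x => (⟨x, s x⟩ : TotalSpace F E))

variable {n F E} in
theorem IsSmoothSection.const_smul [VectorBundle ℂ F E] {s : Π x, E x}
    (hs : IsSmoothSection n F E s) (c : ℂ) : IsSmoothSection n F E (c • s) := by
  intro x₀
  have h := hs x₀
  rw [contMDiffAt_section] at h ⊢
  have h2 : ContMDiffAt (𝓡 n) 𝓘(ℝ, F) ∞
      (fun x => c • (trivializationAt F E x₀ ⟨x, s x⟩).2) x₀ :=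
    (((c • ContinuousLinearMap.id ℂ F).restrictScalars ℝ).contMDiff.contMDiffAt).comp x₀ h
  refine h2.congr_of_eventuallyEq ?_
  set e := trivializationAt F E x₀
  filter_upwards [e.open_baseSet.mem_nhds (mem_baseSet_trivializationAt F E x₀)] with x hx
  exact (e.linear ℂ hx).2 c (s x)

/-- The complex vector space `C^∞(M, E)` of smooth sections. -/
def smoothSections [VectorBundle ℂ F E] [VectorBundle ℝ F E] : Submodule ℂ (Π x, E x) where
  carrier := {s | IsSmoothSection n F E s}
  add_mem' hs ht := ContMDiff.add_section hs ht
  zero_mem' := Bundle.contMDiff_zeroSection ℝ E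
  smul_mem' c _ hs := IsSmoothSection.const_smul hs c

/-- The Hermitian metric on the fibres is smooth: the pointwise product of two smooth sections
is a smooth function. -/
class IsSmoothHermitian : Prop where
  contMDiff_inner : ∀ s t : Π x, E x, IsSmoothSection n F E s → IsSmoothSection n F E t →
    ContMDiff (𝓡 n) 𝓘(ℝ, ℂ) ∞ (fun x => inner ℂ (s x) (t x))

variable [VectorBundle ℂ F E] [VectorBundle ℝ F E]

variable {n F E} in
/-- The section vanishes outside a compact set. -/
def HasCompactSupp (s : smoothSections n F E) : Prop :=
  ∃ K : Set M, IsCompact K ∧ ∀ x, x ∉ K → s.1 x = 0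

variable {n F E} in
/-- The product of a smooth real function and a smooth section. -/
def funSmul (f : C^∞⟮𝓡 n, M; ℝ⟯) (s : smoothSections n F E) : smoothSections n F E :=
  ⟨fun x => f x • s.1 x, ContMDiff.smul_section f.contMDiff s.2⟩

end Sections

/-! ### The Hilbert space of square integrable sections -/

section L2

variable (n : ℕ) {M : Type*} [TopologicalSpace M] [ChartedSpace (EuclideanSpace ℝ (Fin n)) M]
  [RiemannianBundle (fun x : M => TangentSpace (𝓡 n) x)] [MeasurableSpace M]
  (F : Type*) [NormedAddCommGroup F] [NormedSpace ℂ F]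
  (E : M → Type*) [TopologicalSpace (TotalSpace F E)]
  [∀ x, NormedAddCommGroup (E x)] [∀ x, InnerProductSpace ℂ (E x)]
  [FiberBundle F E] [VectorBundle ℂ F E] [VectorBundle ℝ F E]

/-- Almost everywhere measurability of a section: it is almost everywhere the pointwise limit of
a sequence of smooth sections. -/
def IsMeasurableSection (s : Π x, E x) : Prop :=
  ∃ f : ℕ → smoothSections n F E,
    ∀ᵐ x ∂(riemannianVolume n M), Tendsto (fun k => (f k).1 x) atTop (𝓝 (s x))

variable {n F E}

theorem IsMeasurableSection.add {s t : Π x, E x} (hs : IsMeasurableSection n F E s)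
    (ht : IsMeasurableSection n F E t) : IsMeasurableSection n F E (s + t) := by
  obtain ⟨f, hf⟩ := hs
  obtain ⟨g, hg⟩ := ht
  refine ⟨fun k => f k + g k, ?_⟩
  filter_upwards [hf, hg] with x hx hy using hx.add hy

theorem IsMeasurableSection.smul {s : Π x, E x} (hs : IsMeasurableSection n F E s) (c : ℂ) :
    IsMeasurableSection n F E (c • s) := by
  obtain ⟨f, hf⟩ := hs
  refine ⟨fun k => c • f k, ?_⟩
  filter_upwards [hf] with x hx using hx.const_smul c

variable [BorelSpace M] [IsSmoothHermitian n F E]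

theorem IsMeasurableSection.aestronglyMeasurable_inner {s t : Π x, E x} (hs : IsMeasurableSection n F E s)
    (ht : IsMeasurableSection n F E t) :
    AEStronglyMeasurable (fun x => inner ℂ (s x) (t x)) (riemannianVolume n M) := by
  obtain ⟨f, hf⟩ := hs
  obtain ⟨g, hg⟩ := ht
  refine aestronglyMeasurable_of_tendsto_ae (f := fun k x => inner ℂ ((f k).1 x) ((g k).1 x))
    atTop (fun k => ?_) ?_
  · exact (IsSmoothHermitian.contMDiff_inner (n := n) (F := F) _ _ (f k).2
      (g k).2).continuous.aestronglyMeasurable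
  · filter_upwards [hf, hg] with x hx hy using hx.inner hy

theorem IsMeasurableSection.aestronglyMeasurable_norm {s : Π x, E x} (hs : IsMeasurableSection n F E s) :
    AEStronglyMeasurable (fun x => ‖s x‖) (riemannianVolume n M) := by
  have h : (fun x => ‖s x‖) = fun x => Real.sqrt ‖(inner ℂ (s x) (s x) : ℂ)‖ := by
    funext x
    rw [inner_self_eq_norm_sq_to_K]
    simp
  rw [h]
  exact Real.continuous_sqrt.comp_aestronglyMeasurable (hs.aestronglyMeasurable_inner hs).norm

variable (n F E)

/-- The space of measurable sections `s` with `∫ ‖s‖² < ∞`. -/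
def sqIntegrable : Submodule ℂ (Π x, E x) where
  carrier := {s | IsMeasurableSection n F E s ∧
    MemLp (fun x => ‖s x‖) 2 (riemannianVolume n M)}
  add_mem' := by
    rintro s t ⟨hs, hs'⟩ ⟨ht, ht'⟩
    refine ⟨hs.add ht, (hs'.add ht').mono (hs.add ht).aestronglyMeasurable_norm (ae_of_all _ fun x => ?_)⟩
    simp only [Pi.add_apply, norm_norm]
    exact (norm_add_le _ _).trans (le_abs_self _)
  zero_mem' := ⟨⟨fun _ => 0, ae_of_all _ fun x => tendsto_const_nhds⟩, by simp⟩
  smul_mem' := by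
    rintro c s ⟨hs, hs'⟩
    refine ⟨hs.smul c, ?_⟩
    have := hs'.const_mul ‖c‖
    simpa [norm_smul] using this

/-- Square integrable sections, before identifying sections that agree almost everywhere. -/
def PreL2 : Type _ := sqIntegrable n F E

instance : AddCommGroup (PreL2 n F E) := inferInstanceAs (AddCommGroup (sqIntegrable n F E))
instance : Module ℂ (PreL2 n F E) := inferInstanceAs (Module ℂ (sqIntegrable n F E))

variable {n F E}

theorem PreL2.integrable_inner (s t : PreL2 n F E) :
    Integrable (fun x => inner ℂ (s.1 x) (t.1 x)) (riemannianVolume n M) := by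
  refine (s.2.2.integrable_mul t.2.2).mono (s.2.1.aestronglyMeasurable_inner t.2.1) (ae_of_all _ fun x => ?_)
  simpa using norm_inner_le_norm (𝕜 := ℂ) (s.1 x) (t.1 x)

variable (n F E)

/-- The semi-inner product `⟨s, t⟩ = ∫ ⟨s(x), t(x)⟩ dvol(x)`. -/
@[reducible] def preL2Core : PreInnerProductSpace.Core ℂ (PreL2 n F E) where
  inner s t := ∫ x, inner ℂ (s.1 x) (t.1 x) ∂(riemannianVolume n M)
  conj_inner_symm s t := by
    rw [← integral_conj]
    simp
  re_inner_nonneg s := by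
    have h : (fun x => (inner ℂ (s.1 x) (s.1 x) : ℂ)) = fun x => ((‖s.1 x‖ ^ 2 : ℝ) : ℂ) := by
      funext x
      rw [inner_self_eq_norm_sq_to_K]
      simp
    rw [h, integral_complex_ofReal]
    exact integral_nonneg fun x => by positivity
  add_left s t r := by
    rw [← integral_add (s.integrable_inner r) (t.integrable_inner r)]
    exact integral_congr_ae (ae_of_all _ fun x => inner_add_left (s.1 x) (t.1 x) (r.1 x))
  smul_left s t c := by
    rw [← integral_const_mul]
    exact integral_congr_ae (ae_of_all _ fun x => inner_smul_left (s.1 x) (t.1 x) c)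

instance : SeminormedAddCommGroup (PreL2 n F E) :=
  @InnerProductSpace.Core.toSeminormedAddCommGroup ℂ _ _ _ _ (preL2Core n F E)

instance : InnerProductSpace ℂ (PreL2 n F E) := InnerProductSpace.ofCore (preL2Core n F E)

/-- The space `L²(M, E)` of square integrable sections modulo null sections. -/
abbrev L2 : Type _ := SeparationQuotient (PreL2 n F E)

end L2

/-! ### Generalized Laplacians -/

section Laplacians

variable {n : ℕ} {M : Type*} [TopologicalSpace M] [ChartedSpace (EuclideanSpace ℝ (Fin n)) M]
  [RiemannianBundle (fun x : M => TangentSpace (𝓡 n) x)]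
  {F : Type*} [NormedAddCommGroup F] [NormedSpace ℂ F]
  {E : M → Type*} [TopologicalSpace (TotalSpace F E)]
  [∀ x, NormedAddCommGroup (E x)] [∀ x, InnerProductSpace ℂ (E x)]
  [FiberBundle F E] [VectorBundle ℂ F E] [VectorBundle ℝ F E]

/-- `P` is a second order differential operator with principal symbol
`σ₂(P)(x, ξ) = |ξ|²`: for every smooth function `f`, the double commutator `[[P, f], f]` is
multiplication by `-2 |df|²`. (By polarization all triple commutators of `P` with functions
vanish, which means that `P` is a differential operator of order at most two; for such an
operator `[[P, f], f] = -2 σ₂(P)(df)`.) -/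
def IsGeneralizedLaplacian (P : smoothSections n F E →ₗ[ℂ] smoothSections n F E) : Prop :=
  ∀ (f : C^∞⟮𝓡 n, M; ℝ⟯) (s : smoothSections n F E) (x : M),
    (P (funSmul f (funSmul f s))).1 x - (2 * f x) • (P (funSmul f s)).1 x
      + (f x ^ 2) • (P s).1 x = (-2 * ‖mvfderiv (𝓡 n) f x‖ ^ 2 : ℝ) • s.1 x

/-- `P` is symmetric on compactly supported smooth sections. -/
def IsFormallySelfAdjoint [MeasurableSpace M]
    (P : smoothSections n F E →ₗ[ℂ] smoothSections n F E) : Prop :=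
  ∀ s t : smoothSections n F E, HasCompactSupp s → HasCompactSupp t →
    ∫ x, inner ℂ ((P s).1 x) (t.1 x) ∂(riemannianVolume n M)
      = ∫ x, inner ℂ (s.1 x) ((P t).1 x) ∂(riemannianVolume n M)

end Laplacians

/-! ### Manifolds with cylindrical end -/

section Cylinder

/-- `Z` is a complete manifold with cylindrical end over the closed manifold `Y`: an open subset
of `Z` is isometric to the Riemannian product `Y × (-ε, ∞)`, and the complement `Z₀` of
`Y × (0, ∞)` is compact (so that `Z₀` is a compact manifold with boundary `Y × {0}`, with product
metric near the boundary, and `Z = Z₀ ∪ Y × [0, ∞)`). -/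
structure CylindricalEnd (m : ℕ)
    (Z : Type*) [TopologicalSpace Z] [ChartedSpace (EuclideanSpace ℝ (Fin (m + 1))) Z]
    [RiemannianBundle (fun z : Z => TangentSpace (𝓡 (m + 1)) z)]
    (Y : Type*) [TopologicalSpace Y] [ChartedSpace (EuclideanSpace ℝ (Fin m)) Y]
    [RiemannianBundle (fun y : Y => TangentSpace (𝓡 m) y)] where
  ε : ℝ
  ε_pos : 0 < ε
  chart : OpenPartialHomeomorph (Y × ℝ) Z
  source_eq : chart.source = {p | -ε < p.2}
  contMDiffOn : ContMDiffOn ((𝓡 m).prod 𝓘(ℝ, ℝ)) (𝓡 (m + 1)) ∞ chart chart.source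
  contMDiffOn_symm : ContMDiffOn (𝓡 (m + 1)) ((𝓡 m).prod 𝓘(ℝ, ℝ)) ∞ chart.symm chart.target
  isometric : ∀ (y : Y) (u : ℝ), -ε < u → ∀ (v : TangentSpace (𝓡 m) y) (r : ℝ),
    ‖mfderiv ((𝓡 m).prod 𝓘(ℝ, ℝ)) (𝓡 (m + 1)) chart (y, u) (v, r)‖ ^ 2 = ‖v‖ ^ 2 + r ^ 2
  isCompact_core : IsCompact (chart '' {p | 0 < p.2})ᶜ

variable {m : ℕ}
  {Z : Type*} [TopologicalSpace Z] [ChartedSpace (EuclideanSpace ℝ (Fin (m + 1))) Z]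
  [RiemannianBundle (fun z : Z => TangentSpace (𝓡 (m + 1)) z)]
  {Y : Type*} [TopologicalSpace Y] [ChartedSpace (EuclideanSpace ℝ (Fin m)) Y]
  [RiemannianBundle (fun y : Y => TangentSpace (𝓡 m) y)]
  (F : Type*) [NormedAddCommGroup F] [NormedSpace ℂ F]
  (E : Z → Type*) [TopologicalSpace (TotalSpace F E)]
  [∀ z, NormedAddCommGroup (E z)] [∀ z, InnerProductSpace ℂ (E z)]
  [FiberBundle F E] [VectorBundle ℂ F E] [VectorBundle ℝ F E]
  (F' : Type*) [NormedAddCommGroup F'] [NormedSpace ℂ F']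
  (E' : Y → Type*) [TopologicalSpace (TotalSpace F' E')]
  [∀ y, NormedAddCommGroup (E' y)] [∀ y, InnerProductSpace ℂ (E' y)]
  [FiberBundle F' E'] [VectorBundle ℂ F' E'] [VectorBundle ℝ F' E']

/-- A smooth isometric identification of the restriction of `E` to the end with the pull-back of
the Hermitian bundle `E'` over `Y`. Smoothness: it turns smooth sections of `E` into smooth
sections of the pull-back bundle (since it is fibrewise unitary, so does its inverse). Only the
values for `u > -ε` matter. -/
structure BundleEnd (C : CylindricalEnd m Z Y) where
  iso : ∀ (y : Y) (u : ℝ), E' y ≃ₗᵢ[ℂ] E (C.chart (y, u))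
  smooth : ∀ s : smoothSections (m + 1) F E,
    ContMDiffOn ((𝓡 m).prod 𝓘(ℝ, ℝ)) ((𝓡 m).prod 𝓘(ℝ, F')) ∞
      (fun p : Y × ℝ => (⟨p.1, (iso p.1 p.2).symm (s.1 (C.chart p))⟩ : TotalSpace F' E'))
      C.chart.source

variable {F E F' E'} {C : CylindricalEnd m Z Y} (B : BundleEnd F E F' E' C)

/-- The section `s` on the end, as a family of sections of `E'` depending on `u`. -/
def BundleEnd.pull (s : Π z, E z) (y : Y) (u : ℝ) : E' y := (B.iso y u).symm (s (C.chart (y, u)))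

/-- For fixed `u > -ε`, the restriction of a smooth section to `Y × {u}`. -/
def BundleEnd.slice (s : smoothSections (m + 1) F E) (u : ℝ) (hu : -C.ε < u) :
    smoothSections m F' E' :=
  ⟨fun y => B.pull s.1 y u, by
    have h1 : ContMDiff (𝓡 m) ((𝓡 m).prod 𝓘(ℝ, ℝ)) ∞ (fun y : Y => (y, u)) :=
      contMDiff_id.prodMk contMDiff_const
    have h2 : ∀ y : Y, (y, u) ∈ C.chart.source := fun y => by rw [C.source_eq]; exact hu
    exact (B.smooth s).comp_contMDiff h1 h2⟩

/-- A compatible Laplacian: a formally self-adjoint generalized Laplacian which on `Y × [0, ∞)`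
equals `-∂²/∂u² + Δ_Y` with a generalized Laplacian `Δ_Y` on sections of `E'`. -/
structure IsCompatibleLaplacian [MeasurableSpace Z]
    (Δ : smoothSections (m + 1) F E →ₗ[ℂ] smoothSections (m + 1) F E) : Prop where
  generalized : IsGeneralizedLaplacian Δ
  symmetric : IsFormallySelfAdjoint Δ
  product : ∃ ΔY : smoothSections m F' E' →ₗ[ℂ] smoothSections m F' E',
    IsGeneralizedLaplacian ΔY ∧
    ∀ (s : smoothSections (m + 1) F E) (y : Y) (u : ℝ) (hu : 0 ≤ u),
      B.pull (Δ s).1 y u = -iteratedDeriv 2 (fun v => B.pull s.1 y v) u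
        + (ΔY (B.slice s u ((neg_lt_zero.2 C.ε_pos).trans_le hu))).1 y

/-- A smooth complex connection on `E` which on `Y × [0, ∞)` is the pull-back of a connection
on `E'`. -/
structure IsProductConnection [IsManifold (𝓡 (m + 1)) ∞ Z] [IsManifold (𝓡 m) ∞ Y]
    (D : CovariantDerivative (𝓡 (m + 1)) F E) : Prop where
  smooth : D.ContMDiffCovariantDerivative ∞
  complex : ∀ s : smoothSections (m + 1) F E, ∀ z v,
    D (Complex.I • s.1) z v = Complex.I • D s.1 z v
  product : ∃ D' : CovariantDerivative (𝓡 m) F' E', D'.ContMDiffCovariantDerivative ∞ ∧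
    ∀ (s : smoothSections (m + 1) F E) (y : Y) (u : ℝ), 0 ≤ u →
      ∀ (v : TangentSpace (𝓡 m) y) (r : ℝ),
        (B.iso y u).symm (D s.1 (C.chart (y, u))
          (mfderiv ((𝓡 m).prod 𝓘(ℝ, ℝ)) (𝓡 (m + 1)) C.chart (y, u) (v, r)))
        = r • deriv (fun w => B.pull s.1 y w) u + D' (fun y' => B.pull s.1 y' u) y v

end Cylinder

/-! ### The dilated Laplacian -/

section Dilation

/-- The cut-off function used for the dilation. -/
structure IsCutoff (K R : ℝ) (φ : ℝ → ℝ) : Prop where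
  K_pos : 0 < K
  K_lt_R : K < R
  contDiff : ContDiff ℝ ∞ φ
  deriv_nonneg : ∀ u, 0 ≤ deriv φ u
  eq_zero : ∀ u, 0 < u → u < K → φ u = 0
  eq_one : ∀ u, R < u → φ u = 1

/-- The set `Γ` of dilation parameters. -/
def Γ : Set ℂ := {θ | 0 < θ.re ∧ |θ.im| ≤ θ.re ∧ θ.im ^ 2 < 1 / 2}

variable (φ : ℝ → ℝ) (θ : ℂ) (u : ℝ)

/-- `ψ_θ(u) = (φ(u) θ + 1) u`. -/
def ψ (u : ℝ) : ℂ := ((φ u : ℂ) * θ + 1) * u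

/-- `ψ_θ'(u)`, `ψ_θ''(u)` and `ψ_θ'''(u)`. -/
def ψ₁ : ℂ := deriv (ψ φ θ) u

def ψ₂ : ℂ := iteratedDeriv 2 (ψ φ θ) u

def ψ₃ : ℂ := iteratedDeriv 3 (ψ φ θ) u

/-- `α_θ'(ψ_θ(u)) = 1 / ψ_θ'(u)`, where `α_θ` is the inverse function of `ψ_θ` (for real `θ`). -/
def α₁ : ℂ := (ψ₁ φ θ u)⁻¹

/-- `α_θ''(ψ_θ(u)) = -ψ_θ''(u) / ψ_θ'(u)³`. -/
def α₂ : ℂ := -ψ₂ φ θ u / ψ₁ φ θ u ^ 3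

/-- The coefficient of `∂²/∂u²` in `Δ_θ = U_θ Δ U_θ⁻¹`, where
`U_θ f(y, u) = ψ_θ'(u)^{1/2} f(y, ψ_θ(u))`. -/
def a₂ : ℂ := -α₁ φ θ u ^ 2

/-- The coefficient of `∂/∂u` in `Δ_θ`. -/
def a₁ : ℂ := -α₂ φ θ u + (ψ₁ φ θ u)⁻¹ * ψ₂ φ θ u * α₁ φ θ u ^ 2

/-- The coefficient of order zero in `Δ_θ`. -/
def a₀ : ℂ :=
  -(3 / 4) * (ψ₁ φ θ u)⁻¹ ^ 2 * ψ₂ φ θ u ^ 2 * α₁ φ θ u ^ 2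
    + 1 / 2 * (ψ₁ φ θ u)⁻¹ * ψ₃ φ θ u * α₁ φ θ u ^ 2
    + 1 / 2 * (ψ₁ φ θ u)⁻¹ * ψ₂ φ θ u * α₂ φ θ u

variable {m : ℕ}
  {Z : Type*} [TopologicalSpace Z] [ChartedSpace (EuclideanSpace ℝ (Fin (m + 1))) Z]
  [RiemannianBundle (fun z : Z => TangentSpace (𝓡 (m + 1)) z)]
  {Y : Type*} [TopologicalSpace Y] [ChartedSpace (EuclideanSpace ℝ (Fin m)) Y]
  [RiemannianBundle (fun y : Y => TangentSpace (𝓡 m) y)]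
  {F : Type*} [NormedAddCommGroup F] [NormedSpace ℂ F]
  {E : Z → Type*} [TopologicalSpace (TotalSpace F E)]
  [∀ z, NormedAddCommGroup (E z)] [∀ z, InnerProductSpace ℂ (E z)]
  [FiberBundle F E] [VectorBundle ℂ F E] [VectorBundle ℝ F E]
  {F' : Type*} [NormedAddCommGroup F'] [NormedSpace ℂ F']
  {E' : Y → Type*} [TopologicalSpace (TotalSpace F' E')]
  [∀ y, NormedAddCommGroup (E' y)] [∀ y, InnerProductSpace ℂ (E' y)]
  [FiberBundle F' E'] [VectorBundle ℂ F' E'] [VectorBundle ℝ F' E']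
  {C : CylindricalEnd m Z Y} (B : BundleEnd F E F' E' C)
  (Δ : smoothSections (m + 1) F E →ₗ[ℂ] smoothSections (m + 1) F E)

/-- The difference `Δ_θ s - Δ s` on `Y × (0, ∞)`, where `Δ = -∂²/∂u² + Δ_Y`. -/
def endCorrection (s : Π z, E z) (y : Y) (u : ℝ) : E' y :=
  (a₂ φ θ u + 1) • iteratedDeriv 2 (fun v => B.pull s y v) u
    + a₁ φ θ u • deriv (fun v => B.pull s y v) u + a₀ φ θ u • B.pull s y u

open Classical in
/-- The dilated Laplacian `Δ_θ` on smooth sections: `Δ_θ = Δ` on `Z₀`, and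
`Δ_θ = a₂ ∂²/∂u² + a₁ ∂/∂u + a₀ + Δ_Y` on `Y × (0, ∞)` (see `pull_dilatedLaplacian`). -/
def dilatedLaplacian (s : smoothSections (m + 1) F E) (z : Z) : E z :=
  if h : z ∈ C.chart.target ∧ 0 < (C.chart.symm z).2 then
    (Δ s).1 z + (C.chart.right_inv h.1) ▸
      (B.iso (C.chart.symm z).1 (C.chart.symm z).2
        (endCorrection φ θ B s.1 (C.chart.symm z).1 (C.chart.symm z).2))
  else (Δ s).1 z

set_option linter.unusedSectionVars false in
theorem dilatedLaplacian_chart (s : smoothSections (m + 1) F E) (y : Y) (u : ℝ) (hu : 0 < u) :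
    dilatedLaplacian φ θ B Δ s (C.chart (y, u))
      = (Δ s).1 (C.chart (y, u)) + B.iso y u (endCorrection φ θ B s.1 y u) := by
  have hs : (y, u) ∈ C.chart.source := by
    rw [C.source_eq]
    exact (neg_lt_zero.2 C.ε_pos).trans hu
  have hl : C.chart.symm (C.chart (y, u)) = (y, u) := C.chart.left_inv hs
  have h : C.chart (y, u) ∈ C.chart.target ∧ 0 < (C.chart.symm (C.chart (y, u))).2 :=
    ⟨C.chart.map_source hs, by rw [hl]; exact hu⟩
  rw [dilatedLaplacian, dif_pos h]
  congr 1
  have key : ∀ (p : Y × ℝ) (_ : p = (y, u)) (e : C.chart p = C.chart (y, u)),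
      (e ▸ (B.iso p.1 p.2 (endCorrection φ θ B s.1 p.1 p.2)) : E (C.chart (y, u)))
        = B.iso y u (endCorrection φ θ B s.1 y u) := by
    rintro p rfl e
    rfl
  exact key _ hl _

/-- The formula for `Δ_θ` on the end. -/
theorem pull_dilatedLaplacian
    (ΔY : smoothSections m F' E' →ₗ[ℂ] smoothSections m F' E')
    (s : smoothSections (m + 1) F E) (y : Y) (u : ℝ) (hu : 0 < u)
    (h : B.pull (Δ s).1 y u = -iteratedDeriv 2 (fun v => B.pull s.1 y v) u
        + (ΔY (B.slice s u ((neg_lt_zero.2 C.ε_pos).trans hu))).1 y) :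
    B.pull (dilatedLaplacian φ θ B Δ s) y u
      = a₂ φ θ u • iteratedDeriv 2 (fun v => B.pull s.1 y v) u
        + a₁ φ θ u • deriv (fun v => B.pull s.1 y v) u + a₀ φ θ u • B.pull s.1 y u
        + (ΔY (B.slice s u ((neg_lt_zero.2 C.ε_pos).trans hu))).1 y := by
  have e : B.pull (dilatedLaplacian φ θ B Δ s) y u
      = B.pull (Δ s).1 y u + endCorrection φ θ B s.1 y u := by
    simp [BundleEnd.pull, dilatedLaplacian_chart φ θ B Δ s y u hu]
  rw [e, h, endCorrection, add_smul, one_smul]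
  abel

end Dilation

/-! ### The first Sobolev space and the form of the dilated Laplacian -/

section Sobolev

variable {n : ℕ} {M : Type*} [TopologicalSpace M] [ChartedSpace (EuclideanSpace ℝ (Fin n)) M]
  [RiemannianBundle (fun x : M => TangentSpace (𝓡 n) x)] [MeasurableSpace M] [BorelSpace M]
  {F : Type*} [NormedAddCommGroup F] [NormedSpace ℂ F]
  {E : M → Type*} [TopologicalSpace (TotalSpace F E)]
  [∀ x, NormedAddCommGroup (E x)] [∀ x, InnerProductSpace ℂ (E x)]
  [FiberBundle F E] [VectorBundle ℂ F E] [VectorBundle ℝ F E] [IsSmoothHermitian n F E]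
  (D : CovariantDerivative (𝓡 n) F E)

/-- The sequence `f_k` of compactly supported smooth sections is a Cauchy sequence for the norm
`(‖f‖² + ‖∇f‖²)^{1/2}` and converges to `ψ` in `L²`. -/
structure SobolevTendsto (f : ℕ → smoothSections n F E) (ψ : L2 n F E) : Prop where
  compactSupp : ∀ k, HasCompactSupp (f k)
  tendsto_L2 : ∃ s : PreL2 n F E, SeparationQuotient.mk s = ψ ∧
    Tendsto (fun k => ∫⁻ x, ‖(f k).1 x - s.1 x‖ₑ ^ 2 ∂(riemannianVolume n M)) atTop (𝓝 0)
  cauchy_gradient : Tendsto (fun p : ℕ × ℕ =>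
    ∫⁻ x, ‖D (f p.1 - f p.2).1 x‖ₑ ^ 2 ∂(riemannianVolume n M)) atTop (𝓝 0)

/-- The first Sobolev space `W₁(M, E)`, as a subset of `L²(M, E)`: the closure of the compactly
supported smooth sections for the norm `(‖f‖² + ‖∇f‖²)^{1/2}`. -/
def sobolevW1 : Set (L2 n F E) := {ψ | ∃ f : ℕ → smoothSections n F E, SobolevTendsto D f ψ}

/-- `q` is the form `(f, g) ↦ ⟨f, T g⟩` with domain `W₁(M, E)`: it is the extension by continuity,
for the `W₁`-norm, of this form on compactly supported smooth sections. -/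
structure IsFormOf (T : smoothSections n F E → Π x, E x) (q : SesqForm (L2 n F E)) : Prop where
  domain_eq : (q.domain : Set (L2 n F E)) = sobolevW1 D
  tendsto : ∀ (f g : ℕ → smoothSections n F E) (η ψ : q.domain),
    SobolevTendsto D f η → SobolevTendsto D g ψ →
    Tendsto (fun k => ∫ x, inner ℂ ((f k).1 x) (T (g k) x) ∂(riemannianVolume n M))
      atTop (𝓝 (q.toFun η ψ))

end Sobolev

end

end CylEnd

/-! On the end write `Δ_θ = Δ + c₂ ∂_u² + c₁ ∂_u + c₀` with `c₂ = a₂ + 1`, `c₁ = a₁`, `c₀ = a₀`.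
These coefficients vanish for `u < K`, are constant for `u > R`, and hence are bounded. One
integration by parts gives `⟨s, Δ_θ t⟩ = ⟨s, Δ t⟩ - ⟨∂_u s, c₂ ∂_u t⟩ + ⟨s, (c₁ - c₂') ∂_u t⟩ + ⟨s,
c₀ t⟩` (`IsCompatibleLaplacian.inner_compactDilation`). The role of `Γ` is a sign: `ψ_θ' = 1 + θ w`
with `w = φ + u φ' ≥ 0`, so `Re (ψ_θ')² ≥ 1`; as `ψ_θ'` is bounded, `Re (ψ_θ')⁻² ≥ c > 0`, that is
`Re c₂ ≤ 1 - c` (`IsCutoff.exists_coefficients`). The perturbation therefore removes at most the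
fraction `1 - c` of the normal part of the energy of `Δ`.

Since `c` may be small, this needs a Gårding inequality with sharp leading constant. An energy
`e(s)` is constructed, equivalent to `‖∇s‖²` modulo `‖s‖²`, such that for every `δ > 0` there is a
`b` with `|Re ⟨s, Δ s⟩ - e(s)| ≤ δ e(s) + b ‖s‖²` and `‖∂_u s‖² ≤ (1 + δ) e(s) + b ‖s‖²`. With `δ =
c / 4` one obtains `Re ⟨s, Δ_θ s⟩ ≥ (c / 4) e(s) - G ‖s‖²` (`re_inner_perturbation_ge`).

The energy is the sum of `|d Re ⟨e_j, χ_i s⟩|²` over a finite quadratic partition of unity `∑ χ_i² =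
1` and real orthonormal frames `e_j` near the supports. The only input on `Δ` is `[[Δ, f], f] = -2
|df|²` for real `f`. Paired with `s` and integrated, it yields the diagonal terms of the energy
exactly (`IsFormallySelfAdjoint.integral_funSmul`) and the localization formula for the partition.
In an off-diagonal term, `f ↦ Re ⟨e_j, [Δ, f] e_k⟩` is a point derivation, because `e_j ⟂ e_k`;
Hadamard's lemma bounds it by `|df|`. Uniformity over the noncompact `Z` comes from a finite cover
of a compact part together with frames on the end pulled back from the compact `Y`
(`BundleEnd.exists_controlledCover`).

The operator `f'(u) ∂_u` is realized on all of `Z` as `-½ ([Δ, f] + f'')`; its formal adjoint then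
follows from the symmetry of `Δ`, without splitting the volume of the end.

The functional analysis is Friedrichs' argument: `⟨s, Δ t⟩ + a ⟨s, t⟩` is, for large `a`, a
semi-inner product equivalent to energy plus `L²`-norm, and it is represented by a vector of `L²`,
hence closable. The form of `Δ_θ` is bounded and, after adding `γ`, coercive for it, so it extends
to a closed sectorial form whose domain is `W₁` (`exists_strictlyMAccretive_form`). -/

namespace CylEnd

noncomputable section

/-! ### Extension of bounded coercive forms to closed sectorial forms. -/

section FormExtension

variable {H : Type*} [NormedAddCommGroup H] [InnerProductSpace ℂ H]
  {V : Type*} [SeminormedAddCommGroup V] [InnerProductSpace ℂ V]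

/-- The sequence `f` is Cauchy in `V` and its image in `H` converges to `ψ`. -/
structure FormTendsto (ι : V →ₗ[ℂ] H) (f : ℕ → V) (ψ : H) : Prop where
  tendsto : Tendsto (fun k => ι (f k)) atTop (𝓝 ψ)
  cauchy : CauchySeq f

variable {ι : V →ₗ[ℂ] H}

theorem FormTendsto.add {f g : ℕ → V} {η ψ : H} (hf : FormTendsto ι f η) (hg : FormTendsto ι g ψ) :
    FormTendsto ι (fun k => f k + g k) (η + ψ) :=
  ⟨by simpa using hf.1.add hg.1, hf.2.add hg.2⟩

theorem FormTendsto.sub {f g : ℕ → V} {η ψ : H} (hf : FormTendsto ι f η) (hg : FormTendsto ι g ψ) :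
    FormTendsto ι (fun k => f k - g k) (η - ψ) :=
  ⟨by simpa using hf.1.sub hg.1, by
    have := hf.cauchy.add hg.cauchy.neg
    rwa [← sub_eq_add_neg] at this⟩

theorem FormTendsto.smul {f : ℕ → V} {η : H} (hf : FormTendsto ι f η) (c : ℂ) :
    FormTendsto ι (fun k => c • f k) (c • η) :=
  ⟨by simpa using hf.1.const_smul c,
    (uniformContinuous_const_smul c).comp_cauchySeq hf.cauchy⟩

theorem FormTendsto.zero : FormTendsto ι (fun _ => 0) 0 :=
  ⟨by simp, cauchySeq_const 0⟩

/-- The Friedrichs argument: if the inner product of `V` is represented by the one of `H`, then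
the embedding of `V` in `H` is closable. -/
theorem FormTendsto.tendsto_zero
    (hF : ∀ t : V, ∃ τ : H, ∀ s : V, inner ℂ s t = inner ℂ (ι s) τ)
    {f : ℕ → V} (hf : FormTendsto ι f 0) : Tendsto f atTop (𝓝 0) := by
  rw [Metric.tendsto_atTop]
  intro δ hδ
  obtain ⟨M, hM⟩ := hf.cauchy.norm_bddAbove
  have hM' : ∀ k, ‖f k‖ ≤ M := fun k => hM ⟨k, rfl⟩
  have hM0 : 0 ≤ M := (norm_nonneg _).trans (hM' 0)
  -- The tolerance is chosen so that, multiplied by the bound `M` of the sequence, it stays below `δ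
  -- ^ 2`; the `+ 1` covers `M = 0`.
  obtain ⟨N, hN⟩ := Metric.cauchySeq_iff.1 hf.cauchy (δ ^ 2 / (2 * (M + 1))) (by positivity)
  refine ⟨N, fun k hk => ?_⟩
  obtain ⟨τ, hτ⟩ := hF (f k)
  have hlim : Tendsto (fun l => inner ℂ (f l) (f k)) atTop (𝓝 (0 : ℂ)) := by
    have := hf.1.inner (tendsto_const_nhds (x := τ) (f := atTop) (α := ℕ)) (𝕜 := ℂ)
    rw [inner_zero_left] at this
    exact this.congr fun l => (hτ (f l)).symm
  have hbd : ‖f k‖ ^ 2 ≤ δ ^ 2 / (2 * (M + 1)) * M := by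
    have h2 : Tendsto (fun l => ‖(inner ℂ (f l) (f k) : ℂ)‖ + δ ^ 2 / (2 * (M + 1)) * M) atTop
        (𝓝 (0 + δ ^ 2 / (2 * (M + 1)) * M)) := by
      have := hlim.norm
      rw [norm_zero] at this
      exact this.add_const _
    rw [zero_add] at h2
    refine ge_of_tendsto h2 ?_
    filter_upwards [eventually_ge_atTop N] with l hl
    -- With `k` fixed, the first summand tends to `0` as `l → ∞` because it is an inner product in
    -- `H` with a fixed vector; the second is small by the Cauchy property.
    have e : (inner ℂ (f k) (f k) : ℂ) = inner ℂ (f l) (f k) + inner ℂ (f k - f l) (f k) := by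
      rw [inner_sub_left]; ring
    have e2 : ‖f k‖ ^ 2 = ‖(inner ℂ (f k) (f k) : ℂ)‖ := by
      rw [inner_self_eq_norm_sq_to_K]; simp
    rw [e2, e]
    refine (norm_add_le _ _).trans (add_le_add_right ?_ _)
    refine (norm_inner_le_norm _ _).trans ?_
    have := hN k hk l hl
    rw [dist_eq_norm] at this
    gcongr
    exact hM' k
  have hlt : δ ^ 2 / (2 * (M + 1)) * M < δ ^ 2 := by
    rw [div_mul_eq_mul_div, div_lt_iff₀ (by positivity)]
    nlinarith [sq_nonneg δ, pow_pos hδ 2]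
  rw [dist_zero_right]
  exact lt_of_pow_lt_pow_left₀ 2 hδ.le (hbd.trans_lt hlt)

variable (ι) in
/-- The vectors of `H` that are limits of Cauchy sequences of `V`. -/
def formDomain : Submodule ℂ H where
  carrier := {ψ | ∃ f, FormTendsto ι f ψ}
  add_mem' := by
    rintro η ψ ⟨f, hf⟩ ⟨g, hg⟩
    exact ⟨_, hf.add hg⟩
  zero_mem' := ⟨_, FormTendsto.zero⟩
  smul_mem' := by
    rintro c ψ ⟨f, hf⟩
    exact ⟨_, hf.smul c⟩

variable {b : V →ₗ⋆[ℂ] V →ₗ[ℂ] ℂ} {A : ℝ}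

theorem FormTendsto.cauchySeq_form (hb : ∀ s t, ‖b s t‖ ≤ A * ‖s‖ * ‖t‖)
    {f g : ℕ → V} (hf : CauchySeq f) (hg : CauchySeq g) : CauchySeq fun k => b (f k) (g k) := by
  -- The estimates run with `|A|`, since `A` is not known to be nonnegative here.
  have hA : 0 ≤ |A| := abs_nonneg A
  obtain ⟨M, hM⟩ := hf.norm_bddAbove
  obtain ⟨M', hM'⟩ := hg.norm_bddAbove
  have hMk : ∀ k, ‖f k‖ ≤ M := fun k => hM ⟨k, rfl⟩
  have hMk' : ∀ k, ‖g k‖ ≤ M' := fun k => hM' ⟨k, rfl⟩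
  have hM0 : 0 ≤ M := (norm_nonneg _).trans (hMk 0)
  have hM0' : 0 ≤ M' := (norm_nonneg _).trans (hMk' 0)
  rw [cauchySeq_iff_tendsto_dist_atTop_0] at hf hg ⊢
  have hlim : Tendsto (fun n : ℕ × ℕ => |A| * dist (f n.1) (f n.2) * M'
      + |A| * M * dist (g n.1) (g n.2)) atTop (𝓝 0) := by
    simpa using ((hf.const_mul |A|).mul_const M').add (hg.const_mul (|A| * M))
  refine squeeze_zero (fun _ => dist_nonneg) (fun n => ?_) hlim
  rw [dist_eq_norm, dist_eq_norm, dist_eq_norm]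
  have e : b (f n.1) (g n.1) - b (f n.2) (g n.2)
      = b (f n.1 - f n.2) (g n.1) + b (f n.2) (g n.1 - g n.2) := by simp
  rw [e]
  refine (norm_add_le _ _).trans (add_le_add ((hb _ _).trans ?_) ((hb _ _).trans ?_))
  · gcongr
    exacts [le_abs_self A, hMk' _]
  · gcongr
    exacts [le_abs_self A, hMk _]

/-- Two approximating sequences of the same vector differ by a Cauchy sequence that tends to `0` in
`H`, hence in `V` by `FormTendsto.tendsto_zero`. Boundedness of `b` then makes the limit independent
of the choice, which is what well-definedness of the extended form requires. -/
theorem FormTendsto.exists_lim (hb : ∀ s t, ‖b s t‖ ≤ A * ‖s‖ * ‖t‖)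
    (hF : ∀ t : V, ∃ τ : H, ∀ s : V, inner ℂ s t = inner ℂ (ι s) τ) (η ψ : formDomain ι) :
    ∃ z : ℂ, ∀ f g : ℕ → V, FormTendsto ι f η → FormTendsto ι g ψ →
      Tendsto (fun k => b (f k) (g k)) atTop (𝓝 z) := by
  obtain ⟨f₀, hf₀⟩ := η.2
  obtain ⟨g₀, hg₀⟩ := ψ.2
  obtain ⟨z, hz⟩ := cauchySeq_tendsto_of_complete (cauchySeq_form hb hf₀.2 hg₀.2)
  refine ⟨z, fun f g hf hg => ?_⟩
  have h1 : Tendsto (fun k => f k - f₀ k) atTop (𝓝 0) :=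
    FormTendsto.tendsto_zero hF (by simpa using hf.sub hf₀)
  have h2 : Tendsto (fun k => g k - g₀ k) atTop (𝓝 0) :=
    FormTendsto.tendsto_zero hF (by simpa using hg.sub hg₀)
  obtain ⟨M, hM⟩ := hf.2.norm_bddAbove
  obtain ⟨M', hM'⟩ := hg₀.2.norm_bddAbove
  have hMk : ∀ k, ‖f k‖ ≤ M := fun k => hM ⟨k, rfl⟩
  have hMk' : ∀ k, ‖g₀ k‖ ≤ M' := fun k => hM' ⟨k, rfl⟩
  have hM0 : 0 ≤ M := (norm_nonneg _).trans (hMk 0)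
  have hlim : Tendsto (fun k => |A| * ‖f k - f₀ k‖ * M' + |A| * M * ‖g k - g₀ k‖) atTop (𝓝 0) := by
    have h1' := h1.norm
    have h2' := h2.norm
    rw [norm_zero] at h1' h2'
    simpa using ((h1'.const_mul |A|).mul_const M').add (h2'.const_mul (|A| * M))
  have hd : Tendsto (fun k => b (f k) (g k) - b (f₀ k) (g₀ k)) atTop (𝓝 0) := by
    refine squeeze_zero_norm (fun k => ?_) hlim
    have e : b (f k) (g k) - b (f₀ k) (g₀ k)
        = b (f k - f₀ k) (g₀ k) + b (f k) (g k - g₀ k) := by simp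
    rw [e]
    refine (norm_add_le _ _).trans (add_le_add ((hb _ _).trans ?_) ((hb _ _).trans ?_))
    · gcongr
      exacts [le_abs_self A, hMk' _]
    · gcongr
      exacts [le_abs_self A, hMk _]
  simpa using hd.add hz

/-- The extension by continuity of the form `b` on `V` to the form domain. -/
def extendForm (hb : ∀ s t, ‖b s t‖ ≤ A * ‖s‖ * ‖t‖)
    (hF : ∀ t : V, ∃ τ : H, ∀ s : V, inner ℂ s t = inner ℂ (ι s) τ) : SesqForm H where
  domain := formDomain ι
  toFun := LinearMap.mk₂'ₛₗ (starRingEnd ℂ) (RingHom.id ℂ)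
    (fun η ψ => (FormTendsto.exists_lim hb hF η ψ).choose)
    (fun η₁ η₂ ψ => by
      obtain ⟨f₁, hf₁⟩ := η₁.2
      obtain ⟨f₂, hf₂⟩ := η₂.2
      obtain ⟨g, hg⟩ := ψ.2
      have h := (FormTendsto.exists_lim hb hF (η₁ + η₂) ψ).choose_spec _ _ (hf₁.add hf₂) hg
      refine tendsto_nhds_unique h ?_
      simpa using ((FormTendsto.exists_lim hb hF η₁ ψ).choose_spec _ _ hf₁ hg).add
        ((FormTendsto.exists_lim hb hF η₂ ψ).choose_spec _ _ hf₂ hg))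
    (fun c η ψ => by
      obtain ⟨f, hf⟩ := η.2
      obtain ⟨g, hg⟩ := ψ.2
      have h := (FormTendsto.exists_lim hb hF (c • η) ψ).choose_spec _ _ (hf.smul c) hg
      refine tendsto_nhds_unique h ?_
      simpa using ((FormTendsto.exists_lim hb hF η ψ).choose_spec _ _ hf hg).const_mul
        ((starRingEnd ℂ) c))
    (fun η ψ₁ ψ₂ => by
      obtain ⟨f₁, hf₁⟩ := ψ₁.2
      obtain ⟨f₂, hf₂⟩ := ψ₂.2
      obtain ⟨g, hg⟩ := η.2
      have h := (FormTendsto.exists_lim hb hF η (ψ₁ + ψ₂)).choose_spec _ _ hg (hf₁.add hf₂)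
      refine tendsto_nhds_unique h ?_
      simpa using ((FormTendsto.exists_lim hb hF η ψ₁).choose_spec _ _ hg hf₁).add
        ((FormTendsto.exists_lim hb hF η ψ₂).choose_spec _ _ hg hf₂))
    (fun c η ψ => by
      obtain ⟨f, hf⟩ := η.2
      obtain ⟨g, hg⟩ := ψ.2
      have h := (FormTendsto.exists_lim hb hF η (c • ψ)).choose_spec _ _ hf (hg.smul c)
      refine tendsto_nhds_unique h ?_
      simpa using ((FormTendsto.exists_lim hb hF η ψ).choose_spec _ _ hf hg).const_mul c)

theorem extendForm_tendsto (hb : ∀ s t, ‖b s t‖ ≤ A * ‖s‖ * ‖t‖)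
    (hF : ∀ t : V, ∃ τ : H, ∀ s : V, inner ℂ s t = inner ℂ (ι s) τ)
    {f g : ℕ → V} {η ψ : (extendForm hb hF).domain} (hf : FormTendsto ι f η)
    (hg : FormTendsto ι g ψ) :
    Tendsto (fun k => b (f k) (g k)) atTop (𝓝 ((extendForm hb hF).toFun η ψ)) :=
  (FormTendsto.exists_lim hb hF η ψ).choose_spec f g hf hg

/-- The extension of `b + γ ⟨·,·⟩` is comparable to the squared norm of `V`. -/
theorem extendForm_bounds (hb : ∀ s t, ‖b s t‖ ≤ A * ‖s‖ * ‖t‖)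
    (hF : ∀ t : V, ∃ τ : H, ∀ s : V, inner ℂ s t = inner ℂ (ι s) τ)
    (hι : ∀ s, ‖ι s‖ ≤ ‖s‖) {γ c : ℝ} (hγ : 0 < γ)
    (hc : ∀ s, c * ‖s‖ ^ 2 ≤ (b s s).re + γ * ‖ι s‖ ^ 2)
    {f : ℕ → V} {η : (extendForm hb hF).domain} (hf : FormTendsto ι f η) :
    ∃ N : ℝ, Tendsto (fun k => ‖f k‖) atTop (𝓝 N) ∧
      c * N ^ 2 ≤ (((extendForm hb hF).affine 1 γ).toFun η η).re ∧
      ‖((extendForm hb hF).affine 1 γ).toFun η η‖ ≤ (A + γ) * N ^ 2 := by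
  obtain ⟨N, hN : Tendsto (fun k => ‖f k‖) atTop (𝓝 N)⟩ := cauchySeq_tendsto_of_complete
    (uniformContinuous_norm.comp_cauchySeq hf.cauchy)
  have e : ((extendForm hb hF).affine 1 γ).toFun η η
      = (extendForm hb hF).toFun η η + γ * inner ℂ (η : H) (η : H) := by
    simp only [SesqForm.affine, one_smul]
    rfl
  have hlim : Tendsto (fun k => b (f k) (f k) + γ * inner ℂ (ι (f k)) (ι (f k))) atTop
      (𝓝 (((extendForm hb hF).affine 1 γ).toFun η η)) := by
    rw [e]
    exact (extendForm_tendsto hb hF hf hf).add ((hf.1.inner hf.1).const_mul _)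
  have e2 : ∀ k, (γ : ℂ) * inner ℂ (ι (f k)) (ι (f k)) = ((γ * ‖ι (f k)‖ ^ 2 : ℝ) : ℂ) := by
    intro k
    rw [inner_self_eq_norm_sq_to_K]
    push_cast
    rfl
  refine ⟨N, hN, ?_, ?_⟩
  · refine le_of_tendsto_of_tendsto' ((hN.pow 2).const_mul c)
      ((Complex.continuous_re.tendsto _).comp hlim) fun k => ?_
    simp only [Function.comp_apply, Complex.add_re, e2, Complex.ofReal_re]
    exact hc (f k)
  · refine le_of_tendsto_of_tendsto' hlim.norm ((hN.pow 2).const_mul (A + γ)) fun k => ?_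
    refine (norm_add_le _ _).trans ?_
    rw [e2, Complex.norm_real, Real.norm_of_nonneg (by positivity), add_mul]
    have := hι (f k)
    refine add_le_add ((hb _ _).trans (by rw [pow_two, mul_assoc])) ?_
    gcongr

/-- Coercivity and boundedness with respect to the same quantity `N` confine `z` to the sector `|Im
z| ≤ (A / c) Re z`. For `N = 0` the number is `0`, whose argument is `0` by convention. -/
theorem abs_arg_le_arctan {z : ℂ} {c A N : ℝ} (hc : 0 < c) (h1 : c * N ≤ z.re) (h2 : ‖z‖ ≤ A * N)
    (hA : 0 ≤ A) (hN : 0 ≤ N) : |z.arg| ≤ Real.arctan (A / c) := by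
  rcases hN.eq_or_lt with rfl | hN
  · have : z = 0 := by simpa using h2
    rw [this, Complex.arg_zero, abs_zero, Real.arctan_nonneg]
    positivity
  · have hre : 0 < z.re := by nlinarith [mul_pos hc hN]
    have h3 : |z.arg| < Real.pi / 2 := Complex.abs_arg_lt_pi_div_two_iff.2 (Or.inl hre)
    rw [abs_lt] at h3
    have h4 : |z.im| ≤ A / c * z.re := by
      have : |z.im| ≤ A * N := (Complex.abs_im_le_norm z).trans h2
      rw [div_mul_eq_mul_div, le_div_iff₀ hc]
      nlinarith [abs_nonneg z.im, mul_le_mul_of_nonneg_left h1 hA]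
    have h5 : |Real.tan z.arg| ≤ A / c := by
      rw [Complex.tan_arg, abs_div, abs_of_pos hre, div_le_iff₀ hre]
      exact h4
    rw [← Real.arctan_tan (x := z.arg) (by linarith) h3.2]
    rw [abs_le] at h5 ⊢
    rw [← Real.arctan_neg]
    exact ⟨Real.arctan_mono h5.1, Real.arctan_mono h5.2⟩

theorem FormTendsto.const (v : V) : FormTendsto ι (fun _ => v) (ι v) :=
  ⟨tendsto_const_nhds, cauchySeq_const v⟩

/-- A continuous coercive form on `V` extends to a densely defined, closed and sectorial form on
the vectors of `H` that are limits of Cauchy sequences of `V`. -/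
theorem extendForm_isStrictlyMAccretive (hb : ∀ s t, ‖b s t‖ ≤ A * ‖s‖ * ‖t‖) (hA : 0 ≤ A)
    (hF : ∀ t : V, ∃ τ : H, ∀ s : V, inner ℂ s t = inner ℂ (ι s) τ)
    (hι : ∀ s, ‖ι s‖ ≤ ‖s‖) (hd : DenseRange ι) {γ c : ℝ} (hγ : 0 < γ) (h0 : 0 < c)
    (hc : ∀ s, c * ‖s‖ ^ 2 ≤ (b s s).re + γ * ‖ι s‖ ^ 2) :
    ((extendForm hb hF).affine 1 γ).IsStrictlyMAccretive where
  dense := hd.mono (by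
    rintro _ ⟨v, rfl⟩
    exact ⟨_, FormTendsto.const v⟩)
  closed := by
    set Q := (extendForm hb hF).affine 1 γ with hQ
    intro φ ψ hφ hq
    have hex : ∀ k, ∃ f : ℕ → V, FormTendsto ι f (φ k : H) := fun k => (φ k).2
    choose f hf using hex
    -- A diagonal choice: from a Cauchy sequence representing `φ k`, take a term close to `φ k` in
    -- `H` and close in `V` to all later terms. These terms `v k` will represent the limit `ψ`.
    have hv : ∀ k, ∃ n, dist (ι (f k n)) (φ k) < 1 / ((k : ℝ) + 1) ∧
        ∀ l ≥ n, dist (f k l) (f k n) < 1 / ((k : ℝ) + 1) := by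
      intro k
      have hp : (0 : ℝ) < 1 / ((k : ℝ) + 1) := by positivity
      obtain ⟨n₁, h₁⟩ := Metric.tendsto_atTop.1 (hf k).tendsto _ hp
      obtain ⟨n₂, h₂⟩ := Metric.cauchySeq_iff.1 (hf k).cauchy _ hp
      refine ⟨max n₁ n₂, h₁ _ (le_max_left _ _), fun l hl => ?_⟩
      exact h₂ _ ((le_max_right _ _).trans hl) _ (le_max_right _ _)
    choose n hn1 hn2 using hv
    set v : ℕ → V := fun k => f k (n k) with hvdef
    have hone : Tendsto (fun k : ℕ => 1 / ((k : ℝ) + 1)) atTop (𝓝 0) :=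
      tendsto_one_div_add_atTop_nhds_zero_nat
    have hvι : Tendsto (fun k => ι (v k)) atTop (𝓝 ψ) := by
      have h1 : Tendsto (fun k => dist (ι (v k)) (φ k : H)) atTop (𝓝 0) :=
        squeeze_zero (fun _ => dist_nonneg) (fun k => (hn1 k).le) hone
      exact (tendsto_iff_of_dist h1).2 hφ
    -- In `V`, `v j` and `v k` are close to the tails of `f j` and `f k`. The distance of the tails
    -- tends to some `N`, and coercivity bounds `c * N ^ 2` by the form at `φ j - φ k`; so
    -- convergence of the form values makes `v` Cauchy.
    have hvd : ∀ j k, dist (v j) (v k) ≤ 1 / ((j : ℝ) + 1) + 1 / ((k : ℝ) + 1)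
        + Real.sqrt (‖Q.toFun (φ j - φ k) (φ j - φ k)‖ / c) := by
      intro j k
      obtain ⟨N, hN, hN1, -⟩ := extendForm_bounds hb hF hι hγ hc
        (η := φ j - φ k) ((hf j).sub (hf k))
      have hNle : N ≤ Real.sqrt (‖Q.toFun (φ j - φ k) (φ j - φ k)‖ / c) := by
        refine Real.le_sqrt_of_sq_le ?_
        rw [le_div_iff₀ h0, mul_comm]
        exact hN1.trans (Complex.re_le_norm _)
      refine le_trans ?_ (add_le_add_right hNle _)
      refine ge_of_tendsto (hN.const_add _) ?_
      filter_upwards [eventually_ge_atTop (max (n j) (n k))] with l hl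
      have h1 := hn2 j l ((le_max_left _ _).trans hl)
      have h2 := hn2 k l ((le_max_right _ _).trans hl)
      have h3 := dist_triangle4_left (f j l) (f k l) (v j) (v k)
      rw [dist_eq_norm (f j l) (f k l)] at h3
      simp only [hvdef] at h3 ⊢
      linarith
    have hvc : CauchySeq v := by
      rw [cauchySeq_iff_tendsto_dist_atTop_0]
      have ht1 : Tendsto (fun p : ℕ × ℕ => 1 / ((p.1 : ℝ) + 1)) atTop (𝓝 0) := by
        rw [← prod_atTop_atTop_eq]
        exact hone.comp tendsto_fst
      have ht2 : Tendsto (fun p : ℕ × ℕ => 1 / ((p.2 : ℝ) + 1)) atTop (𝓝 0) := by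
        rw [← prod_atTop_atTop_eq]
        exact hone.comp tendsto_snd
      have ht3 : Tendsto (fun p : ℕ × ℕ =>
          Real.sqrt (‖Q.toFun (φ p.1 - φ p.2) (φ p.1 - φ p.2)‖ / c)) atTop (𝓝 0) := by
        have := (hq.norm.div_const c).sqrt
        simpa using this
      refine squeeze_zero (fun _ => dist_nonneg) (fun p => hvd p.1 p.2) ?_
      simpa using (ht1.add ht2).add ht3
    have hψ : FormTendsto ι v ψ := ⟨hvι, hvc⟩
    refine ⟨⟨v, hψ⟩, ?_⟩
    -- Conversely, the upper bound of `extendForm_bounds` controls the form at `φ k - ψ` by the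
    -- limiting `V`-distance between `f k` and `v`.
    have hbd : ∀ k, ∃ N : ℝ, Tendsto (fun l => ‖f k l - v l‖) atTop (𝓝 N) ∧
        ‖Q.toFun (φ k - ⟨ψ, v, hψ⟩) (φ k - ⟨ψ, v, hψ⟩)‖ ≤ (A + γ) * N ^ 2 := by
      intro k
      obtain ⟨N, hN, -, h2⟩ := extendForm_bounds hb hF hι hγ hc
        (η := φ k - (⟨ψ, v, hψ⟩ : Q.domain)) ((hf k).sub hψ)
      exact ⟨N, hN, h2⟩
    choose N hN hNb using hbd
    have hN0 : Tendsto N atTop (𝓝 0) := by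
      rw [Metric.tendsto_atTop]
      intro δ hδ
      obtain ⟨n₁, h₁⟩ := Metric.cauchySeq_iff.1 hvc (δ / 3) (by positivity)
      obtain ⟨n₂, h₂⟩ := Metric.tendsto_atTop.1 hone (δ / 3) (by positivity)
      refine ⟨max n₁ n₂, fun k hk => ?_⟩
      have hNk0 : 0 ≤ N k := ge_of_tendsto' (hN k) fun l => norm_nonneg _
      have hNk : N k ≤ δ / 3 + δ / 3 := by
        refine le_of_tendsto (hN k) ?_
        filter_upwards [eventually_ge_atTop (max n₁ (n k))] with l hl
        have h3 := hn2 k l ((le_max_right _ _).trans hl)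
        have h4 := h₁ k ((le_max_left _ _).trans hk) l ((le_max_left _ _).trans hl)
        have h5 := h₂ k ((le_max_right _ _).trans hk)
        rw [Real.dist_eq, sub_zero, abs_of_pos (by positivity)] at h5
        rw [← dist_eq_norm]
        have h6 := dist_triangle (f k l) (v k) (v l)
        simp only [hvdef] at h6 h4 ⊢
        linarith
      rw [Real.dist_eq, sub_zero, abs_of_nonneg hNk0]
      linarith
    refine squeeze_zero_norm hNb ?_
    simpa using (hN0.pow 2).const_mul (A + γ)
  sectorial := by
    refine ⟨Real.arctan ((A + γ) / c), Real.arctan_pos.2 (by positivity),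
      Real.arctan_lt_pi_div_two _, fun φ => ?_⟩
    obtain ⟨f, hf⟩ := φ.2
    obtain ⟨N, -, h1, h2⟩ := extendForm_bounds hb hF hι hγ hc (η := φ) hf
    exact abs_arg_le_arctan h0 h1 h2 (by positivity) (by positivity)

theorem SesqForm.IsStrictlyMAccretive.isStrictlyMSectorial {q : SesqForm H}
    (hq : q.IsStrictlyMAccretive) : q.IsStrictlyMSectorial := by
  refine ⟨0, 0, ?_⟩
  have : q.affine (Complex.exp ((0 : ℝ) * Complex.I)) 0 = q := by
    rw [SesqForm.affine]
    simp
  rwa [this]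

end FormExtension
end
end CylEnd

set_option linter.unusedSectionVars false

namespace CylEnd

noncomputable section

/-- A shortcut for the topology of the tangent bundle. -/
abbrev tangentTotalSpace {n : ℕ} {M : Type*} [TopologicalSpace M]
    [ChartedSpace (EuclideanSpace ℝ (Fin n)) M] [IsManifold (𝓡 n) ∞ M] :
    TopologicalSpace (TotalSpace (EuclideanSpace ℝ (Fin n)) fun x : M => TangentSpace (𝓡 n) x) :=
  inferInstance

attribute [local instance] tangentTotalSpace

/-! ### Local finiteness of the Riemannian volume. -/

section VolumeLemmas

variable {n : ℕ} {M : Type*} [TopologicalSpace M] [ChartedSpace (EuclideanSpace ℝ (Fin n)) M]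
  [RiemannianBundle (fun x : M => TangentSpace (𝓡 n) x)]

/-- In the chart at `x`, this differential is the inverse of the tangent trivialization at `x`,
which is locally bounded because the metric is continuous. -/
theorem exists_norm_mfderiv_extChartAt_symm_le [IsManifold (𝓡 n) 1 M]
    [IsContinuousRiemannianBundle (EuclideanSpace ℝ (Fin n)) (fun x : M => TangentSpace (𝓡 n) x)]
    (x : M) : ∃ C > 0, ∀ᶠ y in 𝓝 x, ∀ v : EuclideanSpace ℝ (Fin n),
      ‖(mfderiv 𝓘(ℝ, EuclideanSpace ℝ (Fin n)) (𝓡 n) (extChartAt (𝓡 n) x).symm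
        (extChartAt (𝓡 n) x y) v : TangentSpace (𝓡 n) ((extChartAt (𝓡 n) x).symm
        (extChartAt (𝓡 n) x y)))‖ ≤ C * ‖v‖ := by
  rcases eventually_norm_symmL_trivializationAt_lt (EuclideanSpace ℝ (Fin n))
    (fun x : M => TangentSpace (𝓡 n) x) x with ⟨C, C_pos, hC⟩
  refine ⟨C, C_pos, ?_⟩
  have hx := chart_source_mem_nhds (EuclideanSpace ℝ (Fin n)) x
  filter_upwards [hC, hx] with y hy h'y v
  rw [TangentBundle.symmL_trivializationAt h'y] at hy
  have A : (extChartAt (𝓡 n) x).symm (extChartAt (𝓡 n) x y) = y :=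
    (extChartAt (𝓡 n) x).left_inv (by simpa using h'y)
  have h2 := ContinuousLinearMap.le_of_opNorm_le _ hy.le v
  rw [← mfderivWithin_univ]
  have hr : Set.range (𝓡 n) = Set.univ := by simp
  rw [hr] at h2
  -- All tangent spaces are the same vector space, but their norms depend on the base point; the
  -- norm is transported along an equality of points. The same device recurs below for norms and
  -- inner products.
  have key : ∀ (y' : M) (_ : y' = y) (w : EuclideanSpace ℝ (Fin n)),
      @norm (TangentSpace (𝓡 n) y') _ w = @norm (TangentSpace (𝓡 n) y) _ w := by
    rintro _ rfl w
    rfl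
  exact (key _ A _).trans_le h2

theorem exists_norm_mfderiv_extChartAt_le [IsManifold (𝓡 n) 1 M]
    [IsContinuousRiemannianBundle (EuclideanSpace ℝ (Fin n)) (fun x : M => TangentSpace (𝓡 n) x)]
    (x : M) : ∃ C > 0, ∀ᶠ y in 𝓝 x, ∀ v : TangentSpace (𝓡 n) y,
      ‖mvfderiv (𝓡 n) (extChartAt (𝓡 n) x) y v‖ ≤ C * ‖v‖ := by
  rcases eventually_norm_trivializationAt_lt (EuclideanSpace ℝ (Fin n))
    (fun x : M => TangentSpace (𝓡 n) x) x with ⟨C, C_pos, hC⟩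
  refine ⟨C, C_pos, ?_⟩
  have hx := chart_source_mem_nhds (EuclideanSpace ℝ (Fin n)) x
  filter_upwards [hC, hx] with y hy h'y v
  rw [TangentBundle.continuousLinearMapAt_trivializationAt h'y] at hy
  exact ContinuousLinearMap.le_of_opNorm_le _ hy.le v

theorem mdifferentiableAt_extChartAt_symm [IsManifold (𝓡 n) ∞ M] (x₀ : M)
    {p : EuclideanSpace ℝ (Fin n)} (hp : p ∈ (extChartAt (𝓡 n) x₀).target) :
    MDifferentiableAt 𝓘(ℝ, EuclideanSpace ℝ (Fin n)) (𝓡 n) (extChartAt (𝓡 n) x₀).symm p := by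
  have h := (contMDiffOn_extChartAt_symm (I := 𝓡 n) (n := ∞) x₀).contMDiffAt
    ((isOpen_extChartAt_target x₀).mem_nhds hp)
  exact h.mdifferentiableAt (by simp)

theorem mdifferentiableAt_extChartAt' [IsManifold (𝓡 n) ∞ M] (x₀ : M)
    {x : M} (hx : x ∈ (extChartAt (𝓡 n) x₀).source) :
    MDifferentiableAt (𝓡 n) 𝓘(ℝ, EuclideanSpace ℝ (Fin n)) (extChartAt (𝓡 n) x₀) x := by
  have h := contMDiffAt_extChartAt' (I := 𝓡 n) (n := ∞) (x := x₀) (x' := x) (by simpa using hx)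
  exact h.mdifferentiableAt (by simp)

variable [MeasurableSpace M] [BorelSpace M]

theorem measurableSet_chart_preimage (x₀ : M) {s : Set M} (hs : MeasurableSet s) :
    MeasurableSet ((extChartAt (𝓡 n) x₀).symm ⁻¹' s ∩ (extChartAt (𝓡 n) x₀).target) := by
  classical
  have hT : IsOpen (extChartAt (𝓡 n) x₀).target := isOpen_extChartAt_target x₀
  have hc : ContinuousOn (extChartAt (𝓡 n) x₀).symm (extChartAt (𝓡 n) x₀).target :=
    continuousOn_extChartAt_symm x₀
  -- The inverse chart is continuous only on its target, so it is completed by a constant to a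
  -- measurable map on the whole model space.
  have := (hc.measurable_piecewise (g := fun _ => x₀) continuousOn_const hT.measurableSet hs).inter
    hT.measurableSet
  convert this using 1
  ext p
  simp only [Set.mem_inter_iff, Set.mem_preimage]
  refine and_congr_left fun hp => ?_
  rw [Set.piecewise_eq_of_mem _ _ _ hp]

theorem chartVolume_apply (x₀ : M) {s : Set M} (hs : MeasurableSet s) :
    chartVolume n x₀ s = ∫⁻ p in (extChartAt (𝓡 n) x₀).symm ⁻¹' s ∩ (extChartAt (𝓡 n) x₀).target,
      ENNReal.ofReal (Real.sqrt (chartGram n x₀ p).det) := by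
  have hT : IsOpen (extChartAt (𝓡 n) x₀).target := isOpen_extChartAt_target x₀
  have hc : ContinuousOn (extChartAt (𝓡 n) x₀).symm (extChartAt (𝓡 n) x₀).target :=
    continuousOn_extChartAt_symm x₀
  rw [chartVolume, Measure.map_apply_of_aemeasurable (hc.aemeasurable hT.measurableSet) hs,
    Measure.restrict_apply' hT.measurableSet, withDensity_apply _ (measurableSet_chart_preimage x₀ hs)]

/-- The density of the volume transforms by the Jacobian of the change of coordinates. -/
theorem sqrt_det_chartGram_eq [IsManifold (𝓡 n) ∞ M] (x₀ x₁ : M)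
    {p : EuclideanSpace ℝ (Fin n)} (hp : p ∈ (extChartAt (𝓡 n) x₁).target)
    (hp' : (extChartAt (𝓡 n) x₁).symm p ∈ (extChartAt (𝓡 n) x₀).source) :
    DifferentiableAt ℝ (extChartAt (𝓡 n) x₀ ∘ (extChartAt (𝓡 n) x₁).symm) p ∧
    Real.sqrt (chartGram n x₁ p).det
      = |(fderiv ℝ (extChartAt (𝓡 n) x₀ ∘ (extChartAt (𝓡 n) x₁).symm) p).det| *
        Real.sqrt (chartGram n x₀ (extChartAt (𝓡 n) x₀ ((extChartAt (𝓡 n) x₁).symm p))).det := by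
  set τ := extChartAt (𝓡 n) x₀ ∘ (extChartAt (𝓡 n) x₁).symm with hτ
  set e₀ := extChartAt (𝓡 n) x₀
  set e₁ := extChartAt (𝓡 n) x₁
  have hd1 : MDifferentiableAt 𝓘(ℝ, EuclideanSpace ℝ (Fin n)) (𝓡 n) e₁.symm p :=
    mdifferentiableAt_extChartAt_symm x₁ hp
  have hτm : MDifferentiableAt 𝓘(ℝ, EuclideanSpace ℝ (Fin n)) 𝓘(ℝ, EuclideanSpace ℝ (Fin n)) τ p :=
    (mdifferentiableAt_extChartAt' x₀ hp').comp p hd1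
  have hτd : DifferentiableAt ℝ τ p := hτm.differentiableAt
  refine ⟨hτd, ?_⟩
  have hq : τ p ∈ e₀.target := e₀.map_source hp'
  have hd0 : MDifferentiableAt 𝓘(ℝ, EuclideanSpace ℝ (Fin n)) (𝓡 n) e₀.symm (τ p) :=
    mdifferentiableAt_extChartAt_symm x₀ hq
  have hbase : e₀.symm (τ p) = e₁.symm p := e₀.left_inv hp'
  -- The two parametrizations differ near `p` by the transition map `τ`; the chain rule turns this
  -- into `A₁ = A₀ ∘ dτ`, and bilinearity into `G₁ = Jᵀ G₀ J` for the Gram matrices.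
  have hev : e₁.symm =ᶠ[𝓝 p] e₀.symm ∘ τ := by
    have h1 : ∀ᶠ q in 𝓝 p, e₁.symm q ∈ e₀.source :=
      hd1.continuousAt.eventually ((isOpen_extChartAt_source (I := 𝓡 n) x₀).mem_nhds hp')
    filter_upwards [h1] with q hq
    exact (e₀.left_inv hq).symm
  obtain ⟨A₁, hA₁⟩ : ∃ A : EuclideanSpace ℝ (Fin n) →L[ℝ] EuclideanSpace ℝ (Fin n),
    A = mfderiv 𝓘(ℝ, EuclideanSpace ℝ (Fin n)) (𝓡 n) e₁.symm p := ⟨_, rfl⟩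
  obtain ⟨A₀, hA₀⟩ : ∃ A : EuclideanSpace ℝ (Fin n) →L[ℝ] EuclideanSpace ℝ (Fin n),
    A = mfderiv 𝓘(ℝ, EuclideanSpace ℝ (Fin n)) (𝓡 n) e₀.symm (τ p) := ⟨_, rfl⟩
  have hder : ∀ v, A₁ v = A₀ (fderiv ℝ τ p v) := by
    intro v
    have h := hev.mfderiv_eq (I := 𝓘(ℝ, EuclideanSpace ℝ (Fin n))) (I' := 𝓡 n)
    have h2 := mfderiv_comp p hd0 hτm
    rw [mfderiv_eq_fderiv] at h2
    rw [hA₁, hA₀]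
    exact congrArg (fun L : EuclideanSpace ℝ (Fin n) →L[ℝ] EuclideanSpace ℝ (Fin n) => L v)
      (h.trans h2)
  let b := EuclideanSpace.basisFun (Fin n) ℝ
  let J : Matrix (Fin n) (Fin n) ℝ := LinearMap.toMatrix b.toBasis b.toBasis (fderiv ℝ τ p).toLinearMap
  have hJ : J.det = (fderiv ℝ τ p).det := LinearMap.det_toMatrix _ _
  have hexp : ∀ j, A₁ (EuclideanSpace.single j (1 : ℝ))
      = ∑ i, J i j • A₀ (EuclideanSpace.single i (1 : ℝ)) := by
    intro j
    rw [hder]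
    have h3 : fderiv ℝ τ p (EuclideanSpace.single j (1 : ℝ))
        = ∑ i, J i j • EuclideanSpace.single i (1 : ℝ) := by
      have := b.toBasis.sum_repr (fderiv ℝ τ p (EuclideanSpace.single j (1 : ℝ)))
      rw [← this]
      refine Finset.sum_congr rfl fun i _ => ?_
      simp [J, LinearMap.toMatrix_apply, b]
    rw [h3, map_sum]
    exact Finset.sum_congr rfl fun i _ => map_smul _ _ _
  have hinner : ∀ (x x' : M) (_ : x = x') (v w : EuclideanSpace ℝ (Fin n)),
      @inner ℝ (TangentSpace (𝓡 n) x) _ v w = @inner ℝ (TangentSpace (𝓡 n) x') _ v w := by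
    rintro x _ rfl v w
    rfl
  obtain ⟨β, hβ⟩ : ∃ β : EuclideanSpace ℝ (Fin n) → EuclideanSpace ℝ (Fin n) → ℝ,
    ∀ v w, β v w = @inner ℝ (TangentSpace (𝓡 n) (e₁.symm p)) _ v w := ⟨_, fun _ _ => rfl⟩
  have hG : chartGram n x₁ p = J.transpose * chartGram n x₀ (τ p) * J := by
    ext i j
    have e1 : chartGram n x₁ p i j
        = β (A₁ (EuclideanSpace.single i (1 : ℝ))) (A₁ (EuclideanSpace.single j (1 : ℝ))) := by
      rw [hA₁, hβ]
      rfl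
    have e0 : ∀ k l, chartGram n x₀ (τ p) k l
        = β (A₀ (EuclideanSpace.single k (1 : ℝ))) (A₀ (EuclideanSpace.single l (1 : ℝ))) := by
      intro k l
      rw [hA₀, hβ]
      exact hinner _ _ hbase _ _
    have hs : ∀ i v, β (A₁ (EuclideanSpace.single i (1 : ℝ))) v
        = ∑ k, J k i * β (A₀ (EuclideanSpace.single k (1 : ℝ))) v := by
      intro i v
      rw [hexp]
      simp only [hβ]
      refine (sum_inner (E := TangentSpace (𝓡 n) (e₁.symm p)) _ _ _).trans ?_
      exact Finset.sum_congr rfl fun k _ =>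
        real_inner_smul_left (F := TangentSpace (𝓡 n) (e₁.symm p)) _ _ _
    have hs' : ∀ j v, β v (A₁ (EuclideanSpace.single j (1 : ℝ)))
        = ∑ k, J k j * β v (A₀ (EuclideanSpace.single k (1 : ℝ))) := by
      intro i v
      rw [hexp]
      simp only [hβ]
      refine (inner_sum (E := TangentSpace (𝓡 n) (e₁.symm p)) _ _ _).trans ?_
      exact Finset.sum_congr rfl fun k _ =>
        real_inner_smul_right (F := TangentSpace (𝓡 n) (e₁.symm p)) _ _ _
    rw [e1, hs]
    simp only [hs', Matrix.mul_apply, Matrix.transpose_apply, e0, Finset.sum_mul, Finset.mul_sum]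
    rw [Finset.sum_comm]
    refine Finset.sum_congr rfl fun k _ => Finset.sum_congr rfl fun l _ => ?_
    ring
  rw [hG, Matrix.det_mul, Matrix.det_mul, Matrix.det_transpose, hJ]
  have e : (fderiv ℝ τ p).det * (chartGram n x₀ (τ p)).det * (fderiv ℝ τ p).det
      = (fderiv ℝ τ p).det ^ 2 * (chartGram n x₀ (τ p)).det := by ring
  rw [e, Real.sqrt_mul (sq_nonneg _), Real.sqrt_sq_eq_abs]
  rfl

/-- Change of variables along the transition map: the Jacobian is exactly what
`sqrt_det_chartGram_eq` removes from the density. -/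
theorem chartVolume_eq_of_subset [IsManifold (𝓡 n) ∞ M] (x₀ x₁ : M) {s : Set M}
    (hs : MeasurableSet s) (h₀ : s ⊆ (extChartAt (𝓡 n) x₀).source)
    (h₁ : s ⊆ (extChartAt (𝓡 n) x₁).source) : chartVolume n x₁ s = chartVolume n x₀ s := by
  rw [chartVolume_apply _ hs, chartVolume_apply _ hs]
  set e₀ := extChartAt (𝓡 n) x₀
  set e₁ := extChartAt (𝓡 n) x₁
  have himg : e₀.symm ⁻¹' s ∩ e₀.target = (e₀ ∘ e₁.symm) '' (e₁.symm ⁻¹' s ∩ e₁.target) := by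
    ext q
    constructor
    · rintro ⟨hq, hq'⟩
      have h2 : e₁.symm (e₁ (e₀.symm q)) = e₀.symm q := e₁.left_inv (h₁ hq)
      refine ⟨e₁ (e₀.symm q), ⟨?_, e₁.map_source (h₁ hq)⟩, ?_⟩
      · rw [Set.mem_preimage, h2]
        exact hq
      · rw [Function.comp_apply, h2, e₀.right_inv hq']
    · rintro ⟨p, ⟨hp, hp'⟩, rfl⟩
      refine ⟨?_, e₀.map_source (h₀ hp)⟩
      rw [Set.mem_preimage, Function.comp_apply, e₀.left_inv (h₀ hp)]
      exact hp
  rw [himg, lintegral_image_eq_lintegral_abs_det_fderiv_mul volume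
    (measurableSet_chart_preimage x₁ hs)
    (fun p hp => (sqrt_det_chartGram_eq x₀ x₁ hp.2 (h₀ hp.1)).1.hasFDerivAt.hasFDerivWithinAt)]
  · refine setLIntegral_congr_fun (measurableSet_chart_preimage x₁ hs) fun p hp => ?_
    rw [(sqrt_det_chartGram_eq x₀ x₁ hp.2 (h₀ hp.1)).2, ENNReal.ofReal_mul (abs_nonneg _)]
    rfl
  · intro p hp q hq hpq
    have h3 : e₁.symm p = e₁.symm q := e₀.injOn (h₀ hp.1) (h₀ hq.1) hpq
    exact e₁.symm.injOn hp.2 hq.2 h3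

theorem chartVolume_inter_source (x₁ : M) {s : Set M} (hs : MeasurableSet s) :
    chartVolume n x₁ (s ∩ (extChartAt (𝓡 n) x₁).source) = chartVolume n x₁ s := by
  rw [chartVolume_apply _ hs, chartVolume_apply _
    (hs.inter (isOpen_extChartAt_source (I := 𝓡 n) x₁).measurableSet)]
  congr 2
  ext p
  simp only [Set.mem_inter_iff, Set.mem_preimage]
  exact ⟨fun h => ⟨h.1.1, h.2⟩, fun h => ⟨⟨h.1, (extChartAt (𝓡 n) x₁).map_target h.2⟩, h.2⟩⟩

/-- A supremum of measures is estimated by exhibiting an upper bound. Inside the chart domain all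
chart measures are dominated by the one at `x₀`; outside, the measure `⊤` dominates anything and
does not charge `s`. Only this inequality is needed for local finiteness. -/
theorem riemannianVolume_apply_le [IsManifold (𝓡 n) ∞ M] (x₀ : M) {s : Set M}
    (hs : MeasurableSet s) (h₀ : s ⊆ (extChartAt (𝓡 n) x₀).source) :
    riemannianVolume n M s ≤ chartVolume n x₀ s := by
  set U := (extChartAt (𝓡 n) x₀).source
  have hU : MeasurableSet U := (isOpen_extChartAt_source (I := 𝓡 n) x₀).measurableSet
  have hle : riemannianVolume n M ≤ chartVolume n x₀ + (⊤ : Measure M).restrict Uᶜ := by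
    refine iSup_le fun x₁ => ?_
    rw [← Measure.restrict_add_restrict_compl (μ := chartVolume n x₁) hU]
    refine add_le_add ?_ (Measure.restrict_mono le_rfl le_top)
    refine Measure.le_iff.2 fun t ht => ?_
    rw [Measure.restrict_apply ht, ← chartVolume_inter_source x₁ (ht.inter hU),
      chartVolume_eq_of_subset x₀ x₁ ((ht.inter hU).inter
        (isOpen_extChartAt_source (I := 𝓡 n) x₁).measurableSet)
        (fun z hz => hz.1.2) (fun z hz => hz.2)]
    exact measure_mono fun z hz => hz.1.1
  refine (hle s).trans ?_
  rw [Measure.add_apply, Measure.restrict_apply hs]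
  have : s ∩ Uᶜ = ∅ := by
    ext z
    simp only [Set.mem_inter_iff, Set.mem_compl_iff, Set.mem_empty_iff_false, iff_false, not_and,
      not_not]
    exact fun hz => h₀ hz
  rw [this, measure_empty, add_zero]

theorem chartVolume_finiteAt_nhds [IsManifold (𝓡 n) ∞ M]
    [IsContinuousRiemannianBundle (EuclideanSpace ℝ (Fin n)) (fun x : M => TangentSpace (𝓡 n) x)]
    (x₀ : M) : ∃ s ∈ 𝓝 x₀, IsOpen s ∧ chartVolume n x₀ s < ⊤ := by
  have : IsManifold (𝓡 n) 1 M := IsManifold.of_le (n := ∞) (by simp)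
  obtain ⟨C, hC, hev⟩ := exists_norm_mfderiv_extChartAt_symm_le (n := n) x₀
  set e := extChartAt (𝓡 n) x₀
  have hball : e ⁻¹' Metric.ball (e x₀) 1 ∈ 𝓝 x₀ :=
    (continuousAt_extChartAt x₀).preimage_mem_nhds (Metric.ball_mem_nhds _ one_pos)
  obtain ⟨s, hs, hso, hxs⟩ := mem_nhds_iff.1 (inter_mem hev hball)
  refine ⟨s, hso.mem_nhds hxs, hso, ?_⟩
  rw [chartVolume_apply _ hso.measurableSet]
  set T := e.symm ⁻¹' s ∩ e.target
  have hT : MeasurableSet T := measurableSet_chart_preimage x₀ hso.measurableSet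
  -- The Leibniz bound for a determinant whose entries are at most `C * C` in absolute value; the
  -- entries are inner products of vectors of norm at most `C`.
  set B : ℝ := (Fintype.card (Fin n)).factorial • (C * C) ^ Fintype.card (Fin n)
  have hbd : ∀ p ∈ T, ENNReal.ofReal (Real.sqrt (chartGram n x₀ p).det)
      ≤ ENNReal.ofReal (Real.sqrt B) := by
    rintro p ⟨hp, hp'⟩
    refine ENNReal.ofReal_le_ofReal (Real.sqrt_le_sqrt ?_)
    refine (le_abs_self _).trans ?_
    refine Matrix.det_le (abv := AbsoluteValue.abs) (x := C * C) fun i j => ?_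
    have h1 := (hs hp).1
    have hr : e (e.symm p) = p := e.right_inv hp'
    simp only [Set.mem_ofPred_eq] at h1
    rw [hr] at h1
    have h2 := h1 (EuclideanSpace.single i (1 : ℝ))
    have h3 := h1 (EuclideanSpace.single j (1 : ℝ))
    simp only [PiLp.norm_single, norm_one, mul_one] at h2 h3
    refine (abs_real_inner_le_norm (F := TangentSpace (𝓡 n) (e.symm p)) _ _).trans ?_
    exact mul_le_mul h2 h3 (norm_nonneg _) hC.le
  have hTb : volume T < ⊤ := by
    refine (measure_mono (t := Metric.ball (e x₀) 1) ?_).trans_lt measure_ball_lt_top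
    rintro p ⟨hp, hp'⟩
    have := (hs hp).2
    rw [Set.mem_preimage, e.right_inv hp'] at this
    exact this
  calc ∫⁻ p in T, ENNReal.ofReal (Real.sqrt (chartGram n x₀ p).det)
      ≤ ∫⁻ _ in T, ENNReal.ofReal (Real.sqrt B) := setLIntegral_mono' hT hbd
    _ = ENNReal.ofReal (Real.sqrt B) * volume T := by rw [setLIntegral_const]
    _ < ⊤ := ENNReal.mul_lt_top ENNReal.ofReal_lt_top hTb

/-- This is what makes continuous functions with compact support integrable, and hence every pairing
with a compactly supported section meaningful. -/
instance instIsLocallyFiniteMeasureRiemannianVolume [IsManifold (𝓡 n) ∞ M]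
    [IsContinuousRiemannianBundle (EuclideanSpace ℝ (Fin n)) (fun x : M => TangentSpace (𝓡 n) x)] :
    IsLocallyFiniteMeasure (riemannianVolume n M) where
  finiteAtNhds x₀ := by
    obtain ⟨s, hs, hso, hfin⟩ := chartVolume_finiteAt_nhds (n := n) x₀
    have hU := isOpen_extChartAt_source (I := 𝓡 n) x₀
    refine ⟨s ∩ (extChartAt (𝓡 n) x₀).source, inter_mem hs (extChartAt_source_mem_nhds x₀), ?_⟩
    refine (riemannianVolume_apply_le x₀ (hso.inter hU).measurableSet
      Set.inter_subset_right).trans_lt ?_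
    exact (measure_mono Set.inter_subset_left).trans_lt hfin

end VolumeLemmas
end
end CylEnd

namespace CylEnd

noncomputable section

/-! ### Extension of local sections and real orthonormal frames. -/

section Frames

attribute [local instance] tangentTotalSpace InnerProductSpace.complexToReal

variable {n : ℕ} {M : Type*} [TopologicalSpace M] [ChartedSpace (EuclideanSpace ℝ (Fin n)) M]
  {F : Type*} [NormedAddCommGroup F] [NormedSpace ℂ F]
  {E : M → Type*} [TopologicalSpace (TotalSpace F E)]
  [∀ x, NormedAddCommGroup (E x)] [∀ x, InnerProductSpace ℂ (E x)]
  [FiberBundle F E] [VectorBundle ℂ F E] [VectorBundle ℝ F E]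

@[simp]
theorem funSmul_apply (f : C^∞⟮𝓡 n, M; ℝ⟯) (s : smoothSections n F E) (x : M) :
    (funSmul f s).1 x = f x • s.1 x := rfl

@[simp]
theorem smoothSections_add_apply (s t : smoothSections n F E) (x : M) :
    (s + t).1 x = s.1 x + t.1 x := rfl

@[simp]
theorem smoothSections_sub_apply (s t : smoothSections n F E) (x : M) :
    (s - t).1 x = s.1 x - t.1 x := rfl

@[simp]
theorem smoothSections_zero_apply (x : M) : (0 : smoothSections n F E).1 x = 0 := rfl

@[simp]
theorem smoothSections_smul_apply (c : ℂ) (s : smoothSections n F E) (x : M) :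
    (c • s).1 x = c • s.1 x := rfl

theorem smoothSections_sum_apply {ι : Type*} (S : Finset ι) (s : ι → smoothSections n F E) (x : M) :
    (∑ i ∈ S, s i).1 x = ∑ i ∈ S, (s i).1 x := by
  classical
  induction S using Finset.induction_on with
  | empty => simp
  | insert i S hi ih => rw [Finset.sum_insert hi, Finset.sum_insert hi, smoothSections_add_apply, ih]

@[ext]
theorem smoothSections_ext {s t : smoothSections n F E} (h : ∀ x, s.1 x = t.1 x) : s = t :=
  Subtype.ext (funext h)

theorem inner_real_eq_re {x : M} (v w : E x) : inner ℝ v w = (inner ℂ v w).re := rfl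

/-- The smooth function `Re ⟨s, t⟩`. -/
def reInner [IsSmoothHermitian n F E] (s t : smoothSections n F E) : C^∞⟮𝓡 n, M; ℝ⟯ :=
  ⟨fun x => inner ℝ (s.1 x) (t.1 x), by
    have h := IsSmoothHermitian.contMDiff_inner (n := n) (F := F) s.1 t.1 s.2 t.2
    exact Complex.reCLM.contMDiff.comp h⟩

@[simp]
theorem reInner_apply [IsSmoothHermitian n F E] (s t : smoothSections n F E) (x : M) :
    reInner s t x = inner ℝ (s.1 x) (t.1 x) := rfl

theorem continuous_inner_section [IsSmoothHermitian n F E] (s t : smoothSections n F E) :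
    Continuous fun x => (inner ℂ (s.1 x) (t.1 x) : ℂ) :=
  (IsSmoothHermitian.contMDiff_inner (n := n) (F := F) s.1 t.1 s.2 t.2).continuous

theorem continuous_norm_section [IsSmoothHermitian n F E] (s : smoothSections n F E) :
    Continuous fun x => ‖s.1 x‖ := by
  have h : (fun x => ‖s.1 x‖) = fun x => Real.sqrt ‖(inner ℂ (s.1 x) (s.1 x) : ℂ)‖ := by
    funext x
    rw [inner_self_eq_norm_sq_to_K]
    simp
  rw [h]
  exact (continuous_inner_section s s).norm.sqrt

variable [IsManifold (𝓡 n) ∞ M] [T2Space M]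

/-- A smooth function equal to `1` near a given point, with support in a given neighbourhood. -/
theorem exists_smooth_bump (x₀ : M) {u : Set M} (hu : u ∈ 𝓝 x₀) :
    ∃ χ : C^∞⟮𝓡 n, M; ℝ⟯, (∀ᶠ x in 𝓝 x₀, χ x = 1) ∧ tsupport χ ⊆ u ∧ IsCompact (tsupport χ) ∧
      ∀ x, χ x ∈ Set.Icc (0 : ℝ) 1 := by
  obtain ⟨f, -, hf⟩ := (SmoothBumpFunction.nhds_basis_tsupport (I := 𝓡 n) x₀).mem_iff.1 hu
  exact ⟨⟨f, f.contMDiff⟩, f.eventuallyEq_one, hf, f.hasCompactSupport, fun x => f.mem_Icc⟩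

/-- The operators act on global sections only, so local sections are cut off by a bump function;
nothing changes near `x₀`. -/
theorem exists_section_eventuallyEq {x₀ : M} {u : Set M} (hu : IsOpen u) (hx : x₀ ∈ u)
    {s : Π x, E x} (hs : ContMDiffOn (𝓡 n) ((𝓡 n).prod 𝓘(ℝ, F)) ∞
      (fun x => (⟨x, s x⟩ : TotalSpace F E)) u) :
    ∃ t : smoothSections n F E, ∀ᶠ x in 𝓝 x₀, t.1 x = s x := by
  obtain ⟨χ, h1, h2, -, -⟩ := exists_smooth_bump (n := n) x₀ (hu.mem_nhds hx)
  refine ⟨⟨fun x => χ x • s x, ?_⟩, ?_⟩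
  · exact ContMDiffOn.smul_section_of_tsupport χ.contMDiff.contMDiffOn hu h2 hs
  · filter_upwards [h1] with x hx
    simp [hx]

variable [ContMDiffVectorBundle ∞ F E (𝓡 n)]

theorem exists_section_trivialization (x₀ : M) (v : F) : ∃ t : smoothSections n F E,
    ∀ᶠ x in 𝓝 x₀, t.1 x = (trivializationAt F E x₀).symm x v := by
  set e := trivializationAt F E x₀
  refine exists_section_eventuallyEq e.open_baseSet (mem_baseSet_trivializationAt F E x₀) ?_
  rw [e.contMDiffOn_section_baseSet_iff]
  refine (contMDiffOn_const (c := v)).congr fun x hx => ?_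
  rw [e.apply_mk_symm hx]

theorem exists_section_apply_eq (x₀ : M) (v : E x₀) : ∃ t : smoothSections n F E, t.1 x₀ = v := by
  obtain ⟨t, ht⟩ := exists_section_trivialization (n := n) (F := F) (E := E) x₀
    (trivializationAt F E x₀ ⟨x₀, v⟩).2
  refine ⟨t, ?_⟩
  rw [ht.self_of_nhds]
  exact (trivializationAt F E x₀).symm_apply_apply_mk (mem_baseSet_trivializationAt F E x₀) v

variable [IsSmoothHermitian n F E]

/-- Gram–Schmidt: vectors that are orthonormal at a point extend to smooth sections that are
orthonormal near this point. -/
theorem exists_orthonormal_sections (x₀ : M) (b : ℕ → E x₀) (r : ℕ)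
    (hb : ∀ j < r, ∀ k < r, inner ℝ (b j) (b k) = if j = k then (1 : ℝ) else 0) :
    ∃ e : ℕ → smoothSections n F E, (∀ j < r, (e j).1 x₀ = b j) ∧
      ∀ᶠ x in 𝓝 x₀, ∀ j < r, ∀ k < r,
        inner ℝ ((e j).1 x) ((e k).1 x) = if j = k then (1 : ℝ) else 0 := by
  induction r with
  | zero => exact ⟨0, by simp, by simp⟩
  | succ r ih =>
    obtain ⟨e, he, heo⟩ := ih fun j hj k hk => hb j (hj.trans r.lt_succ_self) k (hk.trans r.lt_succ_self)
    obtain ⟨v, hv⟩ := exists_section_apply_eq (n := n) (F := F) (E := E) x₀ (b r)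
    -- The orthogonal projection onto the earlier sections is subtracted globally, although they are
    -- orthonormal only near `x₀`. At `x₀` the correction vanishes, so `w` extends `b r`.
    let w : smoothSections n F E := v - ∑ j ∈ Finset.range r, funSmul (reInner (e j) v) (e j)
    have hw : ∀ x, w.1 x = v.1 x - ∑ j ∈ Finset.range r,
        (inner ℝ ((e j).1 x) (v.1 x) : ℝ) • (e j).1 x := by
      intro x
      simp only [w, smoothSections_sub_apply, smoothSections_sum_apply, funSmul_apply, reInner_apply]
    have hw0 : w.1 x₀ = b r := by
      rw [hw, hv, Finset.sum_eq_zero, sub_zero]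
      intro j hj
      have hj' := Finset.mem_range.1 hj
      rw [he j hj', hb j (hj'.trans r.lt_succ_self) r r.lt_succ_self, if_neg hj'.ne, zero_smul]
    have hw1 : reInner w w x₀ = 1 := by
      rw [reInner_apply, hw0, hb r r.lt_succ_self r r.lt_succ_self, if_pos rfl]
    have hopen : {x | 0 < reInner w w x} ∈ 𝓝 x₀ :=
      (isOpen_lt continuous_const (reInner w w).contMDiff.continuous).mem_nhds (by
        rw [Set.mem_ofPred_eq, hw1]; exact one_pos)
    have hopen' : IsOpen {x | 0 < reInner w w x} :=
      isOpen_lt continuous_const (reInner w w).contMDiff.continuous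
    -- The normalization is smooth only where `w` does not vanish, so it is carried out on that open
    -- set and cut off afterwards.
    obtain ⟨t, ht⟩ := exists_section_eventuallyEq (n := n) (F := F) (E := E) hopen'
      (mem_of_mem_nhds hopen) (s := fun x => (Real.sqrt (reInner w w x))⁻¹ • w.1 x) (by
        refine ContMDiffOn.smul_section ?_ w.2.contMDiffOn
        have h1 : ContDiffOn ℝ ∞ (fun y : ℝ => (Real.sqrt y)⁻¹) {y | 0 < y} := by
          refine (contDiffOn_id.sqrt fun y hy => (ne_of_gt hy)).inv fun y hy => ?_
          exact (Real.sqrt_pos.2 hy).ne'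
        exact h1.contMDiffOn.comp (reInner w w).contMDiff.contMDiffOn fun x hx => hx)
    refine ⟨fun j => if j = r then t else e j, ?_, ?_⟩
    · intro j hj
      by_cases h : j = r
      · subst h
        simp only [if_true]
        rw [ht.self_of_nhds, hw1, hw0]
        simp
      · simp only [if_neg h]
        exact he j (lt_of_le_of_ne (Nat.lt_succ_iff.1 hj) h)
    · filter_upwards [heo, ht, hopen] with x hx htx hpos
      have hwe : ∀ j < r, inner ℝ ((e j).1 x) (w.1 x) = 0 := by
        intro j hj
        rw [hw, inner_sub_right, inner_sum, Finset.sum_eq_single j]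
        · rw [real_inner_smul_right, hx j hj j hj, if_pos rfl, mul_one, sub_self]
        · intro k hk hkj
          rw [real_inner_smul_right, hx j hj k (Finset.mem_range.1 hk), if_neg hkj.symm, mul_zero]
        · exact fun h => absurd (Finset.mem_range.2 hj) h
      have hpos' : 0 < inner ℝ (w.1 x) (w.1 x) := hpos
      have hte : ∀ j < r, inner ℝ ((e j).1 x) (t.1 x) = 0 := by
        intro j hj
        rw [htx, real_inner_smul_right, hwe j hj, mul_zero]
      intro j hj k hk
      by_cases h : j = r <;> by_cases h' : k = r
      · subst h
        subst h'
        simp only [if_true]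
        rw [htx, real_inner_smul_right, real_inner_smul_left, reInner_apply, ← mul_assoc,
          ← mul_inv, Real.mul_self_sqrt hpos'.le, inv_mul_cancel₀ hpos'.ne']
      · have hk' : k < r := lt_of_le_of_ne (Nat.lt_succ_iff.1 hk) h'
        simp only [if_pos h, if_neg h']
        rw [real_inner_comm, hte k hk', if_neg (by omega)]
      · have hj' : j < r := lt_of_le_of_ne (Nat.lt_succ_iff.1 hj) h
        simp only [if_pos h', if_neg h]
        rw [hte j hj', if_neg (by omega)]
      · have hk' : k < r := lt_of_le_of_ne (Nat.lt_succ_iff.1 hk) h'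
        have hj' : j < r := lt_of_le_of_ne (Nat.lt_succ_iff.1 hj) h
        simp only [if_neg h, if_neg h']
        exact hx j hj' k hk'

/-- The sections `e` form, at the point `x`, an orthonormal basis of the fibre, seen as a real
vector space. -/
structure IsOrthoFrameAt {ι : Type*} [Fintype ι] [DecidableEq ι] (e : ι → smoothSections n F E)
    (x : M) : Prop where
  inner_eq : ∀ j k, inner ℝ ((e j).1 x) ((e k).1 x) = if j = k then (1 : ℝ) else 0
  eq_sum : ∀ v : E x, v = ∑ j, (inner ℝ ((e j).1 x) v : ℝ) • (e j).1 x

/-- An orthonormal basis of one fibre extends by Gram–Schmidt. It still spans nearby, because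
neighbouring fibres have the same real dimension through the trivialization. Real frames are used
because the condition on the principal symbol involves real functions only. -/
theorem exists_orthoFrame [FiniteDimensional ℂ F] (x₀ : M) :
    ∃ (r : ℕ) (e : Fin r → smoothSections n F E), ∀ᶠ x in 𝓝 x₀, IsOrthoFrameAt e x := by
  have : FiniteDimensional ℝ F := FiniteDimensional.complexToReal F
  set τ := trivializationAt F E x₀
  have hfd : ∀ x ∈ τ.baseSet, FiniteDimensional ℝ (E x) ∧
      Module.finrank ℝ (E x) = Module.finrank ℝ F := fun x hx =>
    ⟨(τ.linearEquivAt ℝ x hx).symm.finiteDimensional, (τ.linearEquivAt ℝ x hx).finrank_eq⟩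
  obtain ⟨h1, h2⟩ := hfd x₀ (mem_baseSet_trivializationAt F E x₀)
  let B := stdOrthonormalBasis ℝ (E x₀)
  set r := Module.finrank ℝ (E x₀)
  obtain ⟨e, -, he⟩ := exists_orthonormal_sections (n := n) (F := F) (E := E) x₀
    (fun j => if h : j < r then B ⟨j, h⟩ else 0) r (by
      intro j hj k hk
      simp only [dif_pos hj, dif_pos hk]
      rw [orthonormal_iff_ite.1 B.orthonormal]
      simp)
  refine ⟨r, fun j => e j, ?_⟩
  filter_upwards [he, τ.open_baseSet.mem_nhds (mem_baseSet_trivializationAt F E x₀)] with x hx hxb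
  obtain ⟨h3, h4⟩ := hfd x hxb
  have ho : ∀ j k : Fin r, inner ℝ ((e j).1 x) ((e k).1 x) = if j = k then (1 : ℝ) else 0 := by
    intro j k
    rw [hx j j.2 k k.2]
    simp [Fin.ext_iff]
  have hon : Orthonormal ℝ fun j : Fin r => (e j).1 x := orthonormal_iff_ite.2 ho
  refine ⟨ho, fun v => ?_⟩
  have hspan : ⊤ ≤ Submodule.span ℝ (Set.range fun j : Fin r => (e j).1 x) := by
    rw [hon.linearIndependent.span_eq_top_of_card_eq_finrank' (by rw [Fintype.card_fin, h4, ← h2])]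
  have := (OrthonormalBasis.mk hon hspan).sum_repr v
  conv_lhs => rw [← this]
  simp [OrthonormalBasis.repr_apply_apply]

theorem IsOrthoFrameAt.norm_eq {ι : Type*} [Fintype ι] [DecidableEq ι]
    {e : ι → smoothSections n F E} {x : M} (h : IsOrthoFrameAt e x) (j : ι) : ‖(e j).1 x‖ = 1 := by
  have h1 := h.inner_eq j j
  rw [if_pos rfl, real_inner_self_eq_norm_sq] at h1
  exact (pow_eq_one_iff_of_nonneg (norm_nonneg _) two_ne_zero).1 h1

theorem IsOrthoFrameAt.norm_sq_eq {ι : Type*} [Fintype ι] [DecidableEq ι]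
    {e : ι → smoothSections n F E} {x : M} (h : IsOrthoFrameAt e x) (v : E x) :
    ‖v‖ ^ 2 = ∑ j, (inner ℝ ((e j).1 x) v : ℝ) ^ 2 := by
  rw [← real_inner_self_eq_norm_sq]
  nth_rw 2 [h.eq_sum v]
  rw [inner_sum]
  refine Finset.sum_congr rfl fun j _ => ?_
  rw [real_inner_smul_right, real_inner_comm, pow_two]

end Frames
end
end CylEnd

namespace CylEnd

noncomputable section

attribute [local instance] tangentTotalSpace

/-! ### Hadamard's lemma. -/

section Hadamard

/-- Smooth dependence of integrals on parameters. -/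
theorem contDiff_intervalIntegral_param {V W : Type} [NormedAddCommGroup V] [NormedSpace ℝ V]
    [FiniteDimensional ℝ V] [NormedAddCommGroup W] [NormedSpace ℝ W] [CompleteSpace W]
    (k : ℕ) (G : V × ℝ → W) (hG : ContDiff ℝ ∞ G) :
    ContDiff ℝ k fun x => ∫ t in (0 : ℝ)..1, G (x, t) := by
  -- The derivative is an integral of the same kind with values in `V →L[ℝ] W`, so the target space
  -- must vary in the induction.
  induction k generalizing W with
  | zero =>
    rw [Nat.cast_zero, contDiff_zero]
    exact intervalIntegral.continuous_parametric_intervalIntegral_of_continuous'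
      (f := fun x t => G (x, t)) hG.continuous 0 1
  | succ k ih =>
    let G' : V × ℝ → V →L[ℝ] W := fun p => (fderiv ℝ G p).comp (ContinuousLinearMap.inl ℝ V ℝ)
    have hG' : ContDiff ℝ ∞ G' :=
      (hG.fderiv_right (m := ∞) (by simp)).clm_comp contDiff_const
    have hder : ∀ x, HasFDerivAt (fun x => ∫ t in (0 : ℝ)..1, G (x, t))
        (∫ t in (0 : ℝ)..1, G' (x, t)) x := by
      intro x₀
      obtain ⟨C, hC⟩ := ((isCompact_closedBall x₀ (1 : ℝ)).prod
        (isCompact_Icc (a := (0 : ℝ)) (b := 1))).exists_bound_of_continuousOn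
        hG'.continuous.continuousOn
      refine (intervalIntegral.hasFDerivAt_integral_of_dominated_of_fderiv_le
        (F := fun x t => G (x, t)) (F' := fun x t => G' (x, t)) (bound := fun _ => C)
        (Metric.ball_mem_nhds x₀ one_pos) ?_ ?_ ?_ ?_ ?_ ?_)
      · refine Eventually.of_forall fun x => ?_
        exact (hG.continuous.comp (by fun_prop : Continuous fun t : ℝ => (x, t))).aestronglyMeasurable
      · exact (hG.continuous.comp
          (by fun_prop : Continuous fun t : ℝ => (x₀, t))).intervalIntegrable _ _
      · exact (hG'.continuous.comp
          (by fun_prop : Continuous fun t : ℝ => (x₀, t))).aestronglyMeasurable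
      · refine ae_of_all _ fun t ht x hx => ?_
        rw [Set.uIoc_of_le zero_le_one] at ht
        exact hC (x, t) ⟨Metric.ball_subset_closedBall hx, ht.1.le, ht.2⟩
      · exact intervalIntegrable_const
      · refine ae_of_all _ fun t _ x _ => ?_
        have h1 : HasFDerivAt G (fderiv ℝ G (x, t)) (x, t) :=
          (hG.differentiable (by simp) (x, t)).hasFDerivAt
        exact h1.comp x (hasFDerivAt_prodMk_left x t)
    rw [Nat.cast_succ, contDiff_succ_iff_fderiv]
    refine ⟨fun x => (hder x).differentiableAt, by simp, ?_⟩
    have : fderiv ℝ (fun x => ∫ t in (0 : ℝ)..1, G (x, t))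
        = fun x => ∫ t in (0 : ℝ)..1, G' (x, t) := funext fun x => (hder x).fderiv
    rw [this]
    exact ih G' hG'

/-- Hadamard's lemma. -/
theorem exists_hadamard {n : ℕ} (f : EuclideanSpace ℝ (Fin n) → ℝ) (hf : ContDiff ℝ ∞ f)
    (p : EuclideanSpace ℝ (Fin n)) :
    ∃ h : Fin n → EuclideanSpace ℝ (Fin n) → ℝ, (∀ i, ContDiff ℝ ∞ (h i)) ∧
      (∀ i, h i p = fderiv ℝ f p (EuclideanSpace.single i 1)) ∧
      ∀ x, f x - f p = ∑ i, (x i - p i) * h i x := by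
  -- The partial derivatives of `f` along the segment from `p` to `x`; their integrals over `[0, 1]`
  -- are the Hadamard coefficients by the fundamental theorem of calculus.
  let G : Fin n → EuclideanSpace ℝ (Fin n) × ℝ → ℝ := fun i q =>
    fderiv ℝ f (p + q.2 • (q.1 - p)) (EuclideanSpace.single i 1)
  have hG : ∀ i, ContDiff ℝ ∞ (G i) := by
    intro i
    have h1 : ContDiff ℝ ∞ fun q : EuclideanSpace ℝ (Fin n) × ℝ => p + q.2 • (q.1 - p) :=
      contDiff_const.add (contDiff_snd.smul (contDiff_fst.sub contDiff_const))
    exact ((hf.fderiv_right (m := ∞) (by simp)).comp h1).clm_apply contDiff_const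
  refine ⟨fun i x => ∫ t in (0 : ℝ)..1, G i (x, t), fun i => ?_, fun i => ?_, fun x => ?_⟩
  · exact contDiff_infty.2 fun k => contDiff_intervalIntegral_param k (G i) (hG i)
  · simp [G]
  · have hd : ∀ t ∈ Set.uIcc (0 : ℝ) 1, HasDerivAt (fun t : ℝ => f (p + t • (x - p)))
        (∑ i, (x i - p i) * G i (x, t)) t := by
      intro t _
      have h1 : HasDerivAt (fun t : ℝ => p + t • (x - p)) (x - p) t := by
        simpa using ((hasDerivAt_id t).smul_const (x - p)).const_add p
      have h2 := ((hf.differentiable (by simp) (p + t • (x - p))).hasFDerivAt).comp_hasDerivAt t h1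
      refine h2.congr_deriv ?_
      have h3 : x - p = ∑ i, (x i - p i) • EuclideanSpace.single i (1 : ℝ) := by
        have := (EuclideanSpace.basisFun (Fin n) ℝ).sum_repr (x - p)
        rw [← this]
        simp
      have h5 := congrArg (fderiv ℝ f (p + t • (x - p))) h3
      rw [map_sum] at h5
      rw [h5]
      exact Finset.sum_congr rfl fun i _ => by rw [map_smul, smul_eq_mul]
    have hcont : Continuous fun t : ℝ => ∑ i, (x i - p i) * G i (x, t) := by
      refine continuous_finsetSum _ fun i _ => continuous_const.mul ?_
      exact (hG i).continuous.comp (by fun_prop : Continuous fun t : ℝ => (x, t))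
    have h4 := intervalIntegral.integral_eq_sub_of_hasDerivAt hd (hcont.intervalIntegrable _ _)
    simp only [one_smul, zero_smul, add_zero, add_sub_cancel] at h4
    rw [← h4, intervalIntegral.integral_finsetSum]
    · refine Finset.sum_congr rfl fun i _ => ?_
      rw [intervalIntegral.integral_const_mul]
    · intro i _
      exact (continuous_const.mul ((hG i).continuous.comp
        (by fun_prop : Continuous fun t : ℝ => (x, t)))).intervalIntegrable _ _

end Hadamard

/-! ### Bounds for point derivations. -/

section Derivations

variable {n : ℕ} {M : Type*} [TopologicalSpace M] [ChartedSpace (EuclideanSpace ℝ (Fin n)) M]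
  [IsManifold (𝓡 n) ∞ M] [T2Space M]

/-- If `ψ` is a bump at `x` supported where `f = g`, then `ψ * (f - g) = 0`, and the Leibniz rule at
`x` leaves only `L (f - g)`. -/
theorem derivation_congr {x : M} {L : C^∞⟮𝓡 n, M; ℝ⟯ →ₗ[ℝ] ℝ}
    (hL : ∀ f g, L (f * g) = f x * L g + g x * L f) {f g : C^∞⟮𝓡 n, M; ℝ⟯}
    (h : ∀ᶠ y in 𝓝 x, f y = g y) : L f = L g := by
  rw [← sub_eq_zero, ← map_sub]
  obtain ⟨ψ, h1, h2, -, -⟩ := exists_smooth_bump (n := n) x h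
  have h3 : ψ * (f - g) = 0 := by
    ext y
    by_cases hy : y ∈ tsupport ψ
    · have h4 : f y = g y := h2 hy
      change ψ y * (f y - g y) = 0
      rw [h4, sub_self, mul_zero]
    · change ψ y * (f y - g y) = 0
      rw [image_eq_zero_of_notMem_tsupport hy, zero_mul]
  have h5 := hL ψ (f - g)
  have h6 : (f - g) x = 0 := sub_eq_zero.2 h.self_of_nhds
  rw [h3, map_zero, h1.self_of_nhds, h6, zero_mul, add_zero, one_mul] at h5
  exact h5.symm

variable [RiemannianBundle (fun x : M => TangentSpace (𝓡 n) x)]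
  [IsContinuousRiemannianBundle (EuclideanSpace ℝ (Fin n)) (fun x : M => TangentSpace (𝓡 n) x)]

/-- Point derivations near `x₀` are bounded by the norm of the differential, with a bound that
depends only on their values on coordinate functions. -/
theorem exists_derivation_le (x₀ : M) :
    ∃ (ξ : Fin n → C^∞⟮𝓡 n, M; ℝ⟯) (C : ℝ), 0 ≤ C ∧ ∀ᶠ x in 𝓝 x₀,
      ∀ L : C^∞⟮𝓡 n, M; ℝ⟯ →ₗ[ℝ] ℝ, (∀ f g, L (f * g) = f x * L g + g x * L f) →
        ∀ f, |L f| ≤ C * (∑ i, |L (ξ i)|) * ‖mvfderiv (𝓡 n) f x‖ := by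
  have : IsManifold (𝓡 n) 1 M := IsManifold.of_le (n := ∞) (by simp)
  set e := extChartAt (𝓡 n) x₀
  have hsrc : IsOpen e.source := isOpen_extChartAt_source (I := 𝓡 n) x₀
  have htgt : IsOpen e.target := isOpen_extChartAt_target (I := 𝓡 n) x₀
  obtain ⟨χ, hχ1, hχ2, -, -⟩ := exists_smooth_bump (n := n) x₀ (extChartAt_source_mem_nhds (I := 𝓡 n) x₀)
  obtain ⟨C, hC, hCe⟩ := exists_norm_mfderiv_extChartAt_symm_le (n := n) x₀
  have hpull : ∀ h : EuclideanSpace ℝ (Fin n) → ℝ, ContDiff ℝ ∞ h →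
      ContMDiff (𝓡 n) 𝓘(ℝ, ℝ) ∞ fun y => χ y * h (e y) := by
    intro h hh
    refine contMDiff_of_tsupport fun y hy => ?_
    have hy' : y ∈ e.source := hχ2 (closure_mono (Function.support_mul_subset_left _ _) hy)
    have h1 : ContMDiffAt (𝓡 n) 𝓘(ℝ, EuclideanSpace ℝ (Fin n)) ∞ e y :=
      contMDiffAt_extChartAt' (by simpa [e] using hy')
    exact χ.contMDiff.contMDiffAt.mul (hh.contMDiff.contMDiffAt.comp y h1)
  let pull : (h : EuclideanSpace ℝ (Fin n) → ℝ) → ContDiff ℝ ∞ h → C^∞⟮𝓡 n, M; ℝ⟯ :=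
    fun h hh => ⟨fun y => χ y * h (e y), hpull h hh⟩
  have hcoord : ∀ i : Fin n, ContDiff ℝ ∞ fun q : EuclideanSpace ℝ (Fin n) => q i := fun i =>
    (EuclideanSpace.proj (𝕜 := ℝ) i).contDiff
  obtain ⟨r, hr, hball⟩ := Metric.isOpen_iff.1 htgt (e x₀) (mem_extChartAt_target (I := 𝓡 n) x₀)
  -- Hadamard's lemma is stated for functions on the whole model space, whereas `f ∘ e.symm` is
  -- meaningful only on the chart target; `β` extends it by zero.
  let β : ContDiffBump (e x₀) := ⟨r / 4, r / 2, by positivity, by linarith⟩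
  have hβs : tsupport β ⊆ e.target := by
    rw [β.tsupport_eq]
    exact (Metric.closedBall_subset_ball (by simp only [β]; linarith)).trans hball
  have hβ1 : ∀ᶠ q in 𝓝 (e x₀), β q = 1 := β.eventuallyEq_one
  refine ⟨fun i => pull _ (hcoord i), C, hC.le, ?_⟩
  have hev := (continuousAt_extChartAt (I := 𝓡 n) x₀).eventually (eventually_eventually_nhds.2 hβ1)
  filter_upwards [hCe, hev, eventually_eventually_nhds.2 hχ1, extChartAt_source_mem_nhds (I := 𝓡 n) x₀]
    with x hx1 hx2 hx3 hx4 L hL f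
  set p := e x with hp
  have hpt : p ∈ e.target := e.map_source hx4
  have hsymm : ∀ q ∈ e.target,
      ContMDiffAt 𝓘(ℝ, EuclideanSpace ℝ (Fin n)) (𝓡 n) ∞ e.symm q := fun q hq =>
    (contMDiffOn_extChartAt_symm (I := 𝓡 n) (n := ∞) x₀).contMDiffAt (htgt.mem_nhds hq)
  have hF : ContDiff ℝ ∞ fun q => β q * f (e.symm q) := by
    rw [← contMDiff_iff_contDiff]
    refine contMDiff_of_tsupport fun q hq => ?_
    have hq' : q ∈ e.target := hβs (closure_mono (Function.support_mul_subset_left _ _) hq)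
    exact β.contDiff.contMDiff.contMDiffAt.mul (f.contMDiff.contMDiffAt.comp q (hsymm q hq'))
  obtain ⟨h, hh1, hh2, hh3⟩ := exists_hadamard _ hF p
  have hone : L 1 = 0 := by
    have := hL 1 1
    have h1 : (1 : C^∞⟮𝓡 n, M; ℝ⟯) x = 1 := rfl
    rw [mul_one, h1, one_mul] at this
    linarith
  -- Near `x`, `f = f(x) + ∑ (ξ_i - p_i) h_i`. A derivation annihilates constants, and the factors
  -- `ξ_i - p_i` vanish at `x`, so that `L f = ∑ h_i(p) L(ξ_i)`.
  have hexp : L f = L (f x • (1 : C^∞⟮𝓡 n, M; ℝ⟯)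
      + ∑ i, (pull _ (hcoord i) - p i • (1 : C^∞⟮𝓡 n, M; ℝ⟯)) * pull (h i) (hh1 i)) := by
    refine derivation_congr hL ?_
    have hex : ContinuousAt e x := continuousAt_extChartAt' (by simpa [e] using hx4)
    filter_upwards [hx3, hex.eventually hx2, hsrc.mem_nhds hx4] with y hy1 hy2 hy3
    have h4 := hh3 (e y)
    have h5 : ∀ S : Finset (Fin n), ∀ g : Fin n → C^∞⟮𝓡 n, M; ℝ⟯, (∑ i ∈ S, g i) y = ∑ i ∈ S, g i y := by
      intro S g
      classical
      induction S using Finset.induction_on with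
      | empty => simp
      | insert i S hi ih =>
        rw [Finset.sum_insert hi, Finset.sum_insert hi, ← ih]
        rfl
    change f y = f x * 1 + (∑ i, (pull _ (hcoord i) - p i • (1 : C^∞⟮𝓡 n, M; ℝ⟯)) * pull (h i) (hh1 i)) y
    rw [h5]
    have h6 : ∀ i, ((pull _ (hcoord i) - p i • (1 : C^∞⟮𝓡 n, M; ℝ⟯)) * pull (h i) (hh1 i)) y
        = (e y i - p i) * h i (e y) := by
      intro i
      change (χ y * e y i - p i * 1) * (χ y * h i (e y)) = _
      rw [hy1]
      ring
    simp only [h6]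
    rw [← h4, hy2, e.left_inv hy3, hp, e.left_inv hx4, hx2.self_of_nhds]
    ring
  have hLi : ∀ i, L ((pull _ (hcoord i) - p i • (1 : C^∞⟮𝓡 n, M; ℝ⟯)) * pull (h i) (hh1 i))
      = h i p * L (pull _ (hcoord i)) := by
    intro i
    rw [hL, map_sub, map_smul, hone, smul_zero, sub_zero]
    have h7 : (pull _ (hcoord i) - p i • (1 : C^∞⟮𝓡 n, M; ℝ⟯)) x = 0 := by
      change χ x * e x i - p i * 1 = 0
      rw [hx3.self_of_nhds, hp]
      ring
    have h8 : pull (h i) (hh1 i) x = h i p := by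
      change χ x * h i (e x) = _
      rw [hx3.self_of_nhds, one_mul]
    rw [h7, h8, zero_mul, zero_add]
  -- The value `h_i(p)` is a coordinate derivative of `f` at `x`, bounded by `‖df‖` times the length
  -- of a coordinate vector; the latter is uniformly bounded near `x₀`.
  have hhb : ∀ i, |h i p| ≤ C * ‖mvfderiv (𝓡 n) f x‖ := by
    intro i
    have h9 : (fun q => β q * f (e.symm q)) =ᶠ[𝓝 p] f ∘ e.symm := by
      filter_upwards [hx2] with q hq
      rw [hq, one_mul]
      rfl
    have h10 : MDifferentiableAt 𝓘(ℝ, EuclideanSpace ℝ (Fin n)) (𝓡 n) e.symm p :=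
      (hsymm p hpt).mdifferentiableAt (by simp)
    have hxp : e.symm p = x := e.left_inv hx4
    have h11 : ∀ x', e.symm p = x' → ∀ v, fderiv ℝ (f ∘ e.symm) p v = mvfderiv (𝓡 n) f x'
        (mfderiv 𝓘(ℝ, EuclideanSpace ℝ (Fin n)) (𝓡 n) e.symm p v) := by
      rintro _ rfl v
      have hfm : MDifferentiableAt (𝓡 n) 𝓘(ℝ, ℝ) f (e.symm p) :=
        f.contMDiff.contMDiffAt.mdifferentiableAt (by simp)
      have := mfderiv_comp p hfm h10
      rw [mfderiv_eq_fderiv] at this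
      exact congrArg (fun A : EuclideanSpace ℝ (Fin n) →L[ℝ] ℝ => A v) this
    have h12 : ∀ x', e.symm p = x' → ∀ w : EuclideanSpace ℝ (Fin n),
        @norm (TangentSpace (𝓡 n) x') _ w = @norm (TangentSpace (𝓡 n) (e.symm p)) _ w := by
      rintro _ rfl w
      rfl
    rw [hh2, h9.fderiv_eq, h11 x hxp, ← Real.norm_eq_abs]
    refine (ContinuousLinearMap.le_opNorm _ _).trans ?_
    rw [mul_comm]
    refine mul_le_mul_of_nonneg_right ?_ (norm_nonneg _)
    refine (h12 x hxp _).trans_le ((hx1 _).trans ?_)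
    simp
  rw [hexp, map_add, map_smul, hone, smul_zero, zero_add, map_sum]
  simp only [hLi]
  refine (Finset.abs_sum_le_sum_abs _ _).trans ?_
  rw [Finset.mul_sum, Finset.sum_mul]
  refine Finset.sum_le_sum fun i _ => ?_
  rw [abs_mul]
  calc |h i p| * |L (pull _ (hcoord i))|
      ≤ C * ‖mvfderiv (𝓡 n) f x‖ * |L (pull _ (hcoord i))| := by gcongr; exact hhb i
    _ = C * |L (pull _ (hcoord i))| * ‖mvfderiv (𝓡 n) f x‖ := by ring

end Derivations
end
end CylEnd

namespace CylEnd

noncomputable section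

attribute [local instance] tangentTotalSpace InnerProductSpace.complexToReal

/-! ### Locality of generalized Laplacians and locally controlled frames. -/

section LocalTheory

variable {n : ℕ} {M : Type*} [TopologicalSpace M] [ChartedSpace (EuclideanSpace ℝ (Fin n)) M]
  [RiemannianBundle (fun x : M => TangentSpace (𝓡 n) x)]
  {F : Type*} [NormedAddCommGroup F] [NormedSpace ℂ F]
  {E : M → Type*} [TopologicalSpace (TotalSpace F E)]
  [∀ x, NormedAddCommGroup (E x)] [∀ x, InnerProductSpace ℂ (E x)]
  [FiberBundle F E] [VectorBundle ℂ F E] [VectorBundle ℝ F E]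
  {P : smoothSections n F E →ₗ[ℂ] smoothSections n F E}

theorem funSmul_add_left (f g : C^∞⟮𝓡 n, M; ℝ⟯) (s : smoothSections n F E) :
    funSmul (f + g) s = funSmul f s + funSmul g s := by
  ext x
  exact add_smul (f x) (g x) (s.1 x)

theorem funSmul_funSmul (f g : C^∞⟮𝓡 n, M; ℝ⟯) (s : smoothSections n F E) :
    funSmul f (funSmul g s) = funSmul (f * g) s := by
  ext x
  exact smul_smul (f x) (g x) (s.1 x)

theorem funSmul_smul_left (c : ℝ) (f : C^∞⟮𝓡 n, M; ℝ⟯) (s : smoothSections n F E) :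
    funSmul (c • f) s = (c : ℂ) • funSmul f s := by
  ext x
  change (c * f x) • s.1 x = (c : ℂ) • f x • s.1 x
  rw [mul_smul]
  rfl

variable [IsManifold (𝓡 n) ∞ M] [T2Space M]

/-- A generalized Laplacian is a local operator. -/
theorem IsGeneralizedLaplacian.apply_eq_zero (hP : IsGeneralizedLaplacian P)
    {s : smoothSections n F E} {x : M} (hs : ∀ᶠ y in 𝓝 x, s.1 y = 0) : (P s).1 x = 0 := by
  obtain ⟨χ, h1, h2, -, -⟩ := exists_smooth_bump (n := n) x hs
  have h3 : funSmul χ s = 0 := by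
    ext y
    rw [funSmul_apply, smoothSections_zero_apply]
    by_cases hy : y ∈ tsupport χ
    · rw [show s.1 y = 0 from h2 hy, smul_zero]
    · rw [image_eq_zero_of_notMem_tsupport hy, zero_smul]
  have h4 := hP χ s x
  have h5 : funSmul χ (0 : smoothSections n F E) = 0 := by
    ext y
    exact smul_zero _
  rw [h3, h5, map_zero, h1.self_of_nhds, hs.self_of_nhds] at h4
  simpa using h4

theorem IsGeneralizedLaplacian.apply_congr (hP : IsGeneralizedLaplacian P)
    {s t : smoothSections n F E} {x : M} (hs : ∀ᶠ y in 𝓝 x, s.1 y = t.1 y) :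
    (P s).1 x = (P t).1 x := by
  have : (P (s - t)).1 x = 0 := hP.apply_eq_zero (by
    filter_upwards [hs] with y hy
    rw [smoothSections_sub_apply, hy, sub_self])
  rwa [map_sub, smoothSections_sub_apply, sub_eq_zero] at this

theorem IsGeneralizedLaplacian.hasCompactSupp (hP : IsGeneralizedLaplacian P)
    {s : smoothSections n F E} (hs : HasCompactSupp s) : HasCompactSupp (P s) := by
  obtain ⟨K, hK, hs⟩ := hs
  refine ⟨K, hK, fun x hx => hP.apply_eq_zero ?_⟩
  filter_upwards [hK.isClosed.isOpen_compl.mem_nhds hx] with y hy using hs y hy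

/-- The double commutator `[[P, f], g]` is multiplication by a real function. -/
theorem IsGeneralizedLaplacian.double_commutator (hP : IsGeneralizedLaplacian P)
    (f g : C^∞⟮𝓡 n, M; ℝ⟯) (s : smoothSections n F E) (x : M) :
    ∃ c : ℝ, (P (funSmul (f * g) s)).1 x - f x • (P (funSmul g s)).1 x
      - g x • (P (funSmul f s)).1 x + (f x * g x) • (P s).1 x = c • s.1 x := by
  have h1 := hP (f + g) s x
  have h2 := hP f s x
  have h3 := hP g s x
  simp only [funSmul_funSmul] at h1 h2 h3
  -- Polarization of the identity for `f + g`, `f` and `g`.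
  have e1 : (f + g) * (f + g) = f * f + (2 : ℝ) • (f * g) + g * g := by
    ext y
    change (f y + g y) * (f y + g y) = f y * f y + 2 * (f y * g y) + g y * g y
    ring
  have e2 : (f + g) x = f x + g x := rfl
  rw [e1, e2] at h1
  simp only [funSmul_add_left, funSmul_smul_left, map_add, map_smul, smoothSections_add_apply,
    smoothSections_smul_apply] at h1
  have e3 : ∀ v : E x, ((2 : ℝ) : ℂ) • v = (2 : ℝ) • v := fun v => rfl
  rw [e3] at h1
  refine ⟨(1 / 2 : ℝ) * ((-2 * ‖mvfderiv (𝓡 n) (f + g) x‖ ^ 2) - (-2 * ‖mvfderiv (𝓡 n) f x‖ ^ 2)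
    - (-2 * ‖mvfderiv (𝓡 n) g x‖ ^ 2)), ?_⟩
  have h4 : ∀ (a b c : ℝ) (v : E x),
      ((1 / 2 : ℝ) * (a - b - c)) • v = (1 / 2 : ℝ) • (a • v - b • v - c • v) := fun a b c v => by
    module
  rw [h4, ← h1, ← h2, ← h3]
  module

/-- The derivation `f ↦ Re ⟨t, [P, f] s⟩` at a point where `s` and `t` are orthogonal. -/
def commutatorFunctional (P : smoothSections n F E →ₗ[ℂ] smoothSections n F E)
    (s t : smoothSections n F E) (x : M) : C^∞⟮𝓡 n, M; ℝ⟯ →ₗ[ℝ] ℝ where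
  toFun f := inner ℝ (t.1 x) ((P (funSmul f s)).1 x - f x • (P s).1 x)
  map_add' f g := by
    have e : (f + g) x = f x + g x := rfl
    rw [funSmul_add_left, map_add, smoothSections_add_apply, e, add_smul, ← inner_add_right]
    congr 1
    abel
  map_smul' c f := by
    have e : (c • f) x = c * f x := rfl
    have e3 : ∀ v : E x, (c : ℂ) • v = c • v := fun v => rfl
    rw [funSmul_smul_left, map_smul, smoothSections_smul_apply, e, e3, mul_smul, ← smul_sub,
      real_inner_smul_right]
    rfl

/-- The defect of the Leibniz rule is the double commutator, a multiple of `s x`, and this is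
orthogonal to `t x`. Hence `exists_derivation_le` applies and bounds the commutator without any
coordinate expression of `P`. -/
theorem commutatorFunctional_mul (hP : IsGeneralizedLaplacian P)
    {s t : smoothSections n F E} {x : M} (h : inner ℝ (t.1 x) (s.1 x) = (0 : ℝ))
    (f g : C^∞⟮𝓡 n, M; ℝ⟯) : commutatorFunctional P s t x (f * g)
      = f x * commutatorFunctional P s t x g + g x * commutatorFunctional P s t x f := by
  obtain ⟨c, hc⟩ := hP.double_commutator f g s x
  have h2 : inner ℝ (t.1 x) (c • s.1 x) = (0 : ℝ) := by rw [real_inner_smul_right, h, mul_zero]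
  rw [← hc] at h2
  have e : (f * g) x = f x * g x := rfl
  simp only [commutatorFunctional, LinearMap.coe_mk, AddHom.coe_mk, e]
  simp only [inner_sub_right, inner_add_right, real_inner_smul_right] at h2 ⊢
  linear_combination h2

variable [ContMDiffVectorBundle ∞ F E (𝓡 n)] [IsSmoothHermitian n F E]
  [IsContinuousRiemannianBundle (EuclideanSpace ℝ (Fin n)) (fun x : M => TangentSpace (𝓡 n) x)]

/-- Contracting `D s` with the local frame of `TM` given by a trivialization produces smooth
sections of `E`, whose norms are continuous. Boundedness of the trivialization passes from these
finitely many contractions to the operator norm. -/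
theorem exists_norm_covariantDerivative_le {D : CovariantDerivative (𝓡 n) F E}
    (hD : D.ContMDiffCovariantDerivative ∞) (s : smoothSections n F E) (x₀ : M) :
    ∃ C, ∀ᶠ x in 𝓝 x₀, ‖D s.1 x‖ ≤ C := by
  have : IsManifold (𝓡 n) 1 M := IsManifold.of_le (n := ∞) (by simp)
  let V := EuclideanSpace ℝ (Fin n)
  set τ := trivializationAt V (fun x : M => TangentSpace (𝓡 n) x) x₀ with hτ
  have hDs := hD.contMDiff.contMDiff (σ := s.1) (ContMDiff.contMDiffOn s.2)
  have hX : ∀ i : Fin n, ∃ t : smoothSections n F E, ∀ᶠ x in 𝓝 x₀,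
      t.1 x = D s.1 x (τ.symm x (EuclideanSpace.single i (1 : ℝ))) := by
    intro i
    refine exists_section_eventuallyEq τ.open_baseSet (mem_baseSet_trivializationAt _ _ x₀) ?_
    have h1 : ContMDiffOn (𝓡 n) ((𝓡 n).prod 𝓘(ℝ, V)) ∞
        (fun x => (⟨x, τ.symm x (EuclideanSpace.single i (1 : ℝ))⟩ :
          TotalSpace V (fun x : M => TangentSpace (𝓡 n) x))) τ.baseSet := by
      rw [τ.contMDiffOn_section_baseSet_iff]
      refine (contMDiffOn_const (c := EuclideanSpace.single i (1 : ℝ))).congr fun x hx => ?_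
      rw [τ.apply_mk_symm hx]
    exact (hDs.mono (Set.subset_univ _)).clm_bundle_apply h1
  choose t ht using hX
  obtain ⟨C, hC, hCe⟩ := eventually_norm_trivializationAt_lt V (fun x : M => TangentSpace (𝓡 n) x) x₀
  have hbd : ∀ᶠ x in 𝓝 x₀, ∑ i, ‖(t i).1 x‖ < ∑ i, ‖(t i).1 x₀‖ + 1 := by
    have hc : Continuous fun x => ∑ i, ‖(t i).1 x‖ :=
      continuous_finsetSum _ fun i _ => continuous_norm_section (t i)
    exact hc.continuousAt.eventually_lt_const (lt_add_one _)
  refine ⟨(∑ i, ‖(t i).1 x₀‖ + 1) * C, ?_⟩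
  filter_upwards [hCe, hbd, eventually_all.2 ht,
    τ.open_baseSet.mem_nhds (mem_baseSet_trivializationAt _ _ x₀)] with x h1 h2 h3 h4
  have hS0 : 0 ≤ ∑ i, ‖(t i).1 x₀‖ + 1 := by positivity
  refine ContinuousLinearMap.opNorm_le_bound _ (by positivity) fun v => ?_
  set c : V := τ.continuousLinearMapAt ℝ x v with hc
  have hv : v = ∑ i, c i • τ.symmL ℝ x (EuclideanSpace.single i (1 : ℝ)) := by
    have e1 : τ.symmL ℝ x c = v := τ.symmL_continuousLinearMapAt h4 v
    have e2 : c = ∑ i, c i • EuclideanSpace.single i (1 : ℝ) := by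
      refine ((EuclideanSpace.basisFun (Fin n) ℝ).sum_repr c).symm.trans
        (Finset.sum_congr rfl fun i _ => ?_)
      simp
    rw [← e1]
    conv_lhs => rw [e2]
    rw [map_sum]
    exact Finset.sum_congr rfl fun i _ => map_smul _ _ _
  have hcn : ‖c‖ ≤ C * ‖v‖ := ContinuousLinearMap.le_of_opNorm_le _ h1.le v
  rw [hv, map_sum]
  refine (norm_sum_le _ _).trans ?_
  have h5 : ∀ i, ‖D s.1 x (c i • τ.symmL ℝ x (EuclideanSpace.single i (1 : ℝ)))‖
      ≤ ‖(t i).1 x‖ * (C * ‖v‖) := by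
    intro i
    rw [map_smul, norm_smul, Trivialization.symmL_apply _ h4, ← h3 i, mul_comm]
    exact mul_le_mul_of_nonneg_left ((PiLp.norm_apply_le c i).trans hcn) (norm_nonneg _)
  refine (Finset.sum_le_sum fun i _ => h5 i).trans ?_
  rw [← Finset.sum_mul, ← hv, mul_assoc]
  exact mul_le_mul_of_nonneg_right h2.le (by positivity)

/-- A real orthonormal frame at `x`, on which the operators `P`, `[P, f]` and `D` are bounded
by `C`. -/
structure IsControlledFrameAt (P : smoothSections n F E →ₗ[ℂ] smoothSections n F E)
    (D : CovariantDerivative (𝓡 n) F E) {ι : Type*} [Fintype ι] [DecidableEq ι]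
    (e : ι → smoothSections n F E) (C : ℝ) (x : M) : Prop where
  ortho : IsOrthoFrameAt e x
  norm_le : ∀ j, ‖(P (e j)).1 x‖ ≤ C
  commutator_le : ∀ j k, j ≠ k → ∀ f : C^∞⟮𝓡 n, M; ℝ⟯,
    |commutatorFunctional P (e k) (e j) x f| ≤ C * ‖mvfderiv (𝓡 n) f x‖
  gradient_le : ∀ j, ‖D (e j).1 x‖ ≤ C

/-- Each required bound reduces to finitely many locally bounded functions. For the commutators,
which involve all functions `f`, this is where `exists_derivation_le` enters: it suffices to bound
their values on the functions `ξ i`. Diagonal commutators are left out, since there the derivation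
property fails; symmetry of the operator will deal with them. -/
theorem exists_controlledFrame [FiniteDimensional ℂ F] (hP : IsGeneralizedLaplacian P)
    {D : CovariantDerivative (𝓡 n) F E} (hD : D.ContMDiffCovariantDerivative ∞) (x₀ : M) :
    ∃ (r : ℕ) (e : Fin r → smoothSections n F E) (C : ℝ), 0 ≤ C ∧
      ∀ᶠ x in 𝓝 x₀, IsControlledFrameAt P D e C x := by
  obtain ⟨r, e, he⟩ := exists_orthoFrame (n := n) (F := F) (E := E) x₀
  obtain ⟨ξ, C₁, hC₁, hξ⟩ := exists_derivation_le (n := n) x₀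
  have hg : ∀ j, ∃ C, ∀ᶠ x in 𝓝 x₀, ‖D (e j).1 x‖ ≤ C := fun j =>
    exists_norm_covariantDerivative_le hD (e j) x₀
  choose C₂ hC₂ using hg
  let T : Fin r → Fin r → Fin n → M → ℝ := fun j k i x => |commutatorFunctional P (e k) (e j) x (ξ i)|
  have hT : ∀ j k i, Continuous (T j k i) := by
    intro j k i
    exact (reInner (e j)
      (P (funSmul (ξ i) (e k)) - funSmul (ξ i) (P (e k)))).contMDiff.continuous.abs
  let C₃ : ℝ := ∑ j, ∑ k, ∑ i, T j k i x₀ + 1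
  have hC₃ : ∀ᶠ x in 𝓝 x₀, ∑ j, ∑ k, ∑ i, T j k i x < C₃ := by
    have hc : Continuous fun x => ∑ j, ∑ k, ∑ i, T j k i x :=
      continuous_finsetSum _ fun j _ => continuous_finsetSum _ fun k _ =>
        continuous_finsetSum _ fun i _ => hT j k i
    exact hc.continuousAt.eventually_lt_const (lt_add_one _)
  have hC₄ : ∀ᶠ x in 𝓝 x₀, ∑ j, ‖(P (e j)).1 x‖ < ∑ j, ‖(P (e j)).1 x₀‖ + 1 := by
    have hc : Continuous fun x => ∑ j, ‖(P (e j)).1 x‖ :=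
      continuous_finsetSum _ fun i _ => continuous_norm_section (P (e i))
    exact hc.continuousAt.eventually_lt_const (lt_add_one _)
  have hT0 : ∀ j k i x, 0 ≤ T j k i x := fun j k i x => abs_nonneg _
  have hC₃0 : 0 ≤ C₃ := by
    have : 0 ≤ ∑ j, ∑ k, ∑ i, T j k i x₀ := Finset.sum_nonneg fun j _ =>
      Finset.sum_nonneg fun k _ => Finset.sum_nonneg fun i _ => hT0 j k i x₀
    simp only [C₃]
    linarith
  have hC₂s : ∀ j, C₂ j ≤ ∑ j, |C₂ j| := fun j => (le_abs_self _).trans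
    (Finset.single_le_sum (f := fun j => |C₂ j|) (fun _ _ => abs_nonneg _) (Finset.mem_univ j))
  have hC₂0 : 0 ≤ ∑ j, |C₂ j| := Finset.sum_nonneg fun _ _ => abs_nonneg _
  have hC₄0 : 0 ≤ ∑ j, ‖(P (e j)).1 x₀‖ + 1 := by positivity
  refine ⟨r, e, C₁ * C₃ + ∑ j, |C₂ j| + (∑ j, ‖(P (e j)).1 x₀‖ + 1), by positivity, ?_⟩
  filter_upwards [he, hξ, eventually_all.2 hC₂, hC₃, hC₄] with x h1 h2 h3 h4 h5
  refine ⟨h1, fun j => ?_, fun j k hjk f => ?_, fun j => ?_⟩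
  · have := Finset.single_le_sum (f := fun j => ‖(P (e j)).1 x‖) (fun _ _ => norm_nonneg _)
      (Finset.mem_univ j)
    have h6 : 0 ≤ C₁ * C₃ := by positivity
    linarith
  · have h0 : inner ℝ ((e j).1 x) ((e k).1 x) = (0 : ℝ) := by rw [h1.inner_eq, if_neg hjk]
    refine (h2 _ (commutatorFunctional_mul hP h0) f).trans ?_
    refine mul_le_mul_of_nonneg_right ?_ (ContinuousLinearMap.opNorm_nonneg _)
    have h6 : ∑ i, T j k i x ≤ ∑ j, ∑ k, ∑ i, T j k i x := by
      refine le_trans ?_ (Finset.single_le_sum (f := fun j => ∑ k, ∑ i, T j k i x)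
        (fun j _ => Finset.sum_nonneg fun k _ => Finset.sum_nonneg fun i _ => hT0 j k i x)
        (Finset.mem_univ j))
      exact Finset.single_le_sum (f := fun k => ∑ i, T j k i x)
        (fun k _ => Finset.sum_nonneg fun i _ => hT0 j k i x) (Finset.mem_univ k)
    have h7 : C₁ * ∑ i, T j k i x ≤ C₁ * C₃ := mul_le_mul_of_nonneg_left (h6.trans h4.le) hC₁
    refine h7.trans ?_
    linarith
  · have h6 : 0 ≤ C₁ * C₃ := by positivity
    have := h3 j
    have := hC₂s j
    linarith

end LocalTheory
end
end CylEnd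

namespace CylEnd

noncomputable section

/-! ### Compactly supported sections as a dense subspace of `L²`. -/

section CompactSupport

attribute [local instance] tangentTotalSpace InnerProductSpace.complexToReal

variable {n : ℕ} {M : Type*} [TopologicalSpace M] [ChartedSpace (EuclideanSpace ℝ (Fin n)) M]
  {F : Type*} [NormedAddCommGroup F] [NormedSpace ℂ F]
  {E : M → Type*} [TopologicalSpace (TotalSpace F E)]
  [∀ x, NormedAddCommGroup (E x)] [∀ x, InnerProductSpace ℂ (E x)]
  [FiberBundle F E] [VectorBundle ℂ F E] [VectorBundle ℝ F E]

theorem HasCompactSupp.zero : HasCompactSupp (0 : smoothSections n F E) :=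
  ⟨∅, isCompact_empty, fun _ _ => rfl⟩

theorem HasCompactSupp.add {s t : smoothSections n F E} (hs : HasCompactSupp s)
    (ht : HasCompactSupp t) : HasCompactSupp (s + t) := by
  obtain ⟨K, hK, hs⟩ := hs
  obtain ⟨L, hL, ht⟩ := ht
  refine ⟨K ∪ L, hK.union hL, fun x hx => ?_⟩
  rw [smoothSections_add_apply, hs x fun h => hx (Or.inl h), ht x fun h => hx (Or.inr h), add_zero]

theorem HasCompactSupp.smul {s : smoothSections n F E} (hs : HasCompactSupp s) (c : ℂ) :
    HasCompactSupp (c • s) := by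
  obtain ⟨K, hK, hs⟩ := hs
  exact ⟨K, hK, fun x hx => by rw [smoothSections_smul_apply, hs x hx, smul_zero]⟩

theorem HasCompactSupp.sub {s t : smoothSections n F E} (hs : HasCompactSupp s)
    (ht : HasCompactSupp t) : HasCompactSupp (s - t) := by
  obtain ⟨K, hK, hs⟩ := hs
  obtain ⟨L, hL, ht⟩ := ht
  refine ⟨K ∪ L, hK.union hL, fun x hx => ?_⟩
  rw [smoothSections_sub_apply, hs x fun h => hx (Or.inl h), ht x fun h => hx (Or.inr h), sub_zero]

theorem HasCompactSupp.funSmul {s : smoothSections n F E} (hs : HasCompactSupp s)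
    (f : C^∞⟮𝓡 n, M; ℝ⟯) : HasCompactSupp (funSmul f s) := by
  obtain ⟨K, hK, hs⟩ := hs
  exact ⟨K, hK, fun x hx => by rw [funSmul_apply, hs x hx, smul_zero]⟩

theorem HasCompactSupp.funSmul_left {f : C^∞⟮𝓡 n, M; ℝ⟯} {K : Set M} (hK : IsCompact K)
    (hf : ∀ x, x ∉ K → f x = 0) (s : smoothSections n F E) : HasCompactSupp (CylEnd.funSmul f s) :=
  ⟨K, hK, fun x hx => by rw [funSmul_apply, hf x hx, zero_smul]⟩

variable (n F E) in
/-- The space `C_c^∞(M, E)` of compactly supported smooth sections. -/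
def compactSections : Submodule ℂ (smoothSections n F E) where
  carrier := {s | HasCompactSupp s}
  add_mem' := HasCompactSupp.add
  zero_mem' := HasCompactSupp.zero
  smul_mem' c _ hs := HasCompactSupp.smul hs c

variable [IsManifold (𝓡 n) ∞ M] [T2Space M]

theorem exists_smooth_cutoff [SigmaCompactSpace M] {K : Set M} (hK : IsCompact K) :
    ∃ χ : C^∞⟮𝓡 n, M; ℝ⟯, (∀ᶠ x in 𝓝ˢ K, χ x = 1) ∧ (∀ x, χ x ∈ Set.Icc (0 : ℝ) 1) ∧
      ∃ L, IsCompact L ∧ ∀ x, x ∉ L → χ x = 0 := by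
  have : LocallyCompactSpace M := ChartedSpace.locallyCompactSpace (EuclideanSpace ℝ (Fin n)) M
  obtain ⟨L, hL, hKL⟩ := exists_compact_superset hK
  obtain ⟨χ, h1, h2, h3⟩ := exists_contMDiffMap_one_nhds_of_subset_interior (𝓡 n) (n := (⊤ : ℕ∞))
    hK.isClosed hKL
  exact ⟨χ, h1, h3, L, hL, fun x hx => by_contra fun h => hx (by
    by_contra h'
    exact h (h2 x hx))⟩

variable [RiemannianBundle (fun x : M => TangentSpace (𝓡 n) x)] [MeasurableSpace M] [BorelSpace M]
  [IsContinuousRiemannianBundle (EuclideanSpace ℝ (Fin n)) (fun x : M => TangentSpace (𝓡 n) x)]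

theorem integrable_of_compact {G : Type*} [NormedAddCommGroup G] {f : M → G} (hf : Continuous f)
    {K : Set M} (hK : IsCompact K) (h0 : ∀ x, x ∉ K → f x = 0) :
    Integrable f (riemannianVolume n M) :=
  hf.integrable_of_hasCompactSupport (HasCompactSupport.intro hK h0)

variable [IsSmoothHermitian n F E]

theorem integrable_inner_left {s : smoothSections n F E} (hs : HasCompactSupp s)
    (t : smoothSections n F E) :
    Integrable (fun x => (inner ℂ (s.1 x) (t.1 x) : ℂ)) (riemannianVolume n M) := by
  obtain ⟨K, hK, hs⟩ := hs
  exact integrable_of_compact (continuous_inner_section s t) hK fun x hx => by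
    rw [hs x hx, inner_zero_left]

theorem integrable_inner_right (s : smoothSections n F E) {t : smoothSections n F E}
    (ht : HasCompactSupp t) :
    Integrable (fun x => (inner ℂ (s.1 x) (t.1 x) : ℂ)) (riemannianVolume n M) := by
  obtain ⟨K, hK, hs⟩ := ht
  exact integrable_of_compact (continuous_inner_section s t) hK fun x hx => by
    rw [hs x hx, inner_zero_right]

theorem HasCompactSupp.mem_sqIntegrable {s : smoothSections n F E} (hs : HasCompactSupp s) :
    s.1 ∈ sqIntegrable n F E := by
  refine ⟨⟨fun _ => s, ae_of_all _ fun x => tendsto_const_nhds⟩, ?_⟩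
  obtain ⟨K, hK, hs⟩ := hs
  exact (continuous_norm_section s).memLp_of_hasCompactSupport
    (HasCompactSupport.intro hK fun x hx => by rw [hs x hx, norm_zero])

variable (n F E) in
/-- Compactly supported smooth sections are square integrable. -/
def toPreL2 : compactSections n F E →ₗ[ℂ] PreL2 n F E where
  toFun s := ⟨s.1.1, HasCompactSupp.mem_sqIntegrable s.2⟩
  map_add' _ _ := rfl
  map_smul' _ _ := rfl

theorem toPreL2_apply (s : compactSections n F E) (x : M) : (toPreL2 n F E s).1 x = s.1.1 x := rfl

variable (n F E) in
/-- The embedding of the compactly supported smooth sections in `L²`. -/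
def toL2 : compactSections n F E →ₗ[ℂ] L2 n F E :=
  (SeparationQuotient.mkCLM ℂ (PreL2 n F E)).toLinearMap ∘ₗ toPreL2 n F E

theorem toL2_apply (s : compactSections n F E) :
    toL2 n F E s = SeparationQuotient.mk (toPreL2 n F E s) := rfl

theorem PreL2.inner_def (s t : PreL2 n F E) :
    (inner ℂ s t : ℂ) = ∫ x, inner ℂ (s.1 x) (t.1 x) ∂(riemannianVolume n M) := rfl

theorem inner_toL2 (s t : compactSections n F E) :
    (inner ℂ (toL2 n F E s) (toL2 n F E t) : ℂ)
      = ∫ x, inner ℂ (s.1.1 x) (t.1.1 x) ∂(riemannianVolume n M) := rfl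

theorem PreL2.norm_sq (s : PreL2 n F E) :
    ‖s‖ ^ 2 = ∫ x, ‖s.1 x‖ ^ 2 ∂(riemannianVolume n M) := by
  rw [← inner_self_eq_norm_sq (𝕜 := ℂ), PreL2.inner_def]
  have h : (fun x => (inner ℂ (s.1 x) (s.1 x) : ℂ)) = fun x => ((‖s.1 x‖ ^ 2 : ℝ) : ℂ) := by
    funext x
    rw [inner_self_eq_norm_sq_to_K]
    simp
  rw [h, integral_complex_ofReal]
  rfl

theorem norm_toL2_sq (s : compactSections n F E) :
    ‖toL2 n F E s‖ ^ 2 = ∫ x, ‖s.1.1 x‖ ^ 2 ∂(riemannianVolume n M) :=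
  PreL2.norm_sq (toPreL2 n F E s)

theorem PreL2.lintegral_enorm_sq (s : PreL2 n F E) :
    ∫⁻ x, ‖s.1 x‖ₑ ^ 2 ∂(riemannianVolume n M) = ENNReal.ofReal (‖s‖ ^ 2) := by
  rw [PreL2.norm_sq, ofReal_integral_eq_lintegral_ofReal]
  · refine lintegral_congr fun x => ?_
    rw [← ofReal_norm, ENNReal.ofReal_pow (norm_nonneg _)]
  · exact s.2.2.integrable_sq
  · exact ae_of_all _ fun x => by positivity

theorem PreL2.tendsto_of_dominated {f : ℕ → PreL2 n F E} {s : PreL2 n F E} {b : M → ℝ}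
    (hb : MemLp b 2 (riemannianVolume n M)) (hfb : ∀ k, ∀ᵐ x ∂(riemannianVolume n M), ‖(f k).1 x‖ ≤ b x)
    (hf : ∀ᵐ x ∂(riemannianVolume n M), Tendsto (fun k => (f k).1 x) atTop (𝓝 (s.1 x))) :
    Tendsto f atTop (𝓝 s) := by
  rw [tendsto_iff_norm_sub_tendsto_zero]
  have h1 : Tendsto (fun k => ‖f k - s‖ ^ 2) atTop (𝓝 0) := by
    simp only [PreL2.norm_sq]
    have h2 : ∫ x : M, (0 : ℝ) ∂(riemannianVolume n M) = 0 := by simp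
    rw [← h2]
    refine tendsto_integral_of_dominated_convergence (fun x => (2 * b x) ^ 2) (fun k => ?_) ?_
      (fun k => ?_) ?_
    · exact (f k - s).2.2.integrable_sq.aestronglyMeasurable
    · exact (hb.const_mul 2).integrable_sq
    · filter_upwards [ae_all_iff.2 hfb, hf] with x h3 h4
      have h5 : ‖s.1 x‖ ≤ b x := le_of_tendsto h4.norm (Eventually.of_forall h3)
      have h6 : ‖(f k).1 x - s.1 x‖ ≤ 2 * b x := (norm_sub_le _ _).trans (by linarith [h3 k])
      rw [Real.norm_of_nonneg (by positivity)]
      exact pow_le_pow_left₀ (norm_nonneg _) h6 2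
    · filter_upwards [hf] with x hx
      have h3 : Tendsto (fun k => ‖(f k).1 x - s.1 x‖) atTop (𝓝 0) :=
        tendsto_iff_norm_sub_tendsto_zero.1 hx
      have h4 := h3.pow 2
      rw [zero_pow two_ne_zero] at h4
      exact h4
  have h2 := h1.sqrt
  simpa [Real.sqrt_sq] using h2

/-- Compactly supported smooth sections are dense in `L²`. -/
theorem denseRange_toL2 [SigmaCompactSpace M] : DenseRange (toL2 n F E) := by
  have : LocallyCompactSpace M := ChartedSpace.locallyCompactSpace (EuclideanSpace ℝ (Fin n)) M
  have key : DenseRange (toPreL2 n F E) := by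
    intro s
    let K := CompactExhaustion.choice M
    choose χ hχ1 hχ2 L hL hχ3 using fun j => exists_smooth_cutoff (n := n) (K.isCompact j)
    obtain ⟨f, hf⟩ := s.2.1
    -- Truncation in space by `χ N` and in size by a smooth function of `‖t‖ ^ 2`. It makes the
    -- truncated smooth approximants `f k` uniformly dominated for fixed `N`, so that dominated
    -- convergence applies first as `k → ∞` and then as `N → ∞`.
    have hT : ∀ N : ℕ, ∀ t : smoothSections n F E, ContMDiff (𝓡 n) 𝓘(ℝ, ℝ) ∞ fun x =>
        χ N x * (1 + ‖t.1 x‖ ^ 2 / (N + 1))⁻¹ := by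
      intro N t
      have h1 : (fun x => χ N x * (1 + ‖t.1 x‖ ^ 2 / (N + 1))⁻¹)
          = fun x => χ N x * (1 + reInner t t x / (N + 1))⁻¹ := by
        funext x
        rw [reInner_apply, real_inner_self_eq_norm_sq]
      rw [h1]
      have h2 : ContDiffOn ℝ ∞ (fun y : ℝ => (1 + y / (N + 1))⁻¹) {y | 0 ≤ y} := by
        refine ContDiffOn.inv (by fun_prop) fun y hy => ?_
        have hy' : (0 : ℝ) ≤ y := hy
        positivity
      refine (χ N).contMDiff.mul ?_
      rw [← contMDiffOn_univ]
      refine h2.contMDiffOn.comp (reInner t t).contMDiff.contMDiffOn fun x _ => ?_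
      change 0 ≤ reInner t t x
      rw [reInner_apply, real_inner_self_eq_norm_sq]
      positivity
    let g : ℕ → ℕ → compactSections n F E := fun N k =>
      ⟨funSmul ⟨_, hT N (f k)⟩ (f k), HasCompactSupp.funSmul_left (hL N) (fun x hx => by
        change χ N x * _ = 0
        rw [hχ3 N x hx, zero_mul]) _⟩
    have hg : ∀ N k x, (g N k).1.1 x = (χ N x * (1 + ‖(f k).1 x‖ ^ 2 / (N + 1))⁻¹) • (f k).1 x :=
      fun N k x => rfl
    have hle1 : ∀ (N : ℕ) (x : M) (a : ℝ), 0 ≤ a → |χ N x * (1 + a ^ 2 / (N + 1))⁻¹| ≤ χ N x := by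
      intro N x a ha
      have h1 := (hχ2 N x).1
      have h2 : (1 + a ^ 2 / (N + 1) : ℝ)⁻¹ ≤ 1 := inv_le_one_of_one_le₀ (by
        have : 0 ≤ a ^ 2 / (N + 1 : ℝ) := by positivity
        linarith)
      rw [abs_of_nonneg (by positivity)]
      exact mul_le_of_le_one_right h1 h2
    have hle2 : ∀ (N : ℕ) (a : ℝ), 0 ≤ a → (1 + a ^ 2 / (N + 1))⁻¹ * a ≤ N + 1 := by
      intro N a ha
      have hN : (0 : ℝ) < N + 1 := by positivity
      rw [inv_mul_le_iff₀ (by positivity)]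
      have h1 : (1 + a ^ 2 / (N + 1)) * (N + 1 : ℝ) = (N + 1) + a ^ 2 := by field_simp
      rw [h1]
      have h2 : (1 : ℝ) ≤ N + 1 := by linarith [Nat.cast_nonneg (α := ℝ) N]
      nlinarith [sq_nonneg (a - 1)]
    have hlim : ∀ N, ∀ᵐ x ∂(riemannianVolume n M), Tendsto (fun k => (g N k).1.1 x) atTop
        (𝓝 ((χ N x * (1 + ‖s.1 x‖ ^ 2 / (N + 1))⁻¹) • s.1 x)) := by
      intro N
      filter_upwards [hf] with x hx
      simp only [hg]
      refine Tendsto.smul (tendsto_const_nhds.mul (Tendsto.inv₀ ?_ ?_)) hx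
      · exact tendsto_const_nhds.add ((hx.norm.pow 2).div_const _)
      · positivity
    have hSN : ∀ N, (fun x => (χ N x * (1 + ‖s.1 x‖ ^ 2 / (N + 1))⁻¹) • s.1 x) ∈
        sqIntegrable n F E := by
      intro N
      have h1 : IsMeasurableSection n F E
          (fun x => (χ N x * (1 + ‖s.1 x‖ ^ 2 / (N + 1))⁻¹) • s.1 x) := ⟨fun k => (g N k).1, hlim N⟩
      refine ⟨h1, s.2.2.mono h1.aestronglyMeasurable_norm (ae_of_all _ fun x => ?_)⟩
      rw [norm_norm, norm_norm, norm_smul, Real.norm_eq_abs]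
      exact mul_le_of_le_one_left (norm_nonneg _) ((hle1 N x _ (norm_nonneg _)).trans (hχ2 N x).2)
    let S : ℕ → PreL2 n F E := fun N => ⟨_, hSN N⟩
    have h1 : ∀ N, Tendsto (fun k => toPreL2 n F E (g N k)) atTop (𝓝 (S N)) := by
      intro N
      have hcont : Continuous fun x => χ N x * (N + 1 : ℝ) :=
        (χ N).contMDiff.continuous.mul continuous_const
      refine PreL2.tendsto_of_dominated (b := fun x => χ N x * (N + 1))
        (hcont.memLp_of_hasCompactSupport (HasCompactSupport.intro (hL N) fun x hx => by
          rw [hχ3 N x hx, zero_mul])) (fun k => ae_of_all _ fun x => ?_) (hlim N)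
      rw [toPreL2_apply, hg, norm_smul, Real.norm_eq_abs, abs_of_nonneg (by
        have := (hχ2 N x).1
        positivity), mul_assoc]
      exact mul_le_mul_of_nonneg_left (hle2 N _ (norm_nonneg _)) (hχ2 N x).1
    have h2 : Tendsto S atTop (𝓝 s) := by
      refine PreL2.tendsto_of_dominated (b := fun x => ‖s.1 x‖) s.2.2 (fun N => ae_of_all _ fun x => ?_)
        (ae_of_all _ fun x => ?_)
      · change ‖(χ N x * (1 + ‖s.1 x‖ ^ 2 / (N + 1))⁻¹) • s.1 x‖ ≤ _
        rw [norm_smul, Real.norm_eq_abs]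
        exact mul_le_of_le_one_left (norm_nonneg _)
          ((hle1 N x _ (norm_nonneg _)).trans (hχ2 N x).2)
      · change Tendsto (fun N : ℕ => (χ N x * (1 + ‖s.1 x‖ ^ 2 / (N + 1))⁻¹) • s.1 x) atTop _
        have h3 : ∀ᶠ N in atTop, χ N x = 1 := by
          obtain ⟨N₀, hN₀⟩ := K.exists_mem x
          filter_upwards [eventually_ge_atTop N₀] with N hN
          exact (hχ1 N).self_of_nhdsSet x (K.subset hN hN₀)
        have h4 : Tendsto (fun N : ℕ => (1 : ℝ) * (1 + ‖s.1 x‖ ^ 2 / (N + 1))⁻¹) atTop (𝓝 1) := by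
          have h5 : Tendsto (fun N : ℕ => ‖s.1 x‖ ^ 2 / ((N : ℝ) + 1)) atTop (𝓝 0) :=
            tendsto_const_nhds.div_atTop
              (tendsto_atTop_add_const_right _ _ tendsto_natCast_atTop_atTop)
          have h6 := (h5.const_add 1).inv₀ (by norm_num)
          simpa using h6
        have h7 := h4.smul_const (s.1 x)
        rw [one_smul] at h7
        refine h7.congr' ?_
        filter_upwards [h3] with N hN
        rw [hN]
    refine isClosed_closure.mem_of_tendsto h2 (Eventually.of_forall fun N => ?_)
    exact mem_closure_of_tendsto (h1 N) (Eventually.of_forall fun k => ⟨_, rfl⟩)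
  exact SeparationQuotient.surjective_mk.denseRange.comp key SeparationQuotient.continuous_mk

variable {P : smoothSections n F E →ₗ[ℂ] smoothSections n F E}

/-- A formally self-adjoint generalized Laplacian is symmetric as soon as one of the sections has
compact support. -/
theorem IsFormallySelfAdjoint.integral_inner_eq [SigmaCompactSpace M]
    (hS : IsFormallySelfAdjoint P) (hP : IsGeneralizedLaplacian P) (s : smoothSections n F E)
    {t : smoothSections n F E} (ht : HasCompactSupp t) :
    ∫ x, inner ℂ ((P s).1 x) (t.1 x) ∂(riemannianVolume n M)
      = ∫ x, inner ℂ (s.1 x) ((P t).1 x) ∂(riemannianVolume n M) := by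
  obtain ⟨K, hK, htK⟩ := id ht
  obtain ⟨χ, h1, -, L, hL, h2⟩ := exists_smooth_cutoff (n := n) hK
  -- Replacing `s` by `χ s`, with `χ = 1` near the support of `t`, changes neither side because `P`
  -- is local.
  have h3 := hS (funSmul χ s) t (HasCompactSupp.funSmul_left hL h2 s) ht
  have h4 : ∀ x ∈ K, (P (funSmul χ s)).1 x = (P s).1 x := by
    intro x hx
    refine hP.apply_congr ?_
    filter_upwards [eventually_nhdsSet_iff_forall.1 h1 x hx] with y hy
    rw [funSmul_apply, hy, one_smul]
  refine Eq.trans ?_ (h3.trans ?_)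
  · refine integral_congr_ae (ae_of_all _ fun x => ?_)
    by_cases hx : x ∈ K
    · simp only [h4 x hx]
    · simp only [htK x hx, inner_zero_right]
  · refine integral_congr_ae (ae_of_all _ fun x => ?_)
    by_cases hx : x ∈ K
    · simp only [funSmul_apply, h1.self_of_nhdsSet x hx, one_smul]
    · have h5 : (P t).1 x = 0 := hP.apply_eq_zero (by
        filter_upwards [hK.isClosed.isOpen_compl.mem_nhds hx] with y hy using htK y hy)
      simp only [h5, inner_zero_right]

end CompactSupport
end
end CylEnd

namespace CylEnd

noncomputable section

/-! ### Gårding inequality for sections supported in one frame. -/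

section Garding

attribute [local instance] tangentTotalSpace InnerProductSpace.complexToReal

variable {n : ℕ} {M : Type*} [TopologicalSpace M] [ChartedSpace (EuclideanSpace ℝ (Fin n)) M]
  [RiemannianBundle (fun x : M => TangentSpace (𝓡 n) x)]
  {F : Type*} [NormedAddCommGroup F] [NormedSpace ℂ F]
  {E : M → Type*} [TopologicalSpace (TotalSpace F E)]
  [∀ x, NormedAddCommGroup (E x)] [∀ x, InnerProductSpace ℂ (E x)]
  [FiberBundle F E] [VectorBundle ℂ F E] [VectorBundle ℝ F E]
  {P : smoothSections n F E →ₗ[ℂ] smoothSections n F E}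
  {D : CovariantDerivative (𝓡 n) F E}

theorem smoothSections_mdifferentiableAt (s : smoothSections n F E) (x : M) :
    MDifferentiableAt (𝓡 n) ((𝓡 n).prod 𝓘(ℝ, F)) (fun x => (⟨x, s.1 x⟩ : TotalSpace F E)) x :=
  ContMDiffAt.mdifferentiableAt (s.2 x) (by simp)

theorem smoothFun_mdifferentiableAt (f : C^∞⟮𝓡 n, M; ℝ⟯) (x : M) :
    MDifferentiableAt (𝓡 n) 𝓘(ℝ, ℝ) f x :=
  f.contMDiff.contMDiffAt.mdifferentiableAt (by simp)

theorem covariantDerivative_add (s t : smoothSections n F E) (x : M) :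
    D (s + t).1 x = D s.1 x + D t.1 x :=
  D.isCovariantDerivativeOnUniv.add (smoothSections_mdifferentiableAt s x)
    (smoothSections_mdifferentiableAt t x)

theorem covariantDerivative_funSmul (f : C^∞⟮𝓡 n, M; ℝ⟯) (s : smoothSections n F E) (x : M)
    (v : TangentSpace (𝓡 n) x) :
    D (funSmul f s).1 x v = f x • D s.1 x v + (mvfderiv (𝓡 n) f x v) • s.1 x := by
  have h := D.isCovariantDerivativeOnUniv.leibniz (smoothSections_mdifferentiableAt s x)
    (smoothFun_mdifferentiableAt f x)
  exact congrArg (fun A : TangentSpace (𝓡 n) x →L[ℝ] E x => A v) h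

theorem covariantDerivative_zero (x : M) : D (0 : smoothSections n F E).1 x = 0 :=
  congrFun D.zero x

theorem covariantDerivative_sum {ι : Type*} (S : Finset ι) (s : ι → smoothSections n F E) (x : M) :
    D (∑ i ∈ S, s i).1 x = ∑ i ∈ S, D (s i).1 x := by
  classical
  induction S using Finset.induction_on with
  | empty => exact covariantDerivative_zero x
  | insert i S hi ih => rw [Finset.sum_insert hi, Finset.sum_insert hi, covariantDerivative_add, ih]

/-- The real `L²` product of the double commutator identity. -/
theorem IsGeneralizedLaplacian.inner_double_commutator (hP : IsGeneralizedLaplacian P)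
    (f : C^∞⟮𝓡 n, M; ℝ⟯) (s : smoothSections n F E) (x : M) :
    inner ℝ (s.1 x) ((P (funSmul (f * f) s)).1 x)
      - 2 * inner ℝ ((funSmul f s).1 x) ((P (funSmul f s)).1 x)
      + inner ℝ ((funSmul (f * f) s).1 x) ((P s).1 x)
      = -2 * (‖mvfderiv (𝓡 n) f x‖ ^ 2 * ‖s.1 x‖ ^ 2) := by
  have h := congrArg (fun v : E x => (inner ℝ (s.1 x) v : ℝ)) (hP f s x)
  simp only [inner_add_right, inner_sub_right, real_inner_smul_right,
    real_inner_self_eq_norm_sq, funSmul_funSmul] at h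
  have e : (f * f) x = f x * f x := rfl
  simp only [funSmul_apply, real_inner_smul_left, e]
  linear_combination h

/-- The pointwise energy of a section in a frame. -/
def frameEnergy [IsSmoothHermitian n F E] {ι : Type*} [Fintype ι] (e : ι → smoothSections n F E)
    (s : smoothSections n F E) (x : M) : ℝ :=
  ∑ j, ‖mvfderiv (𝓡 n) (reInner (e j) s) x‖ ^ 2

theorem frameEnergy_nonneg [IsSmoothHermitian n F E] {ι : Type*} [Fintype ι]
    (e : ι → smoothSections n F E) (s : smoothSections n F E) (x : M) : 0 ≤ frameEnergy e s x :=
  Finset.sum_nonneg fun _ _ => by positivity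

theorem mvfderiv_eq_zero_of_notMem_tsupport {f : M → ℝ} {x : M} (hx : x ∉ tsupport f) :
    mvfderiv (𝓡 n) f x = 0 := by
  have h : f =ᶠ[𝓝 x] fun _ => 0 := notMem_tsupport_iff_eventuallyEq.1 hx
  have h2 : mfderiv (𝓡 n) 𝓘(ℝ, ℝ) f x = mfderiv (𝓡 n) 𝓘(ℝ, ℝ) (fun _ => (0 : ℝ)) x :=
    h.mfderiv_eq
  have h3 : mvfderiv (𝓡 n) f x = mvfderiv (𝓡 n) (fun _ => (0 : ℝ)) x := by
    ext v
    exact congrArg (fun A : TangentSpace (𝓡 n) x →L[ℝ] ℝ => A v) h2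
  rw [h3, mvfderiv_const]

variable [IsManifold (𝓡 n) ∞ M] [T2Space M] [ContMDiffVectorBundle ∞ F E (𝓡 n)]
  [IsSmoothHermitian n F E] {ι : Type*} [Fintype ι] [DecidableEq ι]
  {e : ι → smoothSections n F E} {C : ℝ}

/-- The section `σ` is supported in the closed set `S`, on which `e` is a controlled frame. -/
structure IsFramedOn (P : smoothSections n F E →ₗ[ℂ] smoothSections n F E)
    (D : CovariantDerivative (𝓡 n) F E) (e : ι → smoothSections n F E) (C : ℝ) (S : Set M)
    (σ : smoothSections n F E) : Prop where
  isClosed : IsClosed S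
  frame : ∀ x ∈ S, IsControlledFrameAt P D e C x
  eq_zero : ∀ x, x ∉ S → σ.1 x = 0

variable {S : Set M} {σ : smoothSections n F E}

theorem IsFramedOn.eq_sum (h : IsFramedOn P D e C S σ) : σ = ∑ j, funSmul (reInner (e j) σ) (e j) := by
  ext x
  rw [smoothSections_sum_apply]
  by_cases hx : x ∈ S
  · exact (h.frame x hx).ortho.eq_sum _
  · simp [h.eq_zero x hx]

theorem IsFramedOn.mvfderiv_eq_zero (h : IsFramedOn P D e C S σ) {x : M} (hx : x ∉ S) (j : ι) :
    mvfderiv (𝓡 n) (reInner (e j) σ) x = 0 := by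
  refine mvfderiv_eq_zero_of_notMem_tsupport fun h2 => hx ?_
  refine h.isClosed.closure_subset_iff.2 (fun y hy => ?_) h2
  by_contra h3
  exact hy (by simp [h.eq_zero y h3])

theorem IsFramedOn.abs_coeff_le (h : IsFramedOn P D e C S σ) (x : M) (j : ι) :
    |reInner (e j) σ x| ≤ ‖σ.1 x‖ := by
  by_cases hx : x ∈ S
  · refine (abs_real_inner_le_norm ((e j).1 x) (σ.1 x)).trans ?_
    rw [(h.frame x hx).ortho.norm_eq, one_mul]
  · simp [h.eq_zero x hx]

theorem IsFramedOn.frameEnergy_eq (h : IsFramedOn P D e C S σ) (x : M) :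
    frameEnergy e σ x = ∑ j, ‖mvfderiv (𝓡 n) (reInner (e j) σ) x‖ ^ 2 * ‖(e j).1 x‖ ^ 2 := by
  refine Finset.sum_congr rfl fun j _ => ?_
  by_cases hx : x ∈ S
  · rw [(h.frame x hx).ortho.norm_eq, one_pow, mul_one]
  · rw [h.mvfderiv_eq_zero hx, ContinuousLinearMap.opNorm_zero]
    simp

theorem IsFramedOn.covariantDerivative_eq (h : IsFramedOn P D e C S σ) (x : M)
    (v : TangentSpace (𝓡 n) x) : D σ.1 x v = ∑ j, reInner (e j) σ x • D (e j).1 x v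
      + ∑ j, (mvfderiv (𝓡 n) (reInner (e j) σ) x v) • (e j).1 x := by
  conv_lhs => rw [h.eq_sum]
  rw [covariantDerivative_sum, _root_.sum_apply, ← Finset.sum_add_distrib]
  exact Finset.sum_congr rfl fun j _ => covariantDerivative_funSmul _ _ _ _

theorem IsFramedOn.norm_sum_coeff_le (h : IsFramedOn P D e C S σ) (x : M)
    (v : TangentSpace (𝓡 n) x) : ‖∑ j, reInner (e j) σ x • D (e j).1 x v‖
      ≤ C * Fintype.card ι * ‖σ.1 x‖ * ‖v‖ := by
  refine (norm_sum_le _ _).trans ?_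
  have h1 : ∀ j ∈ Finset.univ, ‖reInner (e j) σ x • D (e j).1 x v‖ ≤ C * ‖σ.1 x‖ * ‖v‖ := by
    intro j _
    by_cases hx : x ∈ S
    · rw [norm_smul, Real.norm_eq_abs]
      have h2 := ContinuousLinearMap.le_of_opNorm_le _ ((h.frame x hx).gradient_le j) v
      calc _ ≤ ‖σ.1 x‖ * (C * ‖v‖) :=
            mul_le_mul (h.abs_coeff_le x j) h2 (norm_nonneg _) (norm_nonneg _)
        _ = _ := by ring
    · simp [h.eq_zero x hx]
  refine (Finset.sum_le_card_nsmul _ _ _ h1).trans (le_of_eq ?_)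
  rw [nsmul_eq_mul, Finset.card_univ]
  ring

/-- In the frame `D σ = ∑ dσ_j e_j + ∑ σ_j D e_j`. Orthonormality gives the first sum norm at most
the square root of the energy, with constant exactly `1`; this sharp constant is essential for the
comparison with `∂_u`. -/
theorem IsFramedOn.norm_covariantDerivative_le (h : IsFramedOn P D e C S σ) (hC : 0 ≤ C) (x : M) :
    ‖D σ.1 x‖ ≤ √(frameEnergy e σ x) + C * Fintype.card ι * ‖σ.1 x‖ := by
  refine ContinuousLinearMap.opNorm_le_bound _ (by positivity) fun v => ?_
  rw [h.covariantDerivative_eq, add_comm, add_mul]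
  refine (norm_add_le _ _).trans (add_le_add ?_ (h.norm_sum_coeff_le x v))
  by_cases hx : x ∈ S
  · refine le_of_sq_le_sq ?_ (by positivity)
    rw [mul_pow, Real.sq_sqrt (frameEnergy_nonneg _ _ _), (h.frame x hx).ortho.norm_sq_eq,
      frameEnergy, Finset.sum_mul]
    refine Finset.sum_le_sum fun j _ => ?_
    rw [inner_sum, Finset.sum_eq_single j, real_inner_smul_right, (h.frame x hx).ortho.inner_eq,
      if_pos rfl, mul_one, ← mul_pow]
    · refine sq_le_sq' ?_ ?_
      · exact neg_le_of_abs_le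
          (ContinuousLinearMap.le_opNorm (mvfderiv (𝓡 n) (reInner (e j) σ) x) v)
      · exact (le_abs_self _).trans
          (ContinuousLinearMap.le_opNorm (mvfderiv (𝓡 n) (reInner (e j) σ) x) v)
    · intro k _ hk
      rw [real_inner_smul_right, (h.frame x hx).ortho.inner_eq, if_neg (Ne.symm hk), mul_zero]
    · exact fun hj => absurd (Finset.mem_univ j) hj
  · have h1 : ∑ j, (mvfderiv (𝓡 n) (reInner (e j) σ) x v) • (e j).1 x = 0 :=
      Finset.sum_eq_zero fun j _ => by
        rw [h.mvfderiv_eq_zero hx]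
        exact zero_smul _ _
    rw [h1, norm_zero]
    positivity

theorem IsFramedOn.norm_mvfderiv_le (h : IsFramedOn P D e C S σ) (hC : 0 ≤ C) (x : M) (j : ι) :
    ‖mvfderiv (𝓡 n) (reInner (e j) σ) x‖ ≤ ‖D σ.1 x‖ + C * Fintype.card ι * ‖σ.1 x‖ := by
  have h0 : 0 ≤ ‖D σ.1 x‖ := ContinuousLinearMap.opNorm_nonneg _
  refine ContinuousLinearMap.opNorm_le_bound _ (by positivity) fun v => ?_
  by_cases hx : x ∈ S
  · have h1 : mvfderiv (𝓡 n) (reInner (e j) σ) x v = inner ℝ ((e j).1 x)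
        (∑ k, (mvfderiv (𝓡 n) (reInner (e k) σ) x v) • (e k).1 x) := by
      rw [inner_sum, Finset.sum_eq_single j, real_inner_smul_right, (h.frame x hx).ortho.inner_eq,
        if_pos rfl, mul_one]
      · intro k _ hk
        rw [real_inner_smul_right, (h.frame x hx).ortho.inner_eq, if_neg (Ne.symm hk), mul_zero]
      · exact fun hj => absurd (Finset.mem_univ j) hj
    rw [h1, Real.norm_eq_abs]
    refine (abs_real_inner_le_norm _ _).trans ?_
    rw [(h.frame x hx).ortho.norm_eq, one_mul]
    have h2 := h.covariantDerivative_eq x v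
    rw [← sub_eq_iff_eq_add'.2 h2, add_mul]
    exact (norm_sub_le _ _).trans (add_le_add (ContinuousLinearMap.le_opNorm _ _)
      (h.norm_sum_coeff_le x v))
  · rw [h.mvfderiv_eq_zero hx, _root_.zero_apply, norm_zero]
    positivity

variable [MeasurableSpace M] [BorelSpace M]
  [IsContinuousRiemannianBundle (EuclideanSpace ℝ (Fin n)) (fun x : M => TangentSpace (𝓡 n) x)]

theorem integrable_inner_real_left {s : smoothSections n F E} (hs : HasCompactSupp s)
    (t : smoothSections n F E) :
    Integrable (fun x => (inner ℝ (s.1 x) (t.1 x) : ℝ)) (riemannianVolume n M) :=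
  (integrable_inner_left hs t).re

theorem integrable_inner_real_right (s : smoothSections n F E) {t : smoothSections n F E}
    (ht : HasCompactSupp t) :
    Integrable (fun x => (inner ℝ (s.1 x) (t.1 x) : ℝ)) (riemannianVolume n M) :=
  (integrable_inner_right s ht).re

theorem integral_inner_real_eq {s t : smoothSections n F E} (h : HasCompactSupp s ∨ HasCompactSupp t) :
    ∫ x, (inner ℝ (s.1 x) (t.1 x) : ℝ) ∂(riemannianVolume n M)
      = (∫ x, (inner ℂ (s.1 x) (t.1 x) : ℂ) ∂(riemannianVolume n M)).re := by
  have h1 : Integrable (fun x => (inner ℂ (s.1 x) (t.1 x) : ℂ)) (riemannianVolume n M) :=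
    h.elim (fun h => integrable_inner_left h t) fun h => integrable_inner_right s h
  exact integral_re h1

theorem integrable_norm_sq {s : smoothSections n F E} (hs : HasCompactSupp s) :
    Integrable (fun x => ‖s.1 x‖ ^ 2) (riemannianVolume n M) :=
  (HasCompactSupp.mem_sqIntegrable hs).2.integrable_sq

variable [SigmaCompactSpace M]

theorem IsFormallySelfAdjoint.integral_inner_real_eq (hS : IsFormallySelfAdjoint P)
    (hP : IsGeneralizedLaplacian P) (s : smoothSections n F E) {t : smoothSections n F E}
    (ht : HasCompactSupp t) :
    ∫ x, (inner ℝ (s.1 x) ((P t).1 x) : ℝ) ∂(riemannianVolume n M)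
      = ∫ x, (inner ℝ (t.1 x) ((P s).1 x) : ℝ) ∂(riemannianVolume n M) := by
  rw [CylEnd.integral_inner_real_eq (Or.inr (hP.hasCompactSupp ht)), ← hS.integral_inner_eq hP s ht,
    ← CylEnd.integral_inner_real_eq (Or.inr ht)]
  exact integral_congr_ae (ae_of_all _ fun x => real_inner_comm _ _)

/-- By the double commutator identity the density is a combination of three pairings of smooth
sections, each with a compactly supported factor. No regularity of the norm of the differential has
to be discussed. -/
theorem IsGeneralizedLaplacian.integrable_energy (hP : IsGeneralizedLaplacian P)
    {f : C^∞⟮𝓡 n, M; ℝ⟯} {s : smoothSections n F E} (hs : HasCompactSupp (funSmul f s)) :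
    Integrable (fun x => ‖mvfderiv (𝓡 n) f x‖ ^ 2 * ‖s.1 x‖ ^ 2) (riemannianVolume n M) := by
  have hs2 : HasCompactSupp (funSmul (f * f) s) := by
    rw [← funSmul_funSmul]
    exact hs.funSmul f
  have h := (((integrable_inner_real_right s (hP.hasCompactSupp hs2)).sub
    ((integrable_inner_real_left hs (P (funSmul f s))).const_mul 2)).add
    (integrable_inner_real_left hs2 (P s))).const_mul (-1 / 2)
  refine h.congr (ae_of_all _ fun x => ?_)
  have h2 := hP.inner_double_commutator f s x
  simp only [Pi.add_apply, Pi.sub_apply]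
  linear_combination (-1 / 2) * h2

/-- After integrating the double commutator identity, symmetry of `P` identifies the two outer
terms, so all terms of first order in `df` disappear. This extracts `|df|²` with constant `1`. -/
theorem IsFormallySelfAdjoint.integral_funSmul (hS : IsFormallySelfAdjoint P)
    (hP : IsGeneralizedLaplacian P)
    {f : C^∞⟮𝓡 n, M; ℝ⟯} {s : smoothSections n F E} (hs : HasCompactSupp (funSmul f s)) :
    ∫ x, (inner ℝ ((funSmul f s).1 x) ((P (funSmul f s)).1 x) : ℝ) ∂(riemannianVolume n M)
      = ∫ x, (inner ℝ ((funSmul (f * f) s).1 x) ((P s).1 x) : ℝ) ∂(riemannianVolume n M)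
        + ∫ x, ‖mvfderiv (𝓡 n) f x‖ ^ 2 * ‖s.1 x‖ ^ 2 ∂(riemannianVolume n M) := by
  have hs2 : HasCompactSupp (funSmul (f * f) s) := by
    rw [← funSmul_funSmul]
    exact hs.funSmul f
  have i1 := integrable_inner_real_right s (hP.hasCompactSupp hs2)
  have i2 := integrable_inner_real_left hs (P (funSmul f s))
  have i3 := integrable_inner_real_left hs2 (P s)
  have h1 := integral_congr_ae (μ := riemannianVolume n M)
    (ae_of_all _ fun x => hP.inner_double_commutator f s x)
  have h2 := integral_add (i1.sub (i2.const_mul 2)) i3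
  simp only [Pi.sub_apply] at h2
  rw [h2, integral_sub i1 (i2.const_mul 2), integral_const_mul, integral_const_mul, hS.integral_inner_real_eq hP s hs2] at h1
  linarith

theorem IsFramedOn.integrable_frameEnergy (h : IsFramedOn P D e C S σ)
    (hP : IsGeneralizedLaplacian P) (hσ : HasCompactSupp σ) :
    Integrable (frameEnergy e σ) (riemannianVolume n M) := by
  rw [funext h.frameEnergy_eq]
  refine integrable_finsetSum _ fun j _ => hP.integrable_energy ?_
  obtain ⟨K, hK, h0⟩ := hσ
  exact HasCompactSupp.funSmul_left hK (fun x hx => by rw [reInner_apply, h0 x hx, inner_zero_right]) _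

/-- Expand `σ = ∑ f_j e_j`. The diagonal terms give the energy exactly, up to `f_j² ⟨e_j, P e_j⟩`,
by `integral_funSmul`. In the off-diagonal terms `⟨e_j, P (f_k e_k)⟩` is the commutator, bounded by
`|df_k|`, plus `f_k ⟨e_j, P e_k⟩`. These remainders are at most linear in the differentials, so an
arbitrarily small part of the energy absorbs them. -/
theorem IsFramedOn.abs_integral_sub_le (h : IsFramedOn P D e C S σ) (hC : 0 ≤ C)
    (hP : IsGeneralizedLaplacian P) (hS : IsFormallySelfAdjoint P) (hσ : HasCompactSupp σ)
    {δ : ℝ} (hδ : 0 < δ) :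
    |∫ x, (inner ℝ (σ.1 x) ((P σ).1 x) : ℝ) ∂(riemannianVolume n M)
      - ∫ x, frameEnergy e σ x ∂(riemannianVolume n M)|
    ≤ δ * ∫ x, frameEnergy e σ x ∂(riemannianVolume n M)
      + (C * Fintype.card ι ^ 2 + C ^ 2 * (Fintype.card ι) ^ 3 / (4 * δ))
        * ∫ x, ‖σ.1 x‖ ^ 2 ∂(riemannianVolume n M) := by
  set r : ℝ := (Fintype.card ι : ℝ) with hr
  set f : ι → C^∞⟮𝓡 n, M; ℝ⟯ := fun j => reInner (e j) σ with hf
  have hfc : ∀ j (t : smoothSections n F E), HasCompactSupp (funSmul (f j) t) := by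
    obtain ⟨K, hK, h0⟩ := hσ
    exact fun j t => HasCompactSupp.funSmul_left hK
      (fun x hx => by rw [hf, reInner_apply, h0 x hx, inner_zero_right]) _
  have hff : ∀ j, funSmul (f j * f j) (e j) = funSmul (f j) (funSmul (f j) (e j)) := fun j =>
    (funSmul_funSmul _ _ _).symm
  -- the remainder
  let Q : ι → ι → M → ℝ := fun j k x => if j = k
    then inner ℝ ((funSmul (f j * f j) (e j)).1 x) ((P (e j)).1 x)
    else inner ℝ ((funSmul (f j) (e j)).1 x) ((P (funSmul (f k) (e k))).1 x)
  have hQi : ∀ j k, Integrable (Q j k) (riemannianVolume n M) := by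
    intro j k
    by_cases hjk : j = k
    · simp only [Q, if_pos hjk]
      rw [hff]
      exact integrable_inner_real_left (hfc j _) _
    · simp only [Q, if_neg hjk]
      exact integrable_inner_real_left (hfc j _) _
  have h1 : ∫ x, (inner ℝ (σ.1 x) ((P σ).1 x) : ℝ) ∂(riemannianVolume n M)
      - ∫ x, frameEnergy e σ x ∂(riemannianVolume n M)
      = ∫ x, ∑ j, ∑ k, Q j k x ∂(riemannianVolume n M) := by
    have h2 : ∀ x, (inner ℝ (σ.1 x) ((P σ).1 x) : ℝ)
        = ∑ j, ∑ k, inner ℝ ((funSmul (f j) (e j)).1 x) ((P (funSmul (f k) (e k))).1 x) := by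
      intro x
      conv_lhs => rw [h.eq_sum]
      rw [map_sum, smoothSections_sum_apply, smoothSections_sum_apply, sum_inner]
      exact Finset.sum_congr rfl fun j _ => inner_sum _ _ _
    have i2 : ∀ j k, Integrable (fun x => (inner ℝ ((funSmul (f j) (e j)).1 x)
        ((P (funSmul (f k) (e k))).1 x) : ℝ)) (riemannianVolume n M) := fun j k =>
      integrable_inner_real_left (hfc j _) _
    simp only [h2, funext h.frameEnergy_eq]
    rw [integral_finsetSum _ fun j _ => integrable_finsetSum _ fun k _ => i2 j k,
      integral_finsetSum _ fun j _ => hP.integrable_energy (hfc j _),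
      integral_finsetSum _ fun j _ => integrable_finsetSum _ fun k _ => hQi j k,
      ← Finset.sum_sub_distrib]
    refine Finset.sum_congr rfl fun j _ => ?_
    rw [integral_finsetSum _ fun k _ => i2 j k, integral_finsetSum _ fun k _ => hQi j k,
      ← Finset.add_sum_erase _ _ (Finset.mem_univ j), ← Finset.add_sum_erase _ _ (Finset.mem_univ j),
      hS.integral_funSmul hP (hfc j _)]
    have h3 : ∀ k ∈ Finset.univ.erase j, ∫ x, Q j k x ∂(riemannianVolume n M)
        = ∫ x, (inner ℝ ((funSmul (f j) (e j)).1 x) ((P (funSmul (f k) (e k))).1 x) : ℝ)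
          ∂(riemannianVolume n M) := by
      intro k hk
      simp only [Q, if_neg (Finset.ne_of_mem_erase hk).symm]
    rw [Finset.sum_congr rfl h3]
    simp only [Q, if_true]
    ring
  have hQb : ∀ j k x, |Q j k x| ≤ C * (|f j x| * |f k x|)
      + C * (|f j x| * ‖mvfderiv (𝓡 n) (f k) x‖) := by
    intro j k x
    have hd : 0 ≤ ‖mvfderiv (𝓡 n) (f k) x‖ := ContinuousLinearMap.opNorm_nonneg _
    by_cases hx : x ∈ S
    swap
    · have h0 : f j x = 0 := by rw [hf, reInner_apply, h.eq_zero x hx, inner_zero_right]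
      have h3 : (f j * f j) x = 0 := by
        change f j x * f j x = 0
        rw [h0, zero_mul]
      have h2 : Q j k x = 0 := by
        simp only [Q, funSmul_apply, h0, h3, zero_smul, inner_zero_left, ite_self]
      rw [h2, abs_zero]
      positivity
    have hfr := h.frame x hx
    by_cases hjk : j = k
    · subst hjk
      simp only [Q, if_true, funSmul_apply, real_inner_smul_left]
      have e3 : (f j * f j) x = f j x * f j x := rfl
      rw [e3, abs_mul, abs_mul]
      have h3 := (abs_real_inner_le_norm ((e j).1 x) ((P (e j)).1 x)).trans
        ((by rw [hfr.ortho.norm_eq, one_mul] :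
          ‖(e j).1 x‖ * ‖(P (e j)).1 x‖ = ‖(P (e j)).1 x‖).trans_le (hfr.norm_le j))
      have h4 : 0 ≤ C * (|f j x| * ‖mvfderiv (𝓡 n) (f j) x‖) := by positivity
      have h5 := mul_le_mul_of_nonneg_left h3 (by positivity : 0 ≤ |f j x| * |f j x|)
      linarith
    · simp only [Q, if_neg hjk, funSmul_apply, real_inner_smul_left]
      have h3 := hfr.commutator_le j k hjk (f k)
      simp only [commutatorFunctional, LinearMap.coe_mk, AddHom.coe_mk, inner_sub_right,
        real_inner_smul_right] at h3
      have h4 := (abs_real_inner_le_norm ((e j).1 x) ((P (e k)).1 x)).trans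
        ((by rw [hfr.ortho.norm_eq, one_mul] :
          ‖(e j).1 x‖ * ‖(P (e k)).1 x‖ = ‖(P (e k)).1 x‖).trans_le (hfr.norm_le k))
      -- Subtracting and adding `f_k ⟨e_j, P e_k⟩` isolates the commutator, to which the frame bound
      -- for `j ≠ k` applies.
      have h5 : |(inner ℝ ((e j).1 x) ((P (funSmul (f k) (e k))).1 x) : ℝ)|
          ≤ C * ‖mvfderiv (𝓡 n) (f k) x‖ + |f k x| * C := by
        have h6 : (inner ℝ ((e j).1 x) ((P (funSmul (f k) (e k))).1 x) : ℝ)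
            = (inner ℝ ((e j).1 x) ((P (funSmul (f k) (e k))).1 x)
              - f k x * inner ℝ ((e j).1 x) ((P (e k)).1 x))
              + f k x * inner ℝ ((e j).1 x) ((P (e k)).1 x) := by ring
        rw [h6]
        refine (abs_add_le _ _).trans (add_le_add h3 ?_)
        rw [abs_mul]
        exact mul_le_mul_of_nonneg_left h4 (abs_nonneg _)
      rw [abs_mul]
      have h7 := mul_le_mul_of_nonneg_left h5 (abs_nonneg (f j x))
      linarith
  have hQs : ∀ x, |∑ j, ∑ k, Q j k x| ≤ δ * frameEnergy e σ x
      + (C * r ^ 2 + C ^ 2 * r ^ 3 / (4 * δ)) * ‖σ.1 x‖ ^ 2 := by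
    intro x
    set a := ‖σ.1 x‖
    set d : ι → ℝ := fun k => ‖mvfderiv (𝓡 n) (f k) x‖
    have hd0 : ∀ k, 0 ≤ d k := fun k => ContinuousLinearMap.opNorm_nonneg _
    have hfa : ∀ j, |f j x| ≤ a := h.abs_coeff_le x
    have ha : 0 ≤ a := norm_nonneg _
    have hb : ∀ j k, |Q j k x| ≤ C * (a * a) + C * (a * d k) := by
      intro j k
      refine (hQb j k x).trans (add_le_add (mul_le_mul_of_nonneg_left ?_ hC)
        (mul_le_mul_of_nonneg_left ?_ hC))
      · exact mul_le_mul (hfa j) (hfa k) (abs_nonneg _) ha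
      · exact mul_le_mul_of_nonneg_right (hfa j) (hd0 k)
    have hb2 : |∑ j, ∑ k, Q j k x| ≤ ∑ j : ι, ∑ k, (C * (a * a) + C * (a * d k)) :=
      (Finset.abs_sum_le_sum_abs _ _).trans (Finset.sum_le_sum fun j _ =>
        (Finset.abs_sum_le_sum_abs _ _).trans (Finset.sum_le_sum fun k _ => hb j k))
    have hb3 : ∑ j : ι, ∑ k, (C * (a * a) + C * (a * d k))
        = C * r ^ 2 * a ^ 2 + ∑ k, r * C * a * d k := by
      rw [Finset.sum_const, Finset.card_univ, nsmul_eq_mul, Finset.sum_add_distrib, Finset.sum_const,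
        Finset.card_univ, nsmul_eq_mul, mul_add, ← hr, Finset.mul_sum]
      congr 1
      · ring
      · exact Finset.sum_congr rfl fun k _ => by ring
    -- Young's inequality with weight `δ`. The factor `r` comes from the sum over `j`; summing over
    -- `k` then yields the power `r ^ 3`.
    have hb4 : ∀ k, r * C * a * d k ≤ δ * d k ^ 2 + C ^ 2 * r ^ 2 / (4 * δ) * a ^ 2 := by
      intro k
      have h3 : δ * d k ^ 2 + C ^ 2 * r ^ 2 / (4 * δ) * a ^ 2 - r * C * a * d k
          = (2 * δ * d k - r * C * a) ^ 2 / (4 * δ) := by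
        field_simp
        ring
      have h4 : 0 ≤ (2 * δ * d k - r * C * a) ^ 2 / (4 * δ) := by positivity
      linarith
    refine hb2.trans ?_
    rw [hb3]
    have hb5 := Finset.sum_le_sum fun k (_ : k ∈ Finset.univ) => hb4 k
    rw [Finset.sum_add_distrib, ← Finset.mul_sum _ _ δ, Finset.sum_const, Finset.card_univ, nsmul_eq_mul,
      ← hr] at hb5
    have hb6 : ∑ k, d k ^ 2 = frameEnergy e σ x := rfl
    rw [hb6] at hb5
    calc _ ≤ _ := add_le_add le_rfl hb5
      _ = _ := by ring
  have i3 := h.integrable_frameEnergy hP hσ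
  have i4 := integrable_norm_sq hσ
  rw [h1, ← integral_const_mul, ← integral_const_mul, ← integral_add (i3.const_mul _) (i4.const_mul _)]
  refine (abs_integral_le_integral_abs).trans (integral_mono_ae ?_ ?_ (ae_of_all _ hQs))
  · exact (integrable_finsetSum _ fun j _ => integrable_finsetSum _ fun k _ => hQi j k).abs
  · exact (i3.const_mul _).add (i4.const_mul _)

end Garding
end
end CylEnd

namespace CylEnd

noncomputable section

/-! ### Global Gårding inequality for a controlled cover. -/

section Cover

attribute [local instance] tangentTotalSpace InnerProductSpace.complexToReal

variable {n : ℕ} {M : Type*} [TopologicalSpace M] [ChartedSpace (EuclideanSpace ℝ (Fin n)) M]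
  [RiemannianBundle (fun x : M => TangentSpace (𝓡 n) x)]
  {F : Type*} [NormedAddCommGroup F] [NormedSpace ℂ F]
  {E : M → Type*} [TopologicalSpace (TotalSpace F E)]
  [∀ x, NormedAddCommGroup (E x)] [∀ x, InnerProductSpace ℂ (E x)]
  [FiberBundle F E] [VectorBundle ℂ F E] [VectorBundle ℝ F E]
  {P : smoothSections n F E →ₗ[ℂ] smoothSections n F E}
  {D : CovariantDerivative (𝓡 n) F E}

/-- A finite quadratic partition of unity with bounded differentials, together with frames on the
supports of its members that are uniformly controlled. -/
structure ControlledCover (P : smoothSections n F E →ₗ[ℂ] smoothSections n F E)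
    (D : CovariantDerivative (𝓡 n) F E) where
  index : Type
  fintype : Fintype index
  χ : index → C^∞⟮𝓡 n, M; ℝ⟯
  rank : index → ℕ
  frame : ∀ i, Fin (rank i) → smoothSections n F E
  bound : ℝ
  bound_nonneg : 0 ≤ bound
  sum_sq : ∀ x, ∑ i, χ i x ^ 2 = 1
  norm_mvfderiv_le : ∀ i x, ‖mvfderiv (𝓡 n) (χ i) x‖ ≤ bound
  controlled : ∀ i, ∀ x ∈ tsupport (χ i), IsControlledFrameAt P D (frame i) bound x

attribute [instance] ControlledCover.fintype

variable [IsManifold (𝓡 n) ∞ M] [T2Space M] [ContMDiffVectorBundle ∞ F E (𝓡 n)]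
  [IsSmoothHermitian n F E]

/-- The energy density of a section with respect to a controlled cover. -/
def ControlledCover.energy (A : ControlledCover P D) (s : smoothSections n F E) (x : M) : ℝ :=
  ∑ i, frameEnergy (A.frame i) (funSmul (A.χ i) s) x

variable (A : ControlledCover P D)

theorem ControlledCover.isFramedOn (i : A.index) (s : smoothSections n F E) :
    IsFramedOn P D (A.frame i) A.bound (tsupport (A.χ i)) (funSmul (A.χ i) s) where
  isClosed := isClosed_tsupport _
  frame := A.controlled i
  eq_zero x hx := by rw [funSmul_apply, image_eq_zero_of_notMem_tsupport hx, zero_smul]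

theorem ControlledCover.energy_nonneg (s : smoothSections n F E) (x : M) : 0 ≤ A.energy s x :=
  Finset.sum_nonneg fun _ _ => frameEnergy_nonneg _ _ _

theorem ControlledCover.abs_χ_le (i : A.index) (x : M) : |A.χ i x| ≤ 1 := by
  rw [← sq_le_one_iff_abs_le_one, ← A.sum_sq x]
  exact Finset.single_le_sum (f := fun i => A.χ i x ^ 2) (fun _ _ => sq_nonneg _) (Finset.mem_univ i)

theorem ControlledCover.norm_funSmul_le (i : A.index) (s : smoothSections n F E) (x : M) :
    ‖(funSmul (A.χ i) s).1 x‖ ≤ ‖s.1 x‖ := by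
  rw [funSmul_apply, norm_smul, Real.norm_eq_abs]
  exact mul_le_of_le_one_left (norm_nonneg _) (A.abs_χ_le i x)

/-- The constant in the pointwise comparison of `D` and the energy density. -/
def ControlledCover.const : ℝ := ∑ i : A.index, (A.bound * A.rank i) + A.bound

theorem ControlledCover.const_nonneg : 0 ≤ A.const :=
  add_nonneg (Finset.sum_nonneg fun _ _ => mul_nonneg A.bound_nonneg (Nat.cast_nonneg _))
    A.bound_nonneg

theorem ControlledCover.bound_mul_rank_add_le (i : A.index) :
    A.bound * A.rank i + A.bound ≤ A.const :=
  add_le_add (Finset.single_le_sum (f := fun i => A.bound * A.rank i)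
    (fun _ _ => mul_nonneg A.bound_nonneg (Nat.cast_nonneg _)) (Finset.mem_univ i)) le_rfl

theorem ControlledCover.norm_mvfderiv_smul_le (i : A.index) (s : smoothSections n F E) (x : M)
    (v : TangentSpace (𝓡 n) x) :
    ‖(mvfderiv (𝓡 n) (A.χ i) x v) • s.1 x‖ ≤ A.bound * ‖s.1 x‖ * ‖v‖ := by
  rw [norm_smul]
  have h2 := ContinuousLinearMap.le_of_opNorm_le _ (A.norm_mvfderiv_le i x) v
  calc _ ≤ A.bound * ‖v‖ * ‖s.1 x‖ := mul_le_mul_of_nonneg_right h2 (norm_nonneg _)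
    _ = _ := by ring

theorem ControlledCover.norm_covariantDerivative_funSmul_le (i : A.index)
    (s : smoothSections n F E) (x : M) :
    ‖D (funSmul (A.χ i) s).1 x‖ ≤ ‖D s.1 x‖ + A.bound * ‖s.1 x‖ := by
  have h0 := A.bound_nonneg
  have hD : 0 ≤ ‖D s.1 x‖ := ContinuousLinearMap.opNorm_nonneg _
  refine ContinuousLinearMap.opNorm_le_bound _ (by positivity) fun v => ?_
  rw [covariantDerivative_funSmul, add_mul]
  refine (norm_add_le _ _).trans (add_le_add ?_ (A.norm_mvfderiv_smul_le i s x v))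
  rw [norm_smul, Real.norm_eq_abs]
  exact (mul_le_of_le_one_left (norm_nonneg _) (A.abs_χ_le i x)).trans
    (ContinuousLinearMap.le_opNorm _ _)

theorem ControlledCover.abs_mul_norm_covariantDerivative_le (i : A.index)
    (s : smoothSections n F E) (x : M) :
    |A.χ i x| * ‖D s.1 x‖ ≤ ‖D (funSmul (A.χ i) s).1 x‖ + A.bound * ‖s.1 x‖ := by
  have h0 := A.bound_nonneg
  have hD : 0 ≤ ‖D (funSmul (A.χ i) s).1 x‖ := ContinuousLinearMap.opNorm_nonneg _
  rcases eq_or_ne (A.χ i x) 0 with hχ | hχ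
  · rw [hχ, abs_zero, zero_mul]
    positivity
  have hχ' : 0 < |A.χ i x| := abs_pos.2 hχ
  rw [← le_div_iff₀' hχ']
  refine ContinuousLinearMap.opNorm_le_bound _ (by positivity) fun v => ?_
  rw [div_mul_eq_mul_div, le_div_iff₀' hχ', ← Real.norm_eq_abs, ← norm_smul,
    ← sub_eq_iff_eq_add.2 (covariantDerivative_funSmul (D := D) (A.χ i) s x v), add_mul]
  exact (norm_sub_le _ _).trans (add_le_add (ContinuousLinearMap.le_opNorm _ _)
    (A.norm_mvfderiv_smul_le i s x v))

/-- Multiplying by `χ_i` and passing to `D (χ_i s)` costs only a zero order term, and summation uses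
`∑ χ_i² = 1`. No overlap constant appears, so the energy keeps a coefficient arbitrarily close to
`1`. -/
theorem ControlledCover.norm_covariantDerivative_sq_le {δ : ℝ} (hδ : 0 < δ)
    (s : smoothSections n F E) (x : M) :
    ‖D s.1 x‖ ^ 2 ≤ (1 + δ) * A.energy s x
      + Fintype.card A.index * ((1 + δ⁻¹) * A.const ^ 2) * ‖s.1 x‖ ^ 2 := by
  have h0 := A.bound_nonneg
  have hc := A.const_nonneg
  have h1 : ∀ i, (A.χ i x) ^ 2 * ‖D s.1 x‖ ^ 2
      ≤ (1 + δ) * frameEnergy (A.frame i) (funSmul (A.χ i) s) x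
        + (1 + δ⁻¹) * A.const ^ 2 * ‖s.1 x‖ ^ 2 := by
    intro i
    set G := frameEnergy (A.frame i) (funSmul (A.χ i) s) x with hG
    have hG0 : 0 ≤ G := frameEnergy_nonneg _ _ _
    have h2 := (A.isFramedOn i s).norm_covariantDerivative_le h0 x
    rw [Fintype.card_fin] at h2
    have h3 := A.abs_mul_norm_covariantDerivative_le i s x
    have h4 : |A.χ i x| * ‖D s.1 x‖ ≤ √G + A.const * ‖s.1 x‖ := by
      have h7 := mul_le_mul_of_nonneg_left (A.norm_funSmul_le i s x)
        (by positivity : 0 ≤ A.bound * A.rank i)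
      have h8 := mul_le_mul_of_nonneg_right (A.bound_mul_rank_add_le i) (norm_nonneg (s.1 x))
      linarith
    have h9 : (A.χ i x) ^ 2 * ‖D s.1 x‖ ^ 2 = (|A.χ i x| * ‖D s.1 x‖) ^ 2 := by
      rw [mul_pow, sq_abs]
    rw [h9]
    have h10 : 0 ≤ |A.χ i x| * ‖D s.1 x‖ :=
      mul_nonneg (abs_nonneg _) (ContinuousLinearMap.opNorm_nonneg _)
    refine (pow_le_pow_left₀ h10 h4 2).trans ?_
    have h11 : √G ^ 2 = G := Real.sq_sqrt hG0
    -- This square gives `(√G + t)² ≤ (1 + δ) G + (1 + δ⁻¹) t²` with `t = A.const * ‖s.1 x‖`.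
    have h12 : 0 ≤ (δ * √G - A.const * ‖s.1 x‖) ^ 2 * δ⁻¹ := by positivity
    have h13 : (δ * √G - A.const * ‖s.1 x‖) ^ 2 * δ⁻¹
        = δ * √G ^ 2 - 2 * √G * (A.const * ‖s.1 x‖) + δ⁻¹ * (A.const * ‖s.1 x‖) ^ 2 := by
      field_simp
      ring
    nlinarith
  have h2 := Finset.sum_le_sum fun i (_ : i ∈ Finset.univ) => h1 i
  rw [← Finset.sum_mul, A.sum_sq, one_mul, Finset.sum_add_distrib, ← Finset.mul_sum,
    Finset.sum_const, Finset.card_univ, nsmul_eq_mul] at h2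
  rw [ControlledCover.energy]
  linarith

/-- The reverse comparison only serves to identify the form domain with the Sobolev space, so any
constant will do. -/
theorem ControlledCover.exists_energy_le : ∃ B : ℝ, 0 ≤ B ∧ ∀ (s : smoothSections n F E) (x : M),
    A.energy s x ≤ B * (‖D s.1 x‖ ^ 2 + ‖s.1 x‖ ^ 2) := by
  have h0 := A.bound_nonneg
  have hc := A.const_nonneg
  refine ⟨∑ i, A.rank i * (2 + 2 * A.const ^ 2), by positivity, fun s x => ?_⟩
  rw [ControlledCover.energy, Finset.sum_mul]
  refine Finset.sum_le_sum fun i _ => ?_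
  have hD : 0 ≤ ‖D s.1 x‖ := ContinuousLinearMap.opNorm_nonneg _
  have h1 : ∀ j, ‖mvfderiv (𝓡 n) (reInner (A.frame i j) (funSmul (A.χ i) s)) x‖ ^ 2
      ≤ (2 + 2 * A.const ^ 2) * (‖D s.1 x‖ ^ 2 + ‖s.1 x‖ ^ 2) := by
    intro j
    have h2 := (A.isFramedOn i s).norm_mvfderiv_le h0 x j
    rw [Fintype.card_fin] at h2
    have h3 := A.norm_covariantDerivative_funSmul_le i s x
    have h7 := mul_le_mul_of_nonneg_left (A.norm_funSmul_le i s x)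
      (by positivity : 0 ≤ A.bound * A.rank i)
    have h8 := mul_le_mul_of_nonneg_right (A.bound_mul_rank_add_le i) (norm_nonneg (s.1 x))
    have h9 : ‖mvfderiv (𝓡 n) (reInner (A.frame i j) (funSmul (A.χ i) s)) x‖
        ≤ ‖D s.1 x‖ + A.const * ‖s.1 x‖ := by linarith
    refine (pow_le_pow_left₀ (ContinuousLinearMap.opNorm_nonneg _) h9 2).trans ?_
    have h10 : 0 ≤ (‖D s.1 x‖ - A.const * ‖s.1 x‖) ^ 2 := sq_nonneg _
    have h11 : 0 ≤ A.const ^ 2 * ‖D s.1 x‖ ^ 2 := by positivity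
    have h12 : 0 ≤ ‖s.1 x‖ ^ 2 := by positivity
    nlinarith
  refine (Finset.sum_le_card_nsmul _ _ _ fun j _ => h1 j).trans (le_of_eq ?_)
  rw [nsmul_eq_mul, Finset.card_univ, Fintype.card_fin, mul_assoc]

/-- The localization formula for the quadratic form of `P`. -/
theorem ControlledCover.inner_eq (hP : IsGeneralizedLaplacian P) (s : smoothSections n F E) (x : M) :
    (inner ℝ (s.1 x) ((P s).1 x) : ℝ)
      = ∑ i, inner ℝ ((funSmul (A.χ i) s).1 x) ((P (funSmul (A.χ i) s)).1 x)
        - ∑ i, ‖mvfderiv (𝓡 n) (A.χ i) x‖ ^ 2 * ‖s.1 x‖ ^ 2 := by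
  have h1 := Finset.sum_congr (rfl : (Finset.univ : Finset A.index) = _)
    fun i _ => hP.inner_double_commutator (A.χ i) s x
  -- Because the squares of the `χ_i` sum to `1`, the outer terms of the summed double commutator
  -- identities both become the density of `s` itself.
  have h2 : ∑ i, funSmul (A.χ i * A.χ i) s = s := by
    ext y
    rw [smoothSections_sum_apply]
    have h3 : ∀ i, (funSmul (A.χ i * A.χ i) s).1 y = (A.χ i y ^ 2) • s.1 y := fun i => by
      rw [pow_two]
      rfl
    simp only [h3]
    rw [← Finset.sum_smul, A.sum_sq, one_smul]
  rw [Finset.sum_add_distrib, Finset.sum_sub_distrib, ← inner_sum, ← sum_inner,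
    ← smoothSections_sum_apply, ← smoothSections_sum_apply, ← map_sum, h2, ← Finset.mul_sum,
    ← Finset.mul_sum] at h1
  linarith

variable [MeasurableSpace M] [BorelSpace M]
  [IsContinuousRiemannianBundle (EuclideanSpace ℝ (Fin n)) (fun x : M => TangentSpace (𝓡 n) x)]
  [SigmaCompactSpace M]

theorem ControlledCover.integrable_energy (hP : IsGeneralizedLaplacian P)
    {s : smoothSections n F E} (hs : HasCompactSupp s) :
    Integrable (A.energy s) (riemannianVolume n M) :=
  integrable_finsetSum _ fun i _ => (A.isFramedOn i s).integrable_frameEnergy hP (hs.funSmul _)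

/-- The localization formula reduces this to the framed sections `χ_i s`; its error `∑ |dχ_i|² |s|²`
is of order zero. Finiteness of the cover and the uniform bounds give a single constant. -/
theorem ControlledCover.exists_abs_integral_sub_le (hP : IsGeneralizedLaplacian P)
    (hS : IsFormallySelfAdjoint P) {δ : ℝ} (hδ : 0 < δ) :
    ∃ B : ℝ, 0 ≤ B ∧ ∀ s : smoothSections n F E, HasCompactSupp s →
      |∫ x, (inner ℝ (s.1 x) ((P s).1 x) : ℝ) ∂(riemannianVolume n M)
        - ∫ x, A.energy s x ∂(riemannianVolume n M)|
      ≤ δ * ∫ x, A.energy s x ∂(riemannianVolume n M)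
        + B * ∫ x, ‖s.1 x‖ ^ 2 ∂(riemannianVolume n M) := by
  have h0 := A.bound_nonneg
  let b : A.index → ℝ := fun i => A.bound * A.rank i ^ 2 + A.bound ^ 2 * (A.rank i) ^ 3 / (4 * δ)
  have hb : ∀ i, 0 ≤ b i := fun i => by positivity
  refine ⟨∑ i, b i + Fintype.card A.index * A.bound ^ 2, by positivity, fun s hs => ?_⟩
  have hc : ∀ i, HasCompactSupp (funSmul (A.χ i) s) := fun i => hs.funSmul _
  have i1 := integrable_norm_sq hs
  have h1 : ∀ i, |∫ x, (inner ℝ ((funSmul (A.χ i) s).1 x) ((P (funSmul (A.χ i) s)).1 x) : ℝ)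
        ∂(riemannianVolume n M)
      - ∫ x, frameEnergy (A.frame i) (funSmul (A.χ i) s) x ∂(riemannianVolume n M)|
      ≤ δ * ∫ x, frameEnergy (A.frame i) (funSmul (A.χ i) s) x ∂(riemannianVolume n M)
        + b i * ∫ x, ‖s.1 x‖ ^ 2 ∂(riemannianVolume n M) := by
    intro i
    have h2 := (A.isFramedOn i s).abs_integral_sub_le h0 hP hS (hc i) hδ
    rw [Fintype.card_fin] at h2
    refine h2.trans (add_le_add le_rfl (mul_le_mul_of_nonneg_left ?_ (hb i)))
    refine integral_mono (integrable_norm_sq (hc i)) i1 fun x => ?_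
    exact pow_le_pow_left₀ (norm_nonneg _) (A.norm_funSmul_le i s x) 2
  have i2 : ∀ i ∈ Finset.univ, Integrable (fun x => ‖mvfderiv (𝓡 n) (A.χ i) x‖ ^ 2 * ‖s.1 x‖ ^ 2)
      (riemannianVolume n M) := fun i _ => hP.integrable_energy (hc i)
  have i3 : ∀ i ∈ Finset.univ, Integrable (fun x => (inner ℝ ((funSmul (A.χ i) s).1 x)
      ((P (funSmul (A.χ i) s)).1 x) : ℝ)) (riemannianVolume n M) := fun i _ =>
    integrable_inner_real_left (hc i) _
  have h3 : ∀ i, |∫ x, ‖mvfderiv (𝓡 n) (A.χ i) x‖ ^ 2 * ‖s.1 x‖ ^ 2 ∂(riemannianVolume n M)|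
      ≤ A.bound ^ 2 * ∫ x, ‖s.1 x‖ ^ 2 ∂(riemannianVolume n M) := by
    intro i
    rw [abs_of_nonneg (integral_nonneg fun x => by positivity), ← integral_const_mul]
    refine integral_mono (i2 i (Finset.mem_univ i)) (i1.const_mul _) fun x => ?_
    exact mul_le_mul_of_nonneg_right
      (pow_le_pow_left₀ (ContinuousLinearMap.opNorm_nonneg _) (A.norm_mvfderiv_le i x) 2)
      (sq_nonneg _)
  have h4 : ∫ x, (inner ℝ (s.1 x) ((P s).1 x) : ℝ) ∂(riemannianVolume n M)
      - ∫ x, A.energy s x ∂(riemannianVolume n M)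
      = ∑ i, (∫ x, (inner ℝ ((funSmul (A.χ i) s).1 x) ((P (funSmul (A.χ i) s)).1 x) : ℝ)
          ∂(riemannianVolume n M)
        - ∫ x, frameEnergy (A.frame i) (funSmul (A.χ i) s) x ∂(riemannianVolume n M))
        - ∑ i, ∫ x, ‖mvfderiv (𝓡 n) (A.χ i) x‖ ^ 2 * ‖s.1 x‖ ^ 2 ∂(riemannianVolume n M) := by
    simp only [A.inner_eq hP s, ControlledCover.energy]
    rw [integral_sub (integrable_finsetSum _ i3) (integrable_finsetSum _ i2), integral_finsetSum _ i3,
      integral_finsetSum _ i2, integral_finsetSum _ fun i _ =>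
        (A.isFramedOn i s).integrable_frameEnergy hP (hc i), Finset.sum_sub_distrib]
    ring
  have h5 : ∫ x, A.energy s x ∂(riemannianVolume n M)
      = ∑ i, ∫ x, frameEnergy (A.frame i) (funSmul (A.χ i) s) x ∂(riemannianVolume n M) :=
    integral_finsetSum _ fun i _ => (A.isFramedOn i s).integrable_frameEnergy hP (hc i)
  rw [h4]
  refine (abs_sub _ _).trans ?_
  have h6 := (Finset.abs_sum_le_sum_abs _ _).trans
    (Finset.sum_le_sum fun i (_ : i ∈ Finset.univ) => h1 i)
  have h7 := (Finset.abs_sum_le_sum_abs _ _).trans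
    (Finset.sum_le_sum fun i (_ : i ∈ Finset.univ) => h3 i)
  rw [Finset.sum_add_distrib, ← Finset.mul_sum, ← Finset.sum_mul, ← h5] at h6
  rw [Finset.sum_const, Finset.card_univ, nsmul_eq_mul] at h7
  linarith

end Cover
end
end CylEnd

namespace CylEnd

noncomputable section

attribute [local instance] tangentTotalSpace

/-! ### Geometry of the cylindrical end. -/

section EndGeometry

variable {m : ℕ}
  {Z : Type*} [TopologicalSpace Z] [ChartedSpace (EuclideanSpace ℝ (Fin (m + 1))) Z]
  [RiemannianBundle (fun z : Z => TangentSpace (𝓡 (m + 1)) z)]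
  {Y : Type*} [TopologicalSpace Y] [ChartedSpace (EuclideanSpace ℝ (Fin m)) Y]
  [RiemannianBundle (fun y : Y => TangentSpace (𝓡 m) y)]
  (C : CylindricalEnd m Z Y)

theorem CylindricalEnd.mem_source {y : Y} {u : ℝ} : (y, u) ∈ C.chart.source ↔ -C.ε < u := by
  rw [C.source_eq]
  rfl

theorem CylindricalEnd.mem_source_of_nonneg (y : Y) {u : ℝ} (hu : 0 ≤ u) :
    (y, u) ∈ C.chart.source :=
  C.mem_source.2 ((neg_lt_zero.2 C.ε_pos).trans_le hu)

theorem CylindricalEnd.contMDiffAt {p : Y × ℝ} (hp : p ∈ C.chart.source) :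
    ContMDiffAt ((𝓡 m).prod 𝓘(ℝ, ℝ)) (𝓡 (m + 1)) ∞ C.chart p :=
  C.contMDiffOn.contMDiffAt (C.chart.open_source.mem_nhds hp)

theorem CylindricalEnd.contMDiffAt_symm {z : Z} (hz : z ∈ C.chart.target) :
    ContMDiffAt (𝓡 (m + 1)) ((𝓡 m).prod 𝓘(ℝ, ℝ)) ∞ C.chart.symm z :=
  C.contMDiffOn_symm.contMDiffAt (C.chart.open_target.mem_nhds hz)

theorem CylindricalEnd.mdifferentiable :
    C.chart.MDifferentiable ((𝓡 m).prod 𝓘(ℝ, ℝ)) (𝓡 (m + 1)) :=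
  ⟨C.contMDiffOn.mdifferentiableOn (by simp), C.contMDiffOn_symm.mdifferentiableOn (by simp)⟩

variable [IsManifold (𝓡 (m + 1)) ∞ Z] [IsManifold (𝓡 m) ∞ Y]

/-- The differential of the chart of the end is surjective. -/
theorem CylindricalEnd.exists_mfderiv_eq {y : Y} {u : ℝ} (hu : -C.ε < u)
    (w : TangentSpace (𝓡 (m + 1)) (C.chart (y, u))) :
    ∃ (v : TangentSpace (𝓡 m) y) (r : ℝ),
      mfderiv ((𝓡 m).prod 𝓘(ℝ, ℝ)) (𝓡 (m + 1)) C.chart (y, u) (v, r) = w ∧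
      mfderiv (𝓡 (m + 1)) ((𝓡 m).prod 𝓘(ℝ, ℝ)) C.chart.symm (C.chart (y, u)) w = (v, r) ∧
      ‖v‖ ≤ ‖w‖ ∧ |r| ≤ ‖w‖ := by
  have hp : (y, u) ∈ C.chart.source := C.mem_source.2 hu
  have : IsManifold (𝓡 (m + 1)) 1 Z := IsManifold.of_le (n := ∞) (by simp)
  have : IsManifold (𝓡 m) 1 Y := IsManifold.of_le (n := ∞) (by simp)
  obtain ⟨⟨v, r⟩, hvr⟩ := C.mdifferentiable.mfderiv_surjective hp w
  refine ⟨v, r, hvr, ?_, ?_⟩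
  · rw [← hvr]
    exact congrArg (fun A : TangentSpace ((𝓡 m).prod 𝓘(ℝ, ℝ)) (y, u) →L[ℝ]
      TangentSpace ((𝓡 m).prod 𝓘(ℝ, ℝ)) (y, u) => A (v, r)) (C.mdifferentiable.symm_comp_deriv hp)
  · have h := C.isometric y u hu v r
    rw [hvr] at h
    constructor
    · refine le_of_sq_le_sq ?_ (norm_nonneg _)
      nlinarith [sq_nonneg r]
    · refine le_of_sq_le_sq ?_ (norm_nonneg _)
      rw [sq_abs]
      nlinarith [sq_nonneg ‖v‖]

theorem CylindricalEnd.norm_mfderiv_left {y : Y} {u : ℝ} (hu : -C.ε < u)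
    (v : TangentSpace (𝓡 m) y) :
    ‖mfderiv ((𝓡 m).prod 𝓘(ℝ, ℝ)) (𝓡 (m + 1)) C.chart (y, u) (v, (0 : ℝ))‖ = ‖v‖ := by
  have h := C.isometric y u hu v 0
  rw [zero_pow two_ne_zero, add_zero] at h
  exact (sq_eq_sq₀ (norm_nonneg _) (norm_nonneg _)).1 h

theorem CylindricalEnd.norm_mfderiv_right {y : Y} {u : ℝ} (hu : -C.ε < u) :
    ‖mfderiv ((𝓡 m).prod 𝓘(ℝ, ℝ)) (𝓡 (m + 1)) C.chart (y, u)
      ((0 : TangentSpace (𝓡 m) y), (1 : ℝ))‖ = 1 := by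
  have h := C.isometric y u hu 0 1
  rw [norm_zero, zero_pow two_ne_zero, zero_add, one_pow] at h
  exact (pow_eq_one_iff_of_nonneg (norm_nonneg _) two_ne_zero).1 h

theorem CylindricalEnd.isCompact_image [CompactSpace Y] {a b : ℝ} (ha : -C.ε < a) :
    IsCompact (C.chart '' {p | p.2 ∈ Set.Icc a b}) := by
  have h1 : {p : Y × ℝ | p.2 ∈ Set.Icc a b} = Set.univ ×ˢ Set.Icc a b := by
    ext p
    simp
  rw [h1]
  refine (isCompact_univ.prod isCompact_Icc).image_of_continuousOn
    (C.chart.continuousOn.mono fun p hp => ?_)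
  rw [C.source_eq]
  exact ha.trans_le hp.2.1

/-- The end is closed at infinity: this uses that the coordinate `u` changes at most by the length
along a path. -/
theorem CylindricalEnd.isClosed_image [T2Space Z] [CompactSpace Y]
    [IsContinuousRiemannianBundle (EuclideanSpace ℝ (Fin (m + 1)))
      (fun z : Z => TangentSpace (𝓡 (m + 1)) z)] {a : ℝ} (ha : 0 ≤ a) :
    IsClosed (C.chart '' {p | a ≤ p.2}) := by
  have : IsManifold (𝓡 (m + 1)) 1 Z := IsManifold.of_le (n := ∞) (by simp)
  have hε := C.ε_pos
  refine isClosed_of_closure_subset fun z hz => ?_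
  -- it suffices to show that `z` is in the target
  suffices hzt : z ∈ C.chart.target by
    refine ⟨C.chart.symm z, ?_, C.chart.right_inv hzt⟩
    have h1 : ContinuousAt (fun w => (C.chart.symm w).2) z :=
      continuous_snd.continuousAt.comp (C.chart.symm.continuousAt hzt)
    have h2 : (𝓝[C.chart '' {p | a ≤ p.2}] z).NeBot := mem_closure_iff_nhdsWithin_neBot.1 hz
    refine ge_of_tendsto (h1.tendsto.mono_left (nhdsWithin_le_nhds
      (s := C.chart '' {p | a ≤ p.2}))) ?_
    filter_upwards [self_mem_nhdsWithin] with w hw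
    obtain ⟨⟨y, u⟩, hp, rfl⟩ := hw
    have hp' : a ≤ u := hp
    rw [C.chart.left_inv (C.mem_source.2 (by linarith))]
    exact hp'
  set e := extChartAt (𝓡 (m + 1)) z with he
  obtain ⟨L, hL, hLe⟩ := exists_norm_mfderiv_extChartAt_symm_le (n := m + 1) z
  have hezt : e z ∈ e.target := mem_extChartAt_target (I := 𝓡 (m + 1)) z
  have htgt : IsOpen e.target := isOpen_extChartAt_target (I := 𝓡 (m + 1)) z
  have hsc : ContinuousAt e.symm (e z) := continuousAt_extChartAt_symm (I := 𝓡 (m + 1)) z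
  have hes : e.symm (e z) = z := e.left_inv (mem_extChartAt_source (I := 𝓡 (m + 1)) z)
  have hev : ∀ᶠ q in 𝓝 (e z), q ∈ e.target ∧ ∀ v : EuclideanSpace ℝ (Fin (m + 1)),
      @norm (TangentSpace (𝓡 (m + 1)) (e.symm q)) _ (mfderiv 𝓘(ℝ, EuclideanSpace ℝ (Fin (m + 1)))
        (𝓡 (m + 1)) e.symm q v) ≤ L * ‖v‖ := by
    have h1 : Tendsto e.symm (𝓝 (e z)) (𝓝 z) := by
      have := hsc.tendsto
      rwa [hes] at this
    filter_upwards [htgt.mem_nhds hezt, h1.eventually hLe] with q hq1 hq2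
    refine ⟨hq1, fun v => ?_⟩
    have h3 : ∀ q', q' = q → @norm (TangentSpace (𝓡 (m + 1)) (e.symm q')) _
        (mfderiv 𝓘(ℝ, EuclideanSpace ℝ (Fin (m + 1))) (𝓡 (m + 1)) e.symm q' v) ≤ L * ‖v‖ →
        @norm (TangentSpace (𝓡 (m + 1)) (e.symm q)) _
        (mfderiv 𝓘(ℝ, EuclideanSpace ℝ (Fin (m + 1))) (𝓡 (m + 1)) e.symm q v) ≤ L * ‖v‖ := by
      rintro _ rfl h
      exact h
    exact h3 _ (e.right_inv hq1) (hq2 v)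
  obtain ⟨ρ, hρ, hball⟩ := Metric.eventually_nhds_iff_ball.1 hev
  -- Here `L * ρ` bounds the length of a segment in the chart ball, measured in the metric of `Z`.
  -- The extra `1` absorbs the first order Taylor error in the continuity argument.
  set U : ℝ := L * ρ + 1 with hU
  have hU0 : 0 < U := by positivity
  have hsplit : C.chart '' {p | a ≤ p.2} ⊆
      C.chart '' {p | p.2 ∈ Set.Icc a U} ∪ C.chart '' {p | U < p.2} := by
    rintro _ ⟨p, hp, rfl⟩
    rcases le_or_gt p.2 U with h | h
    · exact Or.inl ⟨p, ⟨hp, h⟩, rfl⟩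
    · exact Or.inr ⟨p, h, rfl⟩
  have hz2 := closure_mono hsplit hz
  rw [closure_union, (C.isCompact_image (by linarith)).isClosed.closure_eq] at hz2
  rcases hz2 with ⟨p, hp, rfl⟩ | hz2
  · exact C.chart.map_source (C.mem_source_of_nonneg p.1 (ha.trans hp.1))
  -- a point of the end near `z`, far away
  have hnear : ∀ᶠ w in 𝓝 z, w ∈ e.source ∧ e w ∈ Metric.ball (e z) ρ := by
    filter_upwards [extChartAt_source_mem_nhds (I := 𝓡 (m + 1)) z,
      (continuousAt_extChartAt (I := 𝓡 (m + 1)) z).eventually (Metric.ball_mem_nhds _ hρ)]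
      with w h1 h2 using ⟨h1, h2⟩
  obtain ⟨_, ⟨hws, hwb⟩, ⟨⟨y₁, u₁⟩, hu₁, rfl⟩⟩ := mem_closure_iff_nhds.1 hz2 _ hnear
  have hu₁' : U < u₁ := hu₁
  have hp₁ : (y₁, u₁) ∈ C.chart.source := C.mem_source.2 (by linarith)
  set q₁ := e (C.chart (y₁, u₁)) with hq₁
  set d := e z - q₁ with hd
  have hdn : ‖d‖ < ρ := by
    rw [hd, ← dist_eq_norm, dist_comm]
    exact hwb
  have hline : ∀ t ∈ Set.Icc (0 : ℝ) 1, q₁ + t • d ∈ Metric.ball (e z) ρ := by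
    intro t ht
    have := (convex_ball (e z) ρ).add_smul_sub_mem hwb (Metric.mem_ball_self hρ) ht
    simpa [hd] using this
  -- The segment in the chart at `z` from the far point of the end to `z`. If `z` were not in the
  -- end, the coordinate `u` would have to change from `u₁ > U` along a path of length at most `L *
  -- ρ`.
  let γ : ℝ → Z := fun t => e.symm (q₁ + t • d)
  have hγc : ∀ t ∈ Set.Icc (0 : ℝ) 1, ContinuousAt γ t := by
    intro t ht
    have h1 := (hball _ (hline t ht)).1
    have h2 : ContinuousAt e.symm (q₁ + t • d) :=
      (continuousOn_extChartAt_symm (I := 𝓡 (m + 1)) z).continuousAt (htgt.mem_nhds h1)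
    exact ContinuousAt.comp (f := fun t : ℝ => q₁ + t • d) h2 (by fun_prop)
  let h : ℝ → ℝ := fun t => (C.chart.symm (γ t)).2
  -- Since the end is isometric to a product, `du` has norm at most `1`; the derivative of `u` along
  -- `γ` is thus bounded by the speed.
  have hder : ∀ t ∈ Set.Icc (0 : ℝ) 1, γ t ∈ C.chart.target → ∃ h', |h'| ≤ L * ρ ∧ HasDerivAt h h' t := by
    intro t ht hγt
    obtain ⟨h1, h2⟩ := hball _ (hline t ht)
    have d1 : HasDerivAt (fun t : ℝ => q₁ + t • d) d t := by
      simpa using ((hasDerivAt_id t).smul_const d).const_add q₁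
    have m1 : MDifferentiableAt 𝓘(ℝ, EuclideanSpace ℝ (Fin (m + 1))) (𝓡 (m + 1)) e.symm (q₁ + t • d) :=
      mdifferentiableAt_extChartAt_symm (n := m + 1) z h1
    have m2 : MDifferentiableAt (𝓡 (m + 1)) ((𝓡 m).prod 𝓘(ℝ, ℝ)) C.chart.symm (e.symm (q₁ + t • d)) :=
      (C.contMDiffAt_symm hγt).mdifferentiableAt (by simp)
    have m3 := mdifferentiableAt_snd (I := 𝓡 m) (I' := 𝓘(ℝ, ℝ))
      (x := C.chart.symm (e.symm (q₁ + t • d)))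
    have m4 := HasMFDerivAt.comp (g := Prod.snd) (f := C.chart.symm ∘ e.symm) (q₁ + t • d)
      m3.hasMFDerivAt (m2.hasMFDerivAt.comp _ m1.hasMFDerivAt)
    have d2 := m4.hasFDerivAt.comp_hasDerivAt t d1
    refine ⟨_, ?_, d2⟩
    obtain ⟨⟨y, u⟩, hsrc, hyu⟩ : ∃ p ∈ C.chart.source, C.chart p = γ t :=
      ⟨_, C.chart.map_target hγt, C.chart.right_inv hγt⟩
    have key : ∀ z' : Z, C.chart (y, u) = z' → ∀ w : TangentSpace (𝓡 (m + 1)) z',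
        |(mfderiv (𝓡 (m + 1)) ((𝓡 m).prod 𝓘(ℝ, ℝ)) C.chart.symm z' w :
          EuclideanSpace ℝ (Fin m) × ℝ).2| ≤ ‖w‖ := by
      rintro _ rfl w
      obtain ⟨v, r, -, h5, -, h6⟩ := C.exists_mfderiv_eq (C.mem_source.1 hsrc) w
      rw [h5]
      exact h6
    rw [mfderiv_snd]
    refine (key _ hyu (mfderiv 𝓘(ℝ, EuclideanSpace ℝ (Fin (m + 1))) (𝓡 (m + 1)) e.symm
      (q₁ + t • d) d)).trans ((h2 d).trans ?_)
    exact mul_le_mul_of_nonneg_left hdn.le hL.le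
  have hγ0 : γ 0 = C.chart (y₁, u₁) := by
    simp only [γ, zero_smul, add_zero]
    exact e.left_inv hws
  have hγ1 : γ 1 = z := by
    simp only [γ, one_smul, hd, add_sub_cancel]
    exact hes
  have hQ := C.isCompact_image (a := u₁ - U) (b := u₁ + U) (by linarith)
  set Q := C.chart '' {p | p.2 ∈ Set.Icc (u₁ - U) (u₁ + U)} with hQdef
  have hQt : Q ⊆ C.chart.target := by
    rintro _ ⟨p, hp, rfl⟩
    exact C.chart.map_source (C.mem_source.2 (by linarith [hp.1]))
  -- Continuity argument: this set is closed in `[0, 1]`, contains `0` and can always be continued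
  -- to the right, so it contains `1`. Compactness of the slab `Q` over `[u₁ - U, u₁ + U]`, which
  -- lies in the end because `U < u₁`, provides the closedness.
  let S : Set ℝ := {t | γ t ∈ Q ∧ |h t - u₁| ≤ U * t}
  have hS : IsClosed (S ∩ Set.Icc 0 1) := by
    have hγcont : ContinuousOn γ (Set.Icc 0 1) := fun t ht => (hγc t ht).continuousWithinAt
    have h1 : IsClosed (Set.Icc (0 : ℝ) 1 ∩ γ ⁻¹' Q) :=
      hγcont.preimage_isClosed_of_isClosed isClosed_Icc hQ.isClosed
    have h2 : ContinuousOn (fun t => U * t - |h t - u₁|) (Set.Icc (0 : ℝ) 1 ∩ γ ⁻¹' Q) := by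
      intro t ht
      obtain ⟨h', -, h3⟩ := hder t ht.1 (hQt ht.2)
      exact ((continuousAt_const.mul continuousAt_id).sub
        (h3.continuousAt.sub continuousAt_const).abs).continuousWithinAt
    have h3 := h2.preimage_isClosed_of_isClosed h1 (isClosed_Ici (a := (0 : ℝ)))
    convert h3 using 1
    ext t
    simp only [S, Set.mem_inter_iff, Set.mem_ofPred_eq, Set.mem_preimage, Set.mem_Ici, sub_nonneg]
    tauto
  have hS0 : (0 : ℝ) ∈ S := by
    refine ⟨?_, ?_⟩
    · rw [hγ0]
      exact ⟨_, ⟨by simp only; linarith, by simp only; linarith⟩, rfl⟩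
    · simp only [h, hγ0]
      rw [C.chart.left_inv hp₁]
      simp
  have hall := hS.Icc_subset_of_forall_exists_gt hS0 fun t ht t₁ ht₁ => by
    obtain ⟨⟨htQ, hth⟩, ht0, ht1⟩ := ht
    obtain ⟨h', hh', hd'⟩ := hder t ⟨ht0, ht1.le⟩ (hQt htQ)
    have hev1 : ∀ᶠ s in 𝓝 t, |h s - h t| ≤ U * |s - t| := by
      filter_upwards [(hasDerivAt_iff_isLittleO.1 hd').def one_pos] with s hs
      rw [one_mul, Real.norm_eq_abs, Real.norm_eq_abs, smul_eq_mul] at hs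
      have h5 : |(s - t) * h'| ≤ |s - t| * (L * ρ) := by
        rw [abs_mul]
        exact mul_le_mul_of_nonneg_left hh' (abs_nonneg _)
      have h6 := abs_add_le (h s - h t - (s - t) * h') ((s - t) * h')
      rw [sub_add_cancel] at h6
      rw [hU, add_mul, one_mul]
      linarith
    have hev2 : ∀ᶠ s in 𝓝 t, γ s ∈ C.chart.target :=
      (hγc t ⟨ht0, ht1.le⟩).eventually (C.chart.open_target.mem_nhds (hQt htQ))
    have hev3 : ∀ᶠ s in 𝓝[>] t, s ∈ Set.Ioc t (min t₁ 1) :=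
      Ioc_mem_nhdsGT (lt_min ht₁ ht1)
    obtain ⟨s, ⟨hs1, hs2⟩, hs3⟩ := ((hev1.and hev2).filter_mono nhdsWithin_le_nhds |>.and hev3).exists
    have hs4 : |h s - u₁| ≤ U * s := by
      have h5 := abs_add_le (h s - h t) (h t - u₁)
      rw [sub_add_sub_cancel] at h5
      rw [abs_of_pos (sub_pos.2 hs3.1)] at hs1
      nlinarith
    refine ⟨s, ⟨⟨_, ?_, C.chart.right_inv hs2⟩, hs4⟩, hs3.1, hs3.2.trans (min_le_left _ _)⟩
    have hs5 : s ≤ 1 := hs3.2.trans (min_le_right _ _)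
    have hs6 : |h s - u₁| ≤ U := hs4.trans (mul_le_of_le_one_right hU0.le hs5)
    have hs7 := abs_le.1 hs6
    exact ⟨by change u₁ - U ≤ h s; linarith, by change h s ≤ u₁ + U; linarith⟩
  have := (hall (Set.right_mem_Icc.2 zero_le_one)).1
  rw [hγ1] at this
  exact hQt this

end EndGeometry
end
end CylEnd

namespace CylEnd

noncomputable section

/-! ### Functions and sections on the end, and their extension to `Z`. -/

section EndSections

attribute [local instance] tangentTotalSpace InnerProductSpace.complexToReal

variable {m : ℕ}
  {Z : Type*} [TopologicalSpace Z] [ChartedSpace (EuclideanSpace ℝ (Fin (m + 1))) Z]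
  [RiemannianBundle (fun z : Z => TangentSpace (𝓡 (m + 1)) z)]
  {Y : Type*} [TopologicalSpace Y] [ChartedSpace (EuclideanSpace ℝ (Fin m)) Y]
  [RiemannianBundle (fun y : Y => TangentSpace (𝓡 m) y)]
  [IsManifold (𝓡 (m + 1)) ∞ Z] [IsManifold (𝓡 m) ∞ Y]
  [T2Space Z] [T2Space Y] [CompactSpace Y]

section Functions

variable (C : CylindricalEnd m Z Y)

/-- A smooth function on the end that vanishes for small `u` extends by zero to a smooth
function. -/
theorem CylindricalEnd.exists_extendFun
    [IsContinuousRiemannianBundle (EuclideanSpace ℝ (Fin (m + 1)))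
      (fun z : Z => TangentSpace (𝓡 (m + 1)) z)] {G : Y × ℝ → ℝ}
    (hG : ContMDiff ((𝓡 m).prod 𝓘(ℝ, ℝ)) 𝓘(ℝ, ℝ) ∞ G) {κ : ℝ} (hκ : 0 ≤ κ)
    (h0 : ∀ p : Y × ℝ, p.2 ≤ κ → G p = 0) :
    ∃ f : C^∞⟮𝓡 (m + 1), Z; ℝ⟯, (∀ y u, -C.ε < u → f (C.chart (y, u)) = G (y, u)) ∧
      ∀ z, z ∉ C.chart.target → f z = 0 := by
  classical
  let f : Z → ℝ := fun z => if z ∈ C.chart.target then G (C.chart.symm z) else 0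
  have hf : ∀ z ∈ C.chart.target, f z = G (C.chart.symm z) := fun z hz => if_pos hz
  have hf0 : ∀ z, z ∉ C.chart.target → f z = 0 := fun z hz => if_neg hz
  have hsm : ContMDiff (𝓡 (m + 1)) 𝓘(ℝ, ℝ) ∞ f := by
    intro z
    by_cases hz : z ∈ C.chart.target
    · have h1 : ContMDiffAt (𝓡 (m + 1)) 𝓘(ℝ, ℝ) ∞ (fun z => G (C.chart.symm z)) z :=
        hG.contMDiffAt.comp z (C.contMDiffAt_symm hz)
      refine h1.congr_of_eventuallyEq ?_
      filter_upwards [C.chart.open_target.mem_nhds hz] with w hw using hf w hw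
    -- Closedness of the end at infinity is used here: a point outside the chart target has a
    -- neighbourhood that avoids `u ≥ κ`, and there the extension is zero.
    · have h1 : z ∈ (C.chart '' {p | κ ≤ p.2})ᶜ := by
        rintro ⟨p, hp, rfl⟩
        exact hz (C.chart.map_source (C.mem_source_of_nonneg p.1 (hκ.trans hp)))
      refine (contMDiffAt_const (c := (0 : ℝ))).congr_of_eventuallyEq ?_
      filter_upwards [(C.isClosed_image hκ).isOpen_compl.mem_nhds h1] with w hw
      by_cases hwt : w ∈ C.chart.target
      · rw [hf w hwt]
        refine h0 _ (not_lt.1 fun h => hw ⟨_, h.le, C.chart.right_inv hwt⟩)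
      · exact hf0 w hwt
  refine ⟨⟨f, hsm⟩, fun y u hu => ?_, hf0⟩
  have hp := C.mem_source (y := y).2 hu
  change f _ = _
  rw [hf _ (C.chart.map_source hp), C.chart.left_inv hp]

/-- The restriction of a smooth function to `Y × {u}`. -/
def CylindricalEnd.sliceFun (f : C^∞⟮𝓡 (m + 1), Z; ℝ⟯) (u : ℝ) (hu : -C.ε < u) :
    C^∞⟮𝓡 m, Y; ℝ⟯ :=
  ⟨fun y => f (C.chart (y, u)), by
    have h1 : ContMDiff (𝓡 m) ((𝓡 m).prod 𝓘(ℝ, ℝ)) ∞ (fun y : Y => (y, u)) :=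
      contMDiff_id.prodMk contMDiff_const
    exact (f.contMDiff.comp_contMDiffOn C.contMDiffOn).comp_contMDiff h1
      fun y => C.mem_source.2 hu⟩

/-- The inclusion of a slice `Y × {u}` is isometric, so restriction does not increase the norm of a
differential. -/
theorem CylindricalEnd.norm_mvfderiv_sliceFun_le (f : C^∞⟮𝓡 (m + 1), Z; ℝ⟯) {u : ℝ}
    (hu : -C.ε < u) (y : Y) :
    ‖mvfderiv (𝓡 m) (C.sliceFun f u hu) y‖ ≤ ‖mvfderiv (𝓡 (m + 1)) f (C.chart (y, u))‖ := by
  refine ContinuousLinearMap.opNorm_le_bound _ (ContinuousLinearMap.opNorm_nonneg _) fun v => ?_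
  have m1 : MDifferentiableAt (𝓡 m) ((𝓡 m).prod 𝓘(ℝ, ℝ)) (fun y : Y => (y, u)) y :=
    mdifferentiableAt_id.prodMk mdifferentiableAt_const
  have m2 : MDifferentiableAt ((𝓡 m).prod 𝓘(ℝ, ℝ)) (𝓡 (m + 1)) C.chart (y, u) :=
    (C.contMDiffAt (C.mem_source.2 hu)).mdifferentiableAt (by simp)
  have m3 := smoothFun_mdifferentiableAt f (C.chart (y, u))
  have h1 : mfderiv (𝓡 m) 𝓘(ℝ, ℝ) (C.sliceFun f u hu) y
      = (mfderiv (𝓡 (m + 1)) 𝓘(ℝ, ℝ) f (C.chart (y, u))).comp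
        ((mfderiv ((𝓡 m).prod 𝓘(ℝ, ℝ)) (𝓡 (m + 1)) C.chart (y, u)).comp
          (mfderiv (𝓡 m) ((𝓡 m).prod 𝓘(ℝ, ℝ)) (fun y : Y => (y, u)) y)) :=
    (m3.hasMFDerivAt.comp y (m2.hasMFDerivAt.comp y m1.hasMFDerivAt)).mfderiv
  have h2 : mvfderiv (𝓡 m) (C.sliceFun f u hu) y v = mvfderiv (𝓡 (m + 1)) f (C.chart (y, u))
      (mfderiv ((𝓡 m).prod 𝓘(ℝ, ℝ)) (𝓡 (m + 1)) C.chart (y, u) (v, (0 : ℝ))) := by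
    rw [mfderiv_prod_left] at h1
    exact congrArg (fun A : TangentSpace (𝓡 m) y →L[ℝ] ℝ => A v) h1
  rw [h2, ← C.norm_mfderiv_left hu v]
  exact ContinuousLinearMap.le_opNorm _ _

theorem CylindricalEnd.norm_mvfderiv_le {f : C^∞⟮𝓡 (m + 1), Z; ℝ⟯} {ρ : ℝ → ℝ}
    (hρ : ContDiff ℝ ∞ ρ) (η : C^∞⟮𝓡 m, Y; ℝ⟯)
    (hf : ∀ y u, -C.ε < u → f (C.chart (y, u)) = ρ u * η y) {y : Y} {u : ℝ} (hu : -C.ε < u) :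
    ‖mvfderiv (𝓡 (m + 1)) f (C.chart (y, u))‖
      ≤ |deriv ρ u| * |η y| + |ρ u| * ‖mvfderiv (𝓡 m) η y‖ := by
  have hη0 : 0 ≤ ‖mvfderiv (𝓡 m) η y‖ := ContinuousLinearMap.opNorm_nonneg _
  refine ContinuousLinearMap.opNorm_le_bound _ (by positivity) fun w => ?_
  obtain ⟨v, r, hw, -, hv, hr⟩ := C.exists_mfderiv_eq hu w
  have m1 : MDifferentiableAt ((𝓡 m).prod 𝓘(ℝ, ℝ)) 𝓘(ℝ, ℝ) (fun p : Y × ℝ => ρ p.2) (y, u) :=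
    (hρ.contMDiff.contMDiffAt.mdifferentiableAt (by simp)).comp (y, u) mdifferentiableAt_snd
  have m2 : MDifferentiableAt ((𝓡 m).prod 𝓘(ℝ, ℝ)) 𝓘(ℝ, ℝ) (fun p : Y × ℝ => η p.1) (y, u) :=
    (smoothFun_mdifferentiableAt η y).comp (y, u) mdifferentiableAt_fst
  have m3 : MDifferentiableAt ((𝓡 m).prod 𝓘(ℝ, ℝ)) (𝓡 (m + 1)) C.chart (y, u) :=
    (C.contMDiffAt (C.mem_source.2 hu)).mdifferentiableAt (by simp)
  have e1 : f ∘ C.chart =ᶠ[𝓝 (y, u)] fun p => ρ p.2 * η p.1 := by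
    filter_upwards [C.chart.open_source.mem_nhds (C.mem_source.2 hu)] with p hp
    exact hf p.1 p.2 (C.mem_source.1 hp)
  have h1 : mvfderiv ((𝓡 m).prod 𝓘(ℝ, ℝ)) (f ∘ C.chart) (y, u) (v, r)
      = mvfderiv (𝓡 (m + 1)) f (C.chart (y, u)) w := by
    rw [← hw]
    exact congrArg (fun A : TangentSpace ((𝓡 m).prod 𝓘(ℝ, ℝ)) (y, u) →L[ℝ] ℝ => A (v, r))
      (mfderiv_comp (y, u) (smoothFun_mdifferentiableAt f _) m3)
  have h2 : mvfderiv ((𝓡 m).prod 𝓘(ℝ, ℝ)) (f ∘ C.chart) (y, u)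
      = mvfderiv ((𝓡 m).prod 𝓘(ℝ, ℝ)) (fun p : Y × ℝ => ρ p.2 * η p.1) (y, u) := by
    ext q
    exact congrArg (fun A : TangentSpace ((𝓡 m).prod 𝓘(ℝ, ℝ)) (y, u) →L[ℝ] ℝ => A q) e1.mfderiv_eq
  have h3 : mvfderiv ((𝓡 m).prod 𝓘(ℝ, ℝ)) (fun p : Y × ℝ => ρ p.2) (y, u) (v, r) = deriv ρ u * r := by
    have h4 : mfderiv ((𝓡 m).prod 𝓘(ℝ, ℝ)) 𝓘(ℝ, ℝ) (fun p : Y × ℝ => ρ p.2) (y, u)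
        = (mfderiv 𝓘(ℝ, ℝ) 𝓘(ℝ, ℝ) ρ u).comp
          (mfderiv ((𝓡 m).prod 𝓘(ℝ, ℝ)) 𝓘(ℝ, ℝ) Prod.snd (y, u)) :=
      mfderiv_comp (y, u) (hρ.contMDiff.contMDiffAt.mdifferentiableAt (by simp))
        mdifferentiableAt_snd
    rw [mfderiv_snd, mfderiv_eq_fderiv] at h4
    refine (congrArg (fun A : TangentSpace ((𝓡 m).prod 𝓘(ℝ, ℝ)) (y, u) →L[ℝ] ℝ => A (v, r)) h4).trans ?_
    change fderiv ℝ ρ u r = _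
    rw [fderiv_eq_smul_deriv, smul_eq_mul, mul_comm]
  have h4 : mvfderiv ((𝓡 m).prod 𝓘(ℝ, ℝ)) (fun p : Y × ℝ => η p.1) (y, u) (v, r)
      = mvfderiv (𝓡 m) η y v := by
    have h5 : mfderiv ((𝓡 m).prod 𝓘(ℝ, ℝ)) 𝓘(ℝ, ℝ) (fun p : Y × ℝ => η p.1) (y, u)
        = (mfderiv (𝓡 m) 𝓘(ℝ, ℝ) η y).comp
          (mfderiv ((𝓡 m).prod 𝓘(ℝ, ℝ)) (𝓡 m) Prod.fst (y, u)) :=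
      mfderiv_comp (y, u) (smoothFun_mdifferentiableAt η y) mdifferentiableAt_fst
    rw [mfderiv_fst] at h5
    exact congrArg (fun A : TangentSpace ((𝓡 m).prod 𝓘(ℝ, ℝ)) (y, u) →L[ℝ] ℝ => A (v, r)) h5
  have h5 : mvfderiv (𝓡 (m + 1)) f (C.chart (y, u)) w
      = ρ u * mvfderiv (𝓡 m) η y v + η y * (deriv ρ u * r) := by
    rw [← h1, h2, mvfderiv_fun_mul m1 m2, ← h3, ← h4]
    rfl
  rw [h5, Real.norm_eq_abs, add_mul, add_comm (|deriv ρ u| * |η y| * ‖w‖)]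
  have h6 : |mvfderiv (𝓡 m) η y v| ≤ ‖mvfderiv (𝓡 m) η y‖ * ‖v‖ :=
    ContinuousLinearMap.le_opNorm (mvfderiv (𝓡 m) η y) v
  refine (abs_add_le _ _).trans (add_le_add ?_ ?_)
  · rw [abs_mul, mul_assoc]
    exact mul_le_mul_of_nonneg_left (h6.trans (mul_le_mul_of_nonneg_left hv hη0)) (abs_nonneg _)
  · rw [abs_mul, abs_mul]
    calc |η y| * (|deriv ρ u| * |r|) = |deriv ρ u| * |η y| * |r| := by ring
      _ ≤ _ := mul_le_mul_of_nonneg_left hr (by positivity)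

end Functions

variable {F : Type*} [NormedAddCommGroup F] [NormedSpace ℂ F]
  {E : Z → Type*} [TopologicalSpace (TotalSpace F E)]
  [∀ z, NormedAddCommGroup (E z)] [∀ z, InnerProductSpace ℂ (E z)]
  [FiberBundle F E] [VectorBundle ℂ F E] [VectorBundle ℝ F E]
  {F' : Type*} [NormedAddCommGroup F'] [NormedSpace ℂ F']
  {E' : Y → Type*} [TopologicalSpace (TotalSpace F' E')]
  [∀ y, NormedAddCommGroup (E' y)] [∀ y, InnerProductSpace ℂ (E' y)]
  [FiberBundle F' E'] [VectorBundle ℂ F' E'] [VectorBundle ℝ F' E']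
  {C : CylindricalEnd m Z Y} (B : BundleEnd F E F' E' C)

theorem BundleEnd.iso_pull (s : Π z, E z) (y : Y) (u : ℝ) :
    B.iso y u (B.pull s y u) = s (C.chart (y, u)) := (B.iso y u).apply_symm_apply _

theorem BundleEnd.norm_pull (s : Π z, E z) (y : Y) (u : ℝ) :
    ‖B.pull s y u‖ = ‖s (C.chart (y, u))‖ := (B.iso y u).symm.norm_map _

theorem BundleEnd.inner_pull (s t : Π z, E z) (y : Y) (u : ℝ) :
    (inner ℂ (B.pull s y u) (B.pull t y u) : ℂ) = inner ℂ (s (C.chart (y, u))) (t (C.chart (y, u))) :=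
  (B.iso y u).symm.inner_map_map _ _

theorem BundleEnd.pull_add (s t : smoothSections (m + 1) F E) (y : Y) (u : ℝ) :
    B.pull (s + t).1 y u = B.pull s.1 y u + B.pull t.1 y u := map_add (B.iso y u).symm _ _

theorem BundleEnd.pull_sub (s t : smoothSections (m + 1) F E) (y : Y) (u : ℝ) :
    B.pull (s - t).1 y u = B.pull s.1 y u - B.pull t.1 y u := map_sub (B.iso y u).symm _ _

theorem BundleEnd.pull_smul (c : ℂ) (s : smoothSections (m + 1) F E) (y : Y) (u : ℝ) :
    B.pull (c • s).1 y u = c • B.pull s.1 y u := map_smul (B.iso y u).symm _ _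

theorem BundleEnd.pull_funSmul (f : C^∞⟮𝓡 (m + 1), Z; ℝ⟯) (s : smoothSections (m + 1) F E) (y : Y)
    (u : ℝ) : B.pull (funSmul f s).1 y u = f (C.chart (y, u)) • B.pull s.1 y u :=
  map_smul (B.iso y u).symm ((f (C.chart (y, u)) : ℝ) : ℂ) (s.1 (C.chart (y, u)))

theorem BundleEnd.slice_funSmul (f : C^∞⟮𝓡 (m + 1), Z; ℝ⟯) (s : smoothSections (m + 1) F E) {u : ℝ}
    (hu : -C.ε < u) : B.slice (funSmul f s) u hu = funSmul (C.sliceFun f u hu) (B.slice s u hu) := by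
  ext y
  exact B.pull_funSmul f s y u

variable [ContMDiffVectorBundle ∞ F E (𝓡 (m + 1))] [ContMDiffVectorBundle ∞ F' E' (𝓡 m)]

/-- Near a point of the end, a smooth section of `E` is a combination of sections of `E'` with
smooth coefficients. -/
theorem BundleEnd.exists_pull_eq_sum [FiniteDimensional ℂ F'] (s : smoothSections (m + 1) F E)
    {p₀ : Y × ℝ} (hp₀ : p₀ ∈ C.chart.source) :
    ∃ (r : ℕ) (c : Fin r → Y × ℝ → ℝ) (t : Fin r → smoothSections m F' E'),
      (∀ l, ContMDiffAt ((𝓡 m).prod 𝓘(ℝ, ℝ)) 𝓘(ℝ, ℝ) ∞ (c l) p₀) ∧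
      ∀ᶠ q in 𝓝 p₀, B.pull s.1 q.1 q.2 = ∑ l, c l q • (t l).1 q.1 := by
  have : FiniteDimensional ℝ F' := FiniteDimensional.complexToReal F'
  set τ := trivializationAt F' E' p₀.1
  let b := Module.finBasis ℝ F'
  choose t ht using fun l => exists_section_trivialization (n := m) (F := F') (E := E') p₀.1 (b l)
  have h1 := (B.smooth s).contMDiffAt (C.chart.open_source.mem_nhds hp₀)
  rw [contMDiffAt_totalSpace] at h1
  refine ⟨_, fun l q => b.repr (τ ⟨q.1, B.pull s.1 q.1 q.2⟩).2 l, t, fun l => ?_, ?_⟩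
  · exact (LinearMap.toContinuousLinearMap (b.coord l)).contMDiff.contMDiffAt.comp p₀ h1.2
  · have h2 : ∀ᶠ q : Y × ℝ in 𝓝 p₀, ∀ l, (t l).1 q.1 = τ.symm q.1 (b l) :=
      eventually_all.2 fun l => continuous_fst.continuousAt.eventually (ht l)
    have h3 : ∀ᶠ q : Y × ℝ in 𝓝 p₀, q.1 ∈ τ.baseSet := continuous_fst.continuousAt.eventually
      (τ.open_baseSet.mem_nhds (mem_baseSet_trivializationAt F' E' p₀.1))
    filter_upwards [h2, h3] with q h4 h5
    simp only [h4]
    set v := B.pull s.1 q.1 q.2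
    have h6 : v = τ.symmL ℝ q.1 (τ ⟨q.1, v⟩).2 := by
      rw [Trivialization.symmL_apply _ h5]
      exact (τ.symm_apply_apply_mk h5 v).symm
    conv_lhs => rw [h6, ← b.sum_repr (τ ⟨q.1, v⟩).2, map_sum]
    refine Finset.sum_congr rfl fun l _ => ?_
    rw [map_smul, Trivialization.symmL_apply _ h5]

theorem BundleEnd.contDiffAt_pull [FiniteDimensional ℂ F'] (s : smoothSections (m + 1) F E) (y : Y)
    {u : ℝ} (hu : -C.ε < u) : ContDiffAt ℝ ∞ (fun v => B.pull s.1 y v) u := by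
  obtain ⟨r, c, t, hc, h⟩ := B.exists_pull_eq_sum s (C.mem_source (y := y).2 hu)
  have h1 : ContMDiffAt 𝓘(ℝ, ℝ) ((𝓡 m).prod 𝓘(ℝ, ℝ)) ∞ (fun v : ℝ => (y, v)) u :=
    contMDiffAt_const.prodMk contMDiffAt_id
  have h2 : ContDiffAt ℝ ∞ (fun v => ∑ l, c l (y, v) • (t l).1 y) u := by
    refine ContDiffAt.sum fun l _ => ?_
    have h3 : ContDiffAt ℝ ∞ (fun v => c l (y, v)) u := ((hc l).comp u h1).contDiffAt
    exact h3.smul contDiffAt_const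
  exact h2.congr_of_eventuallyEq (h1.continuousAt.eventually h)

open Classical in
/-- The section of `E` over the end that corresponds to a family of vectors of `E'`, extended by
zero. -/
def BundleEnd.glue (σ : ∀ p : Y × ℝ, E' p.1) (z : Z) : E z :=
  if h : ∃ p ∈ C.chart.source, C.chart p = z then
    h.choose_spec.2 ▸ (B.iso h.choose.1 h.choose.2 (σ h.choose))
  else 0

theorem BundleEnd.glue_chart (σ : ∀ p : Y × ℝ, E' p.1) {p : Y × ℝ} (hp : p ∈ C.chart.source) :
    B.glue σ (C.chart p) = B.iso p.1 p.2 (σ p) := by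
  have h : ∃ q ∈ C.chart.source, C.chart q = C.chart p := ⟨p, hp, rfl⟩
  rw [BundleEnd.glue, dif_pos h]
  have key : ∀ (q : Y × ℝ) (_ : q = p) (e : C.chart q = C.chart p),
      (e ▸ (B.iso q.1 q.2 (σ q)) : E (C.chart p)) = B.iso p.1 p.2 (σ p) := by
    rintro q rfl e
    rfl
  exact key _ (C.chart.injOn h.choose_spec.1 hp h.choose_spec.2) _

theorem BundleEnd.glue_of_notMem (σ : ∀ p : Y × ℝ, E' p.1) {z : Z} (hz : z ∉ C.chart.target) :
    B.glue σ z = 0 := by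
  rw [BundleEnd.glue, dif_neg]
  rintro ⟨p, hp, rfl⟩
  exact hz (C.chart.map_source hp)

variable [IsSmoothHermitian (m + 1) F E] [IsSmoothHermitian m F' E']
  [FiniteDimensional ℂ F] [FiniteDimensional ℂ F']

/-- A smooth section of `E'`, multiplied by a cut-off function on the end, defines a smooth section
of `E`. -/
theorem BundleEnd.exists_push
    [IsContinuousRiemannianBundle (EuclideanSpace ℝ (Fin (m + 1)))
      (fun z : Z => TangentSpace (𝓡 (m + 1)) z)] (σ : smoothSections m F' E') {ρ : ℝ → ℝ}
    (hρ : ContDiff ℝ ∞ ρ) {κ : ℝ} (hκ : 0 ≤ κ) (h0 : ∀ u ≤ κ, ρ u = 0) :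
    ∃ s : smoothSections (m + 1) F E, ∀ y u, -C.ε < u → B.pull s.1 y u = ρ u • σ.1 y := by
  let s : Π z, E z := B.glue fun p => ρ p.2 • σ.1 p.1
  have hs : ∀ p ∈ C.chart.source, s (C.chart p) = B.iso p.1 p.2 (ρ p.2 • σ.1 p.1) := fun p hp =>
    B.glue_chart _ hp
  have hsm : IsSmoothSection (m + 1) F E s := by
    intro z
    by_cases hz : z ∈ C.chart.target
    · obtain ⟨p₀, hp₀, rfl⟩ : ∃ p ∈ C.chart.source, C.chart p = z :=
        ⟨_, C.chart.map_target hz, C.chart.right_inv hz⟩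
      -- A `BundleEnd` turns smooth sections of `E` into smooth sections of the pull-back, and the
      -- opposite direction is needed here. The new section is expanded in an orthonormal frame of
      -- `E`; since the identification is unitary, its coefficients are pairings on the `E'` side of
      -- smooth objects.
      obtain ⟨r, e, he⟩ := exists_orthoFrame (n := m + 1) (F := F) (E := E) (C.chart p₀)
      have hc : ∀ j, ContMDiffAt ((𝓡 m).prod 𝓘(ℝ, ℝ)) 𝓘(ℝ, ℝ) ∞
          (fun p : Y × ℝ => (inner ℝ (B.pull (e j).1 p.1 p.2) (ρ p.2 • σ.1 p.1) : ℝ)) p₀ := by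
        intro j
        obtain ⟨k, c, t, hc, h⟩ := B.exists_pull_eq_sum (e j) hp₀
        have h1 : ContMDiffAt ((𝓡 m).prod 𝓘(ℝ, ℝ)) 𝓘(ℝ, ℝ) ∞
            (fun p : Y × ℝ => ρ p.2 * ∑ l, c l p * reInner (t l) σ p.1) p₀ := by
          refine ContMDiffAt.mul (hρ.contMDiff.contMDiffAt.comp p₀ contMDiffAt_snd) ?_
          refine ContMDiffAt.sum fun l _ => (hc l).mul ?_
          exact (reInner (t l) σ).contMDiff.contMDiffAt.comp p₀ contMDiffAt_fst
        refine h1.congr_of_eventuallyEq ?_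
        filter_upwards [h] with p hp
        rw [hp, real_inner_smul_right, sum_inner]
        simp only [real_inner_smul_left, reInner_apply]
      have h2 : ContMDiffAt (𝓡 (m + 1)) ((𝓡 (m + 1)).prod 𝓘(ℝ, F)) ∞
          (fun z => (⟨z, ∑ j, (inner ℝ (B.pull (e j).1 (C.chart.symm z).1 (C.chart.symm z).2)
            (ρ (C.chart.symm z).2 • σ.1 (C.chart.symm z).1) : ℝ) • (e j).1 z⟩ : TotalSpace F E))
          (C.chart p₀) := by
        refine ContMDiffAt.sum_section fun j _ => ContMDiffAt.smul_section ?_ ((e j).2 _)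
        refine ContMDiffAt.comp_of_eq (hc j) (C.contMDiffAt_symm hz) ?_
        exact C.chart.left_inv hp₀
      refine h2.congr_of_eventuallyEq ?_
      filter_upwards [he, C.chart.open_target.mem_nhds hz] with w h3 h4
      congr 1
      obtain ⟨p, hp, rfl⟩ : ∃ p ∈ C.chart.source, C.chart p = w :=
        ⟨_, C.chart.map_target h4, C.chart.right_inv h4⟩
      rw [C.chart.left_inv hp]
      refine (h3.eq_sum _).trans (Finset.sum_congr rfl fun j _ => ?_)
      congr 1
      rw [hs p hp, inner_real_eq_re, inner_real_eq_re, ← (B.iso p.1 p.2).inner_map_map, B.iso_pull]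
    · have h1 : z ∈ (C.chart '' {p | κ ≤ p.2})ᶜ := by
        rintro ⟨p, hp, rfl⟩
        exact hz (C.chart.map_source (C.mem_source_of_nonneg p.1 (hκ.trans hp)))
      refine ((0 : smoothSections (m + 1) F E).2 z).congr_of_eventuallyEq ?_
      filter_upwards [(C.isClosed_image hκ).isOpen_compl.mem_nhds h1] with w hw
      congr 1
      by_cases hwt : w ∈ C.chart.target
      · obtain ⟨p, hp, rfl⟩ : ∃ p ∈ C.chart.source, C.chart p = w :=
          ⟨_, C.chart.map_target hwt, C.chart.right_inv hwt⟩
        have h2 : ρ p.2 = 0 := h0 _ (not_lt.1 fun h => hw ⟨_, h.le, rfl⟩)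
        rw [hs p hp, h2, zero_smul, map_zero]
        rfl
      · exact B.glue_of_notMem _ hwt
  refine ⟨⟨s, hsm⟩, fun y u hu => ?_⟩
  change (B.iso y u).symm (s (C.chart (y, u))) = _
  rw [hs _ (C.mem_source.2 hu)]
  exact (B.iso y u).symm_apply_apply _

end EndSections
end
end CylEnd

namespace CylEnd

noncomputable section

attribute [local instance] tangentTotalSpace

/-! ### Elementary estimates for differentials of functions. -/

section Gradients

variable {n : ℕ} {M : Type*} [TopologicalSpace M] [ChartedSpace (EuclideanSpace ℝ (Fin n)) M]
  [RiemannianBundle (fun x : M => TangentSpace (𝓡 n) x)]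

theorem norm_mvfderiv_mul_le {f g : M → ℝ} {x : M} (hf : MDifferentiableAt (𝓡 n) 𝓘(ℝ, ℝ) f x)
    (hg : MDifferentiableAt (𝓡 n) 𝓘(ℝ, ℝ) g x) :
    ‖mvfderiv (𝓡 n) (fun y => f y * g y) x‖
      ≤ |f x| * ‖mvfderiv (𝓡 n) g x‖ + |g x| * ‖mvfderiv (𝓡 n) f x‖ := by
  have h1 : 0 ≤ ‖mvfderiv (𝓡 n) f x‖ := ContinuousLinearMap.opNorm_nonneg _
  have h2 : 0 ≤ ‖mvfderiv (𝓡 n) g x‖ := ContinuousLinearMap.opNorm_nonneg _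
  refine ContinuousLinearMap.opNorm_le_bound _ (by positivity) fun v => ?_
  have h3 : mvfderiv (𝓡 n) (fun y => f y * g y) x v
      = f x * mvfderiv (𝓡 n) g x v + g x * mvfderiv (𝓡 n) f x v := by
    rw [mvfderiv_fun_mul hf hg]
    rfl
  have h4 : |mvfderiv (𝓡 n) f x v| ≤ ‖mvfderiv (𝓡 n) f x‖ * ‖v‖ :=
    ContinuousLinearMap.le_opNorm (mvfderiv (𝓡 n) f x) v
  have h5 : |mvfderiv (𝓡 n) g x v| ≤ ‖mvfderiv (𝓡 n) g x‖ * ‖v‖ :=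
    ContinuousLinearMap.le_opNorm (mvfderiv (𝓡 n) g x) v
  rw [h3, Real.norm_eq_abs, add_mul, mul_assoc, mul_assoc]
  refine (abs_add_le _ _).trans (add_le_add ?_ ?_) <;> rw [abs_mul]
  · exact mul_le_mul_of_nonneg_left h5 (abs_nonneg _)
  · exact mul_le_mul_of_nonneg_left h4 (abs_nonneg _)

theorem norm_mvfderiv_sum_le {ι : Type*} (S : Finset ι) {f : ι → M → ℝ} {x : M}
    (hf : ∀ i, MDifferentiableAt (𝓡 n) 𝓘(ℝ, ℝ) (f i) x) :
    MDifferentiableAt (𝓡 n) 𝓘(ℝ, ℝ) (fun y => ∑ i ∈ S, f i y) x ∧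
    ‖mvfderiv (𝓡 n) (fun y => ∑ i ∈ S, f i y) x‖ ≤ ∑ i ∈ S, ‖mvfderiv (𝓡 n) (f i) x‖ := by
  classical
  induction S using Finset.induction_on with
  | empty =>
    simp only [Finset.sum_empty, mvfderiv_const]
    exact ⟨mdifferentiableAt_const, ContinuousLinearMap.opNorm_zero.le⟩
  | insert i S hi ih =>
    simp only [Finset.sum_insert hi]
    refine ⟨(hf i).add ih.1, ?_⟩
    rw [mvfderiv_fun_add (hf i) ih.1]
    exact (ContinuousLinearMap.opNorm_add_le _ _).trans (add_le_add le_rfl ih.2)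

theorem norm_mvfderiv_comp_le {h : ℝ → ℝ} {f : M → ℝ} {x : M} {h' : ℝ}
    (hh : HasDerivAt h h' (f x)) (hf : MDifferentiableAt (𝓡 n) 𝓘(ℝ, ℝ) f x) :
    MDifferentiableAt (𝓡 n) 𝓘(ℝ, ℝ) (fun y => h (f y)) x ∧
    ‖mvfderiv (𝓡 n) (fun y => h (f y)) x‖ ≤ |h'| * ‖mvfderiv (𝓡 n) f x‖ := by
  have h1 : 0 ≤ ‖mvfderiv (𝓡 n) f x‖ := ContinuousLinearMap.opNorm_nonneg _
  have h2 := HasMFDerivAt.comp x hh.hasFDerivAt.hasMFDerivAt hf.hasMFDerivAt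
  refine ⟨h2.mdifferentiableAt, ContinuousLinearMap.opNorm_le_bound _ (by positivity) fun v => ?_⟩
  have h3 : mvfderiv (𝓡 n) (fun y => h (f y)) x v = mvfderiv (𝓡 n) f x v * h' :=
    congrArg (fun A : TangentSpace (𝓡 n) x →L[ℝ] ℝ => A v) h2.mfderiv
  have h4 : |mvfderiv (𝓡 n) f x v| ≤ ‖mvfderiv (𝓡 n) f x‖ * ‖v‖ :=
    ContinuousLinearMap.le_opNorm (mvfderiv (𝓡 n) f x) v
  rw [h3, Real.norm_eq_abs, abs_mul, mul_comm, mul_assoc]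
  exact mul_le_mul_of_nonneg_left h4 (abs_nonneg _)

variable [IsManifold (𝓡 n) ∞ M] [T2Space M]
  [IsContinuousRiemannianBundle (EuclideanSpace ℝ (Fin n)) (fun x : M => TangentSpace (𝓡 n) x)]

/-- In a chart the differential is a continuous coordinate differential composed with the derivative
of the chart, and the latter is bounded near `x₀` by continuity of the metric. -/
theorem exists_eventually_norm_mvfderiv_le (f : C^∞⟮𝓡 n, M; ℝ⟯) (x₀ : M) :
    ∃ C, ∀ᶠ x in 𝓝 x₀, ‖mvfderiv (𝓡 n) f x‖ ≤ C := by
  have : IsManifold (𝓡 n) 1 M := IsManifold.of_le (n := ∞) (by simp)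
  set e := extChartAt (𝓡 n) x₀
  have hsrc : IsOpen e.source := isOpen_extChartAt_source (I := 𝓡 n) x₀
  have htgt : IsOpen e.target := isOpen_extChartAt_target (I := 𝓡 n) x₀
  obtain ⟨L, hL, hLe⟩ := exists_norm_mfderiv_extChartAt_le (n := n) x₀
  have hg : ContDiffOn ℝ ∞ (f ∘ e.symm) e.target :=
    (f.contMDiff.comp_contMDiffOn (contMDiffOn_extChartAt_symm (I := 𝓡 n) (n := ∞) x₀)).contDiffOn
  have hg' : ContinuousAt (fun q => ‖fderiv ℝ (f ∘ e.symm) q‖) (e x₀) :=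
    ((hg.continuousOn_fderiv_of_isOpen htgt (by simp)).continuousAt
      (htgt.mem_nhds (mem_extChartAt_target (I := 𝓡 n) x₀))).norm
  have hb := (continuousAt_extChartAt (I := 𝓡 n) x₀).eventually
    (hg'.eventually_lt_const (lt_add_one _))
  refine ⟨(‖fderiv ℝ (f ∘ e.symm) (e x₀)‖ + 1) * L, ?_⟩
  filter_upwards [hLe, hb, hsrc.mem_nhds (mem_extChartAt_source (I := 𝓡 n) x₀)] with x h1 h2 h3
  refine ContinuousLinearMap.opNorm_le_bound _ (by positivity) fun v => ?_
  have e1 : f =ᶠ[𝓝 x] (f ∘ e.symm) ∘ e := by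
    filter_upwards [hsrc.mem_nhds h3] with y hy
    simp only [Function.comp]
    rw [e.left_inv hy]
  have d1 : MDifferentiableAt 𝓘(ℝ, EuclideanSpace ℝ (Fin n)) 𝓘(ℝ, ℝ) (f ∘ e.symm) (e x) :=
    ((hg.contDiffAt (htgt.mem_nhds (e.map_source h3))).differentiableAt (by simp)).mdifferentiableAt
  have h4 := e1.mfderiv_eq (I := 𝓡 n) (I' := 𝓘(ℝ, ℝ))
  rw [mfderiv_comp x d1 (mdifferentiableAt_extChartAt' x₀ h3), mfderiv_eq_fderiv] at h4
  have h5 : mvfderiv (𝓡 n) f x v = fderiv ℝ (f ∘ e.symm) (e x) (mvfderiv (𝓡 n) e x v) :=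
    congrArg (fun A : TangentSpace (𝓡 n) x →L[ℝ] ℝ => A v) h4
  rw [h5]
  refine (ContinuousLinearMap.le_opNorm _ _).trans ?_
  rw [mul_assoc]
  exact mul_le_mul h2.le (h1 v) (norm_nonneg _) (by positivity)

theorem exists_norm_mvfderiv_le (f : C^∞⟮𝓡 n, M; ℝ⟯) (hf : HasCompactSupport f) :
    ∃ C, 0 ≤ C ∧ ∀ x, ‖mvfderiv (𝓡 n) f x‖ ≤ C := by
  have h1 : ∃ C, ∀ x ∈ tsupport f, ‖mvfderiv (𝓡 n) f x‖ ≤ C := by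
    refine hf.isCompact.induction_on (p := fun S => ∃ C, ∀ x ∈ S, ‖mvfderiv (𝓡 n) f x‖ ≤ C)
      ⟨0, by simp⟩ ?_ ?_ ?_
    · rintro S T hST ⟨C, hC⟩
      exact ⟨C, fun x hx => hC x (hST hx)⟩
    · rintro S T ⟨C, hC⟩ ⟨C', hC'⟩
      exact ⟨max C C', fun x hx => hx.elim (fun h => (hC x h).trans (le_max_left _ _))
        fun h => (hC' x h).trans (le_max_right _ _)⟩
    · intro x _
      obtain ⟨C, hC⟩ := exists_eventually_norm_mvfderiv_le f x
      exact ⟨_, mem_nhdsWithin_of_mem_nhds hC, C, fun y hy => hy⟩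
  obtain ⟨C, hC⟩ := h1
  refine ⟨max C 0, le_max_right _ _, fun x => ?_⟩
  by_cases hx : x ∈ tsupport f
  · exact (hC x hx).trans (le_max_left _ _)
  · rw [mvfderiv_eq_zero_of_notMem_tsupport hx, ContinuousLinearMap.opNorm_zero]
    exact le_max_right _ _

end Gradients

/-! ### Normalizing controlled functions to a quadratic partition of unity. -/

section ExistsCover

attribute [local instance] InnerProductSpace.complexToReal

variable {n : ℕ} {M : Type*} [TopologicalSpace M] [ChartedSpace (EuclideanSpace ℝ (Fin n)) M]
  [RiemannianBundle (fun x : M => TangentSpace (𝓡 n) x)]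
  {F : Type*} [NormedAddCommGroup F] [NormedSpace ℂ F]
  {E : M → Type*} [TopologicalSpace (TotalSpace F E)]
  [∀ x, NormedAddCommGroup (E x)] [∀ x, InnerProductSpace ℂ (E x)]
  [FiberBundle F E] [VectorBundle ℂ F E] [VectorBundle ℝ F E]
  {P : smoothSections n F E →ₗ[ℂ] smoothSections n F E}
  {D : CovariantDerivative (𝓡 n) F E}

/-- A function with values in `[0, 1]` and bounded differential, on the support of which there is a
controlled frame. -/
def IsControlledFun (P : smoothSections n F E →ₗ[ℂ] smoothSections n F E)
    (D : CovariantDerivative (𝓡 n) F E) (g : C^∞⟮𝓡 n, M; ℝ⟯) : Prop :=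
  (∀ x, g x ∈ Set.Icc (0 : ℝ) 1) ∧ ∃ (r : ℕ) (e : Fin r → smoothSections n F E) (C : ℝ), 0 ≤ C ∧
    (∀ x, ‖mvfderiv (𝓡 n) g x‖ ≤ C) ∧ ∀ x ∈ tsupport g, IsControlledFrameAt P D e C x

theorem IsControlledFrameAt.mono {ι : Type*} [Fintype ι] [DecidableEq ι]
    {e : ι → smoothSections n F E} {C C' : ℝ} {x : M} (h : IsControlledFrameAt P D e C x)
    (hC : C ≤ C') : IsControlledFrameAt P D e C' x where
  ortho := h.ortho
  norm_le j := (h.norm_le j).trans hC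
  commutator_le j k hjk f := (h.commutator_le j k hjk f).trans
    (mul_le_mul_of_nonneg_right hC (ContinuousLinearMap.opNorm_nonneg _))
  gradient_le j := (h.gradient_le j).trans hC

/-- The derivative is `-1 / (2 y √y)`. The bound is used for the normalizing factor, whose argument
is at least `1`. -/
theorem hasDerivAt_inv_sqrt {y : ℝ} (hy : 1 ≤ y) :
    ∃ h', |h'| ≤ 1 ∧ HasDerivAt (fun y : ℝ => (√y)⁻¹) h' y := by
  have hy0 : 0 < y := one_pos.trans_le hy
  have hs : 1 ≤ √y := Real.one_le_sqrt.2 hy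
  refine ⟨_, ?_, (Real.hasDerivAt_sqrt hy0.ne').inv (by positivity)⟩
  rw [Real.sq_sqrt hy0.le, neg_div, abs_neg, abs_of_nonneg (by positivity), div_le_one hy0]
  refine le_trans ?_ hy
  rw [div_le_one (by positivity)]
  linarith

/-- Finitely many controlled functions, one of which is `1` at each point, can be normalized to a
controlled cover. -/
theorem exists_controlledCover {κ : Type} [Fintype κ] {g : κ → C^∞⟮𝓡 n, M; ℝ⟯}
    (hg : ∀ i, IsControlledFun P D (g i)) (h1 : ∀ x, ∃ i, g i x = 1) :
    Nonempty (ControlledCover P D) := by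
  choose h01 r e C hC hgC hfr using hg
  let S : M → ℝ := fun x => ∑ i, g i x * g i x
  have hS : ∀ x, 1 ≤ S x := by
    intro x
    obtain ⟨i, hi⟩ := h1 x
    have := Finset.single_le_sum (f := fun i => g i x * g i x) (fun i _ => mul_self_nonneg _)
      (Finset.mem_univ i)
    simp only [hi, mul_one] at this
    exact this
  have hSsm : ContMDiff (𝓡 n) 𝓘(ℝ, ℝ) ∞ S :=
    ContMDiff.sum fun i _ => (g i).contMDiff.mul (g i).contMDiff
  have hw : ContMDiff (𝓡 n) 𝓘(ℝ, ℝ) ∞ fun x => (√(S x))⁻¹ := by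
    have h2 : ContDiffOn ℝ ∞ (fun y : ℝ => (√y)⁻¹) {y | 0 < y} :=
      (contDiffOn_id.sqrt fun y hy => (ne_of_gt hy)).inv fun y hy => (Real.sqrt_pos.2 hy).ne'
    exact h2.contMDiffOn.comp_contMDiff hSsm fun x => one_pos.trans_le (hS x)
  -- Division by `√S` is harmless because some `g_i` equals `1` at each point, whence `S ≥ 1`. With
  -- `T = ∑ 2 C_i`, the differential of `1 / √S` is bounded by `T`, and each `C_i` is at most `T`;
  -- this explains the bound `2 T` below.
  let χ : κ → C^∞⟮𝓡 n, M; ℝ⟯ := fun i => ⟨fun x => g i x * (√(S x))⁻¹, (g i).contMDiff.mul hw⟩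
  have hw1 : ∀ x, 0 ≤ (√(S x))⁻¹ ∧ (√(S x))⁻¹ ≤ 1 := fun x =>
    ⟨by positivity, inv_le_one_of_one_le₀ (Real.one_le_sqrt.2 (hS x))⟩
  have hdS : ∀ x, ‖mvfderiv (𝓡 n) S x‖ ≤ ∑ i, 2 * C i := by
    intro x
    have hm := fun i => smoothFun_mdifferentiableAt (g i) x
    refine (norm_mvfderiv_sum_le Finset.univ (f := fun i y => g i y * g i y)
      fun i => (hm i).mul (hm i)).2.trans (Finset.sum_le_sum fun i _ => ?_)
    refine (norm_mvfderiv_mul_le (hm i) (hm i)).trans ?_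
    have h2 : |g i x| * ‖mvfderiv (𝓡 n) (g i) x‖ ≤ 1 * C i :=
      mul_le_mul (abs_le.2 ⟨by linarith [(h01 i x).1], (h01 i x).2⟩) (hgC i x)
        (ContinuousLinearMap.opNorm_nonneg _) zero_le_one
    linarith
  have hT : 0 ≤ ∑ i, 2 * C i := Finset.sum_nonneg fun i _ => by linarith [hC i]
  have hCs : ∀ i, C i ≤ ∑ i, 2 * C i := fun i => by
    have := Finset.single_le_sum (f := fun i => 2 * C i) (fun i _ => by linarith [hC i])
      (Finset.mem_univ i)
    linarith [hC i]
  refine ⟨{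
    index := κ
    fintype := inferInstance
    χ := χ
    rank := r
    frame := e
    bound := 2 * ∑ i, 2 * C i
    bound_nonneg := by linarith
    sum_sq := fun x => ?_
    norm_mvfderiv_le := fun i x => ?_
    controlled := fun i x hx => ?_ }⟩
  · have h2 : ∀ i, χ i x ^ 2 = g i x * g i x * (S x)⁻¹ := by
      intro i
      change (g i x * (√(S x))⁻¹) ^ 2 = _
      rw [mul_pow, inv_pow, Real.sq_sqrt (zero_le_one.trans (hS x)), pow_two]
    simp only [h2]
    rw [← Finset.sum_mul]
    exact mul_inv_cancel₀ (one_pos.trans_le (hS x)).ne'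
  · obtain ⟨h', hh', hd⟩ := hasDerivAt_inv_sqrt (hS x)
    have h2 := norm_mvfderiv_comp_le hd (hSsm.contMDiffAt.mdifferentiableAt (by simp) : MDifferentiableAt (𝓡 n) 𝓘(ℝ, ℝ) S x)
    have h3 := norm_mvfderiv_mul_le (smoothFun_mdifferentiableAt (g i) x) h2.1
    refine h3.trans ?_
    have h4 : ‖mvfderiv (𝓡 n) (fun y => (√(S y))⁻¹) x‖ ≤ ∑ i, 2 * C i := by
      refine h2.2.trans ?_
      have h5 := mul_le_mul hh' (hdS x) (ContinuousLinearMap.opNorm_nonneg _) zero_le_one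
      linarith
    have h5 : |g i x| * ‖mvfderiv (𝓡 n) (fun y => (√(S y))⁻¹) x‖ ≤ 1 * ∑ i, 2 * C i :=
      mul_le_mul (abs_le.2 ⟨by linarith [(h01 i x).1], (h01 i x).2⟩) h4
        (ContinuousLinearMap.opNorm_nonneg _) zero_le_one
    have h6 : |(√(S x))⁻¹| * ‖mvfderiv (𝓡 n) (g i) x‖ ≤ 1 * C i :=
      mul_le_mul (abs_le.2 ⟨by linarith [(hw1 x).1], (hw1 x).2⟩) (hgC i x)
        (ContinuousLinearMap.opNorm_nonneg _) zero_le_one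
    linarith [hCs i]
  · refine (hfr i x (closure_mono (Function.support_mul_subset_left _ _) hx)).mono ?_
    linarith [hCs i]

end ExistsCover
end
end CylEnd

namespace CylEnd

noncomputable section

/-! ### Controlled cover of a manifold with cylindrical end. -/

section EndCover

attribute [local instance] tangentTotalSpace InnerProductSpace.complexToReal

variable {m : ℕ}
  {Z : Type*} [TopologicalSpace Z] [T2Space Z] [MeasurableSpace Z]
  [ChartedSpace (EuclideanSpace ℝ (Fin (m + 1))) Z] [IsManifold (𝓡 (m + 1)) ∞ Z]
  [RiemannianBundle (fun z : Z => TangentSpace (𝓡 (m + 1)) z)]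
  [IsContinuousRiemannianBundle (EuclideanSpace ℝ (Fin (m + 1)))
    (fun z : Z => TangentSpace (𝓡 (m + 1)) z)]
  {Y : Type*} [TopologicalSpace Y] [T2Space Y] [CompactSpace Y]
  [ChartedSpace (EuclideanSpace ℝ (Fin m)) Y] [IsManifold (𝓡 m) ∞ Y]
  [RiemannianBundle (fun y : Y => TangentSpace (𝓡 m) y)]
  [IsContinuousRiemannianBundle (EuclideanSpace ℝ (Fin m)) (fun y : Y => TangentSpace (𝓡 m) y)]
  {F : Type*} [NormedAddCommGroup F] [NormedSpace ℂ F] [FiniteDimensional ℂ F]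
  {E : Z → Type*} [TopologicalSpace (TotalSpace F E)]
  [∀ z, NormedAddCommGroup (E z)] [∀ z, InnerProductSpace ℂ (E z)]
  [FiberBundle F E] [VectorBundle ℂ F E] [VectorBundle ℝ F E]
  [ContMDiffVectorBundle ∞ F E (𝓡 (m + 1))] [IsSmoothHermitian (m + 1) F E]
  {F' : Type*} [NormedAddCommGroup F'] [NormedSpace ℂ F'] [FiniteDimensional ℂ F']
  {E' : Y → Type*} [TopologicalSpace (TotalSpace F' E')]
  [∀ y, NormedAddCommGroup (E' y)] [∀ y, InnerProductSpace ℂ (E' y)]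
  [FiberBundle F' E'] [VectorBundle ℂ F' E'] [VectorBundle ℝ F' E']
  [ContMDiffVectorBundle ∞ F' E' (𝓡 m)] [IsSmoothHermitian m F' E']
  {C : CylindricalEnd m Z Y} {B : BundleEnd F E F' E' C}
  {Δ : smoothSections (m + 1) F E →ₗ[ℂ] smoothSections (m + 1) F E}
  {D : CovariantDerivative (𝓡 (m + 1)) F E}

/-- The product formula for the connection in the direction of the unit vector `∂_u`. The constant
`1` keeps the bound on `∂_u` sharp. -/
theorem IsProductConnection.norm_deriv_pull_le (hD : IsProductConnection B D)
    (s : smoothSections (m + 1) F E) (y : Y) {u : ℝ} (hu : 0 ≤ u) :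
    ‖deriv (fun w => B.pull s.1 y w) u‖ ≤ ‖D s.1 (C.chart (y, u))‖ := by
  obtain ⟨D', -, h⟩ := hD.product
  have h1 := h s y u hu 0 1
  rw [map_zero, add_zero, one_smul] at h1
  rw [← h1, LinearIsometryEquiv.norm_map]
  refine (ContinuousLinearMap.le_opNorm _ _).trans ?_
  have h2 : -C.ε < u := (neg_lt_zero.2 C.ε_pos).trans_le hu
  exact (mul_le_mul_of_nonneg_left (C.norm_mfderiv_right h2).le
    (ContinuousLinearMap.opNorm_nonneg _)).trans (mul_one _).le

/-- A smooth step from `0` on `(-∞, a]` to `1` on `[a + 1, ∞)`. -/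
def smoothStep (a u : ℝ) : ℝ := Real.smoothTransition (u - a)

theorem contDiff_smoothStep (a : ℝ) : ContDiff ℝ ∞ (smoothStep a) :=
  Real.smoothTransition.contDiff.comp (contDiff_id.sub contDiff_const)

theorem smoothStep_of_le {a u : ℝ} (h : u ≤ a) : smoothStep a u = 0 :=
  Real.smoothTransition.zero_of_nonpos (sub_nonpos.2 h)

theorem smoothStep_of_ge {a u : ℝ} (h : a + 1 ≤ u) : smoothStep a u = 1 :=
  Real.smoothTransition.one_of_one_le (by linarith)

/-- Sections of `E` that do not depend on `u` for `u ≥ 1`. -/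
theorem BundleEnd.exists_controlledFrame (hΔ : IsCompatibleLaplacian B Δ)
    (hD : IsProductConnection B D) (y₀ : Y) :
    ∃ (r : ℕ) (e : Fin r → smoothSections (m + 1) F E) (A : ℝ), 0 ≤ A ∧
      ∀ᶠ y in 𝓝 y₀, ∀ u, 1 < u → IsControlledFrameAt Δ D e A (C.chart (y, u)) := by
  obtain ⟨ΔY, hΔY, hΔp⟩ := hΔ.product
  obtain ⟨D', hD', hDp⟩ := hD.product
  obtain ⟨r, e', A, hA, he'⟩ := CylEnd.exists_controlledFrame hΔY hD' y₀
  -- The cut-off equals `1` from `u = 1` on. There the frame is independent of `u` and every bound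
  -- is inherited from the frame over `Y`, uniformly in `u`.
  choose e he using fun j => B.exists_push (e' j) (contDiff_smoothStep 0) le_rfl
    fun u hu => smoothStep_of_le hu
  refine ⟨r, e, A, hA, ?_⟩
  filter_upwards [he'] with y hy u hu
  have hu0 : 0 ≤ u := by linarith
  have hε : -C.ε < u := (neg_lt_zero.2 C.ε_pos).trans_le hu0
  have hpull : ∀ j y' v, 1 < v → B.pull (e j).1 y' v = (e' j).1 y' := by
    intro j y' v hv
    rw [he j y' v ((neg_lt_zero.2 C.ε_pos).trans (one_pos.trans hv)),
      smoothStep_of_ge (by linarith), one_smul]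
  have hslice : ∀ j, B.slice (e j) u hε = e' j := fun j => by
    ext y'
    exact hpull j y' u hu
  have hval : ∀ j, (e j).1 (C.chart (y, u)) = B.iso y u ((e' j).1 y) := fun j => by
    rw [← hpull j y u hu, B.iso_pull]
  have hev : ∀ᶠ v in 𝓝 u, 1 < v := lt_mem_nhds hu
  have hinner : ∀ s t : smoothSections (m + 1) F E,
      (inner ℝ (s.1 (C.chart (y, u))) (t.1 (C.chart (y, u))) : ℝ)
        = inner ℝ (B.pull s.1 y u) (B.pull t.1 y u) := fun s t => by
    rw [inner_real_eq_re, inner_real_eq_re, B.inner_pull]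
  refine ⟨⟨fun j k => ?_, fun v => ?_⟩, fun j => ?_, fun j k hjk f => ?_, fun j => ?_⟩
  · rw [hinner, hpull j y u hu, hpull k y u hu]
    exact hy.ortho.inner_eq j k
  · have h1 := congrArg (B.iso y u) (hy.ortho.eq_sum ((B.iso y u).symm v))
    rw [LinearIsometryEquiv.apply_symm_apply, map_sum] at h1
    refine h1.trans (Finset.sum_congr rfl fun j _ => ?_)
    have h2 : (inner ℝ ((e' j).1 y) ((B.iso y u).symm v) : ℝ) = inner ℝ ((e j).1 (C.chart (y, u))) v := by
      rw [inner_real_eq_re, inner_real_eq_re, hval, ← (B.iso y u).inner_map_map,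
        LinearIsometryEquiv.apply_symm_apply]
    rw [h2, hval]
    exact map_smul (B.iso y u) ((inner ℝ (B.iso y u ((e' j).1 y)) v : ℝ) : ℂ) _
  · rw [← B.norm_pull, hΔp _ _ _ hu0, hslice]
    have h1 : (fun v => B.pull (e j).1 y v) =ᶠ[𝓝 u] fun _ => (e' j).1 y := by
      filter_upwards [hev] with v hv using hpull j y v hv
    rw [h1.iteratedDeriv_eq, iteratedDeriv_const]
    simpa using hy.norm_le j
  -- The second `u`-derivative acts only on the scalar `f` and leaves a multiple of `e'_k`, which is
  -- orthogonal to `e'_j`. What remains is the commutator of `Δ_Y` with the restriction of `f` to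
  -- the slice.
  · have h0 : (inner ℝ ((e' j).1 y) ((e' k).1 y) : ℝ) = 0 := by
      rw [hy.ortho.inner_eq, if_neg hjk]
    have h1 : (fun v => B.pull (funSmul f (e k)).1 y v)
        =ᶠ[𝓝 u] fun v => f (C.chart (y, v)) • (e' k).1 y := by
      filter_upwards [hev] with v hv
      rw [B.pull_funSmul, hpull k y v hv]
    have hfs : ContDiffAt ℝ ∞ (fun v => f (C.chart (y, v))) u := by
      have h2 : ContMDiffAt 𝓘(ℝ, ℝ) ((𝓡 m).prod 𝓘(ℝ, ℝ)) ∞ (fun v : ℝ => (y, v)) u :=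
        contMDiffAt_const.prodMk contMDiffAt_id
      have h3 : ContMDiffAt 𝓘(ℝ, ℝ) 𝓘(ℝ, ℝ) ∞ (fun v => f (C.chart (y, v))) u :=
        f.contMDiff.contMDiffAt.comp u ((C.contMDiffAt (C.mem_source.2 hε)).comp u h2)
      exact h3.contDiffAt
    have h2 : iteratedDeriv 2 (fun v => f (C.chart (y, v)) • (e' k).1 y) u
        = iteratedDeriv 2 (fun v => f (C.chart (y, v))) u • (e' k).1 y := by
      let A : ℝ →L[ℝ] E' y := (ContinuousLinearMap.id ℝ ℝ).smulRight ((e' k).1 y)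
      have h3 := A.iteratedFDeriv_comp_left (hfs.of_le (m := 2) (by norm_cast)) (i := 2) le_rfl
      rw [iteratedDeriv_eq_iteratedFDeriv, iteratedDeriv_eq_iteratedFDeriv]
      exact congrArg (fun T => T fun _ => (1 : ℝ)) h3
    have h3 : (inner ℝ ((e j).1 (C.chart (y, u))) ((Δ (funSmul f (e k))).1 (C.chart (y, u))) : ℝ)
        = inner ℝ ((e' j).1 y) ((ΔY (funSmul (C.sliceFun f u hε) (e' k))).1 y) := by
      rw [hinner, hpull j y u hu, hΔp _ _ _ hu0, h1.iteratedDeriv_eq, h2, B.slice_funSmul, hslice,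
        inner_add_right, inner_neg_right, real_inner_smul_right, h0, mul_zero, neg_zero, zero_add]
    have h4 : (inner ℝ ((e j).1 (C.chart (y, u))) ((Δ (e k)).1 (C.chart (y, u))) : ℝ)
        = inner ℝ ((e' j).1 y) ((ΔY (e' k)).1 y) := by
      have h5 : (fun v => B.pull (e k).1 y v) =ᶠ[𝓝 u] fun _ => (e' k).1 y := by
        filter_upwards [hev] with v hv using hpull k y v hv
      rw [hinner, hpull j y u hu, hΔp _ _ _ hu0, h5.iteratedDeriv_eq, iteratedDeriv_const, hslice]
      simp
    have h5 : commutatorFunctional Δ (e k) (e j) (C.chart (y, u)) f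
        = commutatorFunctional ΔY (e' k) (e' j) y (C.sliceFun f u hε) := by
      simp only [commutatorFunctional, LinearMap.coe_mk, AddHom.coe_mk, inner_sub_right,
        real_inner_smul_right, h3, h4]
      rfl
    rw [h5]
    exact (hy.commutator_le j k hjk _).trans
      (mul_le_mul_of_nonneg_left (C.norm_mvfderiv_sliceFun_le f hε y) hA)
  · refine ContinuousLinearMap.opNorm_le_bound _ hA fun w => ?_
    obtain ⟨v, r, hw, -, hv, -⟩ := C.exists_mfderiv_eq hε w
    have h1 := hDp (e j) y u hu0 v r
    have h2 : (fun v => B.pull (e j).1 y v) =ᶠ[𝓝 u] fun _ => (e' j).1 y := by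
      filter_upwards [hev] with v hv using hpull j y v hv
    have h3 : (fun y' => B.pull (e j).1 y' u) = (e' j).1 := funext fun y' => hpull j y' u hu
    rw [h2.deriv_eq, deriv_const, smul_zero, zero_add, h3, hw] at h1
    rw [← (B.iso y u).symm.norm_map, h1]
    exact (ContinuousLinearMap.le_of_opNorm_le _ (hy.gradient_le j) v).trans
      (mul_le_mul_of_nonneg_left hv hA)

/-- A compatible Laplacian and a product connection on a manifold with a cylindrical end have a
controlled cover. -/
theorem BundleEnd.exists_controlledCover (hΔ : IsCompatibleLaplacian B Δ)
    (hD : IsProductConnection B D) : Nonempty (ControlledCover Δ D) := by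
  have hε := C.ε_pos
  -- functions on the end
  have hend : ∀ y₀ : Y, ∃ g : C^∞⟮𝓡 (m + 1), Z; ℝ⟯, IsControlledFun Δ D g ∧
      ∀ᶠ y in 𝓝 y₀, ∀ u, 3 ≤ u → g (C.chart (y, u)) = 1 := by
    intro y₀
    obtain ⟨r, e, A, hA, he⟩ := B.exists_controlledFrame hΔ hD y₀
    obtain ⟨η, hη1, hη2, hη3, hη4⟩ := exists_smooth_bump (n := m) y₀ he
    obtain ⟨A₁, hA₁, hη5⟩ := exists_norm_mvfderiv_le η hη3
    have hstep := contDiff_smoothStep 2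
    obtain ⟨A₂, hA₂⟩ : ∃ A₂, ∀ u, |deriv (smoothStep 2) u| ≤ A₂ := by
      obtain ⟨A₂, hA₂⟩ := (isCompact_Icc (a := (2 : ℝ)) (b := 3)).exists_bound_of_continuousOn
        (hstep.continuous_deriv (by simp)).continuousOn
      refine ⟨max A₂ 0, fun u => ?_⟩
      by_cases hu : u ∈ Set.Icc (2 : ℝ) 3
      · exact (hA₂ u hu).trans (le_max_left _ _)
      · have h0 : deriv (smoothStep 2) u = 0 := by
          rw [Set.mem_Icc, not_and_or, not_le, not_le] at hu
          rcases hu with hu | hu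
          · have h1 : smoothStep 2 =ᶠ[𝓝 u] fun _ => 0 := by
              filter_upwards [gt_mem_nhds hu] with v hv using smoothStep_of_le (le_of_lt hv)
            rw [h1.deriv_eq, deriv_const]
          · have h1 : smoothStep 2 =ᶠ[𝓝 u] fun _ => 1 := by
              filter_upwards [lt_mem_nhds hu] with v hv using smoothStep_of_ge (by linarith)
            rw [h1.deriv_eq, deriv_const]
        rw [h0, abs_zero]
        exact le_max_right _ _
    have hA₂0 : 0 ≤ A₂ := (abs_nonneg _).trans (hA₂ 0)
    obtain ⟨g, hg, hg0⟩ := C.exists_extendFun (G := fun p => smoothStep 2 p.2 * η p.1)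
      ((hstep.contMDiff.comp contMDiff_snd).mul (η.contMDiff.comp contMDiff_fst)) zero_le_two
      (fun p hp => by rw [smoothStep_of_le hp, zero_mul])
    have hstep01 : ∀ u, smoothStep 2 u ∈ Set.Icc (0 : ℝ) 1 := fun u =>
      ⟨Real.smoothTransition.nonneg _, Real.smoothTransition.le_one _⟩
    have hcases : ∀ z, z ∉ C.chart.target ∨ ∃ y u, -C.ε < u ∧ C.chart (y, u) = z := by
      intro z
      by_cases hz : z ∈ C.chart.target
      · exact Or.inr ⟨_, _, C.mem_source.1 (C.chart.map_target hz), C.chart.right_inv hz⟩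
      · exact Or.inl hz
    -- The frame is available for `u > 1` and `y` near `y₀`. The closed support of `g` stays in `u ≥
    -- 2` and over the support of `η`, again by closedness of the end.
    have hts : ∀ z ∈ tsupport g, ∃ y ∈ tsupport η, ∃ u, 2 ≤ u ∧ C.chart (y, u) = z := by
      intro z hz
      have h1 : Function.support g ⊆ C.chart '' {p | 2 ≤ p.2} := by
        intro w hw
        rcases hcases w with hw' | ⟨y, u, hu, rfl⟩
        · exact absurd (hg0 w hw') hw
        · refine ⟨(y, u), ?_, rfl⟩
          by_contra h
          refine hw ?_
          rw [hg y u hu, smoothStep_of_le (not_le.1 h).le, zero_mul]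
      obtain ⟨⟨y, u⟩, hu, rfl⟩ := closure_minimal h1 (C.isClosed_image zero_le_two) hz
      have hu' : 2 ≤ u := hu
      have hsrc := C.mem_source_of_nonneg y (zero_le_two.trans hu')
      refine ⟨y, ?_, u, hu', rfl⟩
      by_contra hy
      refine absurd hz (notMem_tsupport_iff_eventuallyEq.2 ?_)
      have h2 : ContinuousAt (fun w => (C.chart.symm w).1) (C.chart (y, u)) :=
        continuous_fst.continuousAt.comp (C.chart.symm.continuousAt (C.chart.map_source hsrc))
      have h3 : ∀ᶠ w in 𝓝 (C.chart (y, u)), (C.chart.symm w).1 ∉ tsupport η := by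
        refine h2.eventually ((isClosed_tsupport η).isOpen_compl.mem_nhds ?_)
        change (C.chart.symm (C.chart (y, u))).1 ∈ (tsupport η)ᶜ
        rw [C.chart.left_inv hsrc]
        exact hy
      filter_upwards [h3, C.chart.open_target.mem_nhds (C.chart.map_source hsrc)] with w h4 h5
      rcases hcases w with hw' | ⟨y', u', hu'', rfl⟩
      · exact hg0 w hw'
      · rw [C.chart.left_inv (C.mem_source.2 hu'')] at h4
        rw [hg y' u' hu'', image_eq_zero_of_notMem_tsupport h4, mul_zero]
        rfl
    refine ⟨g, ⟨fun z => ?_, r, e, max A (A₁ + A₂), hA.trans (le_max_left _ _), fun z => ?_,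
      fun z hz => ?_⟩, ?_⟩
    · rcases hcases z with hz | ⟨y, u, hu, rfl⟩
      · rw [hg0 z hz]
        exact ⟨le_rfl, zero_le_one⟩
      · rw [hg y u hu]
        exact ⟨mul_nonneg (hstep01 u).1 (hη4 y).1,
          mul_le_one₀ (hstep01 u).2 (hη4 y).1 (hη4 y).2⟩
    · by_cases hz : z ∈ tsupport g
      · obtain ⟨y, -, u, hu, rfl⟩ := hts z hz
        refine (C.norm_mvfderiv_le hstep η hg (by linarith : -C.ε < u)).trans ?_
        refine le_trans ?_ (le_max_right _ _)
        rw [add_comm A₁]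
        refine add_le_add ?_ ?_
        · have := mul_le_mul (hA₂ u) (abs_le.2 ⟨by linarith [(hη4 y).1], (hη4 y).2⟩ : |η y| ≤ 1)
            (abs_nonneg _) hA₂0
          rwa [mul_one] at this
        · have := mul_le_mul (abs_le.2 ⟨by linarith [(hstep01 u).1], (hstep01 u).2⟩ :
            |smoothStep 2 u| ≤ 1) (hη5 y) (ContinuousLinearMap.opNorm_nonneg _) zero_le_one
          rwa [one_mul] at this
      · rw [mvfderiv_eq_zero_of_notMem_tsupport hz, ContinuousLinearMap.opNorm_zero]
        exact hA.trans (le_max_left _ _)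
    · obtain ⟨y, hy, u, hu, rfl⟩ := hts z hz
      exact (hη2 hy u (by linarith)).mono (le_max_left _ _)
    · filter_upwards [hη1] with y hy u hu
      rw [hg y u (by linarith), hy, smoothStep_of_ge (by linarith), mul_one]
  -- functions on the core
  have hcore : ∀ z₀ : Z, ∃ g : C^∞⟮𝓡 (m + 1), Z; ℝ⟯, IsControlledFun Δ D g ∧ ∀ᶠ z in 𝓝 z₀, g z = 1 := by
    intro z₀
    obtain ⟨r, e, A, hA, he⟩ := CylEnd.exists_controlledFrame hΔ.generalized hD.smooth z₀
    obtain ⟨η, hη1, hη2, hη3, hη4⟩ := exists_smooth_bump (n := m + 1) z₀ he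
    obtain ⟨A₁, hA₁, hη5⟩ := exists_norm_mvfderiv_le η hη3
    exact ⟨η, ⟨hη4, r, e, max A A₁, hA.trans (le_max_left _ _),
      fun x => (hη5 x).trans (le_max_right _ _), fun x hx => (hη2 hx).mono (le_max_left _ _)⟩, hη1⟩
  choose gY hgY hgY1 using hend
  choose gZ hgZ hgZ1 using hcore
  -- The functions on the end equal `1` only for `u ≥ 3`; the rest of `Z` is the compact core
  -- together with a compact slab.
  have hK : IsCompact ((C.chart '' {p | 0 < p.2})ᶜ ∪ C.chart '' {p | p.2 ∈ Set.Icc (0 : ℝ) 3}) :=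
    C.isCompact_core.union (C.isCompact_image (by linarith))
  obtain ⟨S, -, hS⟩ := hK.elim_nhds_subcover (fun z₀ => {z | gZ z₀ z = 1}) fun z₀ _ => hgZ1 z₀
  obtain ⟨T, hT⟩ := CompactSpace.elim_nhds_subcover
    (fun y₀ : Y => {y | ∀ u, 3 ≤ u → gY y₀ (C.chart (y, u)) = 1}) hgY1
  -- The finite sets of centres are replaced by `Fin` types, since the index type of a cover lives
  -- in `Type`.
  refine CylEnd.exists_controlledCover (κ := Fin S.card ⊕ Fin T.card)
    (g := Sum.elim (fun i => gZ (S.equivFin.symm i)) fun i => gY (T.equivFin.symm i)) ?_ ?_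
  · rintro (i | i)
    · exact hgZ _
    · exact hgY _
  · intro z
    by_cases hz : z ∈ (C.chart '' {p | 0 < p.2})ᶜ ∪ C.chart '' {p | p.2 ∈ Set.Icc (0 : ℝ) 3}
    · obtain ⟨z₀, hz₀, h⟩ := Set.mem_iUnion₂.1 (hS hz)
      refine ⟨Sum.inl (S.equivFin ⟨z₀, hz₀⟩), ?_⟩
      rw [Sum.elim_inl, Equiv.symm_apply_apply]
      exact h
    · rw [Set.mem_union, not_or, Set.mem_compl_iff, not_not] at hz
      obtain ⟨⟨⟨y, u⟩, hu, rfl⟩, h2⟩ := hz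
      have hu' : 0 < u := hu
      have h3 : 3 ≤ u := by
        by_contra h
        exact h2 ⟨(y, u), ⟨hu'.le, (not_le.1 h).le⟩, rfl⟩
      obtain ⟨y₀, hy₀, h⟩ := Set.mem_iUnion₂.1 (hT.symm ▸ Set.mem_univ y :
        y ∈ ⋃ y₀ ∈ T, {y | ∀ u, 3 ≤ u → gY y₀ (C.chart (y, u)) = 1})
      refine ⟨Sum.inr (T.equivFin ⟨y₀, hy₀⟩), ?_⟩
      rw [Sum.elim_inr, Equiv.symm_apply_apply]
      exact h u h3

end EndCover
end
end CylEnd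

namespace CylEnd

noncomputable section

/-! ### Sectorial perturbations of symmetric operators with an energy estimate. -/

section EnergyForms

variable {H : Type*} [NormedAddCommGroup H] [InnerProductSpace ℂ H]

/-- Convergence in `H` together with the Cauchy condition for the quadratic functional `e`. -/
structure EnergyTendsto {W : Type*} [AddCommGroup W] [Module ℂ W] (ι : W →ₗ[ℂ] H) (e : W → ℝ)
    (f : ℕ → W) (ψ : H) : Prop where
  tendsto : Tendsto (fun k => ι (f k)) atTop (𝓝 ψ)
  cauchy : Tendsto (fun p : ℕ × ℕ => e (f p.1 - f p.2)) atTop (𝓝 0)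

/-- The hypotheses say that the norm of `V` is equivalent to energy plus `H`-norm. The `H`-part of
the Cauchy condition is already contained in convergence in `H`. -/
theorem formTendsto_iff_energyTendsto {V : Type*} [SeminormedAddCommGroup V]
    [InnerProductSpace ℂ V] {ι : V →ₗ[ℂ] H} {e : V → ℝ} {a : ℝ} (he : ∀ s, 0 ≤ e s)
    (h1 : ∀ s, e s ≤ a * ‖s‖ ^ 2) (h2 : ∀ s, ‖s‖ ^ 2 ≤ a * (e s + ‖ι s‖ ^ 2))
    {f : ℕ → V} {ψ : H} : FormTendsto ι f ψ ↔ EnergyTendsto ι e f ψ := by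
  constructor
  · rintro ⟨hf, hc⟩
    refine ⟨hf, ?_⟩
    rw [cauchySeq_iff_tendsto_dist_atTop_0] at hc
    have h3 : Tendsto (fun p : ℕ × ℕ => a * dist (f p.1) (f p.2) ^ 2) atTop (𝓝 0) := by
      simpa using (hc.pow 2).const_mul a
    refine squeeze_zero (fun _ => he _) (fun p => ?_) h3
    rw [dist_eq_norm]
    exact h1 _
  · rintro ⟨hf, hc⟩
    refine ⟨hf, ?_⟩
    have h3 := cauchySeq_iff_tendsto_dist_atTop_0.1 hf.cauchySeq
    have h4 : Tendsto (fun p : ℕ × ℕ => Real.sqrt (a * (e (f p.1 - f p.2)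
        + dist (ι (f p.1)) (ι (f p.2)) ^ 2))) atTop (𝓝 0) := by
      simpa using ((hc.add (h3.pow 2)).const_mul a).sqrt
    rw [cauchySeq_iff_tendsto_dist_atTop_0]
    refine squeeze_zero (fun _ => dist_nonneg) (fun p => ?_) h4
    rw [dist_eq_norm, dist_eq_norm, ← map_sub]
    exact Real.le_sqrt_of_sq_le (h2 _)

variable {W : Type*} [AddCommGroup W] [Module ℂ W] {ι : W →ₗ[ℂ] H} {A : W →ₗ[ℂ] W}
  {e : W → ℝ}

/-- The inner product `⟨s, A t⟩ + a ⟨s, t⟩` of a symmetric operator `A` bounded from below. -/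
@[reducible] def energyCore (hA : ∀ s t, inner ℂ (ι s) (ι (A t)) = inner ℂ (ι (A s)) (ι t))
    (a : ℝ) (h0 : ∀ s, 0 ≤ (inner ℂ (ι s) (ι (A s))).re + a * ‖ι s‖ ^ 2) :
    PreInnerProductSpace.Core ℂ W where
  inner s t := inner ℂ (ι s) (ι (A t)) + a * inner ℂ (ι s) (ι t)
  conj_inner_symm s t := by simp [hA t s]
  re_inner_nonneg s := by
    have := h0 s
    rw [inner_self_eq_norm_sq_to_K]
    simpa [← Complex.ofReal_pow] using this
  add_left s t r := by
    simp only [map_add, inner_add_left]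
    ring
  smul_left s t c := by
    simp only [map_smul, inner_smul_left]
    ring

/-- The form `⟨s, T t⟩` of a linear operator. -/
def operatorForm (ι : W →ₗ[ℂ] H) (T : W →ₗ[ℂ] W) : W →ₗ⋆[ℂ] W →ₗ[ℂ] ℂ :=
  LinearMap.mk₂'ₛₗ (starRingEnd ℂ) (RingHom.id ℂ) (fun s t => inner ℂ (ι s) (ι (T t)))
    (fun s t r => by rw [map_add, inner_add_left])
    (fun c s t => by rw [map_smul, inner_smul_left, smul_eq_mul])
    (fun s t r => by rw [map_add, map_add, inner_add_right])
    (fun c s t => by rw [map_smul, map_smul, inner_smul_right]; rfl)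

theorem operatorForm_apply (T : W →ₗ[ℂ] W) (s t : W) :
    operatorForm ι T s t = inner ℂ (ι s) (ι (T t)) := rfl

variable {d L N N₀ T : W →ₗ[ℂ] W} {a c : ℝ}

/-- The energy budget: `A` contributes at least `1 - c / 4`, the term `d* L d` takes away at most
`(1 - c) (1 + c / 4)`, and the first order term at most `(c / 8) (1 + c / 4)` after Young's
inequality. At least `c / 4` is left; everything else is of order zero. -/
theorem re_inner_perturbation_ge (hc : 0 < c) (hc1 : c ≤ 1)
    (hT : ∀ s t, inner ℂ (ι s) (ι (T t)) = inner ℂ (ι s) (ι (A t)) - inner ℂ (ι (d s)) (ι (L (d t)))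
      + inner ℂ (ι s) (ι (N (d t))) + inner ℂ (ι s) (ι (N₀ t)))
    (hN : ∀ s, ‖ι (N s)‖ ≤ a * ‖ι s‖) (hN₀ : ∀ s, ‖ι (N₀ s)‖ ≤ a * ‖ι s‖)
    (hL1 : ∀ s, (inner ℂ (ι s) (ι (L s))).re ≤ (1 - c) * ‖ι s‖ ^ 2) (he : ∀ s, 0 ≤ e s)
    {b : ℝ} (hb : 0 ≤ b)
    (h1 : ∀ s, |(inner ℂ (ι s) (ι (A s))).re - e s| ≤ c / 4 * e s + b * ‖ι s‖ ^ 2)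
    (h2 : ∀ s, ‖ι (d s)‖ ^ 2 ≤ (1 + c / 4) * e s + b * ‖ι s‖ ^ 2) (s : W) :
    c / 4 * e s - (3 * b + 2 * a ^ 2 / c + a) * ‖ι s‖ ^ 2 ≤ (inner ℂ (ι s) (ι (T s))).re := by
  rw [hT]
  simp only [Complex.add_re, Complex.sub_re]
  have i1 := (abs_le.1 (h1 s)).1
  have i2 := h2 s
  have i3 := hL1 (d s)
  have i4 : -(a * ‖ι s‖ * ‖ι (d s)‖) ≤ (inner ℂ (ι s) (ι (N (d s)))).re := by
    have := (abs_le.1 ((Complex.abs_re_le_norm _).trans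
      (norm_inner_le_norm (𝕜 := ℂ) (ι s) (ι (N (d s)))))).1
    nlinarith [mul_le_mul_of_nonneg_left (hN (d s)) (norm_nonneg (ι s))]
  have i5 : -(a * ‖ι s‖ ^ 2) ≤ (inner ℂ (ι s) (ι (N₀ s))).re := by
    have := (abs_le.1 ((Complex.abs_re_le_norm _).trans
      (norm_inner_le_norm (𝕜 := ℂ) (ι s) (ι (N₀ s))))).1
    nlinarith [mul_le_mul_of_nonneg_left (hN₀ s) (norm_nonneg (ι s))]
  -- Young's inequality with weight `c / 8` on `‖d s‖²`, small enough not to exhaust the margin `c`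
  -- of the second order term.
  have i6 : a * ‖ι s‖ * ‖ι (d s)‖ ≤ c / 8 * ‖ι (d s)‖ ^ 2 + 2 * a ^ 2 / c * ‖ι s‖ ^ 2 := by
    have h : c / 8 * ‖ι (d s)‖ ^ 2 + 2 * a ^ 2 / c * ‖ι s‖ ^ 2 - a * ‖ι s‖ * ‖ι (d s)‖
        = c / 8 * (‖ι (d s)‖ - 4 * a / c * ‖ι s‖) ^ 2 := by
      field_simp
      ring
    have := mul_nonneg (by positivity : 0 ≤ c / 8) (sq_nonneg (‖ι (d s)‖ - 4 * a / c * ‖ι s‖))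
    linarith
  have i7 : (1 - c + c / 8) * ‖ι (d s)‖ ^ 2
      ≤ (1 - c + c / 8) * ((1 + c / 4) * e s + b * ‖ι s‖ ^ 2) :=
    mul_le_mul_of_nonneg_left i2 (by linarith)
  have i8 : (1 - c + c / 8) * (1 + c / 4) ≤ 1 - c / 2 := by nlinarith
  have i9 := mul_le_mul_of_nonneg_right i8 (he s)
  have i10 : (1 - c + c / 8) * (b * ‖ι s‖ ^ 2) ≤ 2 * (b * ‖ι s‖ ^ 2) :=
    mul_le_mul_of_nonneg_right (by linarith) (by positivity)
  nlinarith

/-- A symmetric operator `A` with an energy estimate, perturbed by a second order term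
`d* L d` with `Re L ≤ 1 - c` and by terms of first order, defines a closed sectorial form. -/
theorem exists_strictlyMAccretive_form (hι : DenseRange ι) (ha : 0 ≤ a) (hc : 0 < c) (hc1 : c ≤ 1)
    (hA : ∀ s t, inner ℂ (ι s) (ι (A t)) = inner ℂ (ι (A s)) (ι t))
    (hT : ∀ s t, inner ℂ (ι s) (ι (T t)) = inner ℂ (ι s) (ι (A t)) - inner ℂ (ι (d s)) (ι (L (d t)))
      + inner ℂ (ι s) (ι (N (d t))) + inner ℂ (ι s) (ι (N₀ t)))
    (hL : ∀ s, ‖ι (L s)‖ ≤ a * ‖ι s‖) (hN : ∀ s, ‖ι (N s)‖ ≤ a * ‖ι s‖)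
    (hN₀ : ∀ s, ‖ι (N₀ s)‖ ≤ a * ‖ι s‖)
    (hL1 : ∀ s, (inner ℂ (ι s) (ι (L s))).re ≤ (1 - c) * ‖ι s‖ ^ 2) (he : ∀ s, 0 ≤ e s)
    (h1 : ∀ δ > 0, ∃ b ≥ 0, ∀ s,
      |(inner ℂ (ι s) (ι (A s))).re - e s| ≤ δ * e s + b * ‖ι s‖ ^ 2)
    (h2 : ∀ δ > 0, ∃ b ≥ 0, ∀ s, ‖ι (d s)‖ ^ 2 ≤ (1 + δ) * e s + b * ‖ι s‖ ^ 2) :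
    ∃ q : SesqForm H, (∀ ψ, ψ ∈ q.domain ↔ ∃ f, EnergyTendsto ι e f ψ) ∧
      (∀ (f g : ℕ → W) (η ψ : q.domain), EnergyTendsto ι e f η → EnergyTendsto ι e g ψ →
        Tendsto (fun k => inner ℂ (ι (f k)) (ι (T (g k)))) atTop (𝓝 (q.toFun η ψ))) ∧
      ∃ γ : ℝ, 0 < γ ∧ (q.affine 1 γ).IsStrictlyMAccretive := by
  -- Two uses of the estimates: the fixed accuracies `1 / 2` and `1` only compare norms, while `c /
  -- 4` gives the coercivity of the perturbed form.
  obtain ⟨b₁, hb₁, hA1⟩ := h1 (1 / 2) (by norm_num)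
  obtain ⟨b₂, hb₂, hd1⟩ := h2 1 one_pos
  obtain ⟨b₃, hb₃, hA3⟩ := h1 (c / 4) (by positivity)
  obtain ⟨b₄, hb₄, hd3⟩ := h2 (c / 4) (by positivity)
  have hlow : ∀ s, 1 / 2 * e s + ‖ι s‖ ^ 2
      ≤ (inner ℂ (ι s) (ι (A s))).re + (b₁ + 1) * ‖ι s‖ ^ 2 := fun s => by
    have := (abs_le.1 (hA1 s)).1
    linarith
  have hup : ∀ s, (inner ℂ (ι s) (ι (A s))).re + (b₁ + 1) * ‖ι s‖ ^ 2
      ≤ 3 / 2 * e s + (2 * b₁ + 1) * ‖ι s‖ ^ 2 := fun s => by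
    have := (abs_le.1 (hA1 s)).2
    linarith
  have h0 : ∀ s, 0 ≤ (inner ℂ (ι s) (ι (A s))).re + (b₁ + 1) * ‖ι s‖ ^ 2 := fun s =>
    (by have := he s; positivity : 0 ≤ 1 / 2 * e s + ‖ι s‖ ^ 2).trans (hlow s)
  -- The shift `b₁ + 1` makes the quadratic form of `A` at least half the energy plus `‖ι s‖²`, so
  -- it defines a semi-inner product equivalent to energy plus `H`-norm.
  let _ : SeminormedAddCommGroup W :=
    @InnerProductSpace.Core.toSeminormedAddCommGroup ℂ _ _ _ _ (energyCore hA (b₁ + 1) h0)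
  let _ : InnerProductSpace ℂ W := InnerProductSpace.ofCore (energyCore hA (b₁ + 1) h0)
  have hinner : ∀ s t : W, (inner ℂ s t : ℂ)
      = inner ℂ (ι s) (ι (A t)) + (b₁ + 1 : ℝ) * inner ℂ (ι s) (ι t) := fun s t => rfl
  have hnorm : ∀ s : W, ‖s‖ ^ 2 = (inner ℂ (ι s) (ι (A s))).re + (b₁ + 1) * ‖ι s‖ ^ 2 := by
    intro s
    have h : ((‖s‖ : ℂ) ^ 2).re
        = (inner ℂ (ι s) (ι (A s)) + (b₁ + 1 : ℝ) * inner ℂ (ι s) (ι s) : ℂ).re := by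
      rw [← hinner, inner_self_eq_norm_sq_to_K]
      rfl
    rw [inner_self_eq_norm_sq_to_K (𝕜 := ℂ) (ι s), Complex.add_re] at h
    simpa [← Complex.ofReal_pow] using h
  have hlow' : ∀ s, 1 / 2 * e s + ‖ι s‖ ^ 2 ≤ ‖s‖ ^ 2 := fun s => by rw [hnorm]; exact hlow s
  have hup' : ∀ s, ‖s‖ ^ 2 ≤ 3 / 2 * e s + (2 * b₁ + 1) * ‖ι s‖ ^ 2 := fun s => by
    rw [hnorm]; exact hup s
  have hιle : ∀ s, ‖ι s‖ ≤ ‖s‖ := fun s =>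
    le_of_sq_le_sq (by have := hlow' s; have := he s; linarith) (norm_nonneg _)
  -- From `‖d s‖² ≤ 2 e + b₂ ‖ι s‖²` and `e ≤ 2 ‖s‖²` one gets `(4 + b₂) ‖s‖²`; replacing the
  -- constant by its square avoids a square root.
  have hdle : ∀ s, ‖ι (d s)‖ ≤ (4 + b₂) * ‖s‖ := fun s => by
    refine le_of_sq_le_sq ?_ (by positivity)
    have i1 := hd1 s
    have i2 := hlow' s
    have i3 : b₂ * ‖ι s‖ ^ 2 ≤ b₂ * ‖s‖ ^ 2 := by gcongr; exact hιle s
    nlinarith [sq_nonneg ‖s‖, sq_nonneg ‖ι s‖, mul_nonneg hb₂ (sq_nonneg ‖s‖),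
      mul_nonneg (mul_nonneg hb₂ hb₂) (sq_nonneg ‖s‖)]
  set M : ℝ := 1 + (b₁ + 1) + a * (4 + b₂) ^ 2 + a * (4 + b₂) + a with hM
  have hM0 : 0 ≤ M := by positivity
  have hb : ∀ s t, ‖operatorForm ι T s t‖ ≤ M * ‖s‖ * ‖t‖ := by
    intro s t
    have i0 : ‖(inner ℂ (ι s) (ι (A t)) : ℂ)‖ ≤ ‖s‖ * ‖t‖ + (b₁ + 1) * (‖s‖ * ‖t‖) := by
      have h : (inner ℂ (ι s) (ι (A t)) : ℂ)
          = inner ℂ s t - (b₁ + 1 : ℝ) * inner ℂ (ι s) (ι t) := by rw [hinner]; ring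
      rw [h]
      refine (norm_sub_le _ _).trans (add_le_add (norm_inner_le_norm _ _) ?_)
      rw [norm_mul, Complex.norm_real, Real.norm_of_nonneg (by positivity)]
      gcongr
      exact (norm_inner_le_norm _ _).trans
        (mul_le_mul (hιle s) (hιle t) (norm_nonneg _) (norm_nonneg _))
    have i1 : ‖(inner ℂ (ι (d s)) (ι (L (d t))) : ℂ)‖ ≤ a * (4 + b₂) ^ 2 * (‖s‖ * ‖t‖) := by
      refine (norm_inner_le_norm _ _).trans ?_
      calc _ ≤ ((4 + b₂) * ‖s‖) * (a * ((4 + b₂) * ‖t‖)) := by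
            refine mul_le_mul (hdle s) ((hL _).trans ?_) (norm_nonneg _) (by positivity)
            gcongr
            exact hdle t
        _ = _ := by ring
    have i2 : ‖(inner ℂ (ι s) (ι (N (d t))) : ℂ)‖ ≤ a * (4 + b₂) * (‖s‖ * ‖t‖) := by
      refine (norm_inner_le_norm _ _).trans ?_
      calc _ ≤ ‖s‖ * (a * ((4 + b₂) * ‖t‖)) := by
            refine mul_le_mul (hιle s) ((hN _).trans ?_) (norm_nonneg _) (by positivity)
            gcongr
            exact hdle t
        _ = _ := by ring
    have i3 : ‖(inner ℂ (ι s) (ι (N₀ t)) : ℂ)‖ ≤ a * (‖s‖ * ‖t‖) := by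
      refine (norm_inner_le_norm _ _).trans ?_
      calc _ ≤ ‖s‖ * (a * ‖t‖) := by
            refine mul_le_mul (hιle s) ((hN₀ _).trans ?_) (norm_nonneg _) (by positivity)
            gcongr
            exact hιle t
        _ = _ := by ring
    rw [operatorForm_apply, hT]
    refine ((norm_add_le _ _).trans (add_le_add_left ((norm_add_le _ _).trans
      (add_le_add_left (norm_sub_le _ _) _)) _)).trans ?_
    calc _ ≤ (‖s‖ * ‖t‖ + (b₁ + 1) * (‖s‖ * ‖t‖)) + a * (4 + b₂) ^ 2 * (‖s‖ * ‖t‖)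
          + a * (4 + b₂) * (‖s‖ * ‖t‖) + a * (‖s‖ * ‖t‖) := by gcongr
      _ = _ := by rw [hM]; ring
  -- The Friedrichs hypothesis: the inner product with `t` is represented in `H` by `A t + (b₁ + 1)
  -- t`.
  have hF : ∀ t : W, ∃ τ : H, ∀ s : W, inner ℂ s t = inner ℂ (ι s) τ := fun t =>
    ⟨ι (A t) + ((b₁ + 1 : ℝ) : ℂ) • ι t, fun s => by
      rw [hinner, inner_add_right, inner_smul_right]⟩
  have hcv : ∀ {f : ℕ → W} {ψ : H}, FormTendsto ι f ψ ↔ EnergyTendsto ι e f ψ := by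
    intro f ψ
    refine formTendsto_iff_energyTendsto (a := 2 * b₁ + 2) he (fun s => ?_) (fun s => ?_)
    · have := hlow' s
      nlinarith [sq_nonneg ‖ι s‖, mul_nonneg hb₁ (sq_nonneg ‖s‖)]
    · have := hup' s
      nlinarith [sq_nonneg ‖ι s‖, mul_nonneg hb₁ (he s), he s]
  set G : ℝ := 3 * max b₃ b₄ + 2 * a ^ 2 / c + a with hG
  -- Since `‖s‖²` is at most `3 / 2` of the energy plus order zero, `c / 8` of it uses only `3 c /
  -- 16` of the available `c / 4`.
  have hco : ∀ s, c / 8 * ‖s‖ ^ 2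
      ≤ (operatorForm ι T s s).re + (G + c / 8 * (2 * b₁ + 1) + 1) * ‖ι s‖ ^ 2 := by
    intro s
    have h := re_inner_perturbation_ge (b := max b₃ b₄) hc hc1 hT hN hN₀ hL1 he
      (hb₃.trans (le_max_left _ _))
      (fun s => (hA3 s).trans (by gcongr; exact le_max_left _ _))
      (fun s => (hd3 s).trans (by gcongr; exact le_max_right _ _)) s
    rw [operatorForm_apply]
    have := mul_le_mul_of_nonneg_left (hup' s) (by positivity : 0 ≤ c / 8)
    nlinarith [sq_nonneg ‖ι s‖, mul_nonneg hc.le (he s)]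
  have hG0 : 0 ≤ G := by
    have : 0 ≤ max b₃ b₄ := hb₃.trans (le_max_left _ _)
    positivity
  refine ⟨extendForm hb hF, fun ψ => exists_congr fun f => hcv, fun f g η ψ hf hg =>
    extendForm_tendsto hb hF (hcv.2 hf) (hcv.2 hg), _, ?_,
    extendForm_isStrictlyMAccretive hb hM0 hF hιle hι ?_ (by positivity : 0 < c / 8) hco⟩
  · positivity
  · positivity

end EnergyForms

end
end CylEnd

namespace CylEnd

noncomputable section

/-! ### Coefficients of the dilated Laplacian and the role of `Γ`. -/

section Coefficients

theorem exists_norm_le_of_eventually_const {f : ℝ → ℂ} (hf : Continuous f) {K R : ℝ} {x y : ℂ}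
    (hK : ∀ u < K, f u = x) (hR : ∀ u, R < u → f u = y) : ∃ M, ∀ u, ‖f u‖ ≤ M := by
  obtain ⟨M, hM⟩ := (isCompact_Icc (a := K) (b := R)).exists_bound_of_continuousOn hf.continuousOn
  refine ⟨max M (max ‖x‖ ‖y‖), fun u => ?_⟩
  rcases lt_or_ge u K with h1 | h1
  · rw [hK u h1]
    exact (le_max_left _ _).trans (le_max_right _ _)
  rcases lt_or_ge R u with h2 | h2
  · rw [hR u h2]
    exact (le_max_right _ _).trans (le_max_right _ _)
  · exact (hM u ⟨h1, h2⟩).trans (le_max_left _ _)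

variable {K R : ℝ} {φ : ℝ → ℝ} {θ : ℂ}

/-- A cut-off is not prescribed for `u ≤ 0`, where it may be negative. It vanishes on `(0, K)`, so
setting it to zero there keeps it smooth, and the operator, which involves only `u > 0`, does not
change. -/
theorem IsCutoff.exists_truncation (hφ : IsCutoff K R φ) :
    ∃ χ, IsCutoff K R χ ∧ (∀ u < K, χ u = 0) ∧ ∀ u, 0 < u → χ u = φ u := by
  let χ : ℝ → ℝ := fun u => if 0 < u then φ u else 0
  have h1 : ∀ u, 0 < u → χ u = φ u := fun u hu => if_pos hu
  have h2 : ∀ u < K, χ u = 0 := fun u hu => by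
    by_cases h : 0 < u
    · rw [h1 u h, hφ.eq_zero u h hu]
    · exact if_neg h
  have e1 : ∀ u, 0 < u → χ =ᶠ[𝓝 u] φ := fun u hu => by
    filter_upwards [lt_mem_nhds hu] with v hv using h1 v hv
  have e2 : ∀ u < K, χ =ᶠ[𝓝 u] fun _ => 0 := fun u hu => by
    filter_upwards [gt_mem_nhds hu] with v hv using h2 v hv
  refine ⟨χ, ⟨hφ.K_pos, hφ.K_lt_R, ?_, fun u => ?_, fun u _ h => h2 u h, fun u hu => ?_⟩, h2, h1⟩
  · rw [contDiff_iff_contDiffAt]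
    intro u
    rcases lt_or_ge 0 u with h | h
    · exact hφ.contDiff.contDiffAt.congr_of_eventuallyEq (e1 u h)
    · exact contDiffAt_const.congr_of_eventuallyEq (e2 u (h.trans_lt hφ.K_pos))
  · rcases lt_or_ge 0 u with h | h
    · rw [(e1 u h).deriv_eq]
      exact hφ.deriv_nonneg u
    · rw [(e2 u (h.trans_lt hφ.K_pos)).deriv_eq, deriv_const]
  · rw [h1 u ((hφ.K_pos.trans hφ.K_lt_R).trans hu), hφ.eq_one u hu]

theorem iteratedDeriv_ψ_congr {χ : ℝ → ℝ} {u : ℝ} (h : χ =ᶠ[𝓝 u] φ) (k : ℕ) :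
    iteratedDeriv k (ψ χ θ) u = iteratedDeriv k (ψ φ θ) u := by
  refine Filter.EventuallyEq.iteratedDeriv_eq k ?_
  filter_upwards [h] with v hv
  rw [ψ, ψ, hv]

theorem ψ_derivs_congr {χ : ℝ → ℝ} {u : ℝ} (h : χ =ᶠ[𝓝 u] φ) :
    ψ₁ χ θ u = ψ₁ φ θ u ∧ ψ₂ χ θ u = ψ₂ φ θ u ∧ ψ₃ χ θ u = ψ₃ φ θ u := by
  refine ⟨?_, iteratedDeriv_ψ_congr h 2, iteratedDeriv_ψ_congr h 3⟩
  have h1 := iteratedDeriv_ψ_congr (θ := θ) h 1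
  rw [iteratedDeriv_one, iteratedDeriv_one] at h1
  exact h1

theorem coefficients_congr {χ : ℝ → ℝ} {u : ℝ} (h : χ =ᶠ[𝓝 u] φ) :
    a₂ χ θ u = a₂ φ θ u ∧ a₁ χ θ u = a₁ φ θ u ∧ a₀ χ θ u = a₀ φ θ u := by
  obtain ⟨h1, h2, h3⟩ := ψ_derivs_congr (θ := θ) h
  simp only [a₂, a₁, a₀, α₁, α₂, h1, h2, h3, and_self]

theorem ψ_derivs_const (r : ℝ) (u : ℝ) :
    ψ₁ (fun _ => r) θ u = r * θ + 1 ∧ ψ₂ (fun _ => r) θ u = 0 ∧ ψ₃ (fun _ => r) θ u = 0 := by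
  have h1 : deriv (ψ (fun _ => r) θ) = fun _ => (r * θ + 1 : ℂ) := by
    funext v
    have h : HasDerivAt (ψ (fun _ => r) θ) ((r * θ + 1) * ((1 : ℝ) : ℂ)) v :=
      ((hasDerivAt_id v).ofReal_comp).const_mul (r * θ + 1 : ℂ)
    simpa using h.deriv
  have h2 : iteratedDeriv 2 (ψ (fun _ => r) θ) = fun _ => 0 := by
    rw [iteratedDeriv_succ, iteratedDeriv_one, h1]
    simp
  refine ⟨congrFun h1 u, congrFun h2 u, ?_⟩
  rw [ψ₃, iteratedDeriv_succ, h2, deriv_const]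

theorem coefficients_const (r : ℝ) (u : ℝ) :
    a₂ (fun _ => r) θ u = -(r * θ + 1)⁻¹ ^ 2 ∧ a₁ (fun _ => r) θ u = 0 ∧
      a₀ (fun _ => r) θ u = 0 := by
  obtain ⟨h1, h2, h3⟩ := ψ_derivs_const (θ := θ) r u
  simp only [a₂, a₁, a₀, α₁, α₂, h1, h2, h3]
  refine ⟨trivial, by simp, by simp⟩

theorem contDiff_ψ (hφ : ContDiff ℝ ∞ φ) : ContDiff ℝ ∞ (ψ φ θ) :=
  (((Complex.ofRealCLM.contDiff.comp hφ).mul contDiff_const).add contDiff_const).mul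
    Complex.ofRealCLM.contDiff

theorem contDiff_deriv {G : Type*} [NormedAddCommGroup G] [NormedSpace ℝ G] {f : ℝ → G}
    (hf : ContDiff ℝ ∞ f) : ContDiff ℝ ∞ (deriv f) :=
  (contDiff_infty_iff_deriv.1 hf).2

theorem contDiff_iteratedDeriv {G : Type*} [NormedAddCommGroup G] [NormedSpace ℝ G] {f : ℝ → G}
    (hf : ContDiff ℝ ∞ f) (k : ℕ) : ContDiff ℝ ∞ (iteratedDeriv k f) := by
  induction k with
  | zero => simpa using hf
  | succ k ih =>
    rw [iteratedDeriv_succ]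
    exact contDiff_deriv ih

theorem contDiff_coefficients (hφ : ContDiff ℝ ∞ φ) (h : ∀ u, ψ₁ φ θ u ≠ 0) :
    ContDiff ℝ ∞ (a₂ φ θ) ∧ ContDiff ℝ ∞ (a₁ φ θ) ∧ ContDiff ℝ ∞ (a₀ φ θ) := by
  have h1 : ContDiff ℝ ∞ (ψ₁ φ θ) := contDiff_deriv (contDiff_ψ hφ)
  have h2 : ContDiff ℝ ∞ (ψ₂ φ θ) := contDiff_iteratedDeriv (contDiff_ψ hφ) 2
  have h3 : ContDiff ℝ ∞ (ψ₃ φ θ) := contDiff_iteratedDeriv (contDiff_ψ hφ) 3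
  have hi : ContDiff ℝ ∞ fun u => (ψ₁ φ θ u)⁻¹ := h1.inv h
  have hα₁ : ContDiff ℝ ∞ (α₁ φ θ) := hi
  have hα₂ : ContDiff ℝ ∞ (α₂ φ θ) := by
    have h4 := h2.neg.mul ((h1.pow 3).inv fun u => pow_ne_zero 3 (h u))
    have h5 : α₂ φ θ = fun u => -ψ₂ φ θ u * (ψ₁ φ θ u ^ 3)⁻¹ := funext fun u => div_eq_mul_inv _ _
    rw [h5]
    exact h4
  exact ⟨(hα₁.pow 2).neg, hα₂.neg.add ((hi.mul h2).mul (hα₁.pow 2)),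
    ((((contDiff_const.mul (hi.pow 2)).mul (h2.pow 2)).mul (hα₁.pow 2)).add
      (((contDiff_const.mul hi).mul h3).mul (hα₁.pow 2))).add
      (((contDiff_const.mul hi).mul h2).mul hα₂)⟩

theorem ψ₁_eq (hφ : ContDiff ℝ ∞ φ) (u : ℝ) :
    ψ₁ φ θ u = 1 + θ * ((φ u + u * deriv φ u : ℝ) : ℂ) := by
  have h1 : HasDerivAt φ (deriv φ u) u := (hφ.differentiable (by simp) u).hasDerivAt
  have h2 := ((h1.ofReal_comp.mul_const θ).add_const 1).mul (Complex.ofRealCLM.hasDerivAt (x := u))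
  have h3 : ψ₁ φ θ u = _ := h2.deriv
  rw [h3]
  simp
  ring

/-- Here `ψ_θ' = 1 + θ w` with `w = φ + u φ' ≥ 0`, because `φ` is nonnegative and nondecreasing for
`u > 0`. In `Re (1 + θ w)² = 1 + 2 w Re θ + w² ((Re θ)² - (Im θ)²)` both corrections are
nonnegative, by `Re θ > 0` and `|Im θ| ≤ Re θ`. -/
theorem IsCutoff.one_le_re_sq (hφ : IsCutoff K R φ) (h0 : ∀ u < K, φ u = 0) (hθ : θ ∈ Γ) (u : ℝ) :
    1 ≤ (ψ₁ φ θ u ^ 2).re := by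
  have hw : 0 ≤ φ u + u * deriv φ u := by
    rcases lt_or_ge 0 u with h | h
    · have hm : Monotone φ :=
        monotone_of_deriv_nonneg (hφ.contDiff.differentiable (by simp)) hφ.deriv_nonneg
      have h1 := hm h.le
      rw [h0 0 hφ.K_pos] at h1
      have := mul_nonneg h.le (hφ.deriv_nonneg u)
      linarith
    · have h1 : φ =ᶠ[𝓝 u] fun _ => 0 := by
        filter_upwards [gt_mem_nhds (h.trans_lt hφ.K_pos)] with v hv using h0 v hv
      rw [h1.eq_of_nhds, h1.deriv_eq]
      simp
  rw [ψ₁_eq hφ.contDiff]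
  set w := φ u + u * deriv φ u
  obtain ⟨h1, h2, -⟩ := hθ
  have h3 : θ.im ^ 2 ≤ θ.re ^ 2 := sq_le_sq' (by linarith [neg_abs_le θ.im]) ((le_abs_self _).trans h2)
  have h4 : ((1 + θ * (w : ℂ)) ^ 2).re = 1 + 2 * (θ.re * w) + (θ.re ^ 2 - θ.im ^ 2) * w ^ 2 := by
    simp [pow_two]
    ring
  rw [h4]
  have := mul_nonneg h1.le hw
  have := mul_nonneg (sub_nonneg.2 h3) (sq_nonneg w)
  linarith

/-- The coefficients of `Δ_θ - Δ` extend smoothly by zero to the real line. -/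
theorem IsCutoff.exists_coefficients (hφ : IsCutoff K R φ) (hθ : θ ∈ Γ) :
    ∃ c₂ c₁ c₀ : ℝ → ℂ, (ContDiff ℝ ∞ c₂ ∧ ContDiff ℝ ∞ c₁ ∧ ContDiff ℝ ∞ c₀) ∧
      (∀ u < K, c₂ u = 0 ∧ c₁ u = 0 ∧ c₀ u = 0) ∧
      (∀ u, 0 < u → c₂ u = a₂ φ θ u + 1 ∧ c₁ u = a₁ φ θ u ∧ c₀ u = a₀ φ θ u) ∧
      (∃ a : ℝ, ∀ u, ‖c₂ u‖ ≤ a ∧ ‖c₁ u‖ ≤ a ∧ ‖c₀ u‖ ≤ a ∧ ‖deriv c₂ u‖ ≤ a) ∧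
      ∃ c : ℝ, 0 < c ∧ c ≤ 1 ∧ ∀ u, (c₂ u).re ≤ 1 - c := by
  obtain ⟨χ, hχ, h0, hχφ⟩ := hφ.exists_truncation
  have hre := hχ.one_le_re_sq h0 hθ
  have hne : ∀ u, ψ₁ χ θ u ≠ 0 := fun u h => by
    have := hre u
    rw [h] at this
    norm_num at this
  obtain ⟨s2, s1, s0⟩ := contDiff_coefficients (θ := θ) hχ.contDiff hne
  have eK : ∀ u < K, χ =ᶠ[𝓝 u] fun _ => 0 := fun u hu => by
    filter_upwards [gt_mem_nhds hu] with v hv using h0 v hv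
  have eR : ∀ u, R < u → χ =ᶠ[𝓝 u] fun _ => 1 := fun u hu => by
    filter_upwards [lt_mem_nhds hu] with v hv using hχ.eq_one v hv
  have eφ : ∀ u, 0 < u → χ =ᶠ[𝓝 u] φ := fun u hu => by
    filter_upwards [lt_mem_nhds hu] with v hv using hχφ v hv
  have cK : ∀ u < K, a₂ χ θ u + 1 = 0 ∧ a₁ χ θ u = 0 ∧ a₀ χ θ u = 0 := fun u hu => by
    obtain ⟨h1, h2, h3⟩ := coefficients_congr (θ := θ) (eK u hu)
    obtain ⟨k1, k2, k3⟩ := coefficients_const (θ := θ) 0 u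
    rw [h1, h2, h3, k1, k2, k3]
    simp
  have cR : ∀ u, R < u → a₂ χ θ u + 1 = -(θ + 1)⁻¹ ^ 2 + 1 ∧ a₁ χ θ u = 0 ∧ a₀ χ θ u = 0 :=
    fun u hu => by
      obtain ⟨h1, h2, h3⟩ := coefficients_congr (θ := θ) (eR u hu)
      obtain ⟨k1, k2, k3⟩ := coefficients_const (θ := θ) 1 u
      rw [h1, h2, h3, k1, k2, k3]
      simp
  have s2' : ContDiff ℝ ∞ fun u => a₂ χ θ u + 1 := s2.add contDiff_const
  -- The coefficients are constant on both sides of the compact interval `[K, R]`, hence bounded.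
  obtain ⟨m₂, hm₂⟩ := exists_norm_le_of_eventually_const s2'.continuous
    (fun u hu => (cK u hu).1) (fun u hu => (cR u hu).1)
  obtain ⟨m₁, hm₁⟩ := exists_norm_le_of_eventually_const s1.continuous
    (fun u hu => (cK u hu).2.1) (fun u hu => (cR u hu).2.1)
  obtain ⟨m₀, hm₀⟩ := exists_norm_le_of_eventually_const s0.continuous
    (fun u hu => (cK u hu).2.2) (fun u hu => (cR u hu).2.2)
  obtain ⟨m₃, hm₃⟩ := exists_norm_le_of_eventually_const (contDiff_deriv s2').continuous
    (K := K) (R := R) (x := 0) (y := 0)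
    (fun u hu => by
      have h : (fun u => a₂ χ θ u + 1) =ᶠ[𝓝 u] fun _ => 0 := by
        filter_upwards [gt_mem_nhds hu] with v hv using (cK v hv).1
      rw [h.deriv_eq, deriv_const])
    (fun u hu => by
      have h : (fun u => a₂ χ θ u + 1) =ᶠ[𝓝 u] fun _ => -(θ + 1)⁻¹ ^ 2 + 1 := by
        filter_upwards [lt_mem_nhds hu] with v hv using (cR v hv).1
      rw [h.deriv_eq, deriv_const])
  obtain ⟨M, hM⟩ := exists_norm_le_of_eventually_const
    (f := ψ₁ χ θ) (contDiff_deriv (contDiff_ψ hχ.contDiff)).continuous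
    (K := K) (R := R) (x := 1) (y := θ + 1)
    (fun u hu => by
      rw [(ψ_derivs_congr (eK u hu)).1, (ψ_derivs_const 0 u).1]
      simp)
    (fun u hu => by
      rw [(ψ_derivs_congr (eR u hu)).1, (ψ_derivs_const 1 u).1]
      simp)
  refine ⟨fun u => a₂ χ θ u + 1, a₁ χ θ, a₀ χ θ, ⟨s2', s1, s0⟩, cK, fun u hu => ?_,
    ⟨max (max m₂ m₁) (max m₀ m₃), fun u => ⟨?_, ?_, ?_, ?_⟩⟩,
    (max M 1 ^ 4)⁻¹, by positivity, ?_, fun u => ?_⟩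
  · obtain ⟨h1, h2, h3⟩ := coefficients_congr (θ := θ) (eφ u hu)
    exact ⟨congrArg (· + 1) h1, h2, h3⟩
  · exact (hm₂ u).trans ((le_max_left _ _).trans (le_max_left _ _))
  · exact (hm₁ u).trans ((le_max_right _ _).trans (le_max_left _ _))
  · exact (hm₀ u).trans ((le_max_left _ _).trans (le_max_right _ _))
  · exact (hm₃ u).trans ((le_max_right _ _).trans (le_max_right _ _))
  · exact inv_le_one_of_one_le₀ (one_le_pow₀ (le_max_right _ _))
  -- Since `Re (z⁻²) = Re (z²) / |z|⁴`, the bounds `Re (ψ_θ')² ≥ 1` and `|ψ_θ'| ≤ M` give a uniform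
  -- positive lower bound.
  · have h1 : (max M 1 ^ 4)⁻¹ ≤ ((ψ₁ χ θ u)⁻¹ ^ 2).re := by
      rw [inv_pow, Complex.inv_re, map_pow]
      have hp : 0 < Complex.normSq (ψ₁ χ θ u) := Complex.normSq_pos.2 (hne u)
      have h3 : Complex.normSq (ψ₁ χ θ u) ^ 2 ≤ max M 1 ^ 4 := by
        rw [Complex.normSq_eq_norm_sq, ← pow_mul]
        exact pow_le_pow_left₀ (norm_nonneg _) ((hM u).trans (le_max_left _ _)) _
      rw [← one_div]
      exact div_le_div₀ (zero_le_one.trans (hre u)) (hre u) (by positivity) h3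
    simp only [a₂, α₁, Complex.add_re, Complex.neg_re, Complex.one_re]
    linarith

end Coefficients

end
end CylEnd

namespace CylEnd

noncomputable section

attribute [local instance] tangentTotalSpace

/-! ### The operator `f' ∂_u` and multiplication by coefficients on the end. -/

section EndOperators

variable {m : ℕ}
  {Z : Type*} [TopologicalSpace Z] [T2Space Z] [MeasurableSpace Z]
  [ChartedSpace (EuclideanSpace ℝ (Fin (m + 1))) Z] [IsManifold (𝓡 (m + 1)) ∞ Z]
  [RiemannianBundle (fun z : Z => TangentSpace (𝓡 (m + 1)) z)]
  [IsContinuousRiemannianBundle (EuclideanSpace ℝ (Fin (m + 1)))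
    (fun z : Z => TangentSpace (𝓡 (m + 1)) z)]
  {Y : Type*} [TopologicalSpace Y] [T2Space Y] [CompactSpace Y]
  [ChartedSpace (EuclideanSpace ℝ (Fin m)) Y] [IsManifold (𝓡 m) ∞ Y]
  [RiemannianBundle (fun y : Y => TangentSpace (𝓡 m) y)]
  [IsContinuousRiemannianBundle (EuclideanSpace ℝ (Fin m)) (fun y : Y => TangentSpace (𝓡 m) y)]

/-- Smooth functions of `u` vanishing for `u ≤ 0`. -/
structure EndCoefficient where
  toFun : ℝ → ℂ
  contDiff : ContDiff ℝ ∞ toFun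
  eq_zero : ∀ u ≤ 0, toFun u = 0

/-- The derivative of a coefficient. -/
def EndCoefficient.derivative (c : EndCoefficient) : EndCoefficient where
  toFun := deriv c.toFun
  contDiff := contDiff_deriv c.contDiff
  -- For `u < 0` the function vanishes near `u`; the point `u = 0` is reached by continuity of the
  -- derivative.
  eq_zero := by
    have h1 : IsClosed {u | deriv c.toFun u = 0} :=
      isClosed_eq (contDiff_deriv c.contDiff).continuous continuous_const
    have h2 : Set.Iio (0 : ℝ) ⊆ {u | deriv c.toFun u = 0} := fun u hu => by
      have h : c.toFun =ᶠ[𝓝 u] fun _ => 0 := by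
        filter_upwards [gt_mem_nhds (Set.mem_Iio.1 hu)] with v hv using c.eq_zero v hv.le
      exact h.deriv_eq.trans (deriv_const _ _)
    have h3 := h1.closure_subset_iff.2 h2
    rw [closure_Iio] at h3
    exact fun u hu => h3 hu

theorem EndCoefficient.hasDerivAt (c : EndCoefficient) (u : ℝ) :
    HasDerivAt c.toFun (c.derivative.toFun u) u :=
  (c.contDiff.differentiable (by simp) u).hasDerivAt

section Lift

variable (C : CylindricalEnd m Z Y)

open Classical in
/-- A coefficient as a function on `Z`. -/
def CylindricalEnd.lift (c : EndCoefficient) (z : Z) : ℂ :=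
  if z ∈ C.chart.target then c.toFun (C.chart.symm z).2 else 0

theorem CylindricalEnd.lift_chart (c : EndCoefficient) {y : Y} {u : ℝ} (hu : -C.ε < u) :
    C.lift c (C.chart (y, u)) = c.toFun u := by
  have hp := C.mem_source (y := y).2 hu
  rw [CylindricalEnd.lift, if_pos (C.chart.map_source hp), C.chart.left_inv hp]

theorem CylindricalEnd.lift_of_notMem (c : EndCoefficient) {z : Z}
    (hz : ¬ (z ∈ C.chart.target ∧ 0 < (C.chart.symm z).2)) : C.lift c z = 0 := by
  rw [CylindricalEnd.lift]
  split_ifs with h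
  · exact c.eq_zero _ (not_lt.1 fun h1 => hz ⟨h, h1⟩)
  · rfl

theorem CylindricalEnd.lift_of_notMem_image (c : EndCoefficient) {z : Z}
    (hz : z ∉ C.chart '' {p | 0 ≤ p.2}) : C.lift c z = 0 :=
  C.lift_of_notMem c fun h => hz ⟨_, h.2.le, C.chart.right_inv h.1⟩

theorem CylindricalEnd.lift_mem (c : EndCoefficient) (z : Z) :
    C.lift c z = 0 ∨ ∃ u, C.lift c z = c.toFun u := by
  rw [CylindricalEnd.lift]
  split_ifs with h
  · exact Or.inr ⟨_, rfl⟩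
  · exact Or.inl rfl

end Lift

variable {F : Type*} [NormedAddCommGroup F] [NormedSpace ℂ F] [FiniteDimensional ℂ F]
  {E : Z → Type*} [TopologicalSpace (TotalSpace F E)]
  [∀ z, NormedAddCommGroup (E z)] [∀ z, InnerProductSpace ℂ (E z)]
  [FiberBundle F E] [VectorBundle ℂ F E] [VectorBundle ℝ F E]
  {F' : Type*} [NormedAddCommGroup F'] [NormedSpace ℂ F'] [FiniteDimensional ℂ F']
  {E' : Y → Type*} [TopologicalSpace (TotalSpace F' E')]
  [∀ y, NormedAddCommGroup (E' y)] [∀ y, InnerProductSpace ℂ (E' y)]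
  [FiberBundle F' E'] [VectorBundle ℂ F' E'] [VectorBundle ℝ F' E']

/-- Extension by zero is available for real functions, so real and imaginary parts are treated
separately and recombined with the complex structure of `E`. -/
theorem CylindricalEnd.isSmoothSection_lift (C : CylindricalEnd m Z Y) (c : EndCoefficient)
    (s : smoothSections (m + 1) F E) :
    IsSmoothSection (m + 1) F E fun z => C.lift c z • s.1 z := by
  have h : ∀ A : ℂ →L[ℝ] ℝ, ∃ f : C^∞⟮𝓡 (m + 1), Z; ℝ⟯, ∀ z, f z = A (C.lift c z) := by
    intro A
    obtain ⟨f, h1, h2⟩ := C.exists_extendFun (G := fun p => A (c.toFun p.2)) (κ := 0)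
      (A.contMDiff.comp (c.contDiff.contMDiff.comp contMDiff_snd)) le_rfl
      (fun p hp => by rw [c.eq_zero _ hp, map_zero])
    refine ⟨f, fun z => ?_⟩
    by_cases hz : z ∈ C.chart.target
    · obtain ⟨⟨y, u⟩, hp, rfl⟩ : ∃ p ∈ C.chart.source, C.chart p = z :=
        ⟨_, C.chart.map_target hz, C.chart.right_inv hz⟩
      have hu := C.mem_source.1 hp
      rw [h1 y u hu, C.lift_chart c hu]
    · rw [h2 z hz, C.lift_of_notMem c fun h => hz h.1, map_zero]
  obtain ⟨f, hf⟩ := h Complex.reCLM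
  obtain ⟨g, hg⟩ := h Complex.imCLM
  have h3 : (fun z => C.lift c z • s.1 z) = (funSmul f s + Complex.I • funSmul g s).1 := by
    funext z
    change C.lift c z • s.1 z = f z • s.1 z + Complex.I • g z • s.1 z
    rw [hf, hg]
    change _ = ((C.lift c z).re : ℂ) • s.1 z + Complex.I • ((C.lift c z).im : ℂ) • s.1 z
    rw [smul_smul, ← add_smul, mul_comm, Complex.re_add_im]
  rw [h3]
  exact (funSmul f s + Complex.I • funSmul g s).2

variable (F E) in
/-- Multiplication of sections by a coefficient on the end. -/
def CylindricalEnd.mulEnd (C : CylindricalEnd m Z Y) (c : EndCoefficient) :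
    smoothSections (m + 1) F E →ₗ[ℂ] smoothSections (m + 1) F E where
  toFun s := ⟨_, C.isSmoothSection_lift c s⟩
  map_add' s t := by
    ext z
    exact smul_add (C.lift c z) (s.1 z) (t.1 z)
  map_smul' a s := by
    ext z
    exact smul_comm (C.lift c z) a (s.1 z)

variable {C : CylindricalEnd m Z Y}

theorem CylindricalEnd.mulEnd_apply (c : EndCoefficient) (s : smoothSections (m + 1) F E) (z : Z) :
    (C.mulEnd F E c s).1 z = C.lift c z • s.1 z := rfl

theorem HasCompactSupp.mulEnd (c : EndCoefficient) {s : smoothSections (m + 1) F E}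
    (hs : HasCompactSupp s) : HasCompactSupp (C.mulEnd F E c s) := by
  obtain ⟨K, hK, h⟩ := hs
  exact ⟨K, hK, fun z hz => by rw [CylindricalEnd.mulEnd_apply, h z hz, smul_zero]⟩

variable {B : BundleEnd F E F' E' C}

theorem BundleEnd.pull_mulEnd (c : EndCoefficient) (s : smoothSections (m + 1) F E) (y : Y) {u : ℝ}
    (hu : -C.ε < u) : B.pull (C.mulEnd F E c s).1 y u = c.toFun u • B.pull s.1 y u := by
  rw [BundleEnd.pull, CylindricalEnd.mulEnd_apply, C.lift_chart c hu, map_smul]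
  rfl

theorem BundleEnd.slice_mulEnd (c : EndCoefficient) (s : smoothSections (m + 1) F E) {u : ℝ}
    (hu : -C.ε < u) : B.slice (C.mulEnd F E c s) u hu = c.toFun u • B.slice s u hu := by
  ext y
  exact B.pull_mulEnd c s y hu

variable (C) in
/-- The operator `f' ∂/∂u` for a coefficient `f`, expressed through the commutator `[Δ, f]`. -/
def CylindricalEnd.endDeriv (Δ : smoothSections (m + 1) F E →ₗ[ℂ] smoothSections (m + 1) F E)
    (f : EndCoefficient) : smoothSections (m + 1) F E →ₗ[ℂ] smoothSections (m + 1) F E :=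
  (-(1 / 2) : ℂ) • (Δ ∘ₗ C.mulEnd F E f - C.mulEnd F E f ∘ₗ Δ
    + C.mulEnd F E f.derivative.derivative)

variable {Δ : smoothSections (m + 1) F E →ₗ[ℂ] smoothSections (m + 1) F E}

theorem CylindricalEnd.endDeriv_eq (f : EndCoefficient) (s : smoothSections (m + 1) F E) :
    C.endDeriv Δ f s = (-(1 / 2) : ℂ) • (Δ (C.mulEnd F E f s) - C.mulEnd F E f (Δ s)
      + C.mulEnd F E f.derivative.derivative s) := rfl

variable [ContMDiffVectorBundle ∞ F E (𝓡 (m + 1))] [IsSmoothHermitian (m + 1) F E]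
  [ContMDiffVectorBundle ∞ F' E' (𝓡 m)] [IsSmoothHermitian m F' E']

theorem HasCompactSupp.endDeriv (hΔ : IsGeneralizedLaplacian Δ) (f : EndCoefficient)
    {s : smoothSections (m + 1) F E} (hs : HasCompactSupp s) :
    HasCompactSupp (C.endDeriv Δ f s) :=
  HasCompactSupp.smul (((hΔ.hasCompactSupp (hs.mulEnd f)).sub
    ((hΔ.hasCompactSupp hs).mulEnd f)).add (hs.mulEnd _)) _

theorem CylindricalEnd.endDeriv_of_notMem (hΔ : IsGeneralizedLaplacian Δ) (f : EndCoefficient)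
    (s : smoothSections (m + 1) F E) {z : Z} (hz : z ∉ C.chart '' {p | 0 ≤ p.2}) :
    (C.endDeriv Δ f s).1 z = 0 := by
  have h1 : (Δ (C.mulEnd F E f s)).1 z = 0 := by
    refine hΔ.apply_eq_zero ?_
    filter_upwards [(C.isClosed_image le_rfl).isOpen_compl.mem_nhds hz] with w hw
    rw [CylindricalEnd.mulEnd_apply, C.lift_of_notMem_image f hw, zero_smul]
  rw [CylindricalEnd.endDeriv_eq]
  change (-(1 / 2) : ℂ) • ((Δ (C.mulEnd F E f s)).1 z - C.lift f z • (Δ s).1 z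
    + C.lift f.derivative.derivative z • s.1 z) = 0
  rw [h1, C.lift_of_notMem_image _ hz, C.lift_of_notMem_image _ hz]
  simp

theorem BundleEnd.hasDerivAt_pull (B : BundleEnd F E F' E' C) (s : smoothSections (m + 1) F E)
    (y : Y) {u : ℝ} (hu : -C.ε < u) :
    HasDerivAt (fun v => B.pull s.1 y v) (deriv (fun v => B.pull s.1 y v) u) u :=
  ((B.contDiffAt_pull s y hu).differentiableAt (by simp)).hasDerivAt

theorem BundleEnd.hasDerivAt_deriv_pull (B : BundleEnd F E F' E' C)
    (s : smoothSections (m + 1) F E) (y : Y) {u : ℝ} (hu : -C.ε < u) :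
    HasDerivAt (deriv fun v => B.pull s.1 y v) (iteratedDeriv 2 (fun v => B.pull s.1 y v) u) u := by
  rw [iteratedDeriv_succ, iteratedDeriv_one]
  have h : ContDiffAt ℝ ∞ (fun v => fderiv ℝ (fun v => B.pull s.1 y v) v 1) u :=
    ((B.contDiffAt_pull s y hu).fderiv_right (m := ∞) le_rfl).clm_apply contDiffAt_const
  exact (h.differentiableAt (by simp)).hasDerivAt

theorem BundleEnd.deriv_pull_mulEnd (B : BundleEnd F E F' E' C) (c : EndCoefficient)
    (s : smoothSections (m + 1) F E) (y : Y) {u : ℝ} (hu : -C.ε < u) :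
    deriv (fun v => B.pull (C.mulEnd F E c s).1 y v) u
      = c.toFun u • deriv (fun v => B.pull s.1 y v) u + c.derivative.toFun u • B.pull s.1 y u := by
  have h : (fun v => B.pull (C.mulEnd F E c s).1 y v) =ᶠ[𝓝 u]
      fun v => c.toFun v • B.pull s.1 y v := by
    filter_upwards [lt_mem_nhds hu] with v hv using B.pull_mulEnd c s y hv
  rw [h.deriv_eq]
  exact ((c.hasDerivAt u).smul (B.hasDerivAt_pull s y hu)).deriv

theorem BundleEnd.iteratedDeriv_pull_mulEnd (B : BundleEnd F E F' E' C) (c : EndCoefficient)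
    (s : smoothSections (m + 1) F E) (y : Y) {u : ℝ} (hu : -C.ε < u) :
    iteratedDeriv 2 (fun v => B.pull (C.mulEnd F E c s).1 y v) u
      = c.toFun u • iteratedDeriv 2 (fun v => B.pull s.1 y v) u
        + (2 : ℂ) • c.derivative.toFun u • deriv (fun v => B.pull s.1 y v) u
        + c.derivative.derivative.toFun u • B.pull s.1 y u := by
  have h : deriv (fun v => B.pull (C.mulEnd F E c s).1 y v) =ᶠ[𝓝 u]
      fun v => c.toFun v • deriv (fun v => B.pull s.1 y v) v
        + c.derivative.toFun v • B.pull s.1 y v := by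
    filter_upwards [lt_mem_nhds hu] with v hv using B.deriv_pull_mulEnd c s y hv
  rw [iteratedDeriv_succ, iteratedDeriv_one, h.deriv_eq]
  refine (((c.hasDerivAt u).smul (B.hasDerivAt_deriv_pull s y hu)).add
    ((c.derivative.hasDerivAt u).smul (B.hasDerivAt_pull s y hu))).deriv.trans ?_
  rw [two_smul]
  abel

/-- `Δ_Y` commutes with functions of `u`, and `[-∂_u², f] = -f'' - 2 f' ∂_u`; adding `f''` and
dividing by `-2` leaves `f' ∂_u`. Written through `Δ`, the operator is defined globally and inherits
its formal adjoint from the symmetry of `Δ`. -/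
theorem IsCompatibleLaplacian.pull_endDeriv (hΔ : IsCompatibleLaplacian B Δ) (f : EndCoefficient)
    (s : smoothSections (m + 1) F E) (y : Y) {u : ℝ} (hu : 0 ≤ u) :
    B.pull (C.endDeriv Δ f s).1 y u
      = f.derivative.toFun u • deriv (fun v => B.pull s.1 y v) u := by
  obtain ⟨ΔY, -, h⟩ := hΔ.product
  have hu' : -C.ε < u := (neg_lt_zero.2 C.ε_pos).trans_le hu
  have e : (ΔY (f.toFun u • B.slice s u hu')).1 y = f.toFun u • (ΔY (B.slice s u hu')).1 y := by
    rw [map_smul]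
    rfl
  rw [CylindricalEnd.endDeriv_eq, B.pull_smul, B.pull_add, B.pull_sub, h _ y u hu,
    B.pull_mulEnd _ _ y hu', h _ y u hu, B.slice_mulEnd f s hu', e, B.pull_mulEnd _ _ y hu',
    B.iteratedDeriv_pull_mulEnd f s y hu']
  module

theorem IsCompatibleLaplacian.norm_endDeriv_le (hΔ : IsCompatibleLaplacian B Δ)
    {D : CovariantDerivative (𝓡 (m + 1)) F E} (hD : IsProductConnection B D) {f : EndCoefficient}
    (hf : ∀ u, ‖f.derivative.toFun u‖ ≤ 1) (s : smoothSections (m + 1) F E) (z : Z) :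
    ‖(C.endDeriv Δ f s).1 z‖ ≤ ‖D s.1 z‖ := by
  by_cases hz : z ∈ C.chart '' {p | 0 ≤ p.2}
  · obtain ⟨⟨y, u⟩, hu, rfl⟩ := hz
    rw [← B.norm_pull, hΔ.pull_endDeriv f s y hu, norm_smul]
    exact (mul_le_of_le_one_left (norm_nonneg _) (hf u)).trans (hD.norm_deriv_pull_le s y hu)
  · rw [CylindricalEnd.endDeriv_of_notMem hΔ.generalized f s hz, norm_zero]
    exact ContinuousLinearMap.opNorm_nonneg _

/-- The product rule gives `f' c'` as the zero order term, which equals `c'` because `f' = 1`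
wherever `c'` does not vanish. -/
theorem IsCompatibleLaplacian.endDeriv_mulEnd (hΔ : IsCompatibleLaplacian B Δ)
    {f c : EndCoefficient} (hfc : ∀ u, f.derivative.toFun u = 1 ∨ c.derivative.toFun u = 0)
    (s : smoothSections (m + 1) F E) :
    C.endDeriv Δ f (C.mulEnd F E c s)
      = C.mulEnd F E c (C.endDeriv Δ f s) + C.mulEnd F E c.derivative s := by
  ext z
  change _ = C.lift c z • (C.endDeriv Δ f s).1 z + C.lift c.derivative z • s.1 z
  by_cases hz : z ∈ C.chart '' {p | 0 ≤ p.2}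
  · obtain ⟨⟨y, u⟩, hu, rfl⟩ := hz
    have hu' : -C.ε < u := (neg_lt_zero.2 C.ε_pos).trans_le hu
    apply (B.iso y u).symm.injective
    rw [C.lift_chart _ hu', C.lift_chart _ hu', map_add, map_smul, map_smul]
    change B.pull _ y u = c.toFun u • B.pull _ y u + c.derivative.toFun u • B.pull _ y u
    rw [hΔ.pull_endDeriv f _ y hu, hΔ.pull_endDeriv f _ y hu, B.deriv_pull_mulEnd c s y hu']
    rcases hfc u with h | h
    · rw [h]
      module
    · rw [h]
      module
  · rw [CylindricalEnd.endDeriv_of_notMem hΔ.generalized f _ hz,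
      CylindricalEnd.endDeriv_of_notMem hΔ.generalized f _ hz, C.lift_of_notMem_image c hz,
      C.lift_of_notMem_image c.derivative hz]
    simp

/-- The dilated Laplacian, written with operators on smooth sections of `E`. -/
theorem IsCompatibleLaplacian.dilatedLaplacian_eq (hΔ : IsCompatibleLaplacian B Δ) {φ : ℝ → ℝ}
    {θ : ℂ} {K : ℝ} {f c₂ c₁ c₀ : EndCoefficient}
    (hf : ∀ u, K ≤ u → f.derivative.toFun =ᶠ[𝓝 u] fun _ => 1)
    (hK : ∀ u < K, c₂.toFun u = 0 ∧ c₁.toFun u = 0 ∧ c₀.toFun u = 0)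
    (hc : ∀ u, 0 < u → c₂.toFun u = a₂ φ θ u + 1 ∧ c₁.toFun u = a₁ φ θ u ∧
      c₀.toFun u = a₀ φ θ u) (s : smoothSections (m + 1) F E) (z : Z) :
    dilatedLaplacian φ θ B Δ s z
      = (Δ s + C.mulEnd F E c₂ (C.endDeriv Δ f (C.endDeriv Δ f s))
        + C.mulEnd F E c₁ (C.endDeriv Δ f s) + C.mulEnd F E c₀ s).1 z := by
  change _ = (Δ s).1 z + C.lift c₂ z • (C.endDeriv Δ f (C.endDeriv Δ f s)).1 z
    + C.lift c₁ z • (C.endDeriv Δ f s).1 z + C.lift c₀ z • s.1 z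
  by_cases hz : z ∈ C.chart.target ∧ 0 < (C.chart.symm z).2
  · obtain ⟨y, u, hu, rfl⟩ : ∃ y u, 0 < u ∧ C.chart (y, u) = z :=
      ⟨_, _, hz.2, C.chart.right_inv hz.1⟩
    have hu' : -C.ε < u := (neg_lt_zero.2 C.ε_pos).trans hu
    rw [dilatedLaplacian_chart φ θ B Δ s y u hu, add_assoc, add_assoc]
    congr 1
    apply (B.iso y u).symm.injective
    rw [LinearIsometryEquiv.symm_apply_apply, C.lift_chart _ hu', C.lift_chart _ hu',
      C.lift_chart _ hu', map_add, map_add, map_smul, map_smul, map_smul]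
    change _ = c₂.toFun u • B.pull _ y u + (c₁.toFun u • B.pull _ y u + c₀.toFun u • B.pull _ y u)
    obtain ⟨h2, h1, h0⟩ := hc u hu
    rw [endCorrection, ← h2, ← h1, ← h0]
    -- Below `K` all coefficients vanish. From `K` on, `f' = 1` in a neighbourhood, so applying the
    -- operator twice gives exactly `∂_u²`.
    rcases lt_or_ge u K with h | h
    · obtain ⟨k2, k1, k0⟩ := hK u h
      rw [k2, k1, k0]
      simp
    · have e1 : (fun v => B.pull (C.endDeriv Δ f s).1 y v) =ᶠ[𝓝 u]
          deriv fun v => B.pull s.1 y v := by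
        filter_upwards [hf u h, lt_mem_nhds hu] with v hv hv0
        rw [hΔ.pull_endDeriv f s y hv0.le, hv, one_smul]
      rw [hΔ.pull_endDeriv f _ y hu.le, e1.deriv_eq, (hf u h).eq_of_nhds, one_smul,
        e1.eq_of_nhds, iteratedDeriv_succ, iteratedDeriv_one, add_assoc]
  · rw [dilatedLaplacian, dif_neg hz, C.lift_of_notMem _ hz, C.lift_of_notMem _ hz,
      C.lift_of_notMem _ hz]
    simp

/-- A coefficient with derivative between `0` and `1`, equal to `1` for `u ≥ K`. -/
theorem exists_endCoefficient {K : ℝ} (hK : 0 < K) :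
    ∃ (f : EndCoefficient), (∀ u, (starRingEnd ℂ) (f.toFun u) = f.toFun u) ∧
      (∀ u, ‖f.derivative.toFun u‖ ≤ 1) ∧
      ∀ u, K ≤ u → f.derivative.toFun =ᶠ[𝓝 u] fun _ => 1 := by
  -- The derivative reaches `1` already at `K / 2`, so that it is constant in a neighbourhood of
  -- every `u ≥ K`, including `K` itself.
  let ρ : ℝ → ℝ := fun u => Real.smoothTransition (2 * u / K)
  have hρ : ContDiff ℝ ∞ ρ :=
    Real.smoothTransition.contDiff.comp ((contDiff_const.mul contDiff_id).div_const K)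
  let G : ℝ → ℝ := fun u => ∫ v in (0 : ℝ)..u, ρ v
  have hG : ∀ u, HasDerivAt G (ρ u) u := fun u =>
    intervalIntegral.integral_hasDerivAt_right (hρ.continuous.intervalIntegrable _ _)
      hρ.continuous.stronglyMeasurable.stronglyMeasurableAtFilter hρ.continuous.continuousAt
  have hGd : deriv G = ρ := funext fun u => (hG u).deriv
  have hGs : ContDiff ℝ ∞ G :=
    contDiff_infty_iff_deriv.2 ⟨fun u => (hG u).differentiableAt, by rw [hGd]; exact hρ⟩
  have hG0 : ∀ u ≤ 0, G u = 0 := fun u hu => by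
    refine (intervalIntegral.integral_congr (g := fun _ => (0 : ℝ)) fun v hv => ?_).trans (by simp)
    rw [Set.uIcc_of_ge hu] at hv
    exact Real.smoothTransition.zero_of_nonpos
      (div_nonpos_of_nonpos_of_nonneg (by linarith [hv.2]) hK.le)
  let f : EndCoefficient := ⟨fun u => (G u : ℂ), Complex.ofRealCLM.contDiff.comp hGs, fun u hu => by
    rw [hG0 u hu, Complex.ofReal_zero]⟩
  have hf : ∀ u, f.derivative.toFun u = (ρ u : ℂ) := fun u => (hG u).ofReal_comp.deriv
  refine ⟨f, fun u => Complex.conj_ofReal _, fun u => ?_, fun u hu => ?_⟩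
  · rw [hf, Complex.norm_real, Real.norm_of_nonneg (Real.smoothTransition.nonneg _)]
    exact Real.smoothTransition.le_one _
  · filter_upwards [lt_mem_nhds (show K / 2 < u by linarith)] with v hv
    rw [hf, show ρ v = 1 from Real.smoothTransition.one_of_one_le ?_, Complex.ofReal_one]
    rw [le_div_iff₀ hK]
    linarith

end EndOperators

end
end CylEnd

namespace CylEnd

noncomputable section

/-! ### Energy convergence and the first Sobolev space. -/

section SobolevEnergy

attribute [local instance] tangentTotalSpace InnerProductSpace.complexToReal

variable {n : ℕ} {M : Type*} [TopologicalSpace M] [ChartedSpace (EuclideanSpace ℝ (Fin n)) M]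
  [RiemannianBundle (fun x : M => TangentSpace (𝓡 n) x)] [MeasurableSpace M] [BorelSpace M]
  [IsManifold (𝓡 n) ∞ M] [T2Space M] [SigmaCompactSpace M]
  [IsContinuousRiemannianBundle (EuclideanSpace ℝ (Fin n)) (fun x : M => TangentSpace (𝓡 n) x)]
  {F : Type*} [NormedAddCommGroup F] [NormedSpace ℂ F]
  {E : M → Type*} [TopologicalSpace (TotalSpace F E)]
  [∀ x, NormedAddCommGroup (E x)] [∀ x, InnerProductSpace ℂ (E x)]
  [FiberBundle F E] [VectorBundle ℂ F E] [VectorBundle ℝ F E] [ContMDiffVectorBundle ∞ F E (𝓡 n)]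
  [IsSmoothHermitian n F E]
  {P : smoothSections n F E →ₗ[ℂ] smoothSections n F E}
  {D : CovariantDerivative (𝓡 n) F E}

/-- The energy of a compactly supported section with respect to a controlled cover. -/
def ControlledCover.totalEnergy (A : ControlledCover P D) (s : compactSections n F E) : ℝ :=
  ∫ x, A.energy s.1 x ∂(riemannianVolume n M)

variable (A : ControlledCover P D)

theorem ControlledCover.totalEnergy_nonneg (s : compactSections n F E) : 0 ≤ A.totalEnergy s :=
  integral_nonneg fun x => A.energy_nonneg s.1 x

theorem ControlledCover.ofReal_totalEnergy (hP : IsGeneralizedLaplacian P)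
    (s : compactSections n F E) :
    ENNReal.ofReal (A.totalEnergy s)
      = ∫⁻ x, ENNReal.ofReal (A.energy s.1 x) ∂(riemannianVolume n M) :=
  ofReal_integral_eq_lintegral_ofReal (A.integrable_energy hP s.2)
    (ae_of_all _ fun x => A.energy_nonneg s.1 x)

theorem lintegral_enorm_sq_toL2 (s : compactSections n F E) :
    ∫⁻ x, ‖s.1.1 x‖ₑ ^ 2 ∂(riemannianVolume n M) = ENNReal.ofReal (‖toL2 n F E s‖ ^ 2) :=
  PreL2.lintegral_enorm_sq (toPreL2 n F E s)

theorem enorm_covariantDerivative_sq (s : smoothSections n F E) (x : M) :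
    ‖D s.1 x‖ₑ ^ 2 = ENNReal.ofReal (‖D s.1 x‖ ^ 2) := by
  rw [ENNReal.ofReal_pow (ContinuousLinearMap.opNorm_nonneg _)]
  congr 1
  exact (ofReal_norm (D s.1 x)).symm

/-- The Sobolev norm is a lower Lebesgue integral and the energy density is integrable, so the
pointwise comparison with `δ = 1` passes to integrals by monotonicity, without measurability of `‖D
s‖`. -/
theorem ControlledCover.exists_lintegral_covariantDerivative_le (hP : IsGeneralizedLaplacian P) :
    ∃ b : ℝ, ∀ s : compactSections n F E,
      ∫⁻ x, ‖D s.1.1 x‖ₑ ^ 2 ∂(riemannianVolume n M)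
        ≤ ENNReal.ofReal (2 * A.totalEnergy s + b * ‖toL2 n F E s‖ ^ 2) := by
  refine ⟨Fintype.card A.index * ((1 + (1 : ℝ)⁻¹) * A.const ^ 2), fun s => ?_⟩
  have i1 := (A.integrable_energy hP s.2).const_mul (1 + 1)
  have i2 := (integrable_norm_sq s.2).const_mul
    (Fintype.card A.index * ((1 + (1 : ℝ)⁻¹) * A.const ^ 2))
  have h : 2 * A.totalEnergy s
        + Fintype.card A.index * ((1 + (1 : ℝ)⁻¹) * A.const ^ 2) * ‖toL2 n F E s‖ ^ 2
      = ∫ x, ((1 + 1) * A.energy s.1 x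
        + Fintype.card A.index * ((1 + (1 : ℝ)⁻¹) * A.const ^ 2) * ‖s.1.1 x‖ ^ 2)
          ∂(riemannianVolume n M) := by
    rw [integral_add i1 i2, integral_const_mul, integral_const_mul, norm_toL2_sq,
      ControlledCover.totalEnergy]
    norm_num
  rw [h]
  refine le_of_le_of_eq (lintegral_mono fun x => ?_)
    (ofReal_integral_eq_lintegral_ofReal (i1.add i2) (ae_of_all _ fun x => ?_)).symm
  · rw [enorm_covariantDerivative_sq]
    exact ENNReal.ofReal_le_ofReal (A.norm_covariantDerivative_sq_le one_pos s.1 x)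
  · have := A.energy_nonneg s.1 x
    simp only [Pi.zero_apply, Pi.add_apply]
    positivity

theorem ControlledCover.exists_ofReal_totalEnergy_le (hP : IsGeneralizedLaplacian P) :
    ∃ b : ℝ, ∀ s : compactSections n F E, ENNReal.ofReal (A.totalEnergy s)
      ≤ ENNReal.ofReal b * (∫⁻ x, ‖D s.1.1 x‖ₑ ^ 2 ∂(riemannianVolume n M)
        + ENNReal.ofReal (‖toL2 n F E s‖ ^ 2)) := by
  obtain ⟨b, hb, h⟩ := A.exists_energy_le
  refine ⟨b, fun s => ?_⟩
  -- Splitting the integral of a sum requires measurability of one summand only, and `‖s‖²` serves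
  -- that purpose.
  have hm : AEMeasurable (fun x => ‖s.1.1 x‖ₑ ^ 2) (riemannianVolume n M) := by
    have h1 := ((toPreL2 n F E s).2.2.1.aemeasurable.enorm).pow_const 2
    refine h1.congr (ae_of_all _ fun x => ?_)
    simp only [enorm_norm]
    rfl
  rw [A.ofReal_totalEnergy hP, ← lintegral_enorm_sq_toL2, ← lintegral_add_right' _ hm,
    ← lintegral_const_mul' _ _ ENNReal.ofReal_ne_top]
  refine lintegral_mono fun x => ?_
  refine (ENNReal.ofReal_le_ofReal (h s.1 x)).trans ?_
  rw [ENNReal.ofReal_mul hb, ENNReal.ofReal_add (sq_nonneg _) (sq_nonneg _),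
    enorm_covariantDerivative_sq, ENNReal.ofReal_pow (norm_nonneg _) , ofReal_norm]

theorem tendsto_lintegral_sub_iff {f : ℕ → compactSections n F E} {s : PreL2 n F E} :
    Tendsto (fun k => ∫⁻ x, ‖(f k).1.1 x - s.1 x‖ₑ ^ 2 ∂(riemannianVolume n M)) atTop (𝓝 0) ↔
      Tendsto (fun k => toL2 n F E (f k)) atTop (𝓝 (SeparationQuotient.mk s)) := by
  have h : ∀ k, ∫⁻ x, ‖(f k).1.1 x - s.1 x‖ₑ ^ 2 ∂(riemannianVolume n M)
      = ENNReal.ofReal (‖toL2 n F E (f k) - SeparationQuotient.mk s‖ ^ 2) := fun k => by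
    refine (PreL2.lintegral_enorm_sq (toPreL2 n F E (f k) - s)).trans ?_
    rw [toL2_apply, ← SeparationQuotient.mk_sub, SeparationQuotient.norm_mk]
  simp only [h]
  rw [tendsto_iff_norm_sub_tendsto_zero]
  constructor
  · intro h1
    have h2 := (ENNReal.tendsto_toReal ENNReal.zero_ne_top).comp h1
    have h3 := h2.sqrt
    simp only [Function.comp_apply, ENNReal.toReal_zero, Real.sqrt_zero] at h3
    refine h3.congr fun k => ?_
    rw [ENNReal.toReal_ofReal (sq_nonneg _), Real.sqrt_sq (norm_nonneg _)]
  · intro h1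
    simpa using ENNReal.tendsto_ofReal (h1.pow 2)

theorem tendsto_norm_sub_sq {H : Type*} [NormedAddCommGroup H] {f : ℕ → H} {ψ : H}
    (hf : Tendsto f atTop (𝓝 ψ)) :
    Tendsto (fun p : ℕ × ℕ => ‖f p.1 - f p.2‖ ^ 2) atTop (𝓝 0) := by
  have h := (cauchySeq_iff_tendsto_dist_atTop_0.1 hf.cauchySeq).pow 2
  simpa [dist_eq_norm] using h

/-- Convergence for the Sobolev norm is convergence for the energy of a controlled cover. -/
theorem ControlledCover.sobolevTendsto_iff (hP : IsGeneralizedLaplacian P)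
    {f : ℕ → compactSections n F E} {ψ : L2 n F E} :
    SobolevTendsto D (fun k => (f k).1) ψ ↔ EnergyTendsto (toL2 n F E) A.totalEnergy f ψ := by
  have key : Tendsto (fun k => toL2 n F E (f k)) atTop (𝓝 ψ) →
      Tendsto (fun p : ℕ × ℕ => ‖toL2 n F E (f p.1 - f p.2)‖ ^ 2) atTop (𝓝 0) := fun h => by
    exact (tendsto_norm_sub_sq h).congr fun p =>
      congrArg (fun v => ‖v‖ ^ 2) ((toL2 n F E).map_sub (f p.1) (f p.2)).symm
  constructor
  · rintro ⟨-, ⟨s, rfl, hs⟩, hc⟩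
    have h1 := tendsto_lintegral_sub_iff.1 hs
    refine ⟨h1, ?_⟩
    obtain ⟨b, hb⟩ := A.exists_ofReal_totalEnergy_le hP
    have h2 : Tendsto (fun p : ℕ × ℕ => ENNReal.ofReal b
        * (∫⁻ x, ‖D (f p.1 - f p.2).1.1 x‖ₑ ^ 2 ∂(riemannianVolume n M)
          + ENNReal.ofReal (‖toL2 n F E (f p.1 - f p.2)‖ ^ 2))) atTop (𝓝 0) := by
      have := ENNReal.Tendsto.const_mul (a := ENNReal.ofReal b)
        (hc.add (ENNReal.tendsto_ofReal (key h1))) (Or.inr ENNReal.ofReal_ne_top)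
      simpa using this
    have h3 := tendsto_of_tendsto_of_tendsto_of_le_of_le tendsto_const_nhds h2
      (fun _ => zero_le) fun p => hb (f p.1 - f p.2)
    have h4 := (ENNReal.tendsto_toReal ENNReal.zero_ne_top).comp h3
    refine h4.congr fun p => ?_
    exact ENNReal.toReal_ofReal (A.totalEnergy_nonneg _)
  · rintro ⟨h1, hc⟩
    obtain ⟨s, rfl⟩ := SeparationQuotient.surjective_mk ψ
    refine ⟨fun k => (f k).2, ⟨s, rfl, tendsto_lintegral_sub_iff.2 h1⟩, ?_⟩
    obtain ⟨b, hb⟩ := A.exists_lintegral_covariantDerivative_le hP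
    have h2 : Tendsto (fun p : ℕ × ℕ => ENNReal.ofReal (2 * A.totalEnergy (f p.1 - f p.2)
        + b * ‖toL2 n F E (f p.1 - f p.2)‖ ^ 2)) atTop (𝓝 0) := by
      have := ENNReal.tendsto_ofReal ((hc.const_mul 2).add ((key h1).const_mul b))
      simpa using this
    exact tendsto_of_tendsto_of_tendsto_of_le_of_le tendsto_const_nhds h2
      (fun _ => zero_le) fun p => hb (f p.1 - f p.2)

/-- A form that is continuous for the energy of a controlled cover is the extension by continuity
from the compactly supported sections to the first Sobolev space. -/
theorem ControlledCover.isFormOf (hP : IsGeneralizedLaplacian P) {q : SesqForm (L2 n F E)}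
    {T : smoothSections n F E → Π x, E x} {T' : compactSections n F E →ₗ[ℂ] compactSections n F E}
    (hT : ∀ s : compactSections n F E, (T' s).1.1 = T s.1)
    (h1 : ∀ ψ, ψ ∈ q.domain ↔ ∃ f, EnergyTendsto (toL2 n F E) A.totalEnergy f ψ)
    (h2 : ∀ (f g : ℕ → compactSections n F E) (η ψ : q.domain),
      EnergyTendsto (toL2 n F E) A.totalEnergy f (η : L2 n F E) →
      EnergyTendsto (toL2 n F E) A.totalEnergy g (ψ : L2 n F E) →
      Tendsto (fun k => inner ℂ (toL2 n F E (f k)) (toL2 n F E (T' (g k)))) atTop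
        (𝓝 (q.toFun η ψ))) : IsFormOf D T q := by
  have hlift : ∀ {f : ℕ → smoothSections n F E} {ψ : L2 n F E} (hf : SobolevTendsto D f ψ),
      EnergyTendsto (toL2 n F E) A.totalEnergy (fun k => ⟨f k, hf.compactSupp k⟩) ψ :=
    fun {f ψ} hf => (A.sobolevTendsto_iff (f := fun k => ⟨f k, hf.compactSupp k⟩) hP).1 hf
  refine ⟨?_, fun f g η ψ hη hψ => ?_⟩
  · ext ψ
    refine (h1 ψ).trans ⟨?_, ?_⟩
    · rintro ⟨g, hg⟩
      exact ⟨_, (A.sobolevTendsto_iff hP).2 hg⟩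
    · rintro ⟨g, hg⟩
      exact ⟨_, hlift hg⟩
  · refine (h2 _ _ η ψ (hlift hη) (hlift hψ)).congr fun k => ?_
    rw [inner_toL2]
    simp only [hT]

theorem ControlledCover.exists_abs_re_inner_sub_le (hP : IsGeneralizedLaplacian P)
    (hS : IsFormallySelfAdjoint P) {δ : ℝ} (hδ : 0 < δ) :
    ∃ b ≥ 0, ∀ s t : compactSections n F E, t.1 = P s.1 →
      |(inner ℂ (toL2 n F E s) (toL2 n F E t)).re - A.totalEnergy s|
        ≤ δ * A.totalEnergy s + b * ‖toL2 n F E s‖ ^ 2 := by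
  obtain ⟨b, hb, h⟩ := A.exists_abs_integral_sub_le hP hS hδ
  refine ⟨b, hb, fun s t ht => ?_⟩
  have h1 := h s.1 s.2
  rw [integral_inner_real_eq (Or.inl s.2), ← ht] at h1
  rw [inner_toL2, norm_toL2_sq]
  exact h1

/-- To be applied with `t = f' ∂_u s`, which is pointwise dominated by `∇s`. The coefficient `1 + δ`
of the energy is the sharp bound that the perturbation argument relies on. -/
theorem ControlledCover.exists_norm_sq_le (hP : IsGeneralizedLaplacian P) {δ : ℝ} (hδ : 0 < δ) :
    ∃ b ≥ 0, ∀ s t : compactSections n F E, (∀ x, ‖t.1.1 x‖ ≤ ‖D s.1.1 x‖) →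
      ‖toL2 n F E t‖ ^ 2 ≤ (1 + δ) * A.totalEnergy s + b * ‖toL2 n F E s‖ ^ 2 := by
  refine ⟨Fintype.card A.index * ((1 + δ⁻¹) * A.const ^ 2), by positivity, fun s t ht => ?_⟩
  have i1 := (A.integrable_energy hP s.2).const_mul (1 + δ)
  have i2 := (integrable_norm_sq s.2).const_mul
    (Fintype.card A.index * ((1 + δ⁻¹) * A.const ^ 2))
  rw [norm_toL2_sq, norm_toL2_sq, ControlledCover.totalEnergy, ← integral_const_mul,
    ← integral_const_mul, ← integral_add i1 i2]
  refine integral_mono (integrable_norm_sq t.2) (i1.add i2) fun x => ?_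
  exact (pow_le_pow_left₀ (norm_nonneg _) (ht x) 2).trans
    (A.norm_covariantDerivative_sq_le hδ s.1 x)

theorem norm_toL2_le {s t : compactSections n F E} {a : ℝ} (ha : 0 ≤ a)
    (h : ∀ x, ‖t.1.1 x‖ ≤ a * ‖s.1.1 x‖) : ‖toL2 n F E t‖ ≤ a * ‖toL2 n F E s‖ := by
  refine le_of_sq_le_sq ?_ (by positivity)
  rw [mul_pow, norm_toL2_sq, norm_toL2_sq, ← integral_const_mul]
  refine integral_mono (integrable_norm_sq t.2) ((integrable_norm_sq s.2).const_mul _) fun x => ?_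
  simp only [← mul_pow]
  exact pow_le_pow_left₀ (norm_nonneg _) (h x) 2

end SobolevEnergy

end
end CylEnd

namespace CylEnd

noncomputable section

attribute [local instance] tangentTotalSpace

/-! ### The form of the dilated Laplacian after integration by parts. -/

section DilatedForm

variable {m : ℕ}
  {Z : Type*} [TopologicalSpace Z] [T2Space Z] [SigmaCompactSpace Z]
  [MeasurableSpace Z] [BorelSpace Z]
  [ChartedSpace (EuclideanSpace ℝ (Fin (m + 1))) Z] [IsManifold (𝓡 (m + 1)) ∞ Z]
  [RiemannianBundle (fun z : Z => TangentSpace (𝓡 (m + 1)) z)]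
  [IsContinuousRiemannianBundle (EuclideanSpace ℝ (Fin (m + 1)))
    (fun z : Z => TangentSpace (𝓡 (m + 1)) z)]
  {Y : Type*} [TopologicalSpace Y] [T2Space Y] [CompactSpace Y]
  [ChartedSpace (EuclideanSpace ℝ (Fin m)) Y] [IsManifold (𝓡 m) ∞ Y]
  [RiemannianBundle (fun y : Y => TangentSpace (𝓡 m) y)]
  [IsContinuousRiemannianBundle (EuclideanSpace ℝ (Fin m)) (fun y : Y => TangentSpace (𝓡 m) y)]
  {F : Type*} [NormedAddCommGroup F] [NormedSpace ℂ F] [FiniteDimensional ℂ F]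
  {E : Z → Type*} [TopologicalSpace (TotalSpace F E)]
  [∀ z, NormedAddCommGroup (E z)] [∀ z, InnerProductSpace ℂ (E z)]
  [FiberBundle F E] [VectorBundle ℂ F E] [VectorBundle ℝ F E]
  [ContMDiffVectorBundle ∞ F E (𝓡 (m + 1))] [IsSmoothHermitian (m + 1) F E]
  {F' : Type*} [NormedAddCommGroup F'] [NormedSpace ℂ F'] [FiniteDimensional ℂ F']
  {E' : Y → Type*} [TopologicalSpace (TotalSpace F' E')]
  [∀ y, NormedAddCommGroup (E' y)] [∀ y, InnerProductSpace ℂ (E' y)]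
  [FiberBundle F' E'] [VectorBundle ℂ F' E'] [VectorBundle ℝ F' E']
  [ContMDiffVectorBundle ∞ F' E' (𝓡 m)] [IsSmoothHermitian m F' E']
  {C : CylindricalEnd m Z Y} {B : BundleEnd F E F' E' C}
  {Δ : smoothSections (m + 1) F E →ₗ[ℂ] smoothSections (m + 1) F E}
  {D : CovariantDerivative (𝓡 (m + 1)) F E}

/-- A support preserving operator, restricted to compactly supported sections. -/
def compactOperator (P : smoothSections (m + 1) F E →ₗ[ℂ] smoothSections (m + 1) F E)
    (hP : ∀ s, HasCompactSupp s → HasCompactSupp (P s)) :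
    compactSections (m + 1) F E →ₗ[ℂ] compactSections (m + 1) F E :=
  P.restrict hP

variable (F E C) in
/-- Multiplication of compactly supported sections by a coefficient on the end. -/
def compactMul (c : EndCoefficient) :
    compactSections (m + 1) F E →ₗ[ℂ] compactSections (m + 1) F E :=
  compactOperator (C.mulEnd F E c) fun _ hs => hs.mulEnd c

theorem norm_compactMul_le (c : EndCoefficient) {a : ℝ} (ha : ∀ u, ‖c.toFun u‖ ≤ a)
    (s : compactSections (m + 1) F E) :
    ‖toL2 (m + 1) F E (compactMul F E C c s)‖ ≤ a * ‖toL2 (m + 1) F E s‖ := by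
  have h0 : 0 ≤ a := (norm_nonneg _).trans (ha 0)
  refine norm_toL2_le h0 fun z => ?_
  change ‖C.lift c z • s.1.1 z‖ ≤ _
  rw [norm_smul]
  refine mul_le_mul_of_nonneg_right ?_ (norm_nonneg _)
  rcases C.lift_mem c z with h | ⟨u, h⟩
  · rwa [h, norm_zero]
  · rw [h]
    exact ha u

theorem re_inner_compactMul_le (c : EndCoefficient) {a : ℝ} (h0 : 0 ≤ a)
    (ha : ∀ u, (c.toFun u).re ≤ a) (s : compactSections (m + 1) F E) :
    (inner ℂ (toL2 (m + 1) F E s) (toL2 (m + 1) F E (compactMul F E C c s))).re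
      ≤ a * ‖toL2 (m + 1) F E s‖ ^ 2 := by
  have i1 := integrable_inner_left s.2 (compactMul F E C c s).1
  rw [inner_toL2, norm_toL2_sq, ← integral_const_mul]
  refine (integral_re i1).symm.trans_le ?_
  refine integral_mono i1.re ((integrable_norm_sq s.2).const_mul _) fun z => ?_
  change (inner ℂ (s.1.1 z) (C.lift c z • s.1.1 z) : ℂ).re ≤ a * ‖s.1.1 z‖ ^ 2
  have h1 : (C.lift c z).re ≤ a := by
    rcases C.lift_mem c z with h | ⟨u, h⟩
    · rwa [h, Complex.zero_re]
    · rw [h]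
      exact ha u
  have h2 : (inner ℂ (s.1.1 z) (C.lift c z • s.1.1 z) : ℂ).re
      = (C.lift c z).re * ‖s.1.1 z‖ ^ 2 := by
    rw [inner_smul_right, inner_self_eq_norm_sq_to_K]
    change (C.lift c z * ((‖s.1.1 z‖ : ℝ) : ℂ) ^ 2).re = _
    rw [← Complex.ofReal_pow, Complex.re_mul_ofReal]
  rw [h2]
  exact mul_le_mul_of_nonneg_right h1 (sq_nonneg _)

theorem inner_compactMul (c : EndCoefficient) (hc : ∀ u, (starRingEnd ℂ) (c.toFun u) = c.toFun u)
    (s t : compactSections (m + 1) F E) :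
    (inner ℂ (toL2 (m + 1) F E (compactMul F E C c s)) (toL2 (m + 1) F E t) : ℂ)
      = inner ℂ (toL2 (m + 1) F E s) (toL2 (m + 1) F E (compactMul F E C c t)) := by
  rw [inner_toL2, inner_toL2]
  refine integral_congr_ae (ae_of_all _ fun z => ?_)
  change (inner ℂ (C.lift c z • s.1.1 z) (t.1.1 z) : ℂ) = inner ℂ (s.1.1 z) (C.lift c z • t.1.1 z)
  rw [inner_smul_left, inner_smul_right]
  congr 1
  rcases C.lift_mem c z with h | ⟨u, h⟩
  · rw [h, map_zero]
  · rw [h, hc]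

theorem EndCoefficient.conj_derivative {c : EndCoefficient}
    (hc : ∀ u, (starRingEnd ℂ) (c.toFun u) = c.toFun u) (u : ℝ) :
    (starRingEnd ℂ) (c.derivative.toFun u) = c.derivative.toFun u := by
  have h : HasDerivAt c.toFun ((starRingEnd ℂ) (c.derivative.toFun u)) u :=
    (c.hasDerivAt u).star.congr_of_eventuallyEq (Eventually.of_forall fun v => (hc v).symm)
  exact h.unique (c.hasDerivAt u)

theorem IsFormallySelfAdjoint.inner_compactOperator (hS : IsFormallySelfAdjoint Δ)
    (hΔ : ∀ s, HasCompactSupp s → HasCompactSupp (Δ s)) (s t : compactSections (m + 1) F E) :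
    (inner ℂ (toL2 (m + 1) F E s) (toL2 (m + 1) F E (compactOperator Δ hΔ t)) : ℂ)
      = inner ℂ (toL2 (m + 1) F E (compactOperator Δ hΔ s)) (toL2 (m + 1) F E t) :=
  (hS s.1 t.1 s.2 t.2).symm

variable (C) in
/-- The operator `f' ∂/∂u` on compactly supported sections. -/
def compactDeriv (hΔ : IsGeneralizedLaplacian Δ) (f : EndCoefficient) :
    compactSections (m + 1) F E →ₗ[ℂ] compactSections (m + 1) F E :=
  compactOperator (C.endDeriv Δ f) fun _ hs => hs.endDeriv hΔ f

/-- The formal adjoint of `f' ∂/∂u` is `-f' ∂/∂u - f''`. -/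
theorem inner_compactDeriv (hΔ : IsGeneralizedLaplacian Δ) (hS : IsFormallySelfAdjoint Δ)
    {f : EndCoefficient} (hf : ∀ u, (starRingEnd ℂ) (f.toFun u) = f.toFun u)
    (s t : compactSections (m + 1) F E) :
    (inner ℂ (toL2 (m + 1) F E s) (toL2 (m + 1) F E (compactDeriv C hΔ f t)) : ℂ)
      = -inner ℂ (toL2 (m + 1) F E (compactDeriv C hΔ f s)) (toL2 (m + 1) F E t)
        - inner ℂ (toL2 (m + 1) F E s)
          (toL2 (m + 1) F E (compactMul F E C f.derivative.derivative t)) := by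
  set A := compactOperator Δ fun _ hs => hΔ.hasCompactSupp hs with hA
  have hd : ∀ t : compactSections (m + 1) F E, toL2 (m + 1) F E (compactDeriv C hΔ f t)
      = (-(1 / 2) : ℂ) • (toL2 (m + 1) F E (A (compactMul F E C f t))
        - toL2 (m + 1) F E (compactMul F E C f (A t))
        + toL2 (m + 1) F E (compactMul F E C f.derivative.derivative t)) := fun t => rfl
  have h2 := inner_compactMul (C := C) f.derivative.derivative
    (EndCoefficient.conj_derivative (EndCoefficient.conj_derivative hf)) s t
  have h3 := inner_compactMul (C := C) f hf (A s) t
  have h4 := inner_compactMul (C := C) f hf s (A t)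
  have h5 := hS.inner_compactOperator (fun _ hs => hΔ.hasCompactSupp hs) s (compactMul F E C f t)
  have h6 := hS.inner_compactOperator (fun _ hs => hΔ.hasCompactSupp hs) (compactMul F E C f s) t
  rw [← hA] at h5 h6
  have hconj : (starRingEnd ℂ) (-(1 / 2) : ℂ) = -(1 / 2) := by
    simp [Complex.ext_iff]
  rw [hd, hd, inner_smul_left, inner_smul_right, inner_add_left, inner_add_right, inner_sub_left,
    inner_sub_right, hconj, h2, h3, ← h4, h5, h6]
  ring

/-- Integration by parts for the second order part of `Δ_θ - Δ`. -/
theorem IsCompatibleLaplacian.inner_compactMul_compactDeriv (hΔ : IsCompatibleLaplacian B Δ)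
    {f c : EndCoefficient} (hf : ∀ u, (starRingEnd ℂ) (f.toFun u) = f.toFun u)
    (h1 : ∀ u, f.derivative.toFun u = 1 ∨ c.derivative.toFun u = 0)
    (h2 : ∀ u, f.derivative.derivative.toFun u = 0 ∨ c.toFun u = 0)
    (s t : compactSections (m + 1) F E) :
    (inner ℂ (toL2 (m + 1) F E s)
        (toL2 (m + 1) F E (compactMul F E C c (compactDeriv C hΔ.generalized f t))) : ℂ)
      = -inner ℂ (toL2 (m + 1) F E (compactDeriv C hΔ.generalized f s))
          (toL2 (m + 1) F E (compactMul F E C c t))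
        - inner ℂ (toL2 (m + 1) F E s)
          (toL2 (m + 1) F E (compactMul F E C c.derivative t)) := by
  have e1 : compactDeriv C hΔ.generalized f (compactMul F E C c t)
      = compactMul F E C c (compactDeriv C hΔ.generalized f t)
        + compactMul F E C c.derivative t := Subtype.ext (hΔ.endDeriv_mulEnd h1 t.1)
  -- The zero order term `f''` of the adjoint of `f' ∂_u` plays no role, since `f''` vanishes
  -- wherever `c` does not.
  have e2 : compactMul F E C f.derivative.derivative (compactMul F E C c t) = 0 := by
    ext z
    change C.lift f.derivative.derivative z • C.lift c z • t.1.1 z = 0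
    rw [smul_smul]
    have h3 : C.lift f.derivative.derivative z * C.lift c z = 0 := by
      by_cases hz : z ∈ C.chart '' {p | 0 ≤ p.2}
      · obtain ⟨⟨y, u⟩, hu, rfl⟩ := hz
        have hu' : -C.ε < u := (neg_lt_zero.2 C.ε_pos).trans_le hu
        rw [C.lift_chart _ hu', C.lift_chart _ hu']
        exact mul_eq_zero.2 (h2 u)
      · rw [C.lift_of_notMem_image c hz, mul_zero]
    rw [h3, zero_smul]
  have e3 := inner_compactDeriv (C := C) hΔ.generalized hΔ.symmetric hf s (compactMul F E C c t)
  rw [e1, e2, map_zero, inner_zero_right, sub_zero, map_add, inner_add_right] at e3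
  exact eq_sub_of_add_eq e3

/-- The operator `Δ + c₂ ∂² + c₁ ∂ + c₀` on compactly supported sections. -/
def compactDilation (hΔ : IsGeneralizedLaplacian Δ) (f c₂ c₁ c₀ : EndCoefficient) :
    compactSections (m + 1) F E →ₗ[ℂ] compactSections (m + 1) F E :=
  compactOperator Δ (fun _ hs => hΔ.hasCompactSupp hs)
    + compactMul F E C c₂ ∘ₗ compactDeriv C hΔ f ∘ₗ compactDeriv C hΔ f
    + compactMul F E C c₁ ∘ₗ compactDeriv C hΔ f + compactMul F E C c₀

variable (F E C) in
/-- Multiplication by `c₁ - c₂'`. -/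
def compactMulSub (c₁ c₂ : EndCoefficient) :
    compactSections (m + 1) F E →ₗ[ℂ] compactSections (m + 1) F E :=
  compactMul F E C c₁ + (-1 : ℂ) • compactMul F E C c₂.derivative

theorem toL2_compactMulSub (c₁ c₂ : EndCoefficient) (s : compactSections (m + 1) F E) :
    toL2 (m + 1) F E (compactMulSub F E C c₁ c₂ s) = toL2 (m + 1) F E (compactMul F E C c₁ s)
      - toL2 (m + 1) F E (compactMul F E C c₂.derivative s) := by
  rw [compactMulSub, LinearMap.add_apply, LinearMap.smul_apply, map_add, map_smul, neg_one_smul,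
    sub_eq_add_neg]

theorem norm_compactMulSub_le (c₁ c₂ : EndCoefficient) {a : ℝ} (h1 : ∀ u, ‖c₁.toFun u‖ ≤ a)
    (h2 : ∀ u, ‖c₂.derivative.toFun u‖ ≤ a) (s : compactSections (m + 1) F E) :
    ‖toL2 (m + 1) F E (compactMulSub F E C c₁ c₂ s)‖ ≤ 2 * a * ‖toL2 (m + 1) F E s‖ := by
  rw [toL2_compactMulSub]
  refine (norm_sub_le _ _).trans ?_
  have k1 := norm_compactMul_le (C := C) c₁ h1 s
  have k2 := norm_compactMul_le (C := C) c₂.derivative h2 s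
  linarith

/-- One derivative is moved to the left, so that the second order perturbation pairs two first
derivatives and is bounded by the energy. The derivative of `c₂` joins the first order coefficient.
-/
theorem IsCompatibleLaplacian.inner_compactDilation (hΔ : IsCompatibleLaplacian B Δ)
    {f c₂ c₁ c₀ : EndCoefficient} (hf : ∀ u, (starRingEnd ℂ) (f.toFun u) = f.toFun u)
    (h1 : ∀ u, f.derivative.toFun u = 1 ∨ c₂.derivative.toFun u = 0)
    (h2 : ∀ u, f.derivative.derivative.toFun u = 0 ∨ c₂.toFun u = 0)
    (s t : compactSections (m + 1) F E) :
    (inner ℂ (toL2 (m + 1) F E s)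
        (toL2 (m + 1) F E (compactDilation (C := C) hΔ.generalized f c₂ c₁ c₀ t)) : ℂ)
      = inner ℂ (toL2 (m + 1) F E s) (toL2 (m + 1) F E
          (compactOperator Δ (fun _ hs => hΔ.generalized.hasCompactSupp hs) t))
        - inner ℂ (toL2 (m + 1) F E (compactDeriv C hΔ.generalized f s))
          (toL2 (m + 1) F E (compactMul F E C c₂ (compactDeriv C hΔ.generalized f t)))
        + inner ℂ (toL2 (m + 1) F E s)
          (toL2 (m + 1) F E (compactMulSub F E C c₁ c₂ (compactDeriv C hΔ.generalized f t)))
        + inner ℂ (toL2 (m + 1) F E s) (toL2 (m + 1) F E (compactMul F E C c₀ t)) := by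
  have h := hΔ.inner_compactMul_compactDeriv (C := C) hf h1 h2 s (compactDeriv C hΔ.generalized f t)
  rw [compactDilation, toL2_compactMulSub]
  simp only [LinearMap.add_apply, LinearMap.comp_apply, map_add, inner_add_right, inner_sub_right]
  rw [h]
  ring

end DilatedForm

end
end CylEnd

namespace CylEnd

noncomputable section

attribute [local instance] tangentTotalSpace

/-! ### Assembly of the estimates. -/

section Submodule

variable {H : Type*} [NormedAddCommGroup H] [InnerProductSpace ℂ H]
  {X : Type*} [AddCommGroup X] [Module ℂ X] {S : Submodule ℂ X} {ι : S →ₗ[ℂ] H}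
  {A d L N N₀ T : S →ₗ[ℂ] S} {e : S → ℝ} {a c : ℝ}

/-- `exists_strictlyMAccretive_form` for a submodule of a larger space. -/
theorem exists_strictlyMAccretive_form_of_submodule (hι : DenseRange ι) (ha : 0 ≤ a) (hc : 0 < c) (hc1 : c ≤ 1)
    (hA : ∀ s t, inner ℂ (ι s) (ι (A t)) = inner ℂ (ι (A s)) (ι t))
    (hT : ∀ s t, inner ℂ (ι s) (ι (T t)) = inner ℂ (ι s) (ι (A t)) - inner ℂ (ι (d s)) (ι (L (d t)))
      + inner ℂ (ι s) (ι (N (d t))) + inner ℂ (ι s) (ι (N₀ t)))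
    (hL : ∀ s, ‖ι (L s)‖ ≤ a * ‖ι s‖) (hN : ∀ s, ‖ι (N s)‖ ≤ a * ‖ι s‖)
    (hN₀ : ∀ s, ‖ι (N₀ s)‖ ≤ a * ‖ι s‖)
    (hL1 : ∀ s, (inner ℂ (ι s) (ι (L s))).re ≤ (1 - c) * ‖ι s‖ ^ 2) (he : ∀ s, 0 ≤ e s)
    (h1 : ∀ δ > 0, ∃ b ≥ 0, ∀ s,
      |(inner ℂ (ι s) (ι (A s))).re - e s| ≤ δ * e s + b * ‖ι s‖ ^ 2)
    (h2 : ∀ δ > 0, ∃ b ≥ 0, ∀ s, ‖ι (d s)‖ ^ 2 ≤ (1 + δ) * e s + b * ‖ι s‖ ^ 2) :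
    ∃ q : SesqForm H, (∀ ψ, ψ ∈ q.domain ↔ ∃ f, EnergyTendsto ι e f ψ) ∧
      (∀ (f g : ℕ → S) (η ψ : q.domain), EnergyTendsto ι e f η → EnergyTendsto ι e g ψ →
        Tendsto (fun k => inner ℂ (ι (f k)) (ι (T (g k)))) atTop (𝓝 (q.toFun η ψ))) ∧
      ∃ γ : ℝ, 0 < γ ∧ (q.affine 1 γ).IsStrictlyMAccretive :=
  exists_strictlyMAccretive_form hι ha hc hc1 hA hT hL hN hN₀ hL1 he h1 h2

end Submodule

section DilatedForm

variable {m : ℕ}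
  {Z : Type*} [TopologicalSpace Z] [T2Space Z] [SigmaCompactSpace Z]
  [MeasurableSpace Z] [BorelSpace Z]
  [ChartedSpace (EuclideanSpace ℝ (Fin (m + 1))) Z] [IsManifold (𝓡 (m + 1)) ∞ Z]
  [RiemannianBundle (fun z : Z => TangentSpace (𝓡 (m + 1)) z)]
  [IsContinuousRiemannianBundle (EuclideanSpace ℝ (Fin (m + 1)))
    (fun z : Z => TangentSpace (𝓡 (m + 1)) z)]
  {Y : Type*} [TopologicalSpace Y] [T2Space Y] [CompactSpace Y]
  [ChartedSpace (EuclideanSpace ℝ (Fin m)) Y] [IsManifold (𝓡 m) ∞ Y]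
  [RiemannianBundle (fun y : Y => TangentSpace (𝓡 m) y)]
  [IsContinuousRiemannianBundle (EuclideanSpace ℝ (Fin m)) (fun y : Y => TangentSpace (𝓡 m) y)]
  {F : Type*} [NormedAddCommGroup F] [NormedSpace ℂ F] [FiniteDimensional ℂ F]
  {E : Z → Type*} [TopologicalSpace (TotalSpace F E)]
  [∀ z, NormedAddCommGroup (E z)] [∀ z, InnerProductSpace ℂ (E z)]
  [FiberBundle F E] [VectorBundle ℂ F E] [VectorBundle ℝ F E]
  [ContMDiffVectorBundle ∞ F E (𝓡 (m + 1))] [IsSmoothHermitian (m + 1) F E]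
  {F' : Type*} [NormedAddCommGroup F'] [NormedSpace ℂ F'] [FiniteDimensional ℂ F']
  {E' : Y → Type*} [TopologicalSpace (TotalSpace F' E')]
  [∀ y, NormedAddCommGroup (E' y)] [∀ y, InnerProductSpace ℂ (E' y)]
  [FiberBundle F' E'] [VectorBundle ℂ F' E'] [VectorBundle ℝ F' E']
  [ContMDiffVectorBundle ∞ F' E' (𝓡 m)] [IsSmoothHermitian m F' E']
  {C : CylindricalEnd m Z Y} {B : BundleEnd F E F' E' C}
  {Δ : smoothSections (m + 1) F E →ₗ[ℂ] smoothSections (m + 1) F E}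
  {D : CovariantDerivative (𝓡 (m + 1)) F E}

/-- The form of the dilated Laplacian extends to the first Sobolev space, and it is closed and
sectorial after adding a constant. -/
theorem exists_form_dilatedLaplacian (hΔ : IsCompatibleLaplacian B Δ)
    (hD : IsProductConnection B D) {K R : ℝ} {φ : ℝ → ℝ} (hφ : IsCutoff K R φ) {θ : ℂ}
    (hθ : θ ∈ Γ) :
    ∃ q : SesqForm (L2 (m + 1) F E), IsFormOf D (dilatedLaplacian φ θ B Δ) q ∧
      ∃ γ : ℝ, 0 < γ ∧ (q.affine 1 γ).IsStrictlyMAccretive := by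
  obtain ⟨A⟩ := BundleEnd.exists_controlledCover hΔ hD
  obtain ⟨b₂, b₁, b₀, ⟨s2, s1, s0⟩, hK, hpos, ⟨a, ha⟩, c, hc0, hc1, hc⟩ :=
    hφ.exists_coefficients hθ
  obtain ⟨f, hf, hf1, hfK⟩ := exists_endCoefficient hφ.K_pos
  let c₂ : EndCoefficient := ⟨b₂, s2, fun u hu => (hK u (hu.trans_lt hφ.K_pos)).1⟩
  let c₁ : EndCoefficient := ⟨b₁, s1, fun u hu => (hK u (hu.trans_lt hφ.K_pos)).2.1⟩
  let c₀ : EndCoefficient := ⟨b₀, s0, fun u hu => (hK u (hu.trans_lt hφ.K_pos)).2.2⟩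
  have ha0 : 0 ≤ a := (norm_nonneg _).trans (ha 0).1
  have hc₂ : ∀ u < K, c₂.derivative.toFun u = 0 := fun u hu => by
    have h : b₂ =ᶠ[𝓝 u] fun _ => 0 := by
      filter_upwards [gt_mem_nhds hu] with v hv using (hK v hv).1
    exact h.deriv_eq.trans (deriv_const _ _)
  -- The coefficients live on `u ≥ K`, where `f' = 1` and hence `f'' = 0`; this is the reason for
  -- matching `f` to the `K` of the cut-off.
  have h1 : ∀ u, f.derivative.toFun u = 1 ∨ c₂.derivative.toFun u = 0 := fun u =>
    (lt_or_ge u K).elim (fun h => Or.inr (hc₂ u h)) fun h => Or.inl (hfK u h).eq_of_nhds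
  have h2 : ∀ u, f.derivative.derivative.toFun u = 0 ∨ c₂.toFun u = 0 := fun u =>
    (lt_or_ge u K).elim (fun h => Or.inr (hK u h).1) fun h =>
      Or.inl ((hfK u h).deriv_eq.trans (deriv_const _ _))
  have hA := fun s t => hΔ.symmetric.inner_compactOperator
    (fun _ hs => hΔ.generalized.hasCompactSupp hs) s t
  have hT := hΔ.inner_compactDilation (c₁ := c₁) (c₀ := c₀) hf h1 h2
  -- The abstract theorem takes one bound for all three multiplications; `2 * a` is what `c₁ - c₂'`
  -- needs.
  have hL := norm_compactMul_le (F := F) (E := E) (C := C) c₂ (a := 2 * a)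
    fun u => (ha u).1.trans (by linarith)
  have hN := norm_compactMulSub_le (F := F) (E := E) (C := C) c₁ c₂ (fun u => (ha u).2.1)
    fun u => (ha u).2.2.2
  have hN₀ := norm_compactMul_le (F := F) (E := E) (C := C) c₀ (a := 2 * a)
    fun u => (ha u).2.2.1.trans (by linarith)
  have hL1 := re_inner_compactMul_le (F := F) (E := E) (C := C) c₂ (by linarith) hc
  have hE1 : ∀ δ > 0, ∃ b ≥ 0, ∀ s : compactSections (m + 1) F E,
      |(inner ℂ (toL2 (m + 1) F E s) (toL2 (m + 1) F E (compactOperator Δ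
        (fun _ hs => hΔ.generalized.hasCompactSupp hs) s))).re - A.totalEnergy s|
        ≤ δ * A.totalEnergy s + b * ‖toL2 (m + 1) F E s‖ ^ 2 := fun δ hδ => by
    obtain ⟨b, hb, h⟩ := A.exists_abs_re_inner_sub_le hΔ.generalized hΔ.symmetric hδ
    exact ⟨b, hb, fun s => h s _ rfl⟩
  have hE2 : ∀ δ > 0, ∃ b ≥ 0, ∀ s : compactSections (m + 1) F E,
      ‖toL2 (m + 1) F E (compactDeriv C hΔ.generalized f s)‖ ^ 2
        ≤ (1 + δ) * A.totalEnergy s + b * ‖toL2 (m + 1) F E s‖ ^ 2 := fun δ hδ => by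
    obtain ⟨b, hb, h⟩ := A.exists_norm_sq_le hΔ.generalized hδ
    exact ⟨b, hb, fun s => h s _ (hΔ.norm_endDeriv_le hD hf1 s.1)⟩
  obtain ⟨q, hq1, hq2, γ, hγ, hq3⟩ := exists_strictlyMAccretive_form_of_submodule
    (S := compactSections (m + 1) F E) (ι := toL2 (m + 1) F E)
    (a := 2 * a) (c := c) (e := A.totalEnergy) (denseRange_toL2 (n := m + 1) (F := F) (E := E))
    (by positivity) hc0 hc1 hA hT hL hN hN₀ hL1 A.totalEnergy_nonneg hE1 hE2
  refine ⟨q, A.isFormOf hΔ.generalized (fun s => ?_) hq1 hq2, γ, hγ, hq3⟩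
  exact funext fun z => (hΔ.dilatedLaplacian_eq (c₂ := c₂) (c₁ := c₁) (c₀ := c₀) hfK hK hpos s.1
    z).symm

end DilatedForm

end
end CylEnd

namespace CylEnd

theorem isContinuousRiemannianBundle_tangent (n : ℕ) (M : Type*) [TopologicalSpace M]
    [ChartedSpace (EuclideanSpace ℝ (Fin n)) M] [IsManifold (𝓡 n) ∞ M]
    [RiemannianBundle (fun x : M => TangentSpace (𝓡 n) x)]
    [IsContMDiffRiemannianBundle (𝓡 n) ∞ (EuclideanSpace ℝ (Fin n))
      (fun x : M => TangentSpace (𝓡 n) x)] :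
    IsContinuousRiemannianBundle (EuclideanSpace ℝ (Fin n))
      (fun x : M => TangentSpace (𝓡 n) x) := by
  obtain ⟨g, hg, h⟩ := IsContMDiffRiemannianBundle.exists_contMDiff (IB := 𝓡 n) (n := ∞)
    (F := EuclideanSpace ℝ (Fin n)) (E := fun x : M => TangentSpace (𝓡 n) x)
  exact ⟨g, hg.continuous, h⟩

end CylEnd

theorem mainTheorem4
    (m : ℕ)
    -- the manifold `Z`
    {Z : Type*} [TopologicalSpace Z] [T2Space Z] [SecondCountableTopology Z]
    [MeasurableSpace Z] [BorelSpace Z]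
    [ChartedSpace (EuclideanSpace ℝ (Fin (m + 1))) Z] [IsManifold (𝓡 (m + 1)) ∞ Z]
    [RiemannianBundle (fun z : Z => TangentSpace (𝓡 (m + 1)) z)]
    [IsContMDiffRiemannianBundle (𝓡 (m + 1)) ∞ (EuclideanSpace ℝ (Fin (m + 1)))
      (fun z : Z => TangentSpace (𝓡 (m + 1)) z)]
    -- the closed manifold `Y`
    {Y : Type*} [TopologicalSpace Y] [T2Space Y] [CompactSpace Y]
    [ChartedSpace (EuclideanSpace ℝ (Fin m)) Y] [IsManifold (𝓡 m) ∞ Y]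
    [RiemannianBundle (fun y : Y => TangentSpace (𝓡 m) y)]
    [IsContMDiffRiemannianBundle (𝓡 m) ∞ (EuclideanSpace ℝ (Fin m))
      (fun y : Y => TangentSpace (𝓡 m) y)]
    -- the Hermitian vector bundle `E` over `Z`
    {F : Type*} [NormedAddCommGroup F] [NormedSpace ℂ F] [FiniteDimensional ℂ F]
    {E : Z → Type*} [TopologicalSpace (TotalSpace F E)]
    [∀ z, NormedAddCommGroup (E z)] [∀ z, InnerProductSpace ℂ (E z)]
    [FiberBundle F E] [VectorBundle ℂ F E] [VectorBundle ℝ F E]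
    [ContMDiffVectorBundle ∞ F E (𝓡 (m + 1))] [CylEnd.IsSmoothHermitian (m + 1) F E]
    -- the Hermitian vector bundle `E'` over `Y`
    {F' : Type*} [NormedAddCommGroup F'] [NormedSpace ℂ F'] [FiniteDimensional ℂ F']
    {E' : Y → Type*} [TopologicalSpace (TotalSpace F' E')]
    [∀ y, NormedAddCommGroup (E' y)] [∀ y, InnerProductSpace ℂ (E' y)]
    [FiberBundle F' E'] [VectorBundle ℂ F' E'] [VectorBundle ℝ F' E']
    [ContMDiffVectorBundle ∞ F' E' (𝓡 m)] [CylEnd.IsSmoothHermitian m F' E']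
    -- the cylindrical end, the product structures of `E`, `Δ` and `∇`
    (C : CylEnd.CylindricalEnd m Z Y) (B : CylEnd.BundleEnd F E F' E' C)
    (Δ : CylEnd.smoothSections (m + 1) F E →ₗ[ℂ] CylEnd.smoothSections (m + 1) F E)
    (hΔ : CylEnd.IsCompatibleLaplacian B Δ)
    (D : CovariantDerivative (𝓡 (m + 1)) F E) (hD : CylEnd.IsProductConnection B D)
    -- the cut-off function and the dilation parameter
    (K R : ℝ) (φ : ℝ → ℝ) (hφ : CylEnd.IsCutoff K R φ)
    (θ : ℂ) (hθ : θ ∈ CylEnd.Γ) :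
    ∃ q : CylEnd.SesqForm (CylEnd.L2 (m + 1) F E),
      CylEnd.IsFormOf D (CylEnd.dilatedLaplacian φ θ B Δ) q ∧
      ∃ γ : ℝ, 0 < γ ∧
        (q.affine 1 γ).IsStrictlyMAccretive ∧ (q.affine 1 γ).IsStrictlyMSectorial := by
  have := CylEnd.isContinuousRiemannianBundle_tangent (m + 1) Z
  have := CylEnd.isContinuousRiemannianBundle_tangent m Y
  have : LocallyCompactSpace Z :=
    ChartedSpace.locallyCompactSpace (EuclideanSpace ℝ (Fin (m + 1))) Z
  -- Second countability yields the exhaustion by compact sets behind the density of `C_c^∞` in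
  -- `L²`, and the global cut-off functions.
  have : SigmaCompactSpace Z := sigmaCompactSpace_of_locallyCompact_secondCountable
  obtain ⟨q, hq, γ, hγ, h⟩ := CylEnd.exists_form_dilatedLaplacian hΔ hD hφ hθ
  exact ⟨q, hq, γ, hγ, h, h.isStrictlyMSectorial⟩
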